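/- Let $\mathbb K$ be a field of characteristic $0$. **Conventions.** All categories are $\mathbb Z$-graded and $\mathbb K$-linear; $(q^mV)_a=V_{a-m}$, and $\operatorname{Hom}(q^kX,q^lY)=q^{l-k}\operatorname{Hom}(X,Y)$. The object $Y$ is the *biproduct* $\bigoplus_nY_n$ via degree $0$ morphisms $\sigma_n\colon Y_n\to Y$, $\pi_n\colon Y\to Y_n$ if $\pi_n\sigma_m=\delta_{nm}\,\mathrm{id}$, the $\sigma_n$ exhibit $Y$ as the coproduct of the $Y_n$, and the $\pi_n$ exhibit $Y$ as the product of the $Y_n$ (universal properties for morphisms of all degrees). **The categories.** $\mathrm{dTL}$ is the strict monoidal category generated by one object $c$ and morphisms $x\in\operatorname{End}^2(c)$ (dot), $\cup\in\operatorname{Hom}^0(1,c^{2})$, $\cap\in\operatorname{Hom}^0(c^2,1)$ (we write $c^n$ for $c^{\otimes n}$), modulo the zigzag relations, the sliding of dots along cups and caps, $\cap\cup=2$, $x^2=0$ and $x\otimes1+1\otimes x=\cup\circ\cap_\bullet+\cup_\bullet\circ\cap$, where $\cup_\bullet=(x\otimes 1)\cup$ and $\cap_\bullet=\cap(x\otimes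 1)$. With the crossing $1-\cup\cap$, the symmetric group $S_n$ acts on $c^n$; put $P_n=\frac1{n!}\sum_{w\in S_n}w$. Put $z_0=0$ and $z_{n+1}=x\otimes1_n-1\otimes z_n\in\operatorname{End}^2(c^{n+1})$. Let $\overline{\mathrm{dTL}}=\mathrm{Ind}(\mathrm{Mat}(\mathrm{Kar}(\mathrm{dTL})))$, where $\mathrm{Kar}$ is the Karoubi envelope and $\mathrm{Mat}$ adjoins finite biproducts and shifts. For $k\ge0$ the Kirby object is $$\omega_k=\operatorname{colim}\bigl(q^{-k}P_k\to q^{-k-2}P_{k+2}\to q^{-k-4}P_{k+4}\to\cdots\bigr),$$ with transition maps $P_{m+2}\circ(1_m\otimes\cup_\bullet)\circ P_m$; $\omega_k=\omega_{|k|}$ for $k<0$, and $\omega_i$ for $i\in\mathbb Z/2$ means $\omega_0$ or $\omega_1$. $\mathrm{KdTL}'$ is the strict monoidal category obtained from $\mathrm{dTL}$ by adjoining objects $\omega'_i$ ($i\in\mathbb Z/2$) and morphisms $\iota_n\in\operatorname{Hom}^{-n}(c^n,\omega'_n)$, $\mu_{i,j}\in\operatorname{Hom}^0(\omega'_i\otimes\omega'_j,\omega'_{i+j})$,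 $\bullet\in\operatorname{End}^2(\omega'_i)$, subject to: $\mu$ is associative with unit $\iota_0$; $\bullet\circ\mu_{i,j}=\mu_{i,j}(\bullet\otimes1)+(-1)^i\mu_{i,j}(1\otimes\bullet)$; $\bullet\circ\iota_n=\iota_nz_n$; $\iota_{m+n+2}(1_m\otimes\cup\otimes1_n)=0$; $\iota_{m+n+2}(1_m\otimes\cup_\bullet\otimes1_n)=\iota_{m+n}$; $\mu(\iota_m\otimes\iota_n)=\iota_{m+n}$. A *canonical inclusion* into a tensor product $S$ of copies of $c$ and $\omega'_i$ is a tensor product of identities of the factors $c$ and morphisms $\iota_n$, $n\equiv i$ mod $2$, into the factors $\omega'_i$. The category $\mathrm{KdTL}$ has the objects of $\mathrm{KdTL}'$; its morphisms $S\to T$ of degree $a$ are formal sums $\sum_{r\in I}D_r$ with $D_r\in\operatorname{Hom}^a_{\mathrm{KdTL}'}(S,T)$ such that for each canonical inclusion $\iota$ into $S$ only finitely many $D_r\iota$ are nonzero; two formal sums are identified if the finite sums $\sum_rD_r\iota$ agree for all $\iota$. Composition is $(\sum_sE_s)(\sum_rD_r)=\sum_{r,s}E_sD_r$. Shifts of objects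 of $\mathrm{KdTL}$ are taken in $\mathrm{Mat}(\mathrm{KdTL})$. **The morphisms.** For $j\in\mathbb Z/2$ and $n\ge0$ let $b\in\{0,1\}$, $b\equiv j-n$ mod $2$, and $a=n+b$. Let $h_n\in\operatorname{Hom}^{2b}(1,c^a\otimes c^a)$ consist of $n$ nested undotted cups, surrounded by one dotted cup if $b=1$. Define in $\mathrm{KdTL}'$ $$\sigma_n=(\mu_{i+j,j}\otimes1)\circ\bigl(1\otimes(\iota_a\otimes\iota_a)h_n\bigr)\colon\ \omega'_{i+j}\to\omega'_i\otimes\omega'_j,\qquad \pi_n=\frac{(-1)^{\binom n2}}{n!}\,\mu_{i,j}\circ(1\otimes\bullet^n)\colon\ \omega'_i\otimes\omega'_j\to\omega'_{i+j},$$ of degrees $-2n$ and $2n$. They give degree $0$ morphisms $q^{-2n}\omega'_{i+j}\to\omega'_i\otimes\omega'_j\to q^{-2n}\omega'_{i+j}$. **Statement.** 1. For all $i,j\in\mathbb Z$ there is a biproduct decomposition $\omega_i\otimes\omega_j\cong\bigoplus_{n\ge0}q^{-2n}\omega_{i+j}$ in $\overline{\mathrm{dTL}}$. 2. For $i,j\in\mathbb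 Z/2$ there are morphisms $\sigma_n\colon q^{-2n}\omega_{i+j}\to\omega_i\otimes\omega_j$ and $\pi_n\colon\omega_i\otimes\omega_j\to q^{-2n}\omega_{i+j}$ in $\overline{\mathrm{dTL}}$ such that $\sigma_n$ is represented on $P_m$ (a term of the system for $\omega_{i+j}$) by $(P_{m+a}\otimes P_a)\circ(1_m\otimes h_n)\circ P_m$ and $\pi_n$ is represented on $P_p\otimes P_q$ by $\frac{(-1)^{\binom n2}}{n!}P_{p+q}\circ(1_p\otimes z_q^n)\circ(P_p\otimes P_q)$. These morphisms exhibit $\omega_i\otimes\omega_j$ as the biproduct of the $q^{-2n}\omega_{i+j}$, $n\ge0$. The $\sigma_n\pi_n$ are mutually orthogonal idempotents, and $\mathrm{id}_{\omega_i\otimes\omega_j}=\sum_{n\ge0}\sigma_n\pi_n$, where the sum is finite on each $P_p\otimes P_q$. 3. For $i,j\in\mathbb Z/2$ the morphisms $\sigma_n$, $\pi_n$ of $\mathrm{KdTL}$ defined above exhibit $\omega'_i\otimes\omega'_j$ as the biproduct of the $q^{-2n}\omega'_{i+j}$, $n\ge0$. The $\sigma_n\pi_n$ are mutually orthogonal idempotents,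 and $\sum_{n\ge0}\sigma_n\pi_n$ is a formal sum that represents $\mathrm{id}_{\omega'_i\otimes\omega'_j}$ in $\mathrm{KdTL}$. -/

import Mathlib

open CategoryTheory

universe u w

/-- A `ℤ`-graded `K`-linear category, i.e. a category enriched over `ℤ`-graded `K`-vector
spaces: `Hom a X Y` is the degree `a` component of the graded morphism space, and composition
(written in diagrammatic order: `comp h f g` is `g ∘ f`) adds degrees. -/
structure GrCat (K : Type u) [Field K] where
  Obj : Type w
  Hom : ℤ → Obj → Obj → Type u
  grp : ∀ a X Y, AddCommGroup (Hom a X Y)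
  mod : ∀ a X Y, Module K (Hom a X Y)
  id : ∀ X, Hom 0 X X
  comp : ∀ {a b c : ℤ} (_ : a + b = c) {X Y Z : Obj}, Hom a X Y →ₗ[K] Hom b Y Z →ₗ[K] Hom c X Z
  id_comp : ∀ {a : ℤ} (h : 0 + a = a) {X Y : Obj} (f : Hom a X Y), comp h (id X) f = f
  comp_id : ∀ {a : ℤ} (h : a + 0 = a) {X Y : Obj} (f : Hom a X Y), comp h f (id Y) = f
  assoc : ∀ {a b c ab bc abc : ℤ} (h₁ : a + b = ab) (h₂ : ab + c = abc) (h₃ : b + c = bc)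
    (h₄ : a + bc = abc) {W X Y Z : Obj} (f : Hom a W X) (g : Hom b X Y) (k : Hom c Y Z),
    comp h₂ (comp h₁ f g) k = comp h₄ f (comp h₃ g k)

attribute [instance] GrCat.grp GrCat.mod

namespace GrCat

variable {K : Type u} [Field K]

/-- Transport of a morphism along an equality of degrees. -/
def castDeg (C : GrCat.{u, w} K) {a b : ℤ} (h : a = b) {X Y : C.Obj} (f : C.Hom a X Y) :
    C.Hom b X Y := h ▸ f

/-- Powers of an endomorphism of degree `d`. -/
def pow (C : GrCat.{u, w} K) {d : ℤ} {X : C.Obj} (f : C.Hom d X X) : ∀ n : ℕ, C.Hom (n * d) X X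
  | 0 => C.castDeg (by simp) (C.id X)
  | n + 1 => C.comp (by push_cast; ring) (C.pow f n) f

/-- The identity, regarded as a morphism between equal objects and of a degree equal to `0`. -/
def idOf (C : GrCat.{u, w} K) {a : ℤ} (h : a = 0) {X Y : C.Obj} (e : X = Y) : C.Hom a X Y :=
  h ▸ e ▸ C.id X

theorem idOf_comp (C : GrCat.{u, w} K) {a b c : ℤ} (h : a = 0) (hbc : b = c) (h' : a + b = c)
    {X Y : C.Obj} (f : C.Hom b X Y) : C.comp h' (C.idOf h rfl) f = C.castDeg hbc f := by
  subst h; subst hbc; exact C.id_comp h' f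

theorem comp_idOf (C : GrCat.{u, w} K) {a b c : ℤ} (h : b = 0) (hac : a = c) (h' : a + b = c)
    {X Y : C.Obj} (f : C.Hom a X Y) : C.comp h' f (C.idOf h rfl) = C.castDeg hac f := by
  subst h; subst hac; exact C.comp_id h' f

/-- The degree zero subcategory: same objects, morphisms of degree zero. -/
def Deg0 (C : GrCat.{u, w} K) : Type w := C.Obj

instance (C : GrCat.{u, w} K) : Category.{u} C.Deg0 where
  Hom X Y := C.Hom 0 X Y
  id X := C.id X
  comp f g := C.comp (add_zero 0) f g
  id_comp f := C.id_comp _ f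
  comp_id f := C.comp_id _ f
  assoc f g k := C.assoc _ _ _ _ f g k

/-- `Y` is the biproduct of the `X i`, via degree zero morphisms `σ i : X i ⟶ Y` and
`π i : Y ⟶ X i`: the `π i ∘ σ j` are Kronecker deltas, the `σ i` exhibit `Y` as the coproduct
and the `π i` exhibit `Y` as the product of the `X i` (in the graded sense: the universal
properties hold for morphisms of every degree). -/
structure IsBiproduct (C : GrCat.{u, w} K) {I : Type} (Y : C.Obj) (X : I → C.Obj)
    (σ : ∀ i, C.Hom 0 (X i) Y) (π : ∀ i, C.Hom 0 Y (X i)) : Prop where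
  comp_self : ∀ i, C.comp (add_zero 0) (σ i) (π i) = C.id (X i)
  comp_ne : ∀ i j, i ≠ j → C.comp (add_zero 0) (σ j) (π i) = 0
  coproduct : ∀ (a : ℤ) (T : C.Obj),
    Function.Bijective fun (G : C.Hom a Y T) (i : I) => C.comp (zero_add a) (σ i) G
  product : ∀ (a : ℤ) (T : C.Obj),
    Function.Bijective fun (F : C.Hom a T Y) (i : I) => C.comp (add_zero a) F (π i)

/-- The endomorphisms `e i` are mutually orthogonal idempotents. -/
def OrthogonalIdempotents (C : GrCat.{u, w} K) {I : Type} {Y : C.Obj} (e : I → C.Hom 0 Y Y) :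
    Prop :=
  (∀ i, C.comp (add_zero 0) (e i) (e i) = e i) ∧
    ∀ i j, i ≠ j → C.comp (add_zero 0) (e i) (e j) = 0

/-! ### Karoubi envelope -/

/-- Objects of the Karoubi envelope: an object with a degree zero idempotent. -/
structure KarObj (C : GrCat.{u, w} K) where
  X : C.Obj
  e : C.Hom 0 X X
  idem : C.comp (add_zero 0) e e = e

/-- Degree `a` morphisms of the Karoubi envelope: those `f` with `e' ∘ f ∘ e = f`. -/
def KarHom (C : GrCat.{u, w} K) (a : ℤ) (P Q : C.KarObj) : Submodule K (C.Hom a P.X Q.X) where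
  carrier := {f | C.comp (add_zero a) (C.comp (zero_add a) P.e f) Q.e = f}
  add_mem' := by
    intro f g hf hg
    change C.comp (add_zero a) (C.comp (zero_add a) P.e f) Q.e = f at hf
    change C.comp (add_zero a) (C.comp (zero_add a) P.e g) Q.e = g at hg
    change C.comp (add_zero a) (C.comp (zero_add a) P.e (f + g)) Q.e = f + g
    simp only [map_add, LinearMap.add_apply, hf, hg]
  zero_mem' := by simp
  smul_mem' := by
    intro c f hf
    change C.comp (add_zero a) (C.comp (zero_add a) P.e f) Q.e = f at hf
    change C.comp (add_zero a) (C.comp (zero_add a) P.e (c • f)) Q.e = c • f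
    simp only [map_smul, LinearMap.smul_apply, hf]

theorem KarHom.id_comp {C : GrCat.{u, w} K} {a : ℤ} {P Q : C.KarObj} {f : C.Hom a P.X Q.X}
    (hf : f ∈ C.KarHom a P Q) (h : 0 + a = a) : C.comp h P.e f = f := by
  have hf' : C.comp (add_zero a) (C.comp (zero_add a) P.e f) Q.e = f := hf
  rw [← hf', ← C.assoc (zero_add a) (add_zero a) (add_zero a) h,
    ← C.assoc (add_zero 0) (zero_add a) (zero_add a) h, P.idem]

theorem KarHom.comp_id {C : GrCat.{u, w} K} {a : ℤ} {P Q : C.KarObj} {f : C.Hom a P.X Q.X}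
    (hf : f ∈ C.KarHom a P Q) (h : a + 0 = a) : C.comp h f Q.e = f := by
  have hf' : C.comp (add_zero a) (C.comp (zero_add a) P.e f) Q.e = f := hf
  rw [← hf', C.assoc (add_zero a) h (add_zero 0) (add_zero a), Q.idem]

theorem KarHom.mem {C : GrCat.{u, w} K} {a : ℤ} {P Q : C.KarObj} {f : C.Hom a P.X Q.X}
    (h₁ : C.comp (zero_add a) P.e f = f) (h₂ : C.comp (add_zero a) f Q.e = f) :
    f ∈ C.KarHom a P Q := by
  change C.comp (add_zero a) (C.comp (zero_add a) P.e f) Q.e = f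
  rw [h₁, h₂]

/-- The (graded) Karoubi envelope. -/
def Kar (C : GrCat.{u, w} K) : GrCat.{u, max u w} K where
  Obj := C.KarObj
  Hom a P Q := C.KarHom a P Q
  grp _ _ _ := inferInstance
  mod _ _ _ := inferInstance
  id P := ⟨P.e, KarHom.mem P.idem P.idem⟩
  comp {a b c} h {P Q R} := LinearMap.mk₂ K
    (fun f g => ⟨C.comp h f.1 g.1, KarHom.mem
      (by rw [← C.assoc (zero_add a) h h (zero_add c), KarHom.id_comp f.2])
      (by rw [C.assoc h (add_zero c) (add_zero b) h, KarHom.comp_id g.2])⟩)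
    (fun f f' g => Subtype.ext (by simp))
    (fun t f g => Subtype.ext (by simp))
    (fun f g g' => Subtype.ext (by simp))
    (fun t f g => Subtype.ext (by simp))
  id_comp := by
    intro a h P Q f
    exact Subtype.ext (KarHom.id_comp f.2 h)
  comp_id := by
    intro a h P Q f
    exact Subtype.ext (KarHom.comp_id f.2 h)
  assoc := by
    intro a b c ab bc abc h₁ h₂ h₃ h₄ W X Y Z f g k
    exact Subtype.ext (C.assoc h₁ h₂ h₃ h₄ f.1 g.1 k.1)

theorem sandwich_mem (C : GrCat.{u, w} K) {a : ℤ} (P Q : C.KarObj) (f : C.Hom a P.X Q.X) :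
    C.comp (add_zero a) (C.comp (zero_add a) P.e f) Q.e ∈ C.KarHom a P Q :=
  KarHom.mem
    (by rw [← C.assoc (zero_add a) (add_zero a) (add_zero a) (zero_add a),
          ← C.assoc (add_zero 0) (zero_add a) (zero_add a) (zero_add a), P.idem])
    (by rw [C.assoc (add_zero a) (add_zero a) (add_zero 0) (add_zero a), Q.idem])

/-- The morphism `e' ∘ f ∘ e` of the Karoubi envelope. -/
def sandwich (C : GrCat.{u, w} K) {a : ℤ} (P Q : C.KarObj) (f : C.Hom a P.X Q.X) :
    C.Kar.Hom a P Q :=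
  (⟨_, C.sandwich_mem P Q f⟩ : C.KarHom a P Q)

/-! ### Additive completion with shifts -/

/-- Objects of `Mat C`: finite formal sums `⨁ i, q ^ (k i) X i`. -/
structure MatObj (C : GrCat.{u, w} K) where
  I : Type
  fin : Fintype I
  k : I → ℤ
  X : I → C.Obj

attribute [instance] MatObj.fin

/-- Degree `a` morphisms of `Mat C` are matrices; the degree `a` part of `q ^ m Hom(X, Y)` is
the degree `a - m` part of `Hom(X, Y)`. -/
def MatHom (C : GrCat.{u, w} K) (a : ℤ) (A B : C.MatObj) : Type u :=
  ∀ (i : A.I) (j : B.I), C.Hom (a - (B.k j - A.k i)) (A.X i) (B.X j)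

instance (C : GrCat.{u, w} K) (a : ℤ) (A B : C.MatObj) : AddCommGroup (C.MatHom a A B) :=
  inferInstanceAs (AddCommGroup
    (∀ (i : A.I) (j : B.I), C.Hom (a - (B.k j - A.k i)) (A.X i) (B.X j)))

instance (C : GrCat.{u, w} K) (a : ℤ) (A B : C.MatObj) : Module K (C.MatHom a A B) :=
  inferInstanceAs (Module K
    (∀ (i : A.I) (j : B.I), C.Hom (a - (B.k j - A.k i)) (A.X i) (B.X j)))

open scoped Classical in
/-- The identity matrix. -/
noncomputable def matId (C : GrCat.{u, w} K) (A : C.MatObj) : C.MatHom 0 A A := fun i j =>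
  if h : i = j then C.idOf (by rw [h]; ring) (congrArg A.X h) else 0

theorem matId_same (C : GrCat.{u, w} K) (A : C.MatObj) (i : A.I) :
    C.matId A i i = C.idOf (by ring) rfl := by
  simp [matId]

theorem matId_ne (C : GrCat.{u, w} K) (A : C.MatObj) {i j : A.I} (h : i ≠ j) :
    C.matId A i j = 0 := by
  simp [matId, h]

/-- Matrix multiplication. -/
def matComp (C : GrCat.{u, w} K) {a b c : ℤ} (h : a + b = c) {A B D : C.MatObj}
    (f : C.MatHom a A B) (g : C.MatHom b B D) : C.MatHom c A D := fun i l =>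
  ∑ j, C.comp (by rw [← h]; ring) (f i j) (g j l)

/-- The completion of `C` under finite biproducts and shifts. -/
noncomputable def Mat (C : GrCat.{u, w} K) : GrCat.{u, max 1 w} K where
  Obj := C.MatObj
  Hom a A B := C.MatHom a A B
  grp _ _ _ := inferInstance
  mod _ _ _ := inferInstance
  id A := C.matId A
  comp {a b c} h {A B D} := LinearMap.mk₂ K (fun f g => C.matComp h f g)
    (fun f f' g => by
      funext i l
      change ∑ j, C.comp _ (f i j + f' i j) _ = (∑ j, _) + ∑ j, _
      simp only [map_add, LinearMap.add_apply, Finset.sum_add_distrib])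
    (fun t f g => by
      funext i l
      change ∑ j, C.comp _ (t • f i j) _ = t • ∑ j, _
      simp only [map_smul, LinearMap.smul_apply, Finset.smul_sum])
    (fun f g g' => by
      funext i l
      change ∑ j, C.comp _ _ (g j l + g' j l) = (∑ j, _) + ∑ j, _
      simp only [map_add, Finset.sum_add_distrib])
    (fun t f g => by
      funext i l
      change ∑ j, C.comp _ _ (t • g j l) = t • ∑ j, _
      simp only [map_smul, Finset.smul_sum])
  id_comp := by
    intro a h A B f
    funext i l
    change ∑ j, C.comp _ (C.matId A i j) (f j l) = f i l
    rw [Finset.sum_eq_single i]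
    · rw [matId_same]
      exact C.idOf_comp _ rfl _ _
    · intro j _ hj
      rw [matId_ne _ _ (Ne.symm hj), map_zero, LinearMap.zero_apply]
    · simp
  comp_id := by
    intro a h A B f
    funext i l
    change ∑ j, C.comp _ (f i j) (C.matId B j l) = f i l
    rw [Finset.sum_eq_single l]
    · rw [matId_same]
      exact C.comp_idOf _ rfl _ _
    · intro j _ hj
      rw [matId_ne _ _ hj, map_zero]
    · simp
  assoc := by
    intro a b c ab bc abc h₁ h₂ h₃ h₄ A B D E f g k
    funext i l
    change ∑ m, C.comp _ (∑ j, C.comp _ (f i j) (g j m)) (k m l) =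
      ∑ j, C.comp _ (f i j) (∑ m, C.comp _ (g j m) (k m l))
    simp only [map_sum, LinearMap.sum_apply]
    rw [Finset.sum_comm]
    refine Finset.sum_congr rfl fun j _ => Finset.sum_congr rfl fun m _ => ?_
    exact C.assoc _ _ _ _ _ _ _

/-- The object `q ^ k X` of `Mat C`. -/
def single (C : GrCat.{u, w} K) (k : ℤ) (X : C.Obj) : C.Mat.Obj :=
  (⟨Unit, inferInstance, fun _ => k, fun _ => X⟩ : C.MatObj)

/-- A homogeneous morphism `X ⟶ Y` as a `1 × 1` matrix `q ^ k X ⟶ q ^ l Y`. -/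
def singleHom (C : GrCat.{u, w} K) {a b k l : ℤ} {X Y : C.Obj} (h : b = a - (l - k))
    (f : C.Hom b X Y) : C.Mat.Hom a (C.single k X) (C.single l Y) :=
  fun _ _ => C.castDeg h f

/-! ### Tensor products -/

/-- A tensor product on a graded linear category: a bilinear, degree preserving bifunctor.
(Only the bifunctor is recorded, since unit and associativity play no role in forming the
tensor product of two objects.) -/
structure Tensor (C : GrCat.{u, w} K) where
  obj : C.Obj → C.Obj → C.Obj
  hom : ∀ {a b c : ℤ} (_ : a + b = c) {X X' Y Y' : C.Obj},
    C.Hom a X X' →ₗ[K] C.Hom b Y Y' →ₗ[K] C.Hom c (obj X Y) (obj X' Y')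
  hom_id : ∀ (X Y : C.Obj), hom (add_zero 0) (C.id X) (C.id Y) = C.id (obj X Y)
  hom_comp : ∀ {a a' a'' b b' b'' c c' c'' : ℤ} (ha : a + a' = a'') (hb : b + b' = b'')
    (hc : c + c' = c'') (h : a + b = c) (h' : a' + b' = c') (h'' : a'' + b'' = c'')
    {X X' X'' Y Y' Y'' : C.Obj} (f : C.Hom a X X') (f' : C.Hom a' X' X'')
    (g : C.Hom b Y Y') (g' : C.Hom b' Y' Y''),
    hom h'' (C.comp ha f f') (C.comp hb g g') = C.comp hc (hom h f g) (hom h' f' g')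

/-- `(X, e) ⊗ (Y, e') = (X ⊗ Y, e ⊗ e')`. -/
def Tensor.karObj {C : GrCat.{u, w} K} (T : C.Tensor) (P Q : C.KarObj) : C.KarObj where
  X := T.obj P.X Q.X
  e := T.hom (add_zero 0) P.e Q.e
  idem := by
    rw [← T.hom_comp (add_zero 0) (add_zero 0) (add_zero 0) (add_zero 0) (add_zero 0) (add_zero 0),
      P.idem, Q.idem]

/-- The tensor product of two objects of the Karoubi envelope. -/
def Tensor.karObj' {C : GrCat.{u, w} K} (T : C.Tensor) (P Q : C.Kar.Obj) : C.Kar.Obj :=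
  T.karObj P Q

/-- The tensor product on the Karoubi envelope, given by `f ⊗ g` on morphisms. -/
def Tensor.kar {C : GrCat.{u, w} K} (T : C.Tensor) : C.Kar.Tensor where
  obj P Q := T.karObj' P Q
  hom {a b c} h {P P' Q Q'} := LinearMap.mk₂ K
    (fun f g => (⟨T.hom h f.1 g.1, KarHom.mem
      (by
        have := (T.hom_comp (zero_add a) (zero_add b) (zero_add c) (add_zero 0) h h
          (KarObj.e P) f.1 (KarObj.e Q) g.1).symm
        rw [KarHom.id_comp f.2, KarHom.id_comp g.2] at this
        exact this)
      (by
        have := (T.hom_comp (add_zero a) (add_zero b) (add_zero c) h (add_zero 0) h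
          f.1 (KarObj.e P') g.1 (KarObj.e Q')).symm
        rw [KarHom.comp_id f.2, KarHom.comp_id g.2] at this
        exact this)⟩ : C.KarHom c _ _))
    (fun f f' g => Subtype.ext (by
      change T.hom h (f.1 + f'.1) g.1 = T.hom h f.1 g.1 + T.hom h f'.1 g.1; simp))
    (fun t f g => Subtype.ext (by
      change T.hom h (t • f.1) g.1 = t • T.hom h f.1 g.1; simp))
    (fun f g g' => Subtype.ext (by
      change T.hom h f.1 (g.1 + g'.1) = T.hom h f.1 g.1 + T.hom h f.1 g'.1; simp))
    (fun t f g => Subtype.ext (by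
      change T.hom h f.1 (t • g.1) = t • T.hom h f.1 g.1; simp))
  hom_id P Q := rfl
  hom_comp := by
    intro a a' a'' b b' b'' c c' c'' ha hb hc h h' h'' X X' X'' Y Y' Y'' f f' g g'
    exact Subtype.ext (T.hom_comp ha hb hc h h' h'' f.1 f'.1 g.1 g'.1)

theorem Tensor.hom_idOf {C : GrCat.{u, w} K} (T : C.Tensor) {a b c : ℤ} (h : a + b = c)
    (ha : a = 0) (hb : b = 0) (hc : c = 0) (X Y : C.Obj) :
    T.hom h (C.idOf ha (rfl : X = X)) (C.idOf hb (rfl : Y = Y)) = C.idOf hc rfl := by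
  subst ha; subst hb; subst hc; exact T.hom_id X Y

/-- `(⨁ q ^ (k i) X i) ⊗ (⨁ q ^ (l j) Y j) = ⨁ q ^ (k i + l j) (X i ⊗ Y j)`. -/
abbrev Tensor.matObj {C : GrCat.{u, w} K} (T : C.Tensor) (A B : C.MatObj) : C.MatObj where
  I := A.I × B.I
  fin := inferInstance
  k p := A.k p.1 + B.k p.2
  X p := T.obj (A.X p.1) (B.X p.2)

/-- The Kronecker product of matrices. -/
def Tensor.matHom {C : GrCat.{u, w} K} (T : C.Tensor) {a b c : ℤ} (h : a + b = c)
    {A A' B B' : C.MatObj} (f : C.MatHom a A A') (g : C.MatHom b B B') :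
    C.MatHom c (T.matObj A B) (T.matObj A' B') := fun p p' =>
  T.hom (by
    change _ = c - ((A'.k p'.1 + B'.k p'.2) - (A.k p.1 + B.k p.2))
    rw [← h]; ring) (f p.1 p'.1) (g p.2 p'.2)

theorem Tensor.matHom_id {C : GrCat.{u, w} K} (T : C.Tensor) (A B : C.MatObj) :
    T.matHom (add_zero 0) (C.matId A) (C.matId B) = C.matId (T.matObj A B) := by
  funext p p'
  by_cases hp : p = p'
  · subst hp
    rw [matId_same]
    change T.hom _ (C.matId A p.1 p.1) (C.matId B p.2 p.2) = _
    rw [matId_same, matId_same]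
    exact T.hom_idOf _ _ _ _ _ _
  · rw [matId_ne _ _ hp]
    change T.hom _ (C.matId A p.1 p'.1) (C.matId B p.2 p'.2) = _
    by_cases hi : p.1 = p'.1
    · rw [matId_ne C B (fun hj => hp (Prod.ext hi hj)), map_zero]
    · rw [matId_ne C A hi, map_zero, LinearMap.zero_apply]

theorem Tensor.matHom_comp {C : GrCat.{u, w} K} (T : C.Tensor) {a a' a'' b b' b'' c c' c'' : ℤ}
    (ha : a + a' = a'') (hb : b + b' = b'') (hc : c + c' = c'') (h : a + b = c)
    (h' : a' + b' = c') (h'' : a'' + b'' = c'') {A A' A'' B B' B'' : C.MatObj}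
    (f : C.MatHom a A A') (f' : C.MatHom a' A' A'') (g : C.MatHom b B B')
    (g' : C.MatHom b' B' B'') :
    T.matHom h'' (C.matComp ha f f') (C.matComp hb g g') =
      C.matComp hc (T.matHom h f g) (T.matHom h' f' g') := by
  funext p p''
  unfold matHom matComp
  simp only [map_sum, LinearMap.sum_apply]
  rw [Finset.sum_comm]
  refine Eq.trans ?_ (Fintype.sum_prod_type (fun q : A'.I × B'.I => C.comp _
    (T.hom _ (f p.1 q.1) (g p.2 q.2)) (T.hom _ (f' q.1 p''.1) (g' q.2 p''.2)))).symm
  refine Finset.sum_congr rfl fun j _ => Finset.sum_congr rfl fun m _ => ?_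
  exact T.hom_comp _ _ _ _ _ _ _ _ _ _

/-- The tensor product of two objects of `Mat C`. -/
def Tensor.matObj' {C : GrCat.{u, w} K} (T : C.Tensor) (A B : C.Mat.Obj) : C.Mat.Obj :=
  T.matObj A B

/-- The tensor product on `Mat C`, given by the Kronecker product of matrices. -/
noncomputable def Tensor.mat {C : GrCat.{u, w} K} (T : C.Tensor) : C.Mat.Tensor where
  obj A B := T.matObj' A B
  hom {a b c} h {A A' B B'} := LinearMap.mk₂ K (fun f g => T.matHom h f g)
    (fun f f' g => by
      funext p p'
      change T.hom _ (f p.1 p'.1 + f' p.1 p'.1) _ = _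
      simp only [map_add, LinearMap.add_apply]; rfl)
    (fun t f g => by
      funext p p'
      change T.hom _ (t • f p.1 p'.1) _ = _
      simp only [map_smul, LinearMap.smul_apply]; rfl)
    (fun f g g' => by
      funext p p'
      change T.hom _ _ (g p.2 p'.2 + g' p.2 p'.2) = _
      simp only [map_add]; rfl)
    (fun t f g => by
      funext p p'
      change T.hom _ _ (t • g p.2 p'.2) = _
      simp only [map_smul]; rfl)
  hom_id A B := T.matHom_id A B
  hom_comp := by
    intro a a' a'' b b' b'' c c' c'' ha hb hc h h' h'' A A' A'' B B' B'' f f' g g'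
    exact T.matHom_comp ha hb hc h h' h'' f f' g g'

end GrCat

namespace GrCat

variable {K : Type u} [Field K]

/-! ### Ind-completion -/

/-- Directed systems in `C`: diagrams of degree zero morphisms indexed by a small filtered
category. These are the objects of `Ind C`. -/
structure IndObj (C : GrCat.{u, w} K) where
  J : Type u
  cat : SmallCategory J
  filt : IsFiltered J
  F : J ⥤ C.Deg0

attribute [instance] IndObj.cat IndObj.filt

/-- The `j`-th object of a directed system. -/
def IndObj.obj {C : GrCat.{u, w} K} (α : C.IndObj) (j : α.J) : C.Obj := α.F.obj j

/-- The structure maps of a directed system. -/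
def IndObj.map {C : GrCat.{u, w} K} (α : C.IndObj) {i j : α.J} (f : i ⟶ j) :
    C.Hom 0 (α.obj i) (α.obj j) := α.F.map f

/-- The directed system `j ↦ Hom^a(X, β j)` of vector spaces. -/
def homFunctor (C : GrCat.{u, w} K) (a : ℤ) (X : C.Obj) (β : C.IndObj) :
    β.J ⥤ ModuleCat.{u} K where
  obj j := ModuleCat.of K (C.Hom a X (β.obj j))
  map f := ModuleCat.ofHom ((C.comp (add_zero a)).flip (β.map f))
  map_id j := by
    ext x
    change C.comp _ x (β.F.map (𝟙 j)) = x
    rw [β.F.map_id]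
    exact C.comp_id _ x
  map_comp f g := by
    ext x
    change C.comp _ x (β.F.map (f ≫ g)) = C.comp _ (C.comp _ x (β.F.map f)) (β.F.map g)
    rw [β.F.map_comp]
    exact (C.assoc _ _ _ _ _ _ _).symm

/-- `colim_j Hom^a(X, β j)`. -/
noncomputable abbrev ColimHom (C : GrCat.{u, w} K) (a : ℤ) (X : C.Obj) (β : C.IndObj) : Type u :=
  ↑(Limits.colimit (C.homFunctor a X β))

/-- The class in `colim_j Hom^a(X, β j)` of a morphism `X ⟶ β j`. -/
noncomputable def ColimHom.mk {C : GrCat.{u, w} K} {a : ℤ} {X : C.Obj} (β : C.IndObj) (j : β.J) :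
    C.Hom a X (β.obj j) →ₗ[K] C.ColimHom a X β :=
  (Limits.colimit.ι (C.homFunctor a X β) j).hom

theorem ColimHom.mk_map {C : GrCat.{u, w} K} {a : ℤ} {X : C.Obj} (β : C.IndObj) {j j' : β.J}
    (f : j ⟶ j') (h : a + 0 = a) (x : C.Hom a X (β.obj j)) :
    ColimHom.mk β j' (C.comp h x (β.map f)) = ColimHom.mk β j x :=
  congrArg (fun q => q.hom x) (Limits.colimit.w (C.homFunctor a X β) f)

theorem ColimHom.exists_rep {C : GrCat.{u, w} K} {a : ℤ} {X : C.Obj} {β : C.IndObj}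
    (x : C.ColimHom a X β) : ∃ j f, ColimHom.mk β j f = x :=
  Limits.Concrete.colimit_exists_rep (C.homFunctor a X β) x

/-- The cocone given by a compatible family of linear maps. -/
def ColimHom.cocone {C : GrCat.{u, w} K} {a : ℤ} {X : C.Obj} (β : C.IndObj)
    {M : Type u} [AddCommGroup M] [Module K M] (t : ∀ j, C.Hom a X (β.obj j) →ₗ[K] M)
    (ht : ∀ (j j' : β.J) (f : j ⟶ j') (x : C.Hom a X (β.obj j)),
      t j' (C.comp (add_zero a) x (β.map f)) = t j x) : Limits.Cocone (C.homFunctor a X β) where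
  pt := ModuleCat.of K M
  ι := { app := fun j => ModuleCat.ofHom (t j)
         naturality := by
          intro j j' f
          ext x
          exact ht j j' f x }

/-- The linear map out of `colim_j Hom^a(X, β j)` induced by a compatible family. -/
noncomputable def ColimHom.desc {C : GrCat.{u, w} K} {a : ℤ} {X : C.Obj} (β : C.IndObj)
    {M : Type u} [AddCommGroup M] [Module K M] (t : ∀ j, C.Hom a X (β.obj j) →ₗ[K] M)
    (ht : ∀ (j j' : β.J) (f : j ⟶ j') (x : C.Hom a X (β.obj j)),
      t j' (C.comp (add_zero a) x (β.map f)) = t j x) : C.ColimHom a X β →ₗ[K] M :=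
  (Limits.colimit.desc (C.homFunctor a X β) (ColimHom.cocone β t ht)).hom

theorem ColimHom.desc_mk {C : GrCat.{u, w} K} {a : ℤ} {X : C.Obj} (β : C.IndObj)
    {M : Type u} [AddCommGroup M] [Module K M] (t : ∀ j, C.Hom a X (β.obj j) →ₗ[K] M)
    (ht : ∀ (j j' : β.J) (f : j ⟶ j') (x : C.Hom a X (β.obj j)),
      t j' (C.comp (add_zero a) x (β.map f)) = t j x) (j : β.J) (x : C.Hom a X (β.obj j)) :
    ColimHom.desc β t ht (ColimHom.mk β j x) = t j x :=
  congrArg (fun q : (C.homFunctor a X β).obj j ⟶ ModuleCat.of K M => q.hom x)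
    (Limits.colimit.ι_desc (ColimHom.cocone β t ht) j)

/-- Precomposition with a morphism of `C`. -/
noncomputable def ColimHom.pre {C : GrCat.{u, w} K} {a b c : ℤ} (h : a + b = c) {X Y : C.Obj}
    (φ : C.Hom a X Y) (β : C.IndObj) : C.ColimHom b Y β →ₗ[K] C.ColimHom c X β :=
  ColimHom.desc β (fun j => ColimHom.mk β j ∘ₗ C.comp h φ) (by
    intro j j' f x
    simp only [LinearMap.comp_apply]
    rw [← C.assoc h (add_zero c) (add_zero b) h, ColimHom.mk_map])

theorem ColimHom.pre_mk {C : GrCat.{u, w} K} {a b c : ℤ} (h : a + b = c) {X Y : C.Obj}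
    (φ : C.Hom a X Y) (β : C.IndObj) (j : β.J) (x : C.Hom b Y (β.obj j)) :
    ColimHom.pre h φ β (ColimHom.mk β j x) = ColimHom.mk β j (C.comp h φ x) := by
  unfold ColimHom.pre
  rw [ColimHom.desc_mk]
  rfl

theorem ColimHom.pre_add {C : GrCat.{u, w} K} {a b c : ℤ} (h : a + b = c) {X Y : C.Obj}
    (φ φ' : C.Hom a X Y) (β : C.IndObj) (x : C.ColimHom b Y β) :
    ColimHom.pre h (φ + φ') β x = ColimHom.pre h φ β x + ColimHom.pre h φ' β x := by
  obtain ⟨j, f, rfl⟩ := x.exists_rep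
  simp [ColimHom.pre_mk]

theorem ColimHom.pre_smul {C : GrCat.{u, w} K} {a b c : ℤ} (h : a + b = c) {X Y : C.Obj}
    (t : K) (φ : C.Hom a X Y) (β : C.IndObj) (x : C.ColimHom b Y β) :
    ColimHom.pre h (t • φ) β x = t • ColimHom.pre h φ β x := by
  obtain ⟨j, f, rfl⟩ := x.exists_rep
  simp [ColimHom.pre_mk]

theorem ColimHom.pre_pre {C : GrCat.{u, w} K} {a b c ab bc abc : ℤ} (h₁ : a + b = ab)
    (h₂ : ab + c = abc) (h₃ : b + c = bc) (h₄ : a + bc = abc) {X Y Z : C.Obj}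
    (φ : C.Hom a X Y) (ψ : C.Hom b Y Z) (β : C.IndObj) (x : C.ColimHom c Z β) :
    ColimHom.pre h₂ (C.comp h₁ φ ψ) β x = ColimHom.pre h₄ φ β (ColimHom.pre h₃ ψ β x) := by
  obtain ⟨j, f, rfl⟩ := x.exists_rep
  rw [pre_mk, pre_mk, pre_mk, C.assoc h₁ h₂ h₃ h₄]

theorem ColimHom.pre_id {C : GrCat.{u, w} K} {a : ℤ} (h : 0 + a = a) {X : C.Obj} (β : C.IndObj)
    (x : C.ColimHom a X β) : ColimHom.pre h (C.id X) β x = x := by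
  obtain ⟨j, f, rfl⟩ := x.exists_rep
  rw [pre_mk, C.id_comp]

/-- Degree `a` morphisms of `Ind C`: elements of `lim_i colim_j Hom^a(α i, β j)`, i.e. families
of elements of the colimits that are compatible with the structure maps of `α`. -/
def IndHom (C : GrCat.{u, w} K) (a : ℤ) (α β : C.IndObj) :
    Submodule K (∀ i : α.J, C.ColimHom a (α.obj i) β) where
  carrier := {f | ∀ {i i' : α.J} (s : i ⟶ i'),
    ColimHom.pre (zero_add a) (α.map s) β (f i') = f i}
  add_mem' := by
    intro f g hf hg i i' s
    rw [Pi.add_apply, map_add, hf s, hg s, Pi.add_apply]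
  zero_mem' := by
    intro i i' s
    rw [Pi.zero_apply, map_zero, Pi.zero_apply]
  smul_mem' := by
    intro c f hf i i' s
    rw [Pi.smul_apply, map_smul, hf s, Pi.smul_apply]

/-- The map `colim_j Hom^a(X, β j) ⟶ colim_k Hom^(a+b)(X, γ k)` given by postcomposition
with `g : β ⟶ γ`. -/
noncomputable def IndHom.post {C : GrCat.{u, w} K} {a b c : ℤ} (h : a + b = c) (X : C.Obj)
    {β γ : C.IndObj} (g : C.IndHom b β γ) : C.ColimHom a X β →ₗ[K] C.ColimHom c X γ :=
  ColimHom.desc β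
    (fun j => IsLinearMap.mk' (fun φ => ColimHom.pre h φ γ (g.1 j))
      ⟨fun φ φ' => ColimHom.pre_add h φ φ' γ _, fun t φ => ColimHom.pre_smul h t φ γ _⟩)
    (by
      intro j j' f x
      change ColimHom.pre h (C.comp _ x (β.map f)) γ (g.1 j') = ColimHom.pre h x γ (g.1 j)
      rw [ColimHom.pre_pre (add_zero a) h (zero_add b) h, g.2 f])

theorem IndHom.post_mk {C : GrCat.{u, w} K} {a b c : ℤ} (h : a + b = c) (X : C.Obj)
    {β γ : C.IndObj} (g : C.IndHom b β γ) (j : β.J) (φ : C.Hom a X (β.obj j)) :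
    IndHom.post h X g (ColimHom.mk β j φ) = ColimHom.pre h φ γ (g.1 j) := by
  unfold IndHom.post
  rw [ColimHom.desc_mk]
  rfl

theorem IndHom.post_pre {C : GrCat.{u, w} K} {a b c ab bc abc : ℤ} (h₁ : a + b = ab)
    (h₂ : ab + c = abc) (h₃ : b + c = bc) (h₄ : a + bc = abc) {X Y : C.Obj}
    {β γ : C.IndObj} (φ : C.Hom a X Y) (g : C.IndHom c β γ) (x : C.ColimHom b Y β) :
    IndHom.post h₂ X g (ColimHom.pre h₁ φ β x) = ColimHom.pre h₄ φ γ (IndHom.post h₃ Y g x) := by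
  obtain ⟨j, f, rfl⟩ := x.exists_rep
  rw [ColimHom.pre_mk, post_mk, post_mk, ColimHom.pre_pre h₁ h₂ h₃ h₄]

/-- The identity of a directed system. -/
noncomputable def IndHom.id {C : GrCat.{u, w} K} (α : C.IndObj) : C.IndHom 0 α α :=
  ⟨fun i => ColimHom.mk α i (C.id (α.obj i)), by
    intro i i' s
    change _ = ColimHom.mk α i (C.id (α.obj i))
    rw [ColimHom.pre_mk, ← ColimHom.mk_map α s (add_zero 0) (C.id (α.obj i)), C.comp_id,
      C.id_comp]⟩

/-- Composition of morphisms of directed systems. -/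
noncomputable def IndHom.comp {C : GrCat.{u, w} K} {a b c : ℤ} (h : a + b = c) {α β γ : C.IndObj}
    (f : C.IndHom a α β) (g : C.IndHom b β γ) : C.IndHom c α γ :=
  ⟨fun i => IndHom.post h _ g (f.1 i), by
    intro i i' s
    rw [← IndHom.post_pre (zero_add a) h h (zero_add c), f.2 s]⟩

theorem IndHom.comp_val {C : GrCat.{u, w} K} {a b c : ℤ} (h : a + b = c) {α β γ : C.IndObj}
    (f : C.IndHom a α β) (g : C.IndHom b β γ) (i : α.J) :
    (IndHom.comp h f g).1 i = IndHom.post h _ g (f.1 i) := rfl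

theorem IndHom.ext {C : GrCat.{u, w} K} {a : ℤ} {α β : C.IndObj} {f g : C.IndHom a α β}
    (h : ∀ i, f.1 i = g.1 i) : f = g := Subtype.ext (funext h)

theorem IndHom.post_add {C : GrCat.{u, w} K} {a b c : ℤ} (h : a + b = c) (X : C.Obj)
    {β γ : C.IndObj} (g g' : C.IndHom b β γ) (x : C.ColimHom a X β) :
    IndHom.post h X (g + g') x = IndHom.post h X g x + IndHom.post h X g' x := by
  obtain ⟨j, f, rfl⟩ := x.exists_rep
  rw [post_mk, post_mk, post_mk, ← map_add]
  rfl

theorem IndHom.post_smul {C : GrCat.{u, w} K} {a b c : ℤ} (h : a + b = c) (X : C.Obj)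
    {β γ : C.IndObj} (t : K) (g : C.IndHom b β γ) (x : C.ColimHom a X β) :
    IndHom.post h X (t • g) x = t • IndHom.post h X g x := by
  obtain ⟨j, f, rfl⟩ := x.exists_rep
  rw [post_mk, post_mk, ← map_smul]
  rfl

theorem IndHom.comp_add {C : GrCat.{u, w} K} {a b c : ℤ} (h : a + b = c) {α β γ : C.IndObj}
    (f : C.IndHom a α β) (g g' : C.IndHom b β γ) :
    IndHom.comp h f (g + g') = IndHom.comp h f g + IndHom.comp h f g' :=
  IndHom.ext fun i => IndHom.post_add h _ g g' (f.1 i)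

theorem IndHom.comp_smul {C : GrCat.{u, w} K} {a b c : ℤ} (h : a + b = c) {α β γ : C.IndObj}
    (t : K) (f : C.IndHom a α β) (g : C.IndHom b β γ) :
    IndHom.comp h f (t • g) = t • IndHom.comp h f g :=
  IndHom.ext fun i => IndHom.post_smul h _ t g (f.1 i)

theorem IndHom.add_comp {C : GrCat.{u, w} K} {a b c : ℤ} (h : a + b = c) {α β γ : C.IndObj}
    (f f' : C.IndHom a α β) (g : C.IndHom b β γ) :
    IndHom.comp h (f + f') g = IndHom.comp h f g + IndHom.comp h f' g :=
  IndHom.ext fun i => map_add (IndHom.post h _ g) (f.1 i) (f'.1 i)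

theorem IndHom.smul_comp {C : GrCat.{u, w} K} {a b c : ℤ} (h : a + b = c) {α β γ : C.IndObj}
    (t : K) (f : C.IndHom a α β) (g : C.IndHom b β γ) :
    IndHom.comp h (t • f) g = t • IndHom.comp h f g :=
  IndHom.ext fun i => map_smul (IndHom.post h _ g) t (f.1 i)

theorem IndHom.id_comp {C : GrCat.{u, w} K} {a : ℤ} (h : 0 + a = a) {α β : C.IndObj}
    (f : C.IndHom a α β) : IndHom.comp h (IndHom.id α) f = f := by
  refine IndHom.ext fun i => ?_
  rw [comp_val]
  change IndHom.post h _ f (ColimHom.mk α i (C.id (α.obj i))) = f.1 i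
  rw [post_mk, ColimHom.pre_id]

theorem IndHom.comp_id {C : GrCat.{u, w} K} {a : ℤ} (h : a + 0 = a) {α β : C.IndObj}
    (f : C.IndHom a α β) : IndHom.comp h f (IndHom.id β) = f := by
  refine IndHom.ext fun i => ?_
  rw [comp_val]
  obtain ⟨j, φ, hφ⟩ := (f.1 i).exists_rep
  rw [← hφ, post_mk]
  change ColimHom.pre h φ β (ColimHom.mk β j (C.id (β.obj j))) = _
  rw [ColimHom.pre_mk, C.comp_id]

theorem IndHom.assoc {C : GrCat.{u, w} K} {a b c ab bc abc : ℤ} (h₁ : a + b = ab)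
    (h₂ : ab + c = abc) (h₃ : b + c = bc) (h₄ : a + bc = abc) {α β γ δ : C.IndObj}
    (f : C.IndHom a α β) (g : C.IndHom b β γ) (k : C.IndHom c γ δ) :
    IndHom.comp h₂ (IndHom.comp h₁ f g) k = IndHom.comp h₄ f (IndHom.comp h₃ g k) := by
  refine IndHom.ext fun i => ?_
  rw [comp_val, comp_val, comp_val]
  obtain ⟨j, φ, hφ⟩ := (f.1 i).exists_rep
  rw [← hφ, post_mk, post_mk, post_pre h₁ h₂ h₃ h₄, comp_val]

/-- The ind-completion of `C`. -/
noncomputable def Ind (C : GrCat.{u, w} K) : GrCat.{u, max (u + 1) w} K where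
  Obj := C.IndObj
  Hom a α β := C.IndHom a α β
  grp _ _ _ := inferInstance
  mod _ _ _ := inferInstance
  id α := IndHom.id α
  comp h _ _ _ := LinearMap.mk₂ K (fun f g => IndHom.comp h f g)
    (IndHom.add_comp h) (IndHom.smul_comp h) (IndHom.comp_add h) (fun t f g =>
      IndHom.comp_smul h t f g)
  id_comp h _ _ f := IndHom.id_comp h f
  comp_id h _ _ f := IndHom.comp_id h f
  assoc h₁ h₂ h₃ h₄ _ _ _ _ f g k := IndHom.assoc h₁ h₂ h₃ h₄ f g k

/-- The tensor product of ind-objects: `colim_i α i ⊗ colim_j β j = colim_(i,j) α i ⊗ β j`. -/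
def Tensor.ind {C : GrCat.{u, w} K} (T : C.Tensor) (α β : C.IndObj) : C.Ind.Obj :=
  ({J := α.J × β.J
    cat := inferInstance
    filt := inferInstance
    F :=
    { obj := fun p => T.obj (α.obj p.1) (β.obj p.2)
      map := fun f => T.hom (add_zero 0) (α.map f.1) (β.map f.2)
      map_id := by
        intro p
        change T.hom _ (α.F.map (𝟙 p.1)) (β.F.map (𝟙 p.2)) = _
        rw [α.F.map_id, β.F.map_id]
        exact T.hom_id _ _
      map_comp := by
        intro p q r f g
        change T.hom _ (α.F.map (f.1 ≫ g.1)) (β.F.map (f.2 ≫ g.2)) = _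
        rw [α.F.map_comp, β.F.map_comp]
        exact T.hom_comp _ _ _ _ _ _ _ _ _ _ } } : C.IndObj)

/-- The ind-object of a sequence `X 0 ⟶ X 1 ⟶ ⋯` of degree zero morphisms. -/
noncomputable def seqInd (C : GrCat.{u, w} K) (X : ℕ → C.Obj) (s : ∀ n, C.Hom 0 (X n) (X (n + 1))) :
    C.IndObj where
  J := AsSmall.{u} ℕ
  cat := inferInstance
  filt := inferInstance
  F := AsSmall.down ⋙ Functor.ofSequence (C := C.Deg0) (X := X) s

end GrCat

namespace Kirby

/-! ### Diagrammatic categories presented by generators and relations -/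

/-- Data adjoined to the dotted Temperley-Lieb generators: extra strand types `E` and extra
generating morphisms `G`, with domain, codomain and degree. A word in `Option E` is a tensor
product of generating objects; the letter `none` is the black strand. -/
structure Gens where
  E : Type
  G : Type
  dom : G → List (Option E)
  cod : G → List (Option E)
  deg : G → ℤ

/-- Formal `K`-linear combinations of composites and tensor products of generating diagrams:
terms of degree `a` from the word `s` to the word `t`. Composition is in diagrammatic order. -/
inductive Tm (K : Type u) (X : Gens) :
    ℤ → List (Option X.E) → List (Option X.E) → Type u
  | id (s : List (Option X.E)) : Tm K X 0 s s
  | dot : Tm K X 2 [none] [none]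
  | cup : Tm K X 0 [] [none, none]
  | cap : Tm K X 0 [none, none] []
  | gen (g : X.G) : Tm K X (X.deg g) (X.dom g) (X.cod g)
  | comp {a b c : ℤ} (h : a + b = c) {r s t : List (Option X.E)}
      (f : Tm K X a r s) (g : Tm K X b s t) : Tm K X c r t
  | tens {a b c : ℤ} (h : a + b = c) {s s' s'' t t' t'' : List (Option X.E)}
      (hs : s ++ s' = s'') (ht : t ++ t' = t'')
      (f : Tm K X a s t) (g : Tm K X b s' t') : Tm K X c s'' t''
  | zero {a : ℤ} {s t : List (Option X.E)} : Tm K X a s t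
  | add {a : ℤ} {s t : List (Option X.E)} (f g : Tm K X a s t) : Tm K X a s t
  | smul {a : ℤ} {s t : List (Option X.E)} (k : K) (f : Tm K X a s t) : Tm K X a s t

/-- Families of relations on terms. -/
abbrev TmRel (K : Type u) (X : Gens) : Type u :=
  ∀ (a : ℤ) (s t : List (Option X.E)), Tm K X a s t → Tm K X a s t → Prop

/-- The relations of a strict monoidal `ℤ`-graded `K`-linear category, the relations of the
dotted Temperley-Lieb category, and the additional relations `R`. The equivalence relation
that they generate is a congruence. -/
inductive DRel {K : Type u} [Field K] {X : Gens} (R : TmRel K X) : TmRel K X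
  -- additional relations
  | of {a : ℤ} {s t : List (Option X.E)} {f g : Tm K X a s t} (h : R a s t f g) :
      DRel R a s t f g
  -- congruence
  | comp_left {a b c : ℤ} (h : a + b = c) {r s t : List (Option X.E)} {f f' : Tm K X a r s}
      (g : Tm K X b s t) (hf : DRel R a r s f f') : DRel R c r t (.comp h f g) (.comp h f' g)
  | comp_right {a b c : ℤ} (h : a + b = c) {r s t : List (Option X.E)} (f : Tm K X a r s)
      {g g' : Tm K X b s t} (hg : DRel R b s t g g') : DRel R c r t (.comp h f g) (.comp h f g')
  | tens_left {a b c : ℤ} (h : a + b = c) {s s' s'' t t' t'' : List (Option X.E)}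
      (hs : s ++ s' = s'') (ht : t ++ t' = t'') {f f' : Tm K X a s t} (g : Tm K X b s' t')
      (hf : DRel R a s t f f') : DRel R c s'' t'' (.tens h hs ht f g) (.tens h hs ht f' g)
  | tens_right {a b c : ℤ} (h : a + b = c) {s s' s'' t t' t'' : List (Option X.E)}
      (hs : s ++ s' = s'') (ht : t ++ t' = t'') (f : Tm K X a s t) {g g' : Tm K X b s' t'}
      (hg : DRel R b s' t' g g') : DRel R c s'' t'' (.tens h hs ht f g) (.tens h hs ht f g')
  | add_left {a : ℤ} {s t : List (Option X.E)} {f f' : Tm K X a s t} (g : Tm K X a s t)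
      (hf : DRel R a s t f f') : DRel R a s t (.add f g) (.add f' g)
  | add_right {a : ℤ} {s t : List (Option X.E)} (f : Tm K X a s t) {g g' : Tm K X a s t}
      (hg : DRel R a s t g g') : DRel R a s t (.add f g) (.add f g')
  | smul_congr {a : ℤ} {s t : List (Option X.E)} (k : K) {f f' : Tm K X a s t}
      (hf : DRel R a s t f f') : DRel R a s t (.smul k f) (.smul k f')
  -- vector space structure on morphisms
  | add_assoc {a : ℤ} {s t : List (Option X.E)} (f g k : Tm K X a s t) :
      DRel R a s t (.add (.add f g) k) (.add f (.add g k))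
  | add_comm {a : ℤ} {s t : List (Option X.E)} (f g : Tm K X a s t) :
      DRel R a s t (.add f g) (.add g f)
  | zero_add {a : ℤ} {s t : List (Option X.E)} (f : Tm K X a s t) :
      DRel R a s t (.add .zero f) f
  | smul_add {a : ℤ} {s t : List (Option X.E)} (k : K) (f g : Tm K X a s t) :
      DRel R a s t (.smul k (.add f g)) (.add (.smul k f) (.smul k g))
  | add_smul {a : ℤ} {s t : List (Option X.E)} (k l : K) (f : Tm K X a s t) :
      DRel R a s t (.smul (k + l) f) (.add (.smul k f) (.smul l f))
  | mul_smul {a : ℤ} {s t : List (Option X.E)} (k l : K) (f : Tm K X a s t) :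
      DRel R a s t (.smul (k * l) f) (.smul k (.smul l f))
  | one_smul {a : ℤ} {s t : List (Option X.E)} (f : Tm K X a s t) :
      DRel R a s t (.smul 1 f) f
  | zero_smul {a : ℤ} {s t : List (Option X.E)} (f : Tm K X a s t) :
      DRel R a s t (.smul 0 f) .zero
  -- bilinearity of composition and tensor product
  | add_comp {a b c : ℤ} (h : a + b = c) {r s t : List (Option X.E)} (f f' : Tm K X a r s)
      (g : Tm K X b s t) : DRel R c r t (.comp h (.add f f') g) (.add (.comp h f g) (.comp h f' g))
  | smul_comp {a b c : ℤ} (h : a + b = c) {r s t : List (Option X.E)} (k : K)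
      (f : Tm K X a r s) (g : Tm K X b s t) :
      DRel R c r t (.comp h (.smul k f) g) (.smul k (.comp h f g))
  | comp_add {a b c : ℤ} (h : a + b = c) {r s t : List (Option X.E)} (f : Tm K X a r s)
      (g g' : Tm K X b s t) : DRel R c r t (.comp h f (.add g g')) (.add (.comp h f g) (.comp h f g'))
  | comp_smul {a b c : ℤ} (h : a + b = c) {r s t : List (Option X.E)} (k : K)
      (f : Tm K X a r s) (g : Tm K X b s t) :
      DRel R c r t (.comp h f (.smul k g)) (.smul k (.comp h f g))
  | add_tens {a b c : ℤ} (h : a + b = c) {s s' s'' t t' t'' : List (Option X.E)}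
      (hs : s ++ s' = s'') (ht : t ++ t' = t'') (f f' : Tm K X a s t) (g : Tm K X b s' t') :
      DRel R c s'' t'' (.tens h hs ht (.add f f') g)
        (.add (.tens h hs ht f g) (.tens h hs ht f' g))
  | smul_tens {a b c : ℤ} (h : a + b = c) {s s' s'' t t' t'' : List (Option X.E)}
      (hs : s ++ s' = s'') (ht : t ++ t' = t'') (k : K) (f : Tm K X a s t)
      (g : Tm K X b s' t') :
      DRel R c s'' t'' (.tens h hs ht (.smul k f) g) (.smul k (.tens h hs ht f g))
  | tens_add {a b c : ℤ} (h : a + b = c) {s s' s'' t t' t'' : List (Option X.E)}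
      (hs : s ++ s' = s'') (ht : t ++ t' = t'') (f : Tm K X a s t) (g g' : Tm K X b s' t') :
      DRel R c s'' t'' (.tens h hs ht f (.add g g'))
        (.add (.tens h hs ht f g) (.tens h hs ht f g'))
  | tens_smul {a b c : ℤ} (h : a + b = c) {s s' s'' t t' t'' : List (Option X.E)}
      (hs : s ++ s' = s'') (ht : t ++ t' = t'') (k : K) (f : Tm K X a s t)
      (g : Tm K X b s' t') :
      DRel R c s'' t'' (.tens h hs ht f (.smul k g)) (.smul k (.tens h hs ht f g))
  -- category axioms
  | id_comp {a : ℤ} (h : 0 + a = a) {s t : List (Option X.E)} (f : Tm K X a s t) :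
      DRel R a s t (.comp h (.id s) f) f
  | comp_id {a : ℤ} (h : a + 0 = a) {s t : List (Option X.E)} (f : Tm K X a s t) :
      DRel R a s t (.comp h f (.id t)) f
  | assoc {a b c ab bc abc : ℤ} (h₁ : a + b = ab) (h₂ : ab + c = abc) (h₃ : b + c = bc)
      (h₄ : a + bc = abc) {q r s t : List (Option X.E)} (f : Tm K X a q r) (g : Tm K X b r s)
      (k : Tm K X c s t) :
      DRel R abc q t (.comp h₂ (.comp h₁ f g) k) (.comp h₄ f (.comp h₃ g k))
  -- strict monoidal axioms
  | tens_id {s s' s'' : List (Option X.E)} (hs : s ++ s' = s'') :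
      DRel R 0 s'' s'' (.tens (_root_.add_zero 0) hs hs (.id s) (.id s')) (.id s'')
  | interchange {a a' a'' b b' b'' c c' c'' : ℤ} (ha : a + a' = a'') (hb : b + b' = b'')
      (hc : c + c' = c'') (h : a + b = c) (h' : a' + b' = c') (h'' : a'' + b'' = c'')
      {r r' r'' s s' s'' t t' t'' : List (Option X.E)} (hr : r ++ r' = r'')
      (hs : s ++ s' = s'') (ht : t ++ t' = t'') (f : Tm K X a r s) (f' : Tm K X a' s t)
      (g : Tm K X b r' s') (g' : Tm K X b' s' t') :
      DRel R c'' r'' t'' (.tens h'' hr ht (.comp ha f f') (.comp hb g g'))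
        (.comp hc (.tens h hr hs f g) (.tens h' hs ht f' g'))
  | tens_assoc {a b c ab bc abc : ℤ} (h₁ : a + b = ab) (h₂ : ab + c = abc) (h₃ : b + c = bc)
      (h₄ : a + bc = abc) {s₁ s₂ s₃ s₁₂ s₂₃ s t₁ t₂ t₃ t₁₂ t₂₃ t : List (Option X.E)}
      (hs₁ : s₁ ++ s₂ = s₁₂) (hs₂ : s₁₂ ++ s₃ = s) (hs₃ : s₂ ++ s₃ = s₂₃) (hs₄ : s₁ ++ s₂₃ = s)
      (ht₁ : t₁ ++ t₂ = t₁₂) (ht₂ : t₁₂ ++ t₃ = t) (ht₃ : t₂ ++ t₃ = t₂₃) (ht₄ : t₁ ++ t₂₃ = t)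
      (f : Tm K X a s₁ t₁) (g : Tm K X b s₂ t₂) (k : Tm K X c s₃ t₃) :
      DRel R abc s t (.tens h₂ hs₂ ht₂ (.tens h₁ hs₁ ht₁ f g) k)
        (.tens h₄ hs₄ ht₄ f (.tens h₃ hs₃ ht₃ g k))
  | one_tens {a : ℤ} (h : 0 + a = a) {s t : List (Option X.E)} (hs : [] ++ s = s)
      (ht : [] ++ t = t) (f : Tm K X a s t) : DRel R a s t (.tens h hs ht (.id []) f) f
  | tens_one {a : ℤ} (h : a + 0 = a) {s t : List (Option X.E)} (hs : s ++ [] = s)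
      (ht : t ++ [] = t) (f : Tm K X a s t) : DRel R a s t (.tens h hs ht f (.id [])) f
  -- planar isotopy
  | zigzag : DRel R 0 [none] [none]
      (.comp (_root_.add_zero 0)
        (.tens (t'' := [none, none, none]) (_root_.add_zero 0) rfl rfl (.id [none]) .cup)
        (.tens (_root_.add_zero 0) rfl rfl .cap (.id [none]))) (.id [none])
  | zagzig : DRel R 0 [none] [none]
      (.comp (_root_.add_zero 0)
        (.tens (t'' := [none, none, none]) (_root_.add_zero 0) rfl rfl .cup (.id [none]))
        (.tens (_root_.add_zero 0) rfl rfl (.id [none]) .cap)) (.id [none])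
  | dot_cup : DRel R 2 [] [none, none]
      (.comp (_root_.zero_add 2) .cup
        (.tens (_root_.add_zero 2) rfl rfl .dot (.id [none])))
      (.comp (_root_.zero_add 2) .cup
        (.tens (_root_.zero_add 2) rfl rfl (.id [none]) .dot))
  | dot_cap : DRel R 2 [none, none] []
      (.comp (_root_.add_zero 2)
        (.tens (_root_.add_zero 2) rfl rfl .dot (.id [none])) .cap)
      (.comp (_root_.add_zero 2)
        (.tens (_root_.zero_add 2) rfl rfl (.id [none]) .dot) .cap)
  -- the circle evaluates to `2`
  | circle : DRel R 0 [] [] (.comp (_root_.add_zero 0) .cup .cap) (.smul 2 (.id []))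
  -- two dots on a strand vanish
  | dot_dot : DRel R 4 [none] [none] (.comp (by norm_num : (2 : ℤ) + 2 = 4) .dot .dot) .zero
  -- neck cutting: the sum of the two ways of dotting two parallel strands equals the sum of
  -- the two ways of dotting a cap followed by a cup
  | neck : DRel R 2 [none, none] [none, none]
      (.add (.tens (_root_.add_zero 2) rfl rfl .dot (.id [none]))
        (.tens (_root_.zero_add 2) rfl rfl (.id [none]) .dot))
      (.add
        (.comp (_root_.add_zero 2) (.comp (_root_.add_zero 2)
          (.tens (_root_.add_zero 2) rfl rfl .dot (.id [none])) .cap) .cup)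
        (.comp (_root_.zero_add 2) .cap (.comp (_root_.zero_add 2) .cup
          (.tens (_root_.add_zero 2) rfl rfl .dot (.id [none])))))

/-- The word of `n` black strands. -/
abbrev blk {X : Gens} (n : ℕ) : List (Option X.E) := List.replicate n none

theorem blk_add {X : Gens} (m n : ℕ) : (blk m ++ blk n : List (Option X.E)) = blk (m + n) :=
  List.replicate_append_replicate

/-- The alternating sum of dots: `z 0 = 0` and `z (n + 1) = x ⊗ 1 - 1 ⊗ z n`. -/
def zTm {K : Type u} [Field K] {X : Gens} : ∀ n : ℕ, Tm K X 2 (blk n) (blk n)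
  | 0 => .zero
  | n + 1 => .add (.tens (add_zero 2) rfl rfl .dot (.id (blk n)))
      (.smul (-1) (.tens (zero_add 2) rfl rfl (.id [none]) (zTm n)))

namespace Pres

variable {K : Type u} [Field K] {X : Gens} (R : TmRel K X)

/-- Degree `a` morphisms from `s` to `t` of the presented category. -/
def Hom (a : ℤ) (s t : List (Option X.E)) : Type u := Quot (DRel R a s t)

variable {R}

/-- The class of a term. -/
def mk {a : ℤ} {s t : List (Option X.E)} (f : Tm K X a s t) : Hom R a s t := Quot.mk _ f

theorem sound {a : ℤ} {s t : List (Option X.E)} {f g : Tm K X a s t} (h : DRel R a s t f g) :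
    (mk f : Hom R a s t) = mk g := Quot.sound h

theorem mk_surj {a : ℤ} {s t : List (Option X.E)} (f : Hom R a s t) : ∃ f', mk f' = f :=
  Quot.exists_rep f

instance {a : ℤ} {s t : List (Option X.E)} : Add (Hom R a s t) :=
  ⟨Quot.map₂ Tm.add (fun f _ _ h => .add_right f h) (fun _ _ g h => .add_left g h)⟩

instance {a : ℤ} {s t : List (Option X.E)} : Zero (Hom R a s t) := ⟨mk .zero⟩

instance {a : ℤ} {s t : List (Option X.E)} : SMul K (Hom R a s t) :=
  ⟨fun k => Quot.map (Tm.smul k) (fun _ _ h => .smul_congr k h)⟩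

theorem mk_add {a : ℤ} {s t : List (Option X.E)} (f g : Tm K X a s t) :
    (mk (.add f g) : Hom R a s t) = mk f + mk g := rfl

theorem mk_smul {a : ℤ} {s t : List (Option X.E)} (k : K) (f : Tm K X a s t) :
    (mk (.smul k f) : Hom R a s t) = k • mk f := rfl

theorem mk_zero {a : ℤ} {s t : List (Option X.E)} : (mk .zero : Hom R a s t) = 0 := rfl

instance {a : ℤ} {s t : List (Option X.E)} : AddCommMonoid (Hom R a s t) where
  add_assoc := by rintro ⟨f⟩ ⟨g⟩ ⟨k⟩; exact sound (.add_assoc f g k)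
  add_comm := by rintro ⟨f⟩ ⟨g⟩; exact sound (.add_comm f g)
  zero_add := by rintro ⟨f⟩; exact sound (.zero_add f)
  add_zero := by rintro ⟨f⟩; exact (sound (.add_comm f .zero)).trans (sound (.zero_add f))
  nsmul := nsmulRec

instance {a : ℤ} {s t : List (Option X.E)} : Module K (Hom R a s t) where
  one_smul := by rintro ⟨f⟩; exact sound (.one_smul f)
  mul_smul := by rintro k l ⟨f⟩; exact sound (.mul_smul k l f)
  smul_zero := by
    intro k
    have h : (0 : Hom R a s t) = (0 : K) • (0 : Hom R a s t) := (sound (.zero_smul .zero)).symm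
    have h' : k • (0 : K) • (0 : Hom R a s t) = (k * 0) • (0 : Hom R a s t) :=
      (sound (.mul_smul k 0 .zero)).symm
    rw [h, h', mul_zero]
  smul_add := by rintro k ⟨f⟩ ⟨g⟩; exact sound (.smul_add k f g)
  add_smul := by rintro k l ⟨f⟩; exact sound (.add_smul k l f)
  zero_smul := by rintro ⟨f⟩; exact sound (.zero_smul f)

instance {a : ℤ} {s t : List (Option X.E)} : AddCommGroup (Hom R a s t) :=
  Module.addCommMonoidToAddCommGroup K

/-- Composition, in diagrammatic order. -/
def comp {a b c : ℤ} (h : a + b = c) {r s t : List (Option X.E)} :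
    Hom R a r s →ₗ[K] Hom R b s t →ₗ[K] Hom R c r t :=
  LinearMap.mk₂ K (Quot.map₂ (Tm.comp h) (fun f _ _ hg => .comp_right h f hg)
      (fun _ _ g hf => .comp_left h g hf))
    (by rintro ⟨f⟩ ⟨f'⟩ ⟨g⟩; exact sound (.add_comp h f f' g))
    (by rintro k ⟨f⟩ ⟨g⟩; exact sound (.smul_comp h k f g))
    (by rintro ⟨f⟩ ⟨g⟩ ⟨g'⟩; exact sound (.comp_add h f g g'))
    (by rintro k ⟨f⟩ ⟨g⟩; exact sound (.comp_smul h k f g))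

/-- Tensor product: horizontal juxtaposition of diagrams. -/
def tens {a b c : ℤ} (h : a + b = c) {s s' s'' t t' t'' : List (Option X.E)}
    (hs : s ++ s' = s'') (ht : t ++ t' = t'') :
    Hom R a s t →ₗ[K] Hom R b s' t' →ₗ[K] Hom R c s'' t'' :=
  LinearMap.mk₂ K (Quot.map₂ (Tm.tens h hs ht) (fun f _ _ hg => .tens_right h hs ht f hg)
      (fun _ _ g hf => .tens_left h hs ht g hf))
    (by rintro ⟨f⟩ ⟨f'⟩ ⟨g⟩; exact sound (.add_tens h hs ht f f' g))
    (by rintro k ⟨f⟩ ⟨g⟩; exact sound (.smul_tens h hs ht k f g))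
    (by rintro ⟨f⟩ ⟨g⟩ ⟨g'⟩; exact sound (.tens_add h hs ht f g g'))
    (by rintro k ⟨f⟩ ⟨g⟩; exact sound (.tens_smul h hs ht k f g))

/-- The identity morphism. -/
def id (s : List (Option X.E)) : Hom R 0 s s := mk (.id s)

theorem mk_comp {a b c : ℤ} (h : a + b = c) {r s t : List (Option X.E)} (f : Tm K X a r s)
    (g : Tm K X b s t) : (mk (.comp h f g) : Hom R c r t) = comp h (mk f) (mk g) := rfl

theorem mk_tens {a b c : ℤ} (h : a + b = c) {s s' s'' t t' t'' : List (Option X.E)}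
    (hs : s ++ s' = s'') (ht : t ++ t' = t'') (f : Tm K X a s t) (g : Tm K X b s' t') :
    (mk (.tens h hs ht f g) : Hom R c s'' t'') = tens h hs ht (mk f) (mk g) := rfl

theorem mk_id (s : List (Option X.E)) : (mk (.id s) : Hom R 0 s s) = id s := rfl

theorem id_comp {a : ℤ} (h : 0 + a = a) {s t : List (Option X.E)} (f : Hom R a s t) :
    comp h (id s) f = f := by
  obtain ⟨f, rfl⟩ := mk_surj f; exact sound (.id_comp h f)

theorem comp_id {a : ℤ} (h : a + 0 = a) {s t : List (Option X.E)} (f : Hom R a s t) :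
    comp h f (id t) = f := by
  obtain ⟨f, rfl⟩ := mk_surj f; exact sound (.comp_id h f)

theorem assoc {a b c ab bc abc : ℤ} (h₁ : a + b = ab) (h₂ : ab + c = abc) (h₃ : b + c = bc)
    (h₄ : a + bc = abc) {q r s t : List (Option X.E)} (f : Hom R a q r) (g : Hom R b r s)
    (k : Hom R c s t) : comp h₂ (comp h₁ f g) k = comp h₄ f (comp h₃ g k) := by
  obtain ⟨f, rfl⟩ := mk_surj f; obtain ⟨g, rfl⟩ := mk_surj g; obtain ⟨k, rfl⟩ := mk_surj k
  exact sound (.assoc h₁ h₂ h₃ h₄ f g k)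

theorem tens_id {s s' s'' : List (Option X.E)} (hs : s ++ s' = s'') :
    tens (add_zero 0) hs hs (id s) (id s') = (id s'' : Hom R 0 s'' s'') := sound (.tens_id hs)

theorem interchange {a a' a'' b b' b'' c c' c'' : ℤ} (ha : a + a' = a'') (hb : b + b' = b'')
    (hc : c + c' = c'') (h : a + b = c) (h' : a' + b' = c') (h'' : a'' + b'' = c'')
    {r r' r'' s s' s'' t t' t'' : List (Option X.E)} (hr : r ++ r' = r'')
    (hs : s ++ s' = s'') (ht : t ++ t' = t'') (f : Hom R a r s) (f' : Hom R a' s t)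
    (g : Hom R b r' s') (g' : Hom R b' s' t') :
    tens h'' hr ht (comp ha f f') (comp hb g g') =
      comp hc (tens h hr hs f g) (tens h' hs ht f' g') := by
  obtain ⟨f, rfl⟩ := mk_surj f; obtain ⟨g, rfl⟩ := mk_surj g
  obtain ⟨f', rfl⟩ := mk_surj f'; obtain ⟨g', rfl⟩ := mk_surj g'
  exact sound (.interchange ha hb hc h h' h'' hr hs ht f f' g g')

theorem tens_assoc {a b c ab bc abc : ℤ} (h₁ : a + b = ab) (h₂ : ab + c = abc) (h₃ : b + c = bc)
    (h₄ : a + bc = abc) {s₁ s₂ s₃ s₁₂ s₂₃ s t₁ t₂ t₃ t₁₂ t₂₃ t : List (Option X.E)}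
    (hs₁ : s₁ ++ s₂ = s₁₂) (hs₂ : s₁₂ ++ s₃ = s) (hs₃ : s₂ ++ s₃ = s₂₃) (hs₄ : s₁ ++ s₂₃ = s)
    (ht₁ : t₁ ++ t₂ = t₁₂) (ht₂ : t₁₂ ++ t₃ = t) (ht₃ : t₂ ++ t₃ = t₂₃) (ht₄ : t₁ ++ t₂₃ = t)
    (f : Hom R a s₁ t₁) (g : Hom R b s₂ t₂) (k : Hom R c s₃ t₃) :
    tens h₂ hs₂ ht₂ (tens h₁ hs₁ ht₁ f g) k = tens h₄ hs₄ ht₄ f (tens h₃ hs₃ ht₃ g k) := by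
  obtain ⟨f, rfl⟩ := mk_surj f; obtain ⟨g, rfl⟩ := mk_surj g; obtain ⟨k, rfl⟩ := mk_surj k
  exact sound (.tens_assoc h₁ h₂ h₃ h₄ hs₁ hs₂ hs₃ hs₄ ht₁ ht₂ ht₃ ht₄ f g k)

theorem one_tens {a : ℤ} (h : 0 + a = a) {s t : List (Option X.E)} (hs : [] ++ s = s)
    (ht : [] ++ t = t) (f : Hom R a s t) : tens h hs ht (id []) f = f := by
  obtain ⟨f, rfl⟩ := mk_surj f; exact sound (.one_tens h hs ht f)

theorem tens_one {a : ℤ} (h : a + 0 = a) {s t : List (Option X.E)} (hs : s ++ [] = s)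
    (ht : t ++ [] = t) (f : Hom R a s t) : tens h hs ht f (id []) = f := by
  obtain ⟨f, rfl⟩ := mk_surj f; exact sound (.tens_one h hs ht f)

variable (R)

/-- The presented category. -/
def cat : GrCat.{u, 0} K where
  Obj := List (Option X.E)
  Hom a s t := Hom R a s t
  grp _ _ _ := inferInstance
  mod _ _ _ := inferInstance
  id s := id s
  comp h := comp h
  id_comp h _ _ f := id_comp h f
  comp_id h _ _ f := comp_id h f
  assoc h₁ h₂ h₃ h₄ _ _ _ _ f g k := assoc h₁ h₂ h₃ h₄ f g k

/-- The tensor product of the presented category: concatenation of words and horizontal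
juxtaposition of diagrams. -/
def tensor : (cat R).Tensor where
  obj s t := List.append s t
  hom h := tens h rfl rfl
  hom_id _ _ := tens_id rfl
  hom_comp ha hb hc h h' h'' _ _ _ _ _ _ f f' g g' :=
    interchange ha hb hc h h' h'' rfl rfl rfl f f' g g'

variable {R}

/-- A dot on a black strand. -/
def dot : Hom R 2 [none] [none] := mk .dot

/-- The cup. -/
def cup : Hom R 0 [] [none, none] := mk .cup

/-- The cap. -/
def cap : Hom R 0 [none, none] [] := mk .cap

/-- The cup with a dot. -/
def dotCup : Hom R 2 [] [none, none] :=
  comp (zero_add 2) cup (tens (add_zero 2) rfl rfl dot (id [none]))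

/-- A generating morphism. -/
def gen (g : X.G) : Hom R (X.deg g) (X.dom g) (X.cod g) := mk (.gen g)

/-- Addition of a black strand on the left. -/
def left {a : ℤ} {s t : List (Option X.E)} (f : Hom R a s t) :
    Hom R a (none :: s) (none :: t) :=
  tens (zero_add a) rfl rfl (id [none]) f

/-- The crossing `1 - cup ∘ cap`. -/
def cross : Hom R 0 [none, none] [none, none] := id [none, none] - comp (add_zero 0) cap cup

/-- The crossing of the two leftmost among `n + 2` black strands. -/
def crossL (n : ℕ) : Hom R 0 (blk (n + 2)) (blk (n + 2)) :=
  tens (add_zero 0) rfl rfl cross (id (blk n))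

/-- The alternating sum of dots: `z 0 = 0` and `z (n + 1) = x ⊗ 1 - 1 ⊗ z n`. -/
def z (n : ℕ) : Hom R 2 (blk n) (blk n) := mk (zTm n)

/-- With the crossings `s₁, …, s_n` of adjacent strands among `n + 1` black strands, the sum
`1 + s₁ + s₂ s₁ + ⋯ + s_n ⋯ s₁` over the shortest representatives of the left cosets in `S_(n+1)` of
the subgroup `S_n` that permutes the last `n` strands. -/
def cosetSum : ∀ n : ℕ, Hom R 0 (blk (n + 1)) (blk (n + 1))
  | 0 => id _
  | n + 1 => id _ + comp (add_zero 0) (crossL n) (left (cosetSum n))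

/-- The sum over the symmetric group `S_n` of the permutations acting on `n` black strands. -/
def symSum : ∀ n : ℕ, Hom R 0 (blk n) (blk n)
  | 0 => id _
  | n + 1 => comp (add_zero 0) (left (symSum n)) (cosetSum n)

/-- The Jones-Wenzl projector `(1 / n!) ∑ w`. -/
def jw (n : ℕ) : Hom R 0 (blk n) (blk n) := (n.factorial : K)⁻¹ • symSum n

/-- The nested cups `∅ ⟶ blk m ⊗ blk m`. -/
def cups : ∀ m : ℕ, Hom R 0 [] (blk m ++ blk m)
  | 0 => id _
  | m + 1 => comp (zero_add 0) cup
      (left (tens (s'' := [none]) (t'' := blk m ++ blk (m + 1)) (add_zero 0) rfl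
        (by rw [List.append_assoc, show [none] = blk 1 from rfl, blk_add]) (cups m) (id [none])))

/-- `n` nested undotted cups, surrounded by `b` nested cups with a dot. -/
def nestedCups (n : ℕ) : ∀ b : ℕ, Hom R (2 * b) [] (blk (n + b) ++ blk (n + b))
  | 0 => cups n
  | b + 1 => comp (b := 2 * b) (by push_cast; ring) dotCup
      (left (tens (s'' := [none]) (t'' := blk (n + b) ++ blk (n + (b + 1))) (add_zero _) rfl
        (by rw [List.append_assoc, show [none] = blk 1 from rfl, blk_add]; rfl)
        (nestedCups n b) (id [none])))

end Pres

end Kirby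

namespace Kirby

/-! ### The Jones-Wenzl projectors are idempotent -/

section Symmetrizer

variable {A : ℕ → Type u} [∀ n, Ring (A n)] (S : ∀ n, A n →+* A (n + 1)) (s : ∀ n, A (n + 2))

/-- The generators of `S_n`, in a tower of rings. -/
inductive TowerGen : ∀ n, A n → Prop
  | first (n : ℕ) : TowerGen (n + 2) (s n)
  | next (n : ℕ) (t : A n) (h : TowerGen n t) : TowerGen (n + 1) (S n t)

/-- The sum over coset representatives, in a tower of rings. -/
def towerCoset : ∀ n, A (n + 1)
  | 0 => 1
  | n + 1 => 1 + S (n + 1) (towerCoset n) * s n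

/-- The symmetrizer, in a tower of rings. -/
def towerSym : ∀ n, A n
  | 0 => 1
  | n + 1 => towerCoset S s n * S n (towerSym n)

theorem towerCoset_absorb (hs : ∀ n, s n * s n = 1)
    (hbr : ∀ n, s (n + 1) * S _ (s n) * s (n + 1) = S _ (s n) * s (n + 1) * S _ (s n))
    (hcomm : ∀ n (a : A n), s n * S _ (S _ a) = S _ (S _ a) * s n)
    (n : ℕ) : ∀ {B : Type u} [Ring B] (φ : A (n + 1) →+* B) (Y : B),
    (∀ t, TowerGen S s n t → φ (S n t) * Y = Y) → ∀ t, TowerGen S s (n + 1) t →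
      φ t * (φ (towerCoset S s n) * Y) = φ (towerCoset S s n) * Y := by
  induction n with
  | zero =>
    intro B _ φ Y _ t ht
    cases ht with
    | next _ t h => nomatch h
  | succ n ih =>
    intro B _ φ Y hY t ht
    have key : φ (towerCoset S s (n + 1)) * Y =
        Y + φ (S _ (towerCoset S s n)) * (φ (s n) * Y) := by
      simp only [towerCoset, map_add, map_mul, map_one, add_mul, one_mul, mul_assoc]
    rw [key]
    cases ht with
    | first _ =>
      have hss : φ (s n) * (φ (s n) * Y) = Y := by
        rw [← mul_assoc, ← map_mul, hs, map_one, one_mul]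
      cases n with
      | zero => simp only [towerCoset, map_one, one_mul, mul_add, hss, add_comm]
      | succ m =>
        have h1 : φ (S _ (s m)) * Y = Y := hY _ (.first m)
        have h2 : φ (s (m + 1)) * (φ (S _ (S _ (towerCoset S s m))) * (φ (S _ (s m)) *
            (φ (s (m + 1)) * Y))) = φ (S _ (S _ (towerCoset S s m))) * (φ (S _ (s m)) *
            (φ (s (m + 1)) * Y)) := by
          have h3 : s (m + 1) * (S _ (S _ (towerCoset S s m)) * (S _ (s m) * s (m + 1))) =
              S _ (S _ (towerCoset S s m)) * (S _ (s m) * (s (m + 1) * S _ (s m))) := by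
            rw [← mul_assoc, hcomm, mul_assoc, ← mul_assoc (s (m + 1)), hbr, mul_assoc]
          have h4 := congrArg (fun q => φ q * Y) h3
          simpa only [map_mul, mul_assoc, h1] using h4
        simp only [towerCoset, map_add, map_mul, map_one, one_mul, add_mul, mul_add, mul_assoc,
          hss, h2]
        abel
    | next _ t h =>
      rw [mul_add, hY t h, ← mul_assoc, ← map_mul, ← map_mul]
      congr 1
      have := ih (φ.comp (S _)) (φ (s n) * Y) (fun t' h' => by
        have := hY _ (.next _ t' h')
        rw [RingHom.comp_apply, ← mul_assoc, ← map_mul, ← hcomm, map_mul, mul_assoc, this]) t h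
      simp only [RingHom.comp_apply, ← mul_assoc, ← map_mul] at this ⊢
      exact this

theorem towerSym_absorb (hs : ∀ n, s n * s n = 1)
    (hbr : ∀ n, s (n + 1) * S _ (s n) * s (n + 1) = S _ (s n) * s (n + 1) * S _ (s n))
    (hcomm : ∀ n (a : A n), s n * S _ (S _ a) = S _ (S _ a) * s n)
    (n : ℕ) : ∀ t, TowerGen S s n t →
    t * towerSym S s n = towerSym S s n := by
  induction n with
  | zero => intro t h; nomatch h
  | succ n ih =>
    intro t h
    exact towerCoset_absorb S s hs hbr hcomm n (RingHom.id _) (S n (towerSym S s n))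
      (fun t' h' => by rw [RingHom.id_apply, ← map_mul, ih t' h']) t h

theorem towerCoset_fixed (n : ℕ) : ∀ {B : Type u} [Ring B] (φ : A (n + 1) →+* B) (Y : B),
    (∀ t, TowerGen S s (n + 1) t → φ t * Y = Y) →
      φ (towerCoset S s n) * Y = ((n + 1 : ℕ) : B) * Y := by
  induction n with
  | zero => intro B _ φ Y _; simp [towerCoset]
  | succ n ih =>
    intro B _ φ Y hY
    have := ih (φ.comp (S _)) Y (fun t h => hY _ (.next _ t h))
    rw [RingHom.comp_apply] at this
    simp only [towerCoset, map_add, map_mul, map_one, add_mul, one_mul, mul_assoc,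
      hY _ (.first n)]
    rw [this]
    push_cast
    noncomm_ring

theorem towerSym_fixed (n : ℕ) : ∀ {B : Type u} [Ring B] (φ : A n →+* B) (Y : B),
    (∀ t, TowerGen S s n t → φ t * Y = Y) →
      φ (towerSym S s n) * Y = (n.factorial : B) * Y := by
  induction n with
  | zero => intro B _ φ Y _; simp [towerSym]
  | succ n ih =>
    intro B _ φ Y hY
    have h1 := ih (φ.comp (S _)) Y (fun t h => hY _ (.next _ t h))
    have h2 := towerCoset_fixed S s n φ Y hY
    rw [RingHom.comp_apply] at h1
    rw [towerSym, map_mul, mul_assoc, h1, ← mul_assoc, ← (Nat.cast_commute n.factorial _).eq,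
      mul_assoc, h2, ← mul_assoc, ← Nat.cast_mul, Nat.factorial_succ, mul_comm n.factorial]

theorem towerSym_sq (hs : ∀ n, s n * s n = 1)
    (hbr : ∀ n, s (n + 1) * S _ (s n) * s (n + 1) = S _ (s n) * s (n + 1) * S _ (s n))
    (hcomm : ∀ n (a : A n), s n * S _ (S _ a) = S _ (S _ a) * s n)
    (n : ℕ) :
    towerSym S s n * towerSym S s n = (n.factorial : A n) * towerSym S s n :=
  towerSym_fixed S s n (RingHom.id _) _ (towerSym_absorb S s hs hbr hcomm n)

end Symmetrizer

end Kirby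

namespace Kirby

namespace Pres

variable {K : Type u} [Field K] {X : Gens} {R : TmRel K X}

/-- The ring of degree zero endomorphisms; the product `f * g` is `f ∘ g`. -/
instance {s : List (Option X.E)} : Ring (Hom R 0 s s) where
  __ := (inferInstance : AddCommGroup (Hom R 0 s s))
  mul f g := comp (add_zero 0) g f
  one := id s
  left_distrib f g k := by
    change comp _ (g + k) f = comp _ g f + comp _ k f
    rw [map_add, LinearMap.add_apply]
  right_distrib f g k := by
    change comp _ k (f + g) = comp _ k f + comp _ k g
    rw [map_add]
  zero_mul f := by
    change comp _ f 0 = 0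
    rw [map_zero]
  mul_zero f := by
    change comp _ 0 f = 0
    rw [map_zero, LinearMap.zero_apply]
  mul_assoc f g k := (assoc (add_zero 0) (add_zero 0) (add_zero 0) (add_zero 0) k g f).symm
  one_mul f := comp_id _ f
  mul_one f := id_comp _ f

theorem mul_def {s : List (Option X.E)} (f g : Hom R 0 s s) : f * g = comp (add_zero 0) g f := rfl

theorem one_def (s : List (Option X.E)) : (1 : Hom R 0 s s) = id s := rfl

/-- `f ↦ 1 ⊗ f`, as a ring homomorphism. -/
def leftHom (s : List (Option X.E)) : Hom R 0 s s →+* Hom R 0 (none :: s) (none :: s) where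
  toFun f := left f
  map_one' := tens_id rfl
  map_mul' f g := by
    change tens _ rfl rfl (id [none]) (comp _ g f) = comp _ (left g) (left f)
    rw [left, left, ← interchange (add_zero 0) (add_zero 0) (add_zero 0) (add_zero 0)
      (add_zero 0) (add_zero 0), id_comp]
  map_zero' := map_zero _
  map_add' := map_add _

/-- `f ↦ f ⊗ 1`, as a ring homomorphism. -/
def rightHom (s t : List (Option X.E)) : Hom R 0 s s →+* Hom R 0 (s ++ t) (s ++ t) where
  toFun f := tens (add_zero 0) rfl rfl f (id t)
  map_one' := tens_id rfl
  map_mul' f g := by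
    rw [mul_def, mul_def, ← interchange (add_zero 0) (add_zero 0) (add_zero 0) (add_zero 0)
      (add_zero 0) (add_zero 0), id_comp]
  map_zero' := by simp
  map_add' := by simp

/-- `f ↦ f ⊗ 1`, from two to three strands. -/
def right23 : Hom R 0 [none, none] [none, none] →+*
    Hom R 0 [none, none, none] [none, none, none] := rightHom [none, none] [none]

/-- `f ↦ 1 ⊗ f`, from two to three strands. -/
def left23 : Hom R 0 [none, none] [none, none] →+*
    Hom R 0 [none, none, none] [none, none, none] := leftHom [none, none]

/-- `f ↦ 1 ⊗ f`, from `n` to `n + 1` strands. -/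
def leftBlk (n : ℕ) : Hom R 0 (blk n) (blk n) →+* Hom R 0 (blk (n + 1)) (blk (n + 1)) :=
  leftHom (blk n)

/-- `f ↦ f ⊗ 1`, from three to `n + 3` strands. -/
def rightBlk (n : ℕ) : Hom R 0 [none, none, none] [none, none, none] →+*
    Hom R 0 (blk (n + 3)) (blk (n + 3)) := rightHom [none, none, none] (blk n)

theorem cupcap_sq : (comp (add_zero 0) cap cup * comp (add_zero 0) cap cup :
    Hom R 0 [none, none] [none, none]) = 2 * comp (add_zero 0) cap cup := by
  rw [mul_def, assoc (add_zero 0) (add_zero 0) (add_zero 0) (add_zero 0),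
    ← assoc (add_zero 0) (add_zero 0) (add_zero 0) (add_zero 0) cup cap cup]
  have h : comp (add_zero 0) cup cap = (2 : K) • (id [] : Hom R 0 [] []) := sound .circle
  rw [h, map_smul, LinearMap.smul_apply, id_comp, map_smul, two_smul, two_mul]

theorem cross_sq : (cross * cross : Hom R 0 [none, none] [none, none]) = 1 := by
  have h := cupcap_sq (R := R)
  unfold cross
  rw [← one_def, sub_mul, mul_sub, mul_sub, h, two_mul]
  noncomm_ring

theorem zigzag : comp (add_zero 0)
    (tens (t'' := [none, none, none]) (add_zero 0) rfl rfl (id [none]) cup)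
    (tens (add_zero 0) rfl rfl cap (id [none])) = (id [none] : Hom R 0 [none] [none]) :=
  sound .zigzag

theorem zagzig : comp (add_zero 0)
    (tens (t'' := [none, none, none]) (add_zero 0) rfl rfl cup (id [none]))
    (tens (add_zero 0) rfl rfl (id [none]) cap) = (id [none] : Hom R 0 [none] [none]) :=
  sound .zagzig

theorem cupcap_left : (left23 (comp (add_zero 0) cap cup) :
    Hom R 0 [none, none, none] [none, none, none]) =
      comp (add_zero 0) (tens (add_zero 0) rfl rfl (id [none]) cap)
        (tens (t'' := [none, none, none]) (add_zero 0) rfl rfl (id [none]) cup) := by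
  rw [← interchange (add_zero 0) (add_zero 0) (add_zero 0) (add_zero 0) (add_zero 0) (add_zero 0),
    id_comp]
  rfl

theorem cupcap_right : (right23 (comp (add_zero 0) cap cup) :
    Hom R 0 [none, none, none] [none, none, none]) =
      comp (add_zero 0) (tens (add_zero 0) rfl rfl cap (id [none]))
        (tens (t'' := [none, none, none]) (add_zero 0) rfl rfl cup (id [none])) := by
  rw [← interchange (add_zero 0) (add_zero 0) (add_zero 0) (add_zero 0) (add_zero 0) (add_zero 0),
    id_comp]
  rfl

theorem comp_three {s t : List (Option X.E)} (p : Hom R 0 s t) (q : Hom R 0 t s)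
    (p' : Hom R 0 s t) (q' : Hom R 0 t s) (h : comp (add_zero 0) q p' = id t)
    (h' : comp (add_zero 0) q' p = id t) :
    comp (add_zero 0) p q * comp (add_zero 0) p' q' * comp (add_zero 0) p q =
      comp (add_zero 0) p q := by
  simp only [mul_def]
  rw [assoc (add_zero 0) (add_zero 0) (add_zero 0) (add_zero 0) p q,
    ← assoc (add_zero 0) (add_zero 0) (add_zero 0) (add_zero 0) q _ _,
    ← assoc (add_zero 0) (add_zero 0) (add_zero 0) (add_zero 0) q p' q', h, id_comp,
    ← assoc (add_zero 0) (add_zero 0) (add_zero 0) (add_zero 0) q' p q, h', id_comp]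

theorem braid : (right23 cross * left23 cross *
      right23 cross : Hom R 0 [none, none, none] [none, none, none]) =
    left23 cross * right23 cross *
      left23 cross := by
  unfold cross
  rw [← one_def, map_sub, map_sub, map_one, map_one]
  have h1 := congrArg (left23) (cupcap_sq (R := R))
  have h2 := congrArg (right23) (cupcap_sq (R := R))
  rw [map_mul, map_mul, map_ofNat] at h1 h2
  have h3 : right23 (comp (add_zero 0) cap cup) *
      left23 (comp (add_zero 0) cap cup) *
      right23 (comp (add_zero 0) cap cup) =
      (right23 (comp (add_zero 0) cap cup) :
        Hom R 0 [none, none, none] [none, none, none]) := by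
    rw [cupcap_left, cupcap_right]
    exact comp_three _ _ _ _ zagzig zigzag
  have h4 : left23 (comp (add_zero 0) cap cup) *
      right23 (comp (add_zero 0) cap cup) *
      left23 (comp (add_zero 0) cap cup) =
      (left23 (comp (add_zero 0) cap cup) :
        Hom R 0 [none, none, none] [none, none, none]) := by
    rw [cupcap_left, cupcap_right]
    exact comp_three _ _ _ _ zigzag zagzig
  generalize (right23 (comp (add_zero 0) cap cup) :
    Hom R 0 [none, none, none] [none, none, none]) = e at *
  generalize (left23 (comp (add_zero 0) cap cup) :
    Hom R 0 [none, none, none] [none, none, none]) = f at *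
  have e1 : (1 - e) * (1 - f) * (1 - e) = 1 - e - e - f + e * f + f * e + e * e - e * f * e := by
    noncomm_ring
  have e2 : (1 - f) * (1 - e) * (1 - f) = 1 - f - f - e + f * e + e * f + f * f - f * e * f := by
    noncomm_ring
  rw [e1, e2, h1, h2, h3, h4]
  noncomm_ring

theorem crossL_sq (n : ℕ) : (crossL n * crossL n : Hom R 0 (blk (n + 2)) (blk (n + 2))) = 1 := by
  change rightHom [none, none] (blk n) cross * rightHom [none, none] (blk n) cross = 1
  rw [← map_mul, cross_sq, map_one]

theorem crossL_succ (n : ℕ) : (crossL (n + 1) : Hom R 0 (blk (n + 3)) (blk (n + 3))) =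
    rightBlk n (right23 cross) := by
  change tens _ _ _ cross (id _) = tens _ _ _ (tens _ _ _ cross (id [none])) (id (blk n))
  refine Eq.trans ?_ (tens_assoc (add_zero 0) (add_zero 0) (add_zero 0) (add_zero 0)
    rfl rfl rfl rfl rfl rfl rfl rfl cross (id [none]) (id (blk n))).symm
  rw [tens_id]
  rfl

theorem left_crossL (n : ℕ) : (left (crossL n) : Hom R 0 (blk (n + 3)) (blk (n + 3))) =
    rightBlk n (left23 cross) :=
  (tens_assoc (add_zero 0) (add_zero 0) (add_zero 0) (add_zero 0) rfl rfl rfl rfl rfl rfl rfl rfl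
    (id [none]) cross (id (blk n))).symm

theorem crossL_braid (n : ℕ) : (crossL (n + 1) * leftBlk _ (crossL n) * crossL (n + 1) :
      Hom R 0 (blk (n + 3)) (blk (n + 3))) =
    leftBlk _ (crossL n) * crossL (n + 1) * leftBlk _ (crossL n) := by
  have h : leftBlk _ (crossL n) = rightBlk n (left23 cross) := left_crossL (R := R) n
  rw [crossL_succ, h, ← map_mul, ← map_mul, braid, map_mul, map_mul]

theorem crossL_comm (n : ℕ) (f : Hom R 0 (blk n) (blk n)) :
    (crossL n * leftBlk _ (leftBlk _ f) : Hom R 0 (blk (n + 2)) (blk (n + 2))) =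
      leftBlk _ (leftBlk _ f) * crossL n := by
  have h : (leftBlk _ (leftBlk _ f) : Hom R 0 (blk (n + 2)) (blk (n + 2))) =
      tens (add_zero 0) rfl rfl (id [none, none]) f := by
    rw [← tens_id (s := [none]) (s' := [none]) (s'' := [none, none]) rfl]
    exact (tens_assoc (add_zero 0) (add_zero 0) (add_zero 0) (add_zero 0) rfl rfl rfl rfl rfl rfl
      rfl rfl (id [none]) (id [none]) f).symm
  rw [h, mul_def, mul_def, crossL,
    ← interchange (add_zero 0) (add_zero 0) (add_zero 0) (add_zero 0) (add_zero 0) (add_zero 0),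
    ← interchange (add_zero 0) (add_zero 0) (add_zero 0) (add_zero 0) (add_zero 0) (add_zero 0),
    id_comp, comp_id, id_comp, comp_id]

theorem cosetSum_eq (n : ℕ) : (cosetSum n : Hom R 0 (blk (n + 1)) (blk (n + 1))) =
    towerCoset (A := fun n => Hom R 0 (blk n) (blk n)) (fun n => leftHom (blk n)) crossL n := by
  induction n with
  | zero => rfl
  | succ n ih => rw [cosetSum, ih]; rfl

theorem symSum_eq (n : ℕ) : (symSum n : Hom R 0 (blk n) (blk n)) =
    towerSym (A := fun n => Hom R 0 (blk n) (blk n)) (fun n => leftHom (blk n)) crossL n := by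
  induction n with
  | zero => rfl
  | succ n ih => rw [symSum, ih, cosetSum_eq]; rfl

theorem symSum_sq (n : ℕ) : (symSum n * symSum n : Hom R 0 (blk n) (blk n)) =
    (n.factorial : K) • symSum n := by
  rw [symSum_eq]
  refine (towerSym_sq (A := fun n => Hom R 0 (blk n) (blk n)) (fun n => leftHom (blk n)) crossL
    crossL_sq crossL_braid crossL_comm n).trans ?_
  rw [← nsmul_eq_mul, Nat.cast_smul_eq_nsmul]

theorem jw_idem [CharZero K] (n : ℕ) :
    comp (add_zero 0) (jw n) (jw n) = (jw n : Hom R 0 (blk n) (blk n)) := by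
  have h : (n.factorial : K) ≠ 0 := Nat.cast_ne_zero.mpr n.factorial_ne_zero
  have h' := symSum_sq (R := R) n
  rw [mul_def] at h'
  rw [jw, map_smul, map_smul, LinearMap.smul_apply, h', smul_smul, smul_smul, mul_assoc,
    inv_mul_cancel₀ h, mul_one]

end Pres

end Kirby

namespace Kirby

open GrCat

/-! ### The dotted Temperley-Lieb category and the Kirby objects -/

/-- No additional generators. -/
def noGens : Gens where
  E := Empty
  G := Empty
  dom := fun g => nomatch g
  cod := fun g => nomatch g
  deg := fun g => nomatch g

/-- No additional relations. -/
def noRel (K : Type u) : TmRel K noGens := fun _ _ _ _ _ => False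

variable (K : Type u) [Field K]

/-- The dotted Temperley-Lieb category. Its objects are the words in the single letter `none`. -/
abbrev dTL : GrCat.{u, 0} K := Pres.cat (noRel K)

/-- The tensor product on `Mat (Kar dTL)`. -/
noncomputable def dTLTensor : (dTL K).Kar.Mat.Tensor := (Pres.tensor (noRel K)).kar.mat

variable [CharZero K]

/-- The object `P_n = (c^n, P_n)` of `Kar dTL`. -/
def jwObj (n : ℕ) : (dTL K).KarObj := ⟨blk n, Pres.jw n, Pres.jw_idem n⟩

/-- The morphism `P_(n+2) ∘ (1_n ⊗ dotted cup) ∘ P_n`. -/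
def uMap (n : ℕ) : (dTL K).Kar.Hom 2 (jwObj K n) (jwObj K (n + 2)) :=
  sandwich _ (jwObj K n) (jwObj K (n + 2))
    (Pres.tens (s'' := blk n) (t'' := blk (n + 2)) (zero_add 2) (List.append_nil _) (blk_add n 2)
      (Pres.id (blk n)) Pres.dotCup)

/-- The shifted Kirby object `q^d κ_k`, the directed system
`q^(d-k) P_k ⟶ q^(d-k-2) P_(k+2) ⟶ q^(d-k-4) P_(k+4) ⟶ ⋯`. -/
noncomputable def kirby (d : ℤ) (k : ℕ) : (dTL K).Kar.Mat.IndObj :=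
  seqInd _ (fun r => single _ (d - (k + 2 * r)) (jwObj K (k + 2 * r)))
    (fun r => singleHom _ (by push_cast; ring) (uMap K (k + 2 * r)))

/-- The tensor product `κ_i ⊗ κ_j`. -/
noncomputable def kirbyTensor (i j : ℕ) : (dTL K).Kar.Mat.IndObj :=
  (dTLTensor K).ind (kirby K 0 i) (kirby K 0 j)

end Kirby

namespace Kirby

/-! ### The category of Kirby-colored diagrams -/

/-- The generating morphisms adjoined to the dotted Temperley-Lieb category. -/
inductive KGen : Type
  | iota (n : ℕ) (i : ZMod 2) (h : (n : ZMod 2) = i)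
  | merge (i j k : ZMod 2) (h : i + j = k)
  | pdot (i : ZMod 2)

/-- The strands `κ'_i` and the generating morphisms `ι_n : c^n ⟶ κ'_n` of degree `-n`,
`κ'_i ⊗ κ'_j ⟶ κ'_(i+j)` of degree `0` and `κ'_i ⟶ κ'_i` of degree `2`. -/
def kGens : Gens where
  E := ZMod 2
  G := KGen
  dom
    | .iota n _ _ => List.replicate n none
    | .merge i j _ _ => [some i, some j]
    | .pdot i => [some i]
  cod
    | .iota _ i _ => [some i]
    | .merge _ _ k _ => [some k]
    | .pdot i => [some i]
  deg
    | .iota n _ _ => -n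
    | .merge _ _ _ _ => 0
    | .pdot _ => 2

/-- The letter `κ'_i`. -/
abbrev pink (i : ZMod 2) : Option kGens.E := some i

/-- The term `ι_n`. -/
def iotaTm (K : Type u) (n : ℕ) (i : ZMod 2) (h : (n : ZMod 2) = i) :
    Tm K kGens (-n) (blk n) [pink i] :=
  .gen (X := kGens) (KGen.iota n i h)

/-- The trivalent vertex. -/
def mergeTm (K : Type u) (i j k : ZMod 2) (h : i + j = k) :
    Tm K kGens 0 [pink i, pink j] [pink k] :=
  .gen (X := kGens) (KGen.merge i j k h)

/-- The dot on a strand `κ'_i`. -/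
def pdotTm (K : Type u) (i : ZMod 2) : Tm K kGens 2 [pink i] [pink i] :=
  .gen (X := kGens) (KGen.pdot i)

/-- The relations on the adjoined generators. -/
inductive KRel (K : Type u) [Field K] : TmRel K kGens
  -- the trivalent vertex is an associative multiplication with unit `ι_0`
  | unit_left (i : ZMod 2) (h : -((0 : ℕ) : ℤ) + 0 = 0) (h' : (0 : ZMod 2) + i = i) :
      KRel K 0 [pink i] [pink i]
        (.comp (add_zero 0)
          (.tens (t'' := [pink 0, pink i]) h rfl rfl (iotaTm K 0 0 Nat.cast_zero) (.id [pink i]))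
          (mergeTm K 0 i i h'))
        (.id [pink i])
  | unit_right (i : ZMod 2) (h : 0 + -((0 : ℕ) : ℤ) = 0) (h' : i + (0 : ZMod 2) = i) :
      KRel K 0 [pink i] [pink i]
        (.comp (add_zero 0)
          (.tens (t'' := [pink i, pink 0]) h rfl rfl (.id [pink i]) (iotaTm K 0 0 Nat.cast_zero))
          (mergeTm K i 0 i h'))
        (.id [pink i])
  | assoc (i j k ij jk ijk : ZMod 2) (h₁ : i + j = ij) (h₂ : ij + k = ijk) (h₃ : j + k = jk)
      (h₄ : i + jk = ijk) :
      KRel K 0 [pink i, pink j, pink k] [pink ijk]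
        (.comp (add_zero 0)
          (.tens (t'' := [pink ij, pink k]) (add_zero 0) rfl rfl (mergeTm K i j ij h₁)
            (.id [pink k]))
          (mergeTm K ij k ijk h₂))
        (.comp (add_zero 0)
          (.tens (t'' := [pink i, pink jk]) (add_zero 0) rfl rfl (.id [pink i])
            (mergeTm K j k jk h₃))
          (mergeTm K i jk ijk h₄))
  -- dots slide through trivalent vertices as a twisted derivation
  | dot_merge (i j k : ZMod 2) (h : i + j = k) :
      KRel K 2 [pink i, pink j] [pink k]
        (.comp (zero_add 2) (mergeTm K i j k h) (pdotTm K k))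
        (.add
          (.comp (add_zero 2)
            (.tens (t'' := [pink i, pink j]) (add_zero 2) rfl rfl (pdotTm K i) (.id [pink j]))
            (mergeTm K i j k h))
          (.smul ((-1) ^ i.val)
            (.comp (add_zero 2)
              (.tens (t'' := [pink i, pink j]) (zero_add 2) rfl rfl (.id [pink i]) (pdotTm K j))
              (mergeTm K i j k h))))
  -- a dot on `ι_n` is the alternating sum of dots on its black strands
  | dot_iota (n : ℕ) (i : ZMod 2) (h : (n : ZMod 2) = i) (a : ℤ) (h₁ : -(n : ℤ) + 2 = a)
      (h₂ : 2 + -(n : ℤ) = a) :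
      KRel K a (blk n) [pink i]
        (.comp h₁ (iotaTm K n i h) (pdotTm K i))
        (.comp h₂ (zTm n) (iotaTm K n i h))
  -- an undotted cup under `ι` is zero, a dotted cup under `ι` can be removed
  | cup_iota (m n : ℕ) (i : ZMod 2) (h : ((m + n + 2 : ℕ) : ZMod 2) = i) (a : ℤ)
      (h₁ : 0 + -((m + n + 2 : ℕ) : ℤ) = a)
      (hs : blk m ++ blk n = (blk (m + n) : List (Option kGens.E)))
      (ht : blk m ++ ([none, none] ++ blk n) = (blk (m + n + 2) : List (Option kGens.E))) :
      KRel K a (blk (m + n)) [pink i]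
        (.comp h₁ (.tens (add_zero 0) hs ht (.id (blk m))
          (.tens (add_zero 0) rfl rfl .cup (.id (blk n)))) (iotaTm K (m + n + 2) i h))
        .zero
  | dotCup_iota (m n : ℕ) (i : ZMod 2) (h : ((m + n + 2 : ℕ) : ZMod 2) = i)
      (h' : ((m + n : ℕ) : ZMod 2) = i)
      (h₁ : 2 + -((m + n + 2 : ℕ) : ℤ) = -((m + n : ℕ) : ℤ))
      (hs : blk m ++ blk n = (blk (m + n) : List (Option kGens.E)))
      (ht : blk m ++ ([none, none] ++ blk n) = (blk (m + n + 2) : List (Option kGens.E))) :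
      KRel K (-((m + n : ℕ) : ℤ)) (blk (m + n)) [pink i]
        (.comp h₁ (.tens (zero_add 2) hs ht (.id (blk m))
          (.tens (add_zero 2) rfl rfl
            (.comp (zero_add 2) .cup (.tens (add_zero 2) rfl rfl .dot (.id [none])))
            (.id (blk n)))) (iotaTm K (m + n + 2) i h))
        (iotaTm K (m + n) i h')
  -- merging `ι_m` and `ι_n` gives `ι_(m+n)`
  | merge_iota (m n : ℕ) (i j k : ZMod 2) (hi : (m : ZMod 2) = i) (hj : (n : ZMod 2) = j)
      (h : i + j = k) (hk : ((m + n : ℕ) : ZMod 2) = k)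
      (h₁ : -(m : ℤ) + -(n : ℤ) = -((m + n : ℕ) : ℤ))
      (hs : blk m ++ blk n = (blk (m + n) : List (Option kGens.E))) :
      KRel K (-((m + n : ℕ) : ℤ)) (blk (m + n)) [pink k]
        (.comp (add_zero _)
          (.tens (t'' := [pink i, pink j]) h₁ hs rfl (iotaTm K m i hi) (iotaTm K n j hj))
          (mergeTm K i j k h))
        (iotaTm K (m + n) k hk)

/-- The category `KdTL'`, the dotted Temperley-Lieb category with the objects `κ'_i` and the
generating morphisms `ι_n`, the trivalent vertices and the dots adjoined. -/
abbrev KdTL' (K : Type u) [Field K] : GrCat.{u, 0} K := Pres.cat (KRel K)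

/-- The words of generating objects of `KdTL'`. -/
abbrev KWord : Type := List (Option kGens.E)

/-- Morphisms of `KdTL'`. -/
abbrev KHom' (K : Type u) [Field K] (a : ℤ) (S T : KWord) : Type u := Pres.Hom (KRel K) a S T

section KHom'

variable {K : Type u} [Field K]

/-- The morphism `ι_n`. -/
def iota (n : ℕ) (i : ZMod 2) (h : (n : ZMod 2) = i) : KHom' K (-n) (blk n) [pink i] :=
  Pres.mk (iotaTm K n i h)

/-- The trivalent vertex. -/
def merge (i j k : ZMod 2) (h : i + j = k) : KHom' K 0 [pink i, pink j] [pink k] :=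
  Pres.mk (mergeTm K i j k h)

/-- The dot on `κ'_i`. -/
def pdot (i : ZMod 2) : KHom' K 2 [pink i] [pink i] := Pres.mk (pdotTm K i)

end KHom'

/-! ### Locally finite sums -/

/-- Only finitely many of the `v i` are nonzero, and their sum is `m`. -/
def FinSum {I : Type} {M : Type u} [AddCommGroup M] (v : I → M) (m : M) : Prop :=
  v.support.Finite ∧ ∑ᶠ i, v i = m

section FinSum

variable {I J : Type} {M N : Type u} [AddCommGroup M] [AddCommGroup N]

theorem finSum_iff {v : I → M} {m : M} :
    FinSum v m ↔ ∃ t : Finset I, (∀ i, i ∉ t → v i = 0) ∧ ∑ i ∈ t, v i = m := by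
  constructor
  · rintro ⟨h, h'⟩
    refine ⟨h.toFinset, fun i hi => by simpa using hi, ?_⟩
    rw [← h', finsum_eq_sum_of_support_subset v (s := h.toFinset) (by simp)]
  · rintro ⟨t, ht, h⟩
    have hs : v.support ⊆ t := fun i hi => by
      by_contra hc
      exact hi (ht i hc)
    exact ⟨t.finite_toSet.subset hs, by rw [finsum_eq_sum_of_support_subset v hs, h]⟩

theorem FinSum.unique {v : I → M} {m m' : M} (h : FinSum v m) (h' : FinSum v m') : m = m' :=
  h.2.symm.trans h'.2

theorem FinSum.map {v : I → M} {m : M} (h : FinSum v m) (f : M →+ N) :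
    FinSum (fun i => f (v i)) (f m) := by
  obtain ⟨t, ht, h⟩ := finSum_iff.1 h
  exact finSum_iff.2 ⟨t, fun i hi => by rw [ht i hi, map_zero], by rw [← h, map_sum]⟩

theorem FinSum.add {v w : I → M} {m n : M} (h : FinSum v m) (h' : FinSum w n) :
    FinSum (fun i => v i + w i) (m + n) := by
  classical
  obtain ⟨t, ht, h⟩ := finSum_iff.1 h
  obtain ⟨s, hs, h'⟩ := finSum_iff.1 h'
  refine finSum_iff.2 ⟨t ∪ s, fun i hi => ?_, ?_⟩
  · rw [Finset.mem_union, not_or] at hi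
    rw [ht i hi.1, hs i hi.2, add_zero]
  · rw [Finset.sum_add_distrib, ← h, ← h',
      Finset.sum_subset Finset.subset_union_left (fun i _ hi => ht i hi),
      Finset.sum_subset Finset.subset_union_right (fun i _ hi => hs i hi)]

theorem FinSum.sum {v : I → M} {w : J → M} {m n : M} (h : FinSum v m) (h' : FinSum w n) :
    FinSum (Sum.elim v w) (m + n) := by
  classical
  obtain ⟨t, ht, h⟩ := finSum_iff.1 h
  obtain ⟨s, hs, h'⟩ := finSum_iff.1 h'
  refine finSum_iff.2 ⟨t.disjSum s, ?_, ?_⟩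
  · rintro (i | j) hi
    · exact ht i (by simpa using hi)
    · exact hs j (by simpa using hi)
  · rw [Finset.sum_disjSum, ← h, ← h']; rfl

theorem FinSum.congr {v w : I → M} {m n : M} (h : FinSum v m) (hv : ∀ i, v i = w i)
    (hm : m = n) : FinSum w n := by
  obtain rfl : v = w := funext hv
  rwa [← hm]

theorem FinSum.smul {R : Type*} [Ring R] [Module R M] {v : I → M} {m : M} (h : FinSum v m)
    (k : R) : FinSum (fun i => k • v i) (k • m) :=
  h.map (DistribSMul.toAddMonoidHom M k)

theorem FinSum.empty {v : Empty → M} : FinSum v 0 :=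
  finSum_iff.2 ⟨∅, fun i => i.elim, rfl⟩

theorem FinSum.single (m : M) : FinSum (fun _ : Unit => m) m :=
  finSum_iff.2 ⟨{()}, fun i hi => by simp at hi, by simp⟩

/-- A double sum. -/
theorem FinSum.prod {v : I → M} {m : M} (h : FinSum v m) {e : J → M →+ N} {n : N}
    (he : ∀ i, ∃ n', FinSum (fun j => e j (v i)) n') (hm : FinSum (fun j => e j m) n) :
    FinSum (fun p : I × J => e p.2 (v p.1)) n := by
  classical
  obtain ⟨t, ht, h⟩ := finSum_iff.1 h
  obtain ⟨r, hr, hm⟩ := finSum_iff.1 hm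
  choose n' hn' using he
  choose u hu _ using fun i => finSum_iff.1 (hn' i)
  set U := t.biUnion u ∪ r
  refine finSum_iff.2 ⟨t ×ˢ U, ?_, ?_⟩
  · rintro ⟨i, j⟩ hij
    by_cases hi : i ∈ t
    · refine hu i j fun hj => hij ?_
      simp only [Finset.mem_product, hi, true_and, U, Finset.mem_union, Finset.mem_biUnion]
      exact Or.inl ⟨i, hi, hj⟩
    · change e j (v i) = 0
      rw [ht i hi, map_zero]
  · rw [Finset.sum_product_right, ← hm,
      Finset.sum_subset (Finset.subset_union_right : r ⊆ U) (fun j _ hj => hr j hj)]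
    refine Finset.sum_congr rfl fun j _ => ?_
    rw [← h, map_sum]

end FinSum

end Kirby

namespace Kirby

/-! ### Canonical inclusions -/

/-- The canonical inclusions into a word `S`: tensor products of identities of black strands
and of morphisms `ι_n` into `κ'_i`, with `n` congruent to `i` modulo `2`. -/
inductive Incl : KWord → Type
  | nil : Incl []
  | black {S : KWord} (x : Incl S) : Incl (none :: S)
  | pink (n : ℕ) (i : ZMod 2) (h : (n : ZMod 2) = i) {S : KWord} (x : Incl S) : Incl (some i :: S)

namespace Incl

/-- The number of black strands in the domain. -/
def strands : ∀ {S : KWord}, Incl S → ℕ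
  | _, nil => 0
  | _, black x => x.strands + 1
  | _, pink n _ _ x => n + x.strands

/-- The degree. -/
def deg : ∀ {S : KWord}, Incl S → ℤ
  | _, nil => 0
  | _, black x => x.deg
  | _, pink n _ _ x => -n + x.deg

/-- The morphism. (Its domain in the Karoubi envelope is a tensor product of objects `P_n`; since
`ι_n ∘ P_n = ι_n`, equalities and vanishing of composites with it may be tested in `KdTL'`.) -/
def mor (K : Type u) [Field K] : ∀ {S : KWord} (x : Incl S), KHom' K x.deg (blk x.strands) S
  | _, nil => Pres.id []
  | _, black x => Pres.left (x.mor K)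
  | _, pink n i h x => Pres.tens rfl (blk_add n x.strands) rfl (iota n i h) (x.mor K)

/-- The tensor product of two canonical inclusions. -/
def append : ∀ {S S' : KWord}, Incl S → Incl S' → Incl (S ++ S')
  | _, _, nil, y => y
  | _, _, black x, y => black (x.append y)
  | _, _, pink n i h x, y => pink n i h (x.append y)

theorem append_deg : ∀ {S S' : KWord} (x : Incl S) (y : Incl S'),
    x.deg + y.deg = (x.append y).deg
  | _, _, nil, _ => zero_add _
  | _, _, black x, y => append_deg x y
  | _, _, pink n _ _ x, y => (add_assoc _ _ _).trans (congrArg (-(n : ℤ) + ·) (append_deg x y))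

theorem append_strands : ∀ {S S' : KWord} (x : Incl S) (y : Incl S'),
    x.strands + y.strands = (x.append y).strands
  | _, _, nil, _ => zero_add _
  | _, _, black x, y => by
    change x.strands + 1 + y.strands = (x.append y).strands + 1
    rw [← append_strands x y]; omega
  | _, _, pink n _ _ x, y => (add_assoc _ _ _).trans (congrArg (n + ·) (append_strands x y))

theorem exists_append : ∀ {S S' : KWord} (z : Incl (S ++ S')),
    ∃ (x : Incl S) (y : Incl S'), x.append y = z
  | [], _, z => ⟨nil, z, rfl⟩
  | none :: S, S', z => by
    match z with
    | black z =>
      obtain ⟨x, y, h⟩ := exists_append (S := S) (S' := S') z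
      exact ⟨black x, y, congrArg black h⟩
  | some i :: S, S', z => by
    match z with
    | pink n _ hn z =>
      obtain ⟨x, y, h⟩ := exists_append (S := S) (S' := S') z
      exact ⟨pink n i hn x, y, congrArg (pink n i hn) h⟩

variable {K : Type u} [Field K]

theorem append_mor {S S' : KWord} (x : Incl S) (y : Incl S')
    (h : x.deg + y.deg = (x.append y).deg)
    (hs : blk x.strands ++ blk y.strands = (blk (x.append y).strands : KWord)) :
    (x.append y).mor K = Pres.tens h hs rfl (x.mor K) (y.mor K) := by
  induction x with
  | nil => exact (Pres.one_tens _ _ _ _).symm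
  | black x ih =>
    have hs' : blk x.strands ++ blk y.strands = (blk (x.append y).strands : KWord) := by
      rw [blk_add, append_strands]
    exact (congrArg Pres.left (ih h hs')).trans
      (Pres.tens_assoc (zero_add _) _ _ _ rfl _ _ _ rfl rfl rfl rfl _ _ _).symm
  | pink n i hn x ih =>
    have hs' : blk x.strands ++ blk y.strands = (blk (x.append y).strands : KWord) := by
      rw [blk_add, append_strands]
    refine (congrArg (fun q => Pres.tens rfl (blk_add n (x.append y).strands) rfl (iota n i hn) q)
      (ih (append_deg x y) hs')).trans ?_
    exact (Pres.tens_assoc rfl _ _ _ (blk_add n x.strands) _ _ _ rfl rfl rfl rfl _ _ _).symm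

end Incl

variable {K : Type u} [Field K]

/-- The morphisms `s ⟶ T` that are sums of morphisms which factor through a canonical inclusion
into `T`. -/
def Fac (c : ℤ) (s T : KWord) : Submodule K (KHom' K c s T) :=
  Submodule.span K {g | ∃ (y : Incl T) (b : ℤ) (h : b + y.deg = c)
    (D : KHom' K b s (blk y.strands)), Pres.comp h D (y.mor K) = g}

theorem Fac.mk {b c : ℤ} {s T : KWord} (y : Incl T) (h : b + y.deg = c)
    (D : KHom' K b s (blk y.strands)) : Pres.comp h D (y.mor K) ∈ (Fac c s T : Submodule K _) :=
  Submodule.subset_span ⟨y, b, h, D, rfl⟩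

theorem Fac.comp {a b c : ℤ} (h : a + b = c) {r s T : KWord} (D : KHom' K a r s)
    {g : KHom' K b s T} (hg : g ∈ Fac b s T) : Pres.comp h D g ∈ Fac c r T := by
  induction hg using Submodule.span_induction with
  | mem g hg =>
    obtain ⟨y, e, he, D', rfl⟩ := hg
    rw [← Pres.assoc (ab := a + e) rfl (by rw [← h, ← he]; ring) he h]
    exact Fac.mk y _ _
  | zero => rw [map_zero]; exact zero_mem _
  | add f g _ _ hf hg => rw [map_add]; exact add_mem hf hg
  | smul k f _ hf => rw [map_smul]; exact Submodule.smul_mem _ _ hf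

theorem Fac.comp_of {a b c : ℤ} (h : a + b = c) {s T U : KWord} {g : KHom' K a s T}
    (hg : g ∈ Fac a s T) (f : KHom' K b T U)
    (hf : ∀ (x : Incl T) {e : ℤ} (he : x.deg + b = e),
      Pres.comp he (x.mor K) f ∈ Fac e (blk x.strands) U) : Pres.comp h g f ∈ Fac c s U := by
  induction hg using Submodule.span_induction with
  | mem g hg =>
    obtain ⟨y, e, he, D, rfl⟩ := hg
    rw [Pres.assoc he h rfl (by rw [← h, ← he]; ring)]
    exact Fac.comp _ _ (hf y rfl)
  | zero => rw [map_zero, LinearMap.zero_apply]; exact zero_mem _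
  | add f g _ _ hf hg => rw [map_add, LinearMap.add_apply]; exact add_mem hf hg
  | smul k f _ hf => rw [map_smul, LinearMap.smul_apply]; exact Submodule.smul_mem _ _ hf

theorem Fac.tens {a b c : ℤ} (h : a + b = c) {s s' s'' T T' T'' : KWord} (hs : s ++ s' = s'')
    (ht : T ++ T' = T'') {f : KHom' K a s T} {g : KHom' K b s' T'} (hf : f ∈ Fac a s T)
    (hg : g ∈ Fac b s' T') : Pres.tens h hs ht f g ∈ Fac c s'' T'' := by
  subst ht
  induction hf using Submodule.span_induction with
  | mem f hf =>
    obtain ⟨x, d, hd, D, rfl⟩ := hf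
    induction hg using Submodule.span_induction with
    | mem g hg =>
      obtain ⟨y, e, he, E, rfl⟩ := hg
      have hst : blk x.strands ++ blk y.strands = (blk (x.append y).strands : KWord) := by
        rw [blk_add, Incl.append_strands]
      rw [Pres.interchange (c := d + e) (c' := (x.append y).deg) hd he
        (by rw [← Incl.append_deg, ← h, ← hd, ← he]; ring) rfl (Incl.append_deg x y) h hs hst rfl,
        ← Incl.append_mor]
      exact Fac.mk _ _ _
    | zero => rw [map_zero]; exact zero_mem _
    | add f g _ _ hf hg => rw [map_add]; exact add_mem hf hg
    | smul k f _ hf => rw [map_smul]; exact Submodule.smul_mem _ _ hf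
  | zero => rw [map_zero, LinearMap.zero_apply]; exact zero_mem _
  | add f g _ _ hf hg => rw [map_add, LinearMap.add_apply]; exact add_mem hf hg
  | smul k f _ hf => rw [map_smul, LinearMap.smul_apply]; exact Submodule.smul_mem _ _ hf

theorem Fac.mor {T : KWord} (y : Incl T) : y.mor K ∈ Fac y.deg (blk y.strands) T := by
  have := Fac.mk y (zero_add y.deg) (Pres.id (blk y.strands) : KHom' K 0 _ _)
  rwa [Pres.id_comp] at this

theorem Fac.id_nil : (Pres.id [] : KHom' K 0 [] []) ∈ Fac 0 [] [] := Fac.mor Incl.nil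

theorem Fac.id_none : (Pres.id [none] : KHom' K 0 [none] [none]) ∈ Fac 0 [none] [none] := by
  have h : (Incl.black .nil).mor K = Pres.id [none] := Pres.tens_id rfl
  rw [← h]
  exact Fac.mor (Incl.black .nil)

theorem Fac.iota_mem (n : ℕ) (i : ZMod 2) (h : (n : ZMod 2) = i) :
    (iota n i h : KHom' K (-n) (blk n) [pink i]) ∈ Fac (-n) (blk n) [pink i] := by
  have h1 := Fac.mk (K := K) (Incl.pink n i h .nil) (show 0 + (-(n : ℤ) + 0) = -n by simp)
    (Pres.id (blk n))
  have h2 := Pres.interchange (R := KRel K) (zero_add (-(n : ℤ))) (zero_add 0)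
    (show 0 + (-(n : ℤ) + 0) = -n by simp) (add_zero 0) rfl (add_zero (-(n : ℤ)))
    (blk_add n 0) (blk_add n 0) rfl (Pres.id (blk n)) (iota n i h) (Pres.id []) (Pres.id [])
  have h3 : iota n i h = Pres.comp (zero_add (-(n : ℤ))) (Pres.id (blk n)) (iota (K := K) n i h) :=
    (Pres.id_comp _ _).symm
  have h4 : (Pres.id [] : KHom' K 0 [] []) = Pres.comp (zero_add 0) (Pres.id []) (Pres.id []) :=
    (Pres.id_comp _ _).symm
  have h5 : Pres.tens (add_zero 0) (blk_add n 0) (blk_add n 0) (Pres.id (blk n)) (Pres.id []) =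
      (Pres.id (blk n) : KHom' K 0 (blk n) (blk n)) := Pres.tens_id _
  have h6 : iota n i h = Pres.tens (t'' := [pink i]) (add_zero (-(n : ℤ))) (blk_add n 0) rfl
      (iota n i h) (Pres.id [] : KHom' K 0 [] []) := (Pres.tens_one _ _ _ _).symm
  refine (congrArg (· ∈ Fac _ _ _) (h6.trans ((congrArg₂ (fun p q => Pres.tens _ _ _ p q) h3 h4).trans
    (h2.trans (congrArg (fun p => Pres.comp _ p _) h5))))).mpr h1

theorem Fac.dom_black {a : ℤ} {s T : KWord} {f : KHom' K a s T}
    (hT : (Pres.id T : KHom' K 0 T T) ∈ Fac 0 T T) :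
    f ∈ Fac a s T := by
  have := Fac.comp (add_zero a) f hT
  rwa [Pres.comp_id] at this

theorem Fac.mor_comp {a : ℤ} {S T : KWord} (f : Tm K kGens a S T) (x : Incl S) {e : ℤ}
    (he : x.deg + a = e) :
    Pres.comp he (x.mor K) (Pres.mk f) ∈ Fac e (blk x.strands) T := by
  induction f generalizing e with
  | id s =>
    obtain rfl : x.deg = e := (add_zero _).symm.trans he
    rw [Pres.mk_id, Pres.comp_id]
    exact Fac.mor x
  | dot => exact Fac.comp _ _ (Fac.dom_black Fac.id_none)
  | cup =>
    refine Fac.comp _ _ (Fac.dom_black ?_)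
    have := Fac.tens (K := K) (T'' := [none, none]) (add_zero 0) rfl rfl Fac.id_none Fac.id_none
    rwa [Pres.tens_id] at this
  | cap => exact Fac.comp _ _ (Fac.dom_black Fac.id_nil)
  | gen g =>
    cases g with
    | iota n i h => exact Fac.comp _ _ (Fac.iota_mem n i h)
    | merge i j k h =>
      change Incl [pink i, pink j] at x
      match x with
      | .pink m _ hm (.pink n _ hn .nil) =>
        have hk : ((m + n : ℕ) : ZMod 2) = k := by push_cast; rw [hm, hn, h]
        have hd : -(m : ℤ) + -(n : ℤ) = -((m + n : ℕ) : ℤ) := by push_cast; ring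
        have hd' : -((m + n : ℕ) : ℤ) + 0 = -(m : ℤ) + (-(n : ℤ) + 0) := by push_cast; ring
        have he' : -((m + n : ℕ) : ℤ) + 0 = e := by rw [← he, hd']; exact (add_zero _).symm
        have h1 := Pres.sound (R := KRel K) (.of (KRel.merge_iota m n i j k hm hn h hk hd
          (blk_add m n)))
        have h2 : (Incl.pink m i hm (.pink n j hn .nil)).mor K =
            Pres.tens hd' (blk_add (m + n) 0) rfl
              (Pres.tens (t'' := [pink i, pink j]) hd (blk_add m n) rfl (iota m i hm) (iota n j hn))
              (Pres.id []) :=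
          (Pres.tens_assoc hd hd' rfl rfl (blk_add m n) (blk_add (m + n) 0) (blk_add n 0)
            (blk_add m n) rfl rfl rfl rfl (iota m i hm) (iota n j hn) (Pres.id [])).symm
        have h3 : (Pres.mk (.gen (X := kGens) (KGen.merge i j k h)) : KHom' K 0 [pink i, pink j] [pink k]) =
          Pres.tens (add_zero 0) rfl rfl (merge i j k h) (Pres.id []) :=
            (Pres.tens_one (add_zero 0) rfl rfl (merge i j k h)).symm
        have h4 := Pres.interchange (R := KRel K) (add_zero (-((m + n : ℕ) : ℤ))) (add_zero 0)
          he hd' (add_zero 0) he' (blk_add (m + n) 0) rfl rfl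
          (Pres.tens (t'' := [pink i, pink j]) hd (blk_add m n) rfl (iota m i hm) (iota n j hn))
          (merge i j k h) (Pres.id []) (Pres.id [])
        refine (congrArg (· ∈ Fac e _ _) ((congrArg₂ (fun p q => Pres.comp he p q) h2 h3).trans
          h4.symm)).mpr (Fac.tens _ _ _ ?_ ?_)
        · exact (congrArg (· ∈ Fac _ _ _) h1).mpr (Fac.iota_mem (m + n) k hk)
        · exact Fac.comp (add_zero 0) (Pres.id []) Fac.id_nil
    | pdot i =>
      change Incl [pink i] at x
      match x with
      | .pink n _ hn .nil =>
        have he' : -(n : ℤ) + 2 + 0 = e := by rw [← he]; exact add_right_comm _ _ _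
        have h1 := Pres.sound (R := KRel K) (.of (KRel.dot_iota n i hn (-(n : ℤ) + 2) rfl
          (add_comm _ _)))
        have h3 : (Pres.mk (.gen (X := kGens) (KGen.pdot i)) : KHom' K 2 [pink i] [pink i]) =
          Pres.tens (add_zero 2) rfl rfl (pdot i) (Pres.id []) :=
            (Pres.tens_one (add_zero 2) rfl rfl (pdot i)).symm
        have h4 := Pres.interchange (R := KRel K) (rfl : -(n : ℤ) + 2 = _) (add_zero 0)
          he rfl (add_zero 2) he' (blk_add n 0) rfl rfl
          (iota n i hn) (pdot i) (Pres.id []) (Pres.id [])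
        refine (congrArg (· ∈ Fac e _ _) ((congrArg (fun q => Pres.comp he _ q) h3).trans
          h4.symm)).mpr (Fac.tens _ _ _ ?_ ?_)
        · exact (congrArg (· ∈ Fac _ _ _) h1).mpr (Fac.comp _ (Pres.z n) (Fac.iota_mem n i hn))
        · exact Fac.comp (add_zero 0) (Pres.id []) Fac.id_nil
  | comp h f g hf hg =>
    rw [Pres.mk_comp, ← Pres.assoc rfl (by rw [← he, ← h]; ring) h he]
    exact Fac.comp_of _ (hf x rfl) _ fun y _ he' => hg y he'
  | tens h hs ht f g hf hg =>
    subst hs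
    obtain ⟨y, z, rfl⟩ := x.exists_append
    have hst : blk y.strands ++ blk z.strands = (blk (y.append z).strands : KWord) := by
      rw [blk_add, Incl.append_strands]
    rw [Pres.mk_tens, Incl.append_mor y z (Incl.append_deg y z) hst,
      ← Pres.interchange rfl rfl he (Incl.append_deg y z) h
        (by rw [← he, ← Incl.append_deg, ← h]; ring) hst rfl ht]
    exact Fac.tens _ _ _ (hf y rfl) (hg z rfl)
  | zero => rw [Pres.mk_zero, map_zero]; exact zero_mem _
  | add f g hf hg => rw [Pres.mk_add, map_add]; exact add_mem (hf x he) (hg x he)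
  | smul k f hf => rw [Pres.mk_smul, map_smul]; exact Submodule.smul_mem _ _ (hf x he)

/-! ### Completion -/

/-- The formal sum of the morphisms `D i : S ⟶ T` is locally finite, and `F x` is the finite sum of
the `D i ∘ x` for every canonical inclusion `x` into `S`. -/
def Represents {a : ℤ} {S T : KWord} (F : ∀ x : Incl S, KHom' K (x.deg + a) (blk x.strands) T)
    {I : Type} (D : I → KHom' K a S T) : Prop :=
  ∀ x : Incl S, FinSum (fun i => Pres.comp rfl (x.mor K) (D i)) (F x)

/-- Degree `a` morphisms of `KdTL`: equivalence classes of locally finite formal sums of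
morphisms `D i` of `KdTL'`. Two formal sums are equivalent if and only if the sums of the `D i ∘ x`
agree for all canonical inclusions `x`, so an equivalence class is the family of these sums. -/
def KHom (a : ℤ) (S T : KWord) :
    Submodule K (∀ x : Incl S, KHom' K (x.deg + a) (blk x.strands) T) where
  carrier := {F | ∃ (I : Type) (D : I → KHom' K a S T), Represents F D}
  zero_mem' := ⟨Empty, nofun, fun _ => FinSum.empty⟩
  add_mem' := by
    rintro F G ⟨I, D, hD⟩ ⟨J, E, hE⟩
    refine ⟨I ⊕ J, Sum.elim D E, fun x => ?_⟩
    exact ((hD x).sum (hE x)).congr (by rintro (i | j) <;> rfl) rfl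
  smul_mem' := by
    rintro k F ⟨I, D, hD⟩
    refine ⟨I, fun i => k • D i, fun x => ?_⟩
    exact ((hD x).smul k).congr (fun _ => (map_smul _ _ _).symm) rfl

theorem Represents.exists_finSum {b : ℤ} {T U : KWord}
    {G : ∀ x : Incl T, KHom' K (x.deg + b) (blk x.strands) U} {J : Type} {E : J → KHom' K b T U}
    (hE : Represents G E) {J' : Type} {E' : J' → KHom' K b T U} (hE' : Represents G E') {a c : ℤ}
    (h : a + b = c) {s : KWord} {g : KHom' K a s T} (hg : g ∈ Fac a s T) :
    ∃ m, FinSum (fun j => Pres.comp h g (E j)) m ∧ FinSum (fun j => Pres.comp h g (E' j)) m := by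
  induction hg using Submodule.span_induction with
  | mem g hg =>
    obtain ⟨y, e, he, D, rfl⟩ := hg
    have h' : e + (y.deg + b) = c := by rw [← h, ← he]; ring
    have h1 := (hE y).map (Pres.comp h' D).toAddMonoidHom
    have h2 := (hE' y).map (Pres.comp h' D).toAddMonoidHom
    refine ⟨Pres.comp h' D (G y), ?_, ?_⟩
    · simp only [Pres.assoc he h rfl h']; exact h1
    · simp only [Pres.assoc he h rfl h']; exact h2
  | zero =>
    have h0 : ∀ {I : Type}, FinSum (fun _ : I => (0 : KHom' K c s U)) 0 := fun {I} =>
      finSum_iff.2 ⟨∅, fun _ _ => rfl, rfl⟩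
    refine ⟨0, ?_, ?_⟩ <;> simpa only [map_zero, LinearMap.zero_apply] using h0
  | add f g _ _ hf hg =>
    obtain ⟨m, h1, h2⟩ := hf
    obtain ⟨n, h3, h4⟩ := hg
    refine ⟨m + n, ?_, ?_⟩
    · simpa only [map_add, LinearMap.add_apply] using h1.add h3
    · simpa only [map_add, LinearMap.add_apply] using h2.add h4
  | smul k f _ hf =>
    obtain ⟨m, h1, h2⟩ := hf
    refine ⟨k • m, ?_, ?_⟩
    · simpa only [map_smul, LinearMap.smul_apply] using h1.smul k
    · simpa only [map_smul, LinearMap.smul_apply] using h2.smul k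

/-- The composite of `g : s ⟶ T` with the class `G` of a formal sum `∑ E j`, that is, the finite sum
of the `E j ∘ g`. -/
noncomputable def KHom.eval {a b c : ℤ} (h : a + b = c) {s T U : KWord} (G : KHom (K := K) b T U)
    (g : KHom' K a s T) : KHom' K c s U :=
  ∑ᶠ j, Pres.comp h g (G.2.choose_spec.choose j)

theorem KHom.eval_spec {a b c : ℤ} (h : a + b = c) {s T U : KWord} {G : KHom (K := K) b T U}
    {J : Type} {E : J → KHom' K b T U} (hE : Represents G.1 E) {g : KHom' K a s T}
    (hg : g ∈ Fac a s T) : FinSum (fun j => Pres.comp h g (E j)) (KHom.eval h G g) := by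
  obtain ⟨m, h1, h2⟩ := hE.exists_finSum G.2.choose_spec.choose_spec h hg
  have : KHom.eval h G g = m := h2.2
  rwa [this]

theorem Fac.of_represents {a : ℤ} {S T : KWord}
    {F : ∀ x : Incl S, KHom' K (x.deg + a) (blk x.strands) T} {I : Type}
    {D : I → KHom' K a S T} (hD : Represents F D) (x : Incl S) :
    F x ∈ Fac (x.deg + a) (blk x.strands) T := by
  obtain ⟨t, -, h⟩ := finSum_iff.1 (hD x)
  rw [← h]
  refine sum_mem fun i _ => ?_
  obtain ⟨f, hf⟩ := Pres.mk_surj (D i)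
  rw [← hf]
  exact Fac.mor_comp f x rfl

/-- Composition in `KdTL`: the composite of the classes of `∑ D i` and `∑ E j` is the class of
`∑ E j ∘ D i`. -/
theorem Represents.comp {a b c : ℤ} (h : a + b = c) {S T U : KWord}
    {F : ∀ x : Incl S, KHom' K (x.deg + a) (blk x.strands) T} {G : KHom (K := K) b T U}
    {I : Type} {D : I → KHom' K a S T} (hD : Represents F D) {J : Type} {E : J → KHom' K b T U}
    (hE : Represents G.1 E) :
    Represents (fun x => KHom.eval (show x.deg + a + b = x.deg + c by rw [← h]; ring) G (F x))
      (fun p : I × J => Pres.comp h (D p.1) (E p.2)) := by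
  intro x
  have h' : x.deg + a + b = x.deg + c := by rw [← h]; ring
  exact ((hD x).prod (e := fun j => ((Pres.comp h').flip (E j)).toAddMonoidHom)
    (n := KHom.eval h' G (F x))
    (fun i => by
      obtain ⟨f, hf⟩ := Pres.mk_surj (D i)
      rw [← hf]
      exact ⟨_, KHom.eval_spec h' hE (Fac.mor_comp f x rfl)⟩)
    (KHom.eval_spec h' hE (Fac.of_represents hD x))).congr
      (fun p => Pres.assoc rfl h' h rfl (x.mor K) (D p.1) (E p.2)) rfl

/-- Composition in `KdTL`. -/
noncomputable def KHom.comp {a b c : ℤ} (h : a + b = c) {S T U : KWord} (F : KHom (K := K) a S T)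
    (G : KHom (K := K) b T U) : KHom (K := K) c S U :=
  ⟨fun x => KHom.eval (by rw [← h]; ring) G (F.1 x), by
    obtain ⟨I, D, hD⟩ := F.2
    obtain ⟨J, E, hE⟩ := G.2
    exact ⟨I × J, _, hD.comp h hE⟩⟩

/-- The class in `KdTL` of a morphism of `KdTL'`. -/
def KHom.of {a : ℤ} {S T : KWord} (D : KHom' K a S T) : KHom (K := K) a S T :=
  ⟨fun x => Pres.comp rfl (x.mor K) D, Unit, fun _ => D, fun _ => FinSum.single _⟩

theorem Represents.of {a : ℤ} {S T : KWord} (D : KHom' K a S T) :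
    Represents (KHom.of D).1 (fun _ : Unit => D) := fun _ => FinSum.single _

theorem KHom.exists_rep {a : ℤ} {S T : KWord} (F : KHom (K := K) a S T) :
    ∃ (I : Type) (D : I → KHom' K a S T), Represents F.1 D := F.2

theorem Represents.add {a : ℤ} {S T : KWord} {F G : KHom (K := K) a S T} {I J : Type}
    {D : I → KHom' K a S T} {E : J → KHom' K a S T} (hD : Represents F.1 D)
    (hE : Represents G.1 E) : Represents (F + G).1 (Sum.elim D E) := fun x =>
  ((hD x).sum (hE x)).congr (by rintro (i | j) <;> rfl) rfl

theorem Represents.smul {a : ℤ} {S T : KWord} {F : KHom (K := K) a S T} {I : Type}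
    {D : I → KHom' K a S T} (hD : Represents F.1 D) (k : K) :
    Represents (k • F).1 (fun i => k • D i) := fun x =>
  ((hD x).smul k).congr (fun _ => (map_smul _ _ _).symm) rfl

theorem KHom.fac {a : ℤ} {S T : KWord} (F : KHom (K := K) a S T) (x : Incl S) :
    F.1 x ∈ Fac (x.deg + a) (blk x.strands) T := by
  obtain ⟨I, D, hD⟩ := KHom.exists_rep F
  exact Fac.of_represents hD x

theorem KHom.comp_val {a b c : ℤ} (h : a + b = c) {S T U : KWord} (F : KHom (K := K) a S T)
    (G : KHom (K := K) b T U) (x : Incl S) (h' : x.deg + a + b = x.deg + c) :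
    (KHom.comp h F G).1 x = KHom.eval h' G (F.1 x) := rfl

theorem KHom.eval_add {a b c : ℤ} (h : a + b = c) {s T U : KWord} (G : KHom (K := K) b T U)
    {g g' : KHom' K a s T} (hg : g ∈ Fac a s T) (hg' : g' ∈ Fac a s T) :
    KHom.eval h G (g + g') = KHom.eval h G g + KHom.eval h G g' := by
  obtain ⟨J, E, hE⟩ := KHom.exists_rep G
  exact (KHom.eval_spec h hE (add_mem hg hg')).unique
    (((KHom.eval_spec h hE hg).add (KHom.eval_spec h hE hg')).congr (fun j => by simp) rfl)

theorem KHom.eval_smul {a b c : ℤ} (h : a + b = c) {s T U : KWord} (G : KHom (K := K) b T U)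
    {g : KHom' K a s T} (hg : g ∈ Fac a s T) (k : K) :
    KHom.eval h G (k • g) = k • KHom.eval h G g := by
  obtain ⟨J, E, hE⟩ := KHom.exists_rep G
  exact (KHom.eval_spec h hE (Submodule.smul_mem _ k hg)).unique
    (((KHom.eval_spec h hE hg).smul k).congr (fun j => by simp) rfl)

theorem KHom.add_eval {a b c : ℤ} (h : a + b = c) {s T U : KWord} (G G' : KHom (K := K) b T U)
    {g : KHom' K a s T} (hg : g ∈ Fac a s T) :
    KHom.eval h (G + G') g = KHom.eval h G g + KHom.eval h G' g := by
  obtain ⟨J, E, hE⟩ := KHom.exists_rep G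
  obtain ⟨J', E', hE'⟩ := KHom.exists_rep G'
  exact (KHom.eval_spec h (hE.add hE') hg).unique
    (((KHom.eval_spec h hE hg).sum (KHom.eval_spec h hE' hg)).congr
      (by rintro (i | j) <;> rfl) rfl)

theorem KHom.smul_eval {a b c : ℤ} (h : a + b = c) {s T U : KWord} (G : KHom (K := K) b T U)
    {g : KHom' K a s T} (hg : g ∈ Fac a s T) (k : K) :
    KHom.eval h (k • G) g = k • KHom.eval h G g := by
  obtain ⟨J, E, hE⟩ := KHom.exists_rep G
  exact (KHom.eval_spec h (hE.smul k) hg).unique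
    (((KHom.eval_spec h hE hg).smul k).congr (fun j => by simp) rfl)

theorem KHom.of_eval {a b c : ℤ} (h : a + b = c) {s T U : KWord} (f : KHom' K b T U)
    {g : KHom' K a s T} (hg : g ∈ Fac a s T) : KHom.eval h (KHom.of f) g = Pres.comp h g f :=
  (KHom.eval_spec h (Represents.of f) hg).unique (FinSum.single _)

theorem KHom.id_comp {a : ℤ} (h : 0 + a = a) {S T : KWord} (F : KHom (K := K) a S T) :
    KHom.comp h (KHom.of (Pres.id S)) F = F := by
  obtain ⟨I, D, hD⟩ := KHom.exists_rep F
  refine Subtype.ext (funext fun x => ?_)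
  have h' : x.deg + 0 + a = x.deg + a := by rw [add_zero]
  have h1 := KHom.eval_spec h' hD (KHom.fac (KHom.of (Pres.id S)) x)
  refine h1.unique ((hD x).congr (fun i => ?_) rfl)
  change _ = Pres.comp h' (Pres.comp rfl (x.mor K) (Pres.id S)) (D i)
  rw [Pres.assoc rfl h' h rfl, Pres.id_comp]

theorem KHom.comp_id {a : ℤ} (h : a + 0 = a) {S T : KWord} (F : KHom (K := K) a S T) :
    KHom.comp h F (KHom.of (Pres.id T)) = F := by
  refine Subtype.ext (funext fun x => ?_)
  rw [KHom.comp_val h _ _ x (add_zero _), KHom.of_eval _ _ (KHom.fac F x), Pres.comp_id]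

theorem KHom.assoc {a b c ab bc abc : ℤ} (h₁ : a + b = ab) (h₂ : ab + c = abc) (h₃ : b + c = bc)
    (h₄ : a + bc = abc) {S T U V : KWord} (F : KHom (K := K) a S T) (G : KHom (K := K) b T U)
    (L : KHom (K := K) c U V) :
    KHom.comp h₂ (KHom.comp h₁ F G) L = KHom.comp h₄ F (KHom.comp h₃ G L) := by
  obtain ⟨I, D, hD⟩ := KHom.exists_rep F
  obtain ⟨J, E, hE⟩ := KHom.exists_rep G
  obtain ⟨M, H, hH⟩ := KHom.exists_rep L
  have r1 := (hD.comp (G := G) h₁ hE)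
  have r2 := Represents.comp (F := (KHom.comp h₁ F G).1) h₂ r1 hH
  have r3 := (hE.comp (G := L) h₃ hH)
  have r4 := hD.comp (G := KHom.comp h₃ G L) h₄ r3
  refine Subtype.ext (funext fun x => ?_)
  obtain ⟨hfin, hsum⟩ := r2 x
  obtain ⟨hfin', hsum'⟩ := r4 x
  refine hsum.symm.trans (Eq.trans ?_ hsum')
  rw [← finsum_comp_equiv (Equiv.prodAssoc I J M)]
  refine finsum_congr fun p => ?_
  change Pres.comp _ _ (Pres.comp h₂ (Pres.comp h₁ (D p.1.1) (E p.1.2)) (H p.2)) =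
    Pres.comp _ _ (Pres.comp h₄ (D p.1.1) (Pres.comp h₃ (E p.1.2) (H p.2)))
  rw [Pres.assoc h₁ h₂ h₃ h₄]

/-- The category `KdTL` of Kirby-colored diagrams. -/
noncomputable def KdTL (K : Type u) [Field K] : GrCat.{u, 0} K where
  Obj := KWord
  Hom a S T := KHom (K := K) a S T
  grp _ _ _ := inferInstance
  mod _ _ _ := inferInstance
  id S := KHom.of (Pres.id S)
  comp h _ _ _ := LinearMap.mk₂ K (fun F G => KHom.comp h F G)
    (fun F F' G => Subtype.ext (funext fun x => KHom.eval_add _ G (KHom.fac F x) (KHom.fac F' x)))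
    (fun k F G => Subtype.ext (funext fun x => KHom.eval_smul _ G (KHom.fac F x) k))
    (fun F G G' => Subtype.ext (funext fun x => KHom.add_eval _ G G' (KHom.fac F x)))
    (fun k F G => Subtype.ext (funext fun x => KHom.smul_eval _ G (KHom.fac F x) k))
  id_comp h _ _ F := KHom.id_comp h F
  comp_id h _ _ F := KHom.comp_id h F
  assoc h₁ h₂ h₃ h₄ _ _ _ _ F G L := KHom.assoc h₁ h₂ h₃ h₄ F G L

end Kirby

namespace Kirby

open GrCat

/-! ### The inclusions and projections in `KdTL` -/

section

variable (K : Type u) [Field K]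

/-- The number of dotted cups that are needed to extend `n` strands to a number of strands that is
congruent to `j` modulo `2`. -/
def parity (j : ZMod 2) (n : ℕ) : ℕ := ZMod.val (j - (n : ZMod 2))

theorem parity_spec (j : ZMod 2) (n : ℕ) : ((n + parity j n : ℕ) : ZMod 2) = j := by
  rw [Nat.cast_add, parity, ZMod.natCast_zmod_val, add_sub_cancel]

/-- The cup `∅ ⟶ κ'_j ⊗ κ'_j` with a hole labeled `n`: nested cups on `n` strands, surrounded by a
dotted cup if `n` is not congruent to `j` modulo `2`, and followed by `ι ⊗ ι`. -/
def holeCup (j : ZMod 2) (n : ℕ) : KHom' K (-2 * n) [] [pink j, pink j] :=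
  Pres.comp (by push_cast; ring) (Pres.nestedCups n (parity j n))
    (Pres.tens (t'' := [pink j, pink j]) rfl rfl rfl
      (iota (n + parity j n) j (parity_spec j n)) (iota (n + parity j n) j (parity_spec j n)))

theorem add_add_self (i j : ZMod 2) : i + j + j = i := by
  rw [add_assoc, CharTwo.add_self_eq_zero, add_zero]

/-- The inclusion `σ_n : κ'_(i+j) ⟶ κ'_i ⊗ κ'_j` of degree `-2n`. -/
def kSigma (i j : ZMod 2) (n : ℕ) : KHom' K (-2 * n) [pink (i + j)] [pink i, pink j] :=
  Pres.comp (add_zero _)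
    (Pres.tens (t'' := [pink (i + j), pink j, pink j]) (zero_add _) rfl rfl
      (Pres.id [pink (i + j)]) (holeCup K j n))
    (Pres.tens (add_zero 0) rfl rfl (merge (i + j) j i (add_add_self i j)) (Pres.id [pink j]))

/-- The projection `π_n : κ'_i ⊗ κ'_j ⟶ κ'_(i+j)` of degree `2n`. -/
def kPi (i j : ZMod 2) (n : ℕ) : KHom' K (2 * n) [pink i, pink j] [pink (i + j)] :=
  ((-1) ^ n.choose 2 * (n.factorial : K)⁻¹) •
    Pres.comp (a := n * 2) (by ring)
      (Pres.tens (t'' := [pink i, pink j]) (zero_add _) rfl rfl (Pres.id [pink i])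
        ((KdTL' K).pow (pdot j) n))
      (merge i j (i + j) rfl)

/-- The object `κ'_i ⊗ κ'_j` of `Mat KdTL`. -/
noncomputable def kTensor (i j : ZMod 2) : (KdTL K).Mat.Obj :=
  single (KdTL K) 0 ([pink i, pink j] : KWord)

/-- The object `q^d κ'_i` of `Mat KdTL`. -/
noncomputable def kKirby (d : ℤ) (i : ZMod 2) : (KdTL K).Mat.Obj :=
  single (KdTL K) d ([pink i] : KWord)

/-- The degree zero morphism `q^(-2n) κ'_(i+j) ⟶ κ'_i ⊗ κ'_j` of `Mat KdTL` given by `σ_n`. -/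
noncomputable def kSigmaMat (i j : ZMod 2) (n : ℕ) :
    (KdTL K).Mat.Hom 0 (kKirby K (-2 * n) (i + j)) (kTensor K i j) :=
  singleHom (KdTL K) (b := -2 * n) (by ring) (KHom.of (kSigma K i j n))

/-- The degree zero morphism `κ'_i ⊗ κ'_j ⟶ q^(-2n) κ'_(i+j)` of `Mat KdTL` given by `π_n`. -/
noncomputable def kPiMat (i j : ZMod 2) (n : ℕ) :
    (KdTL K).Mat.Hom 0 (kTensor K i j) (kKirby K (-2 * n) (i + j)) :=
  singleHom (KdTL K) (b := 2 * n) (by ring) (KHom.of (kPi K i j n))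

end

/-! ### The inclusions and projections in the ind-completion -/

section

variable (K : Type u) [Field K] [CharZero K]

/-- The diagram `1_m ⊗ (n nested cups surrounded by b dotted cups)` from `c^m` to
`c^p ⊗ c^q`, where `p = m + n + b` and `q = n + b`. -/
def sigmaDiag (m n b p q : ℕ) (hp : m + (n + b) = p) (hq : n + b = q) :
    (dTL K).Hom (2 * b) (blk m) (List.append (blk p) (blk q)) :=
  Pres.tens (s'' := blk m) (zero_add _) (List.append_nil _)
    (by subst hp hq; rw [← blk_add m]; exact (List.append_assoc _ _ _).symm)
    (Pres.id (blk m)) (Pres.nestedCups n b)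

/-- The diagram `(-1)^(n choose 2) / n! (1_p ⊗ z_q^n)` from `c^p ⊗ c^q` to `c^m`, where
`m = p + q`. -/
def piDiag (n p q m : ℕ) (h : p + q = m) :
    (dTL K).Hom (2 * n) (List.append (blk p) (blk q)) (blk m) :=
  ((-1) ^ n.choose 2 * (n.factorial : K)⁻¹) •
    Pres.tens (b := n * 2) (by ring) rfl ((blk_add p q).trans (congrArg blk h))
      (Pres.id (blk p)) ((dTL K).pow (Pres.z q) n)

/-- The objects `P_p ⊗ P_q` of `Kar dTL`. -/
def jwTensor (p q : ℕ) : (dTL K).KarObj := (Pres.tensor (noRel K)).karObj (jwObj K p) (jwObj K q)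

/-- The component of `σ_n : q^(-2n) κ_v ⟶ κ_i ⊗ κ_j` given by `sigmaDiag`, from
`q^(-2n-v-2r) P_(v+2r)` to `q^(-i-2k) P_(i+2k) ⊗ q^(-j-2l) P_(j+2l)`. -/
noncomputable def sigmaComp (i j v n b r k l : ℕ) (hp : v + 2 * r + (n + b) = i + 2 * k)
    (hq : n + b = j + 2 * l) :
    (dTL K).Kar.Mat.Hom 0 ((kirby K (-2 * n) v).obj ⟨r⟩) ((kirbyTensor K i j).obj (⟨k⟩, ⟨l⟩)) :=
  fun _ _ => (dTL K).Kar.castDeg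
    (show (2 * b : ℤ) = 0 - ((0 - (i + 2 * k) + (0 - (j + 2 * l))) - (-2 * n - (v + 2 * r))) by
      have hp' : (v + 2 * r + (n + b) : ℤ) = i + 2 * k := by exact_mod_cast hp
      have hq' : (n + b : ℤ) = j + 2 * l := by exact_mod_cast hq
      linarith)
    (sandwich (dTL K) (jwObj K (v + 2 * r)) (jwTensor K (i + 2 * k) (j + 2 * l))
      (sigmaDiag K (v + 2 * r) n b (i + 2 * k) (j + 2 * l) hp hq))

/-- The component of `π_n : κ_i ⊗ κ_j ⟶ q^(-2n) κ_v` given by `piDiag`, from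
`q^(-i-2k) P_(i+2k) ⊗ q^(-j-2l) P_(j+2l)` to `q^(-2n-v-2r) P_(v+2r)`. -/
noncomputable def piComp (i j v n r k l : ℕ) (h : i + 2 * k + (j + 2 * l) = v + 2 * r) :
    (dTL K).Kar.Mat.Hom 0 ((kirbyTensor K i j).obj (⟨k⟩, ⟨l⟩)) ((kirby K (-2 * n) v).obj ⟨r⟩) :=
  fun _ _ => (dTL K).Kar.castDeg
    (show (2 * n : ℤ) = 0 - ((-2 * n - (v + 2 * r)) - (0 - (i + 2 * k) + (0 - (j + 2 * l)))) by
      have h' : (i + 2 * k + (j + 2 * l) : ℤ) = v + 2 * r := by exact_mod_cast h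
      linarith)
    (sandwich (dTL K) (jwTensor K (i + 2 * k) (j + 2 * l)) (jwObj K (v + 2 * r))
      (piDiag K n (i + 2 * k) (j + 2 * l) (v + 2 * r) h))

/-- The morphisms `σ_n : q^(-2n) κ_(i+j) ⟶ κ_i ⊗ κ_j` of the ind-completion are induced by the
diagrams with `n` nested cups (and a dotted cup around them, if parity requires it). -/
def IsSigma (i j : ZMod 2) (n : ℕ)
    (σ : (dTL K).Kar.Mat.Ind.Hom 0 (kirby K (-2 * n) (ZMod.val (i + j)))
      (kirbyTensor K (ZMod.val i) (ZMod.val j))) : Prop :=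
  ∀ (r k l : ℕ) (hp : ZMod.val (i + j) + 2 * r + (n + parity j n) = ZMod.val i + 2 * k)
    (hq : n + parity j n = ZMod.val j + 2 * l),
    σ.1 ⟨r⟩ = ColimHom.mk (kirbyTensor K (ZMod.val i) (ZMod.val j)) (⟨k⟩, ⟨l⟩)
      (sigmaComp K _ _ _ n (parity j n) r k l hp hq)

/-- The morphisms `π_n : κ_i ⊗ κ_j ⟶ q^(-2n) κ_(i+j)` of the ind-completion are induced by
`(-1)^(n choose 2) / n!` times the merging of strands after `1 ⊗ z^n`. -/
def IsPi (i j : ZMod 2) (n : ℕ)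
    (π : (dTL K).Kar.Mat.Ind.Hom 0 (kirbyTensor K (ZMod.val i) (ZMod.val j))
      (kirby K (-2 * n) (ZMod.val (i + j)))) : Prop :=
  ∀ (r k l : ℕ) (h : ZMod.val i + 2 * k + (ZMod.val j + 2 * l) = ZMod.val (i + j) + 2 * r),
    π.1 (⟨k⟩, ⟨l⟩) = ColimHom.mk (kirby K (-2 * n) (ZMod.val (i + j))) ⟨r⟩
      (piComp K _ _ _ n r k l h)

end

end Kirby

open Kirby

/-! ### Local moves of cups, caps and dots among black strands. -/

namespace Kirby

namespace Pres

/-! ### Insertion of diagrams between black strands -/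

variable {K : Type u} [Field K] {X : Gens} {R : TmRel K X}

/-! Maps into the objects are studied through diagrams. A diagram `f` from a word `s` to `c^(p+q)`,
with `p ≡ i` and `q ≡ j` mod 2, gives a map to `ω_i ⊗ ω_j` through the term `P_p ⊗ P_q`, and a map
to `ω'_i ⊗ ω'_j` through `ι_p ⊗ ι_q`. As a function of `f` this value vanishes if `f` ends in an
undotted cup inside one of the two groups of strands, and a dotted cup inside one group can be
removed. A family `E` of functionals with these properties is called a system (`IsSys2`; `IsSys1`
for a single object). The same calculus of systems serves the ind-completion and `KdTL`.

Spanning. If one end of the neck cutting relation is bent around (`neck_cup`), it says that an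
undotted cup next to a dotted strand plus a dotted cup is the same on both sides of the strand.
Evaluated by a system, this becomes `IsSys2.wall`: a strand moves from the right group to the left
one at the price of a cup, dotted or not, through the wall between the groups. Inserting such a cup
or dotted cup defines operators `cup` and `dotCup` on systems; they anticommute and `dotCup` is an
involution. Iteration until the right group consists only of legs of inserted cups shows
(`IsSys2.mem`) that every value of `E` is a combination of values on `n` nested cups surrounded by
at most one dotted cup, that is, of elements in the images of the `σ_n`.

Orthogonality. Insertion of `z_q` on the right group is an operator `zeta` with `E.zeta.dotCup =
-E.dotCup.zeta` and `E.zeta.cup = E.dotCup - E.cup.zeta`. On the system of the single object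
`ω_(i+j)`, where the grouping does not matter, `cup` is zero and `dotCup` is the identity. So `zeta`
raises, `cup` lowers with a factor `± n`, and the normalization by `(-1)^(n choose 2) / n!` makes
`cup` send the `n`-th projection functional exactly to the preceding one. Since `z_0 = 0`, only `n =
m` survives when the right group is emptied: this is `IsSys1.hole_proj`, the formula `π_n σ_m =
δ_(nm)`. Together with spanning it gives `∑ σ_n π_n = id`, finite on every diagram.

Universal properties. It remains to form infinite sums of given maps composed with the `σ_n` or
`π_n` (`isBiproduct_of_sums`). They are locally finite for degree reasons: dotted crossingless
matchings span the morphisms between black words, each arc has two ends and carries at most one dot,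
and hence a morphism vanishes if its degree exceeds the number of boundary points
(`eq_zero_of_degree`).

On the ind side, Jones-Wenzl projectors annihilate cups (`U_jw`), which gives the first rule of a
system, and the transition maps give the second. A Kirby object has no terms with few strands,
whereas the wall argument empties a group; the functionals are extended downwards by adding dotted
cups (`IsSys1From.shift_iterate`, `Fam2.extend`). On the side of `KdTL` the rules are the relations
imposed on the `ι_n`. -/

theorem comp_zero' {a b c : ℤ} (h : a + b = c) {r s t : List (Option X.E)} (f : Hom R a r s) :
    comp h f (0 : Hom R b s t) = 0 := map_zero _

theorem zero_comp' {a b c : ℤ} (h : a + b = c) {r s t : List (Option X.E)} (f : Hom R b s t) :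
    comp h (0 : Hom R a r s) f = 0 := by rw [map_zero, LinearMap.zero_apply]

/-- The diagram `1_a ⊗ f ⊗ 1_b`. -/
def ins (a b : ℕ) {d : ℤ} {s t N N' : ℕ} (hN : a + s + b = N) (hN' : a + t + b = N') :
    Hom R d (blk s) (blk t) →ₗ[K] Hom R d (blk N) (blk N') :=
  tens (zero_add d) (by rw [blk_add, ← add_assoc, hN]) (by rw [blk_add, ← add_assoc, hN'])
    (id (blk a)) ∘ₗ (tens (add_zero d) (blk_add s b) (blk_add t b)).flip (id (blk b))

theorem ins_apply (a b : ℕ) {d : ℤ} {s t N N' : ℕ} (hN : a + s + b = N) (hN' : a + t + b = N')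
    (f : Hom R d (blk s) (blk t)) : ins a b hN hN' f =
      tens (zero_add d) (by rw [blk_add, ← add_assoc, hN]) (by rw [blk_add, ← add_assoc, hN'])
        (id (blk a)) (tens (add_zero d) (blk_add s b) (blk_add t b) f (id (blk b))) := rfl

theorem ins_congr {a a' b b' : ℕ} {d : ℤ} {s t N N' : ℕ} {hN : a + s + b = N}
    {hN' : a + t + b = N'} (ha : a = a') (hb : b = b') (f : Hom R d (blk s) (blk t)) :
    ins a b hN hN' f = ins a' b' (by rw [← ha, ← hb, hN]) (by rw [← ha, ← hb, hN']) f := by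
  subst ha hb; rfl

theorem ins_comp (a b : ℕ) {d e c : ℤ} {s t r N N' N'' : ℕ} (hN : a + s + b = N)
    (hN' : a + t + b = N') (hN'' : a + r + b = N'') (h : d + e = c) (f : Hom R d (blk s) (blk t))
    (g : Hom R e (blk t) (blk r)) :
    ins a b hN hN'' (comp h f g) = comp h (ins a b hN hN' f) (ins a b hN' hN'' g) := by
  simp only [ins_apply]
  rw [← interchange (add_zero 0) h h (zero_add d) (zero_add e) (zero_add c), id_comp,
    ← interchange h (add_zero 0) h (add_zero d) (add_zero e) (add_zero c), id_comp]

theorem ins_id (a b : ℕ) {s N : ℕ} (hN : a + s + b = N) :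
    ins a b hN hN (id (blk s) : Hom R 0 _ _) = id (blk N) := by
  rw [ins_apply, tens_id, tens_id]

theorem tens_id_blk {a b c : ℕ} (h : a + b = c) :
    tens (add_zero 0) (by rw [blk_add, h]) (by rw [blk_add, h]) (id (blk a)) (id (blk b)) =
      (id (blk c) : Hom R 0 (blk c) (blk c)) := tens_id _

theorem ins_zero {d : ℤ} {s t : ℕ} (hN : 0 + s + 0 = s) (hN' : 0 + t + 0 = t)
    (f : Hom R d (blk s) (blk t)) : ins 0 0 hN hN' f = f := by
  rw [ins_apply]
  exact (one_tens (zero_add d) _ _ _).trans (tens_one _ _ _ _)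

theorem ins_ins (a b a' b' : ℕ) {d : ℤ} {s t M M' N N' : ℕ} (hM : a' + s + b' = M)
    (hM' : a' + t + b' = M') (hN : a + M + b = N) (hN' : a + M' + b = N')
    (f : Hom R d (blk s) (blk t)) :
    ins a b hN hN' (ins a' b' hM hM' f) = ins (a + a') (b' + b) (by omega) (by omega) f := by
  subst hM hM' hN hN'
  simp only [ins_apply]
  have e1 : ∀ n, (blk (n + b') : List (Option X.E)) ++ blk b = blk (n + (b' + b)) := fun n => by
    rw [blk_add, add_assoc]
  have e2 : ∀ n, (blk a' : List (Option X.E)) ++ blk (n + (b' + b)) = blk (a' + n + b' + b) :=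
    fun n => by rw [blk_add]; congr 1; omega
  rw [tens_assoc (zero_add d) (add_zero d) (add_zero d) (zero_add d)
    (by rw [blk_add, add_assoc]) (blk_add _ b) (e1 s) (e2 s)
    (by rw [blk_add, add_assoc]) (blk_add _ b) (e1 t) (e2 t)]
  rw [tens_assoc (add_zero d) (add_zero d) (add_zero 0) (add_zero d) (blk_add s b') (e1 s)
    (blk_add b' b) (blk_add s (b' + b)) (blk_add t b') (e1 t) (blk_add b' b) (blk_add t (b' + b)),
    tens_id]
  have e3 : ∀ n, (blk (a + a') : List (Option X.E)) ++ blk (n + (b' + b)) =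
      blk (a + (a' + n + b') + b) := fun n => by rw [blk_add]; congr 1; omega
  rw [← tens_assoc (add_zero 0) (zero_add d) (zero_add d) (zero_add d)
    (blk_add a a') (e3 s) (e2 s) (by rw [blk_add]; congr 1; omega)
    (blk_add a a') (e3 t) (e2 t) (by rw [blk_add]; congr 1; omega), tens_id]

theorem tens_comm {d e c : ℤ} {s s' t t' : List (Option X.E)} {ss st ts tt : List (Option X.E)}
    (h : d + e = c) (h' : e + d = c) (h1 : s ++ t = st) (h2 : s' ++ t = ss) (h3 : s ++ t' = ts)
    (h4 : s' ++ t' = tt) (f : Hom R d s s') (g : Hom R e t t') :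
    comp h (tens (add_zero d) h1 h2 f (id t)) (tens (zero_add e) h2 h4 (id s') g) =
      comp h' (tens (zero_add e) h1 h3 (id s) g) (tens (add_zero d) h3 h4 f (id t')) := by
  rw [← interchange (add_zero d) (zero_add e) h (add_zero d) (zero_add e) h,
    ← interchange (zero_add d) (add_zero e) h' (zero_add e) (add_zero d) h, id_comp, comp_id,
    id_comp, comp_id]

/-- Far commutativity for `f` on the left of `g`, with `m` strands between them. All offsets and
word lengths are variables tied by equations, so that applications need no transport. -/
theorem ins_comm (a m b : ℕ) {d e c : ℤ} {s t s' t' N N₁ N₂ N' b₁ b₂ a₁ a₂ : ℕ}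
    (f : Hom R d (blk s) (blk t)) (g : Hom R e (blk s') (blk t'))
    (hb₁ : b₁ = m + s' + b) (ha₁ : a₁ = a + t + m) (ha₂ : a₂ = a + s + m) (hb₂ : b₂ = m + t' + b)
    (h1 : a + s + b₁ = N) (h2 : a + t + b₁ = N₁) (h3 : a₁ + s' + b = N₁) (h4 : a₁ + t' + b = N')
    (h5 : a₂ + s' + b = N) (h6 : a₂ + t' + b = N₂) (h7 : a + s + b₂ = N₂) (h8 : a + t + b₂ = N')
    (h : d + e = c) (h' : e + d = c) :
    comp h (ins a b₁ h1 h2 f) (ins a₁ b h3 h4 g) =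
      comp h' (ins a₂ b h5 h6 g) (ins a b₂ h7 h8 f) := by
  -- Rebracketing: `f` is written as `(1 ⊗ f) ⊗ 1` and `g`, in `key2`, as `1 ⊗ (1 ⊗ g ⊗ 1)`, so that
  -- both fit `tens_comm`.
  have key : ∀ (a b : ℕ) {d : ℤ} {s t N N' : ℕ} (hN : a + s + b = N) (hN' : a + t + b = N')
      (f : Hom R d (blk s) (blk t)), ins a b hN hN' f =
      tens (add_zero d) (by rw [blk_add, hN]) (by rw [blk_add, hN']) (tens (zero_add d) (blk_add _ _)
        (blk_add _ _) (id (blk a)) f) (id (blk b)) := by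
    intro a b d s t N N' hN hN' f
    rw [ins_apply]
    exact (tens_assoc (zero_add d) (add_zero d) (add_zero d) (zero_add d) _ _ _ _ _ _ _ _ _ _ _).symm
  have key2 : ∀ (x : ℕ) {a a₁ : ℕ} (ha : a₁ = x + a) (b : ℕ) {d : ℤ} {s t N N' : ℕ}
      (hN : a₁ + s + b = N) (hN' : a₁ + t + b = N') (f : Hom R d (blk s) (blk t)),
      ins a₁ b hN hN' f =
      tens (zero_add d) (by rw [blk_add]; congr 1; omega) (by rw [blk_add]; congr 1; omega)
        (id (blk x)) (ins (N := a + s + b) (N' := a + t + b) a b rfl rfl f) := by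
    intro x a a₁ ha b d s t N N' hN hN' f
    subst ha
    rw [ins_apply, ins_apply, ← tens_id_blk (R := R) rfl]
    exact tens_assoc (add_zero 0) (zero_add d) (zero_add d) (zero_add d) _ _ _ _ _ _ _ _ _ _ _
  subst hb₁ hb₂
  rw [key a _ h1 h2, key a _ h7 h8, key2 (a + t) (a := m) (by omega) b h3 h4 g,
    key2 (a + s) (a := m) (by omega) b h5 h6 g]
  exact tens_comm _ _ _ _ _ _ _ _

/-! ### Cups, caps and dots on black strands -/

/-- The dot, as a diagram between words of black strands. -/
abbrev dotB : Hom R 2 (blk 1) (blk 1) := dot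

/-- The cup, as a diagram between words of black strands. -/
abbrev cupB : Hom R 0 (blk 0) (blk 2) := cup

/-- The dotted cup, as a diagram between words of black strands. -/
abbrev dotCupB : Hom R 2 (blk 0) (blk 2) := dotCup

/-- The cap, as a diagram between words of black strands. -/
abbrev capB : Hom R 0 (blk 2) (blk 0) := cap

/-- The diagram `1_m ⊗ g ⊗ 1_(N-m)`, for a diagram `g` that creates two strands. -/
def cupAt {d : ℤ} (g : Hom R d (blk 0) (blk 2)) (N m : ℕ) : Hom R d (blk N) (blk (N + 2)) :=
  -- The value `0` out of range keeps the bound out of the term; `dotAt`, `capAt` and `zAt` follow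
  -- the same convention.
  if h : m ≤ N then ins m (N - m) (by omega) (by omega) g else 0

/-- A cup to the right of the first `m` among `N` strands. -/
abbrev U (N m : ℕ) : Hom R 0 (blk N) (blk (N + 2)) := cupAt cupB N m

/-- A dotted cup to the right of the first `m` among `N` strands. -/
abbrev V (N m : ℕ) : Hom R 2 (blk N) (blk (N + 2)) := cupAt dotCupB N m

/-- A dot on the strand to the right of the first `m` among `N` strands. -/
def dotAt (N m : ℕ) : Hom R 2 (blk N) (blk N) :=
  if h : m < N then ins (s := 1) (t := 1) m (N - m - 1) (by omega) (by omega) dotB else 0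

/-- A cap to the right of the first `m` among `N + 2` strands. -/
def capAt (N m : ℕ) : Hom R 0 (blk (N + 2)) (blk N) :=
  if h : m ≤ N then ins (s := 2) (t := 0) m (N - m) (by omega) (by omega) capB else 0

theorem cupAt_eq {d : ℤ} (g : Hom R d (blk 0) (blk 2)) {N m k : ℕ} (h : m + k = N) :
    cupAt g N m = ins m k (by omega) (by omega) g := by
  rw [cupAt, dif_pos (by omega)]; exact ins_congr rfl (by omega) g

theorem dotAt_eq {N m k : ℕ} (h : m + 1 + k = N) :
    (dotAt N m : Hom R 2 _ _) = ins (s := 1) (t := 1) m k h h dotB := by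
  rw [dotAt, dif_pos (by omega)]; exact ins_congr rfl (by omega) _

theorem capAt_eq {N m k : ℕ} (h : m + k = N) :
    (capAt N m : Hom R 0 _ _) = ins (s := 2) (t := 0) m k (by omega) (by omega) capB := by
  rw [capAt, dif_pos (by omega)]; exact ins_congr rfl (by omega) _

theorem ins_cupAt {d : ℤ} (g : Hom R d (blk 0) (blk 2)) (a b : ℕ) {N m M : ℕ} (h : m ≤ N)
    (hM : a + N + b = M) : ins a b hM (by omega) (cupAt g N m) = cupAt g M (a + m) := by
  rw [cupAt_eq g (k := N - m) (by omega), ins_ins, cupAt_eq g (k := N - m + b) (by omega)]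

theorem ins_dotAt (a b : ℕ) {N m M : ℕ} (h : m < N) (hM : a + N + b = M) :
    ins a b hM hM (dotAt N m) = (dotAt M (a + m) : Hom R 2 _ _) := by
  rw [dotAt_eq (k := N - m - 1) (by omega), ins_ins, dotAt_eq (k := N - m - 1 + b) (by omega)]

theorem ins_capAt (a b : ℕ) {N m M : ℕ} (h : m ≤ N) (hM : a + N + b = M) :
    ins a b (by omega) hM (capAt N m) = (capAt M (a + m) : Hom R 0 _ _) := by
  rw [capAt_eq (k := N - m) (by omega), ins_ins, capAt_eq (k := N - m + b) (by omega)]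

theorem cupAt_cupAt {d e c : ℤ} (g : Hom R d (blk 0) (blk 2)) (g' : Hom R e (blk 0) (blk 2))
    {N l m m' : ℕ} (hl : l ≤ m) (hm : m ≤ N) (hm' : m' = m + 2) (h : d + e = c) (h' : e + d = c) :
    comp h (cupAt g N m) (cupAt g' (N + 2) l) = comp h' (cupAt g' N l) (cupAt g (N + 2) m') := by
  rw [cupAt_eq g (k := N - m) (by omega), cupAt_eq g' (k := N + 2 - l) (by omega),
    cupAt_eq g' (k := N - l) (by omega), cupAt_eq g (k := N - m) (by omega)]
  exact (ins_comm (s := 0) (t := 2) (s' := 0) (t' := 2) l (m - l) (N - m) g' g (by omega) (by omega) (by omega) (by omega) _ _ _ _ _ _ _ _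
    h' h).symm

theorem dotAt_cupAt_left {d c : ℤ} (g : Hom R d (blk 0) (blk 2)) {N l m : ℕ} (hl : l < m)
    (hm : m ≤ N) (h : 2 + d = c) (h' : d + 2 = c) :
    comp h (dotAt N l) (cupAt g N m) = comp h' (cupAt g N m) (dotAt (N + 2) l) := by
  rw [cupAt_eq g (k := N - m) (by omega), dotAt_eq (k := N - l - 1) (by omega),
    dotAt_eq (k := N + 2 - l - 1) (by omega)]
  exact ins_comm (s := 1) (t := 1) (s' := 0) (t' := 2) l (m - l - 1) (N - m) dotB g (by omega) (by omega) (by omega) (by omega)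
    _ _ _ _ _ _ _ _ h h'

theorem dotAt_cupAt_right {d c : ℤ} (g : Hom R d (blk 0) (blk 2)) {N l l' m : ℕ} (hl : m ≤ l)
    (hN : l < N) (hl' : l' = l + 2) (h : 2 + d = c) (h' : d + 2 = c) :
    comp h (dotAt N l) (cupAt g N m) = comp h' (cupAt g N m) (dotAt (N + 2) l') := by
  rw [cupAt_eq g (k := N - m) (by omega), dotAt_eq (k := N - l - 1) (by omega),
    dotAt_eq (k := N - l - 1) (by omega)]
  exact (ins_comm (s := 0) (t := 2) (s' := 1) (t' := 1) m (l - m) (N - l - 1) g dotB (by omega) (by omega) (by omega) (by omega)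
    _ _ _ _ _ _ _ _ h' h).symm

theorem cupAt_capAt_left {d c : ℤ} (g : Hom R d (blk 0) (blk 2)) {N l m : ℕ} (hl : l ≤ m)
    (hm : m ≤ N) (h : d + 0 = c) (h' : 0 + d = c) :
    comp h (cupAt g (N + 2) (m + 2)) (capAt (N + 2) l) = comp h' (capAt N l) (cupAt g N m) := by
  rw [cupAt_eq g (k := N - m) (by omega), cupAt_eq g (k := N - m) (by omega),
    capAt_eq (k := N + 2 - l) (by omega), capAt_eq (k := N - l) (by omega)]
  exact (ins_comm (s := 2) (t := 0) (s' := 0) (t' := 2) l (m - l) (N - m) capB g (by omega) (by omega) (by omega) (by omega)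
    _ _ _ _ _ _ _ _ h' h).symm

theorem cupAt_capAt_right {d c : ℤ} (g : Hom R d (blk 0) (blk 2)) {N l l' m : ℕ} (hl : m ≤ l)
    (hN : l ≤ N) (hl' : l' = l + 2) (h : d + 0 = c) (h' : 0 + d = c) :
    comp h (cupAt g (N + 2) m) (capAt (N + 2) l') = comp h' (capAt N l) (cupAt g N m) := by
  rw [cupAt_eq g (k := N + 2 - m) (by omega), cupAt_eq g (k := N - m) (by omega),
    capAt_eq (k := N - l) (by omega), capAt_eq (k := N - l) (by omega)]
  exact ins_comm (s := 0) (t := 2) (s' := 2) (t' := 0) m (l - m) (N - l) g capB (by omega) (by omega) (by omega) (by omega)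
    _ _ _ _ _ _ _ _ h h'

/-! Relations between cups, caps and dots. -/

theorem dotAt_two_zero : (dotAt 2 0 : Hom R 2 (blk 2) (blk 2)) =
    tens (add_zero 2) rfl rfl dotB (id [none]) := by
  rw [dotAt_eq (k := 1) rfl, ins_apply]; exact one_tens _ _ _ _

theorem dotAt_two_one : (dotAt 2 1 : Hom R 2 (blk 2) (blk 2)) =
    tens (zero_add 2) rfl rfl (id [none]) dotB := by
  rw [dotAt_eq (k := 0) rfl, ins_apply]
  congr 1
  exact tens_one (add_zero 2) rfl rfl dotB

theorem U_dotAt_left {N m : ℕ} (h : m ≤ N) (h' : 0 + 2 = (2 : ℤ)) :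
    comp h' (U N m) (dotAt (N + 2) m) = (V N m : Hom R 2 _ _) := by
  have h0 : comp h' cupB (dotAt 2 0) = (dotCupB : Hom R 2 (blk 0) (blk 2)) := by
    rw [dotAt_two_zero]; rfl
  have := congrArg (ins (s := 0) (t := 2) m (N - m) (N := N) (N' := N + 2) (by omega) (by omega)) h0
  rw [ins_comp (N' := N + 2) m (N - m) _ (by omega), ins_dotAt _ _ (by omega)] at this
  rwa [U, V, cupAt_eq (k := N - m) _ (by omega), cupAt_eq (k := N - m) _ (by omega)]

theorem U_dotAt_right {N m : ℕ} (h : m ≤ N) (h' : 0 + 2 = (2 : ℤ)) :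
    comp h' (U N m) (dotAt (N + 2) (m + 1)) = (V N m : Hom R 2 _ _) := by
  have h0 : comp h' cupB (dotAt 2 1) = (dotCupB : Hom R 2 (blk 0) (blk 2)) := by
    rw [dotAt_two_one]; exact (sound .dot_cup).symm
  have := congrArg (ins (s := 0) (t := 2) m (N - m) (N := N) (N' := N + 2) (by omega) (by omega)) h0
  rw [ins_comp (N' := N + 2) m (N - m) _ (by omega), ins_dotAt _ _ (by omega)] at this
  rwa [U, V, cupAt_eq (k := N - m) _ (by omega), cupAt_eq (k := N - m) _ (by omega)]

theorem dotAt_sq {N m : ℕ} (h : m < N) {c : ℤ} (h' : 2 + 2 = c) :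
    comp h' (dotAt N m) (dotAt N m) = (0 : Hom R c _ _) := by
  subst h'
  have h0 : comp rfl dotB dotB = (0 : Hom R (2 + 2) (blk 1) (blk 1)) := sound .dot_dot
  have := congrArg (ins (s := 1) (t := 1) m (N - m - 1) (N := N) (N' := N) (by omega) (by omega)) h0
  rwa [ins_comp (N' := N) m (N - m - 1) _ (by omega), map_zero, ← dotAt_eq] at this

theorem V_dotAt_left {N m : ℕ} (h : m ≤ N) {c : ℤ} (h' : 2 + 2 = c) :
    comp h' (V N m) (dotAt (N + 2) m) = (0 : Hom R c _ _) := by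
  rw [← U_dotAt_left h (zero_add 2), assoc (zero_add 2) h' h' (zero_add c), dotAt_sq (by omega),
    map_zero]

theorem V_dotAt_right {N m : ℕ} (h : m ≤ N) {c : ℤ} (h' : 2 + 2 = c) :
    comp h' (V N m) (dotAt (N + 2) (m + 1)) = (0 : Hom R c _ _) := by
  rw [← U_dotAt_right h (zero_add 2), assoc (zero_add 2) h' h' (zero_add c), dotAt_sq (by omega),
    map_zero]

theorem U_capAt_same {N m : ℕ} (h : m ≤ N) :
    comp (add_zero 0) (U N m) (capAt N m) = (2 : K) • (id (blk N) : Hom R 0 _ _) := by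
  have h0 : comp (add_zero 0) cupB capB = (2 : K) • (id (blk 0) : Hom R 0 (blk 0) (blk 0)) :=
    sound .circle
  have := congrArg (ins (s := 0) (t := 0) m (N - m) (N := N) (N' := N) (by omega) (by omega)) h0
  rw [ins_comp (N' := N + 2) m (N - m) _ (by omega), map_smul, ins_id] at this
  rwa [U, capAt_eq (k := N - m) (by omega), cupAt_eq (k := N - m) _ (by omega)]

theorem U_capAt_left {N m : ℕ} (h : m < N) :
    comp (add_zero 0) (U N (m + 1)) (capAt N m) = (id (blk N) : Hom R 0 _ _) := by
  have h0 : comp (add_zero 0) (U 1 1) (capAt 1 0) = (id (blk 1) : Hom R 0 (blk 1) (blk 1)) := by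
    refine Eq.trans ?_ zigzag
    rw [U, cupAt_eq (k := 0) _ rfl, capAt_eq (k := 1) rfl, ins_apply, ins_apply]
    refine congrArg₂ (fun (f : Hom R 0 (blk 1) (blk 3)) (g : Hom R 0 (blk 3) (blk 1)) =>
      comp (add_zero 0) f g) ?_ ?_
    · exact congrArg _ (tens_one _ _ _ _)
    · exact one_tens _ _ _ _
  have := congrArg (ins (s := 1) (t := 1) m (N - m - 1) (N := N) (N' := N) (by omega) (by omega)) h0
  rwa [ins_comp (N' := N + 2) m (N - m - 1) _ (by omega), ins_id, ins_cupAt _ _ _ (by omega),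
    ins_capAt _ _ (by omega)] at this

theorem U_capAt_right {N m : ℕ} (h : m < N) :
    comp (add_zero 0) (U N m) (capAt N (m + 1)) = (id (blk N) : Hom R 0 _ _) := by
  have h0 : comp (add_zero 0) (U 1 0) (capAt 1 1) = (id (blk 1) : Hom R 0 (blk 1) (blk 1)) := by
    refine Eq.trans ?_ zagzig
    rw [U, cupAt_eq (k := 1) _ rfl, capAt_eq (k := 0) rfl, ins_apply, ins_apply]
    refine congrArg₂ (fun (f : Hom R 0 (blk 1) (blk 3)) (g : Hom R 0 (blk 3) (blk 1)) =>
      comp (add_zero 0) f g) ?_ ?_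
    · exact one_tens _ _ _ _
    · exact congrArg _ (tens_one _ _ _ _)
  have := congrArg (ins (s := 1) (t := 1) m (N - m - 1) (N := N) (N' := N) (by omega) (by omega)) h0
  rwa [ins_comp (N' := N + 2) m (N - m - 1) _ (by omega), ins_id, ins_cupAt _ _ _ (by omega),
    ins_capAt _ _ (by omega)] at this

/-- The dot is put on the leg that the cap does not meet, slides past the cap, and the undotted
zigzag is straightened. -/
theorem V_capAt_left {N m : ℕ} (h : m < N) :
    comp (add_zero 2) (V N (m + 1)) (capAt N m) = (dotAt N m : Hom R 2 _ _) := by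
  have h1 : comp (zero_add 2) (U N (m + 1)) (dotAt (N + 2) (m + 2)) =
      (V N (m + 1) : Hom R 2 _ _) := U_dotAt_right (by omega) _
  have h2 : comp (add_zero 2) (dotAt (N + 2) (m + 2)) (capAt N m) =
      (comp (zero_add 2) (capAt N m) (dotAt N m) : Hom R 2 _ _) := by
    rw [dotAt_eq (N := N + 2) (k := N - m - 1) (by omega),
      dotAt_eq (N := N) (k := N - m - 1) (by omega), capAt_eq (k := N - m) (by omega)]
    exact (ins_comm (s := 2) (t := 0) (s' := 1) (t' := 1) m 0 (N - m - 1) capB dotB (by omega) (by omega) (by omega) (by omega)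
      _ _ _ _ _ _ _ _ _ _).symm
  rw [← h1, assoc (zero_add 2) (add_zero 2) (add_zero 2) (zero_add 2), h2,
    ← assoc (add_zero 0) (zero_add 2) (zero_add 2) (zero_add 2), U_capAt_left h, id_comp]

theorem V_capAt_right {N m : ℕ} (h : m < N) :
    comp (add_zero 2) (V N m) (capAt N (m + 1)) = (dotAt N m : Hom R 2 _ _) := by
  have h2 : comp (add_zero 2) (dotAt (N + 2) m) (capAt N (m + 1)) =
      (comp (zero_add 2) (capAt N (m + 1)) (dotAt N m) : Hom R 2 _ _) := by
    rw [dotAt_eq (N := N + 2) (k := N + 1 - m) (by omega),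
      dotAt_eq (N := N) (k := N - m - 1) (by omega), capAt_eq (k := N - m - 1) (by omega)]
    exact ins_comm (s := 1) (t := 1) (s' := 2) (t' := 0) m 0 (N - m - 1) dotB capB (by omega) (by omega) (by omega) (by omega)
      _ _ _ _ _ _ _ _ _ _
  rw [← U_dotAt_left h.le (zero_add 2), assoc (zero_add 2) (add_zero 2) (add_zero 2) (zero_add 2),
    h2, ← assoc (add_zero 0) (zero_add 2) (zero_add 2) (zero_add 2), U_capAt_right h, id_comp]

theorem neck_two : (dotAt 2 0 + dotAt 2 1 : Hom R 2 (blk 2) (blk 2)) =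
    comp (add_zero 2) (comp (add_zero 2) (dotAt 2 0) capB) cupB + comp (zero_add 2) capB dotCupB := by
  rw [dotAt_two_zero, dotAt_two_one]
  exact sound .neck

/-- The neck cutting relation, with one end of the strands bent around. -/
theorem neck_cup {N m : ℕ} (h : m < N) :
    (comp (add_zero 2) (dotAt N m) (U N (m + 1)) + V N (m + 1) : Hom R 2 _ _) =
      comp (add_zero 2) (dotAt N m) (U N m) + V N m := by
  -- A single strand suffices; the general case inserts this one between further strands.
  have h0 : (comp (add_zero 2) (dotAt 1 0) (U 1 1) + V 1 1 : Hom R 2 (blk 1) (blk 3)) =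
      comp (add_zero 2) (dotAt 1 0) (U 1 0) + V 1 0 := by
    -- Neck cutting acts on the first two of three strands, after a cup on the last two. On the
    -- right-hand side the cap of the neck closes a zigzag with this cup, and only the new cup
    -- survives.
    have h1 := congrArg (fun q => comp (zero_add 2) (U 1 1)
      (ins (s := 2) (t := 2) (N := 3) (N' := 3) 0 1 rfl rfl q)) (neck_two (R := R))
    have e1 : ins (s := 2) (t := 0) (N := 3) (N' := 1) 0 1 rfl rfl (capB : Hom R 0 (blk 2) (blk 0)) = capAt 1 0 := by
      rw [capAt_eq (k := 1) rfl]
    have e2 : ins (s := 0) (t := 2) (N := 1) (N' := 3) 0 1 rfl rfl (cupB : Hom R 0 (blk 0) (blk 2)) = U 1 0 := by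
      rw [U, cupAt_eq (k := 1) _ rfl]
    have e3 : ins (s := 0) (t := 2) (N := 1) (N' := 3) 0 1 rfl rfl (dotCupB : Hom R 2 (blk 0) (blk 2)) = V 1 0 := by
      rw [V, cupAt_eq (k := 1) _ rfl]
    have e4 : comp (zero_add 2) (U 1 1) (dotAt 3 0) =
        (comp (add_zero 2) (dotAt 1 0) (U 1 1) : Hom R 2 (blk 1) (blk 3)) :=
      (dotAt_cupAt_left _ (by omega) (by omega) _ _).symm
    have e5 : comp (zero_add 2) (U 1 1) (dotAt 3 1) = (V 1 1 : Hom R 2 (blk 1) (blk 3)) :=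
      U_dotAt_left le_rfl _
    simp only [map_add] at h1
    rw [ins_comp (t := 0) (N' := 1) 0 1 _ rfl _ _ _ cupB,
      ins_comp (t := 2) (r := 0) (N' := 3) 0 1 _ rfl _ _ _ capB,
      ins_comp (s := 2) (t := 0) (N' := 1) 0 1 _ rfl _ _ capB, e1, e2, e3, ins_dotAt 0 1 (by omega),
      ins_dotAt 0 1 (by omega), Nat.zero_add, Nat.zero_add, e5] at h1
    rw [← assoc (add_zero 0) (zero_add 2) (zero_add 2) (zero_add 2) (U 1 1) (capAt 1 0),
      U_capAt_left (by omega), id_comp, ← assoc (zero_add 2) (add_zero 2) (add_zero 2) (zero_add 2),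
      ← assoc (zero_add 2) (add_zero 2) (add_zero 2) (zero_add 2), e4,
      assoc (add_zero 2) (add_zero 2) (add_zero 0) (add_zero 2) _ (U 1 1),
      U_capAt_left (by omega), comp_id] at h1
    exact h1
  have := congrArg (ins (s := 1) (t := 3) m (N - m - 1) (N := N) (N' := N + 2) (by omega) (by omega)) h0
  rw [map_add, map_add, ins_comp (N' := N) m (N - m - 1) _ (by omega),
    ins_comp (N' := N) m (N - m - 1) _ (by omega), ins_dotAt _ _ (by omega)] at this
  simpa only [ins_cupAt _ _ _ (le_refl _), ins_cupAt _ _ _ (Nat.zero_le 1), add_zero] using this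

/-- A circle with a dot vanishes. -/
theorem dotCup_cap [CharZero K] : comp (add_zero 2) dotCupB capB =
    (0 : Hom R 2 (blk 0) (blk 0)) := by
  -- Closing up both sides of neck cutting gives `2δ = 4δ` for the dotted circle `δ`, because each
  -- term on the right acquires an undotted circle of value `2`.
  have h1 := congrArg (fun q => comp (zero_add 2) cupB (comp (add_zero 2) q capB))
    (neck_two (R := R))
  have hc : comp (add_zero 0) cupB capB = (2 : K) • (id (blk 0) : Hom R 0 (blk 0) (blk 0)) := sound .circle
  have e0 : comp (zero_add 2) cupB (dotAt 2 0) = (dotCupB : Hom R 2 (blk 0) (blk 2)) := by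
    rw [dotAt_two_zero]; rfl
  have e1 : comp (zero_add 2) cupB (dotAt 2 1) = (dotCupB : Hom R 2 (blk 0) (blk 2)) := by
    rw [dotAt_two_one]; exact (sound .dot_cup).symm
  simp only [map_add, LinearMap.add_apply] at h1
  rw [← assoc (zero_add 2) (add_zero 2) (add_zero 2) (zero_add 2) cupB (dotAt 2 0) capB,
    ← assoc (zero_add 2) (add_zero 2) (add_zero 2) (zero_add 2) cupB (dotAt 2 1) capB, e0, e1,
    assoc (add_zero 2) (add_zero 2) (add_zero 0) (add_zero 2) _ cupB capB, hc, map_smul, comp_id,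
    map_smul, ← assoc (zero_add 2) (add_zero 2) (add_zero 2) (zero_add 2) cupB (dotAt 2 0) capB, e0,
    assoc (zero_add 2) (add_zero 2) (add_zero 2) (zero_add 2) capB dotCupB capB,
    ← assoc (add_zero 0) (zero_add 2) (zero_add 2) (zero_add 2) cupB capB, hc, map_smul,
    LinearMap.smul_apply, id_comp, ← two_smul K, left_eq_add, smul_eq_zero] at h1
  exact h1.resolve_left two_ne_zero

theorem V_capAt_same [CharZero K] {N m : ℕ} (h : m ≤ N) :
    comp (add_zero 2) (V N m) (capAt N m) = (0 : Hom R 2 _ _) := by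
  have := congrArg (ins (s := 0) (t := 0) m (N - m) (N := N) (N' := N) (by omega) (by omega))
    (dotCup_cap (R := R))
  rw [ins_comp (N' := N + 2) m (N - m) _ (by omega), map_zero] at this
  rwa [V, capAt_eq (k := N - m) (by omega), cupAt_eq (k := N - m) _ (by omega)]

end Pres

end Kirby

/-! ### Alternating sums of dots, and systems of functionals on two groups of strands. -/

namespace Kirby

namespace Pres

variable {K : Type u} [Field K] {X : Gens} {R : TmRel K X}

theorem ins_left (b : ℕ) {d : ℤ} {s t N N' : ℕ} (hN : 0 + s + b = N) (hN' : 0 + t + b = N')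
    (hs : blk s ++ blk b = (blk N : List (Option X.E)))
    (ht : blk t ++ blk b = (blk N' : List (Option X.E))) (f : Hom R d (blk s) (blk t)) :
    ins 0 b hN hN' f = tens (add_zero d) hs ht f (id (blk b)) := by
  obtain rfl : N = s + b := by omega
  obtain rfl : N' = t + b := by omega
  rw [ins_apply]; exact one_tens _ _ _ _

theorem ins_right (a : ℕ) {d : ℤ} {s t N N' : ℕ} (hN : a + s + 0 = N) (hN' : a + t + 0 = N')
    (hs : blk a ++ blk s = (blk N : List (Option X.E)))
    (ht : blk a ++ blk t = (blk N' : List (Option X.E))) (f : Hom R d (blk s) (blk t)) :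
    ins a 0 hN hN' f = tens (zero_add d) hs ht (id (blk a)) f := by
  rw [ins_apply]
  exact congrArg _ (tens_one _ _ _ _)

/-- The alternating sum of the dots on the last `q` among `N` strands. -/
def zAt (N q : ℕ) : Hom R 2 (blk N) (blk N) :=
  if h : q ≤ N then ins (N - q) 0 (by omega) (by omega) (z q) else 0

theorem zAt_eq {N p q : ℕ} (h : p + q = N) :
    (zAt N q : Hom R 2 _ _) = ins p 0 (by omega) (by omega) (z q) := by
  rw [zAt, dif_pos (by omega)]; exact ins_congr (by omega) rfl _

theorem zAt_zero (N : ℕ) : (zAt N 0 : Hom R 2 _ _) = 0 := by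
  rw [zAt_eq (N := N) (p := N) (q := 0) rfl]
  exact map_zero _

theorem z_succ (q : ℕ) : (z (q + 1) : Hom R 2 _ _) = dotAt (q + 1) 0 - zAt (q + 1) q := by
  have h : (z (q + 1) : Hom R 2 _ _) = tens (add_zero 2) rfl rfl dot (id (blk q)) +
    (-1 : K) • tens (zero_add 2) rfl rfl (id [none]) (z q) := rfl
  rw [h, neg_one_smul, ← sub_eq_add_neg, dotAt_eq (k := q) (by omega), zAt_eq (p := 1) (by omega)]
  congr 1
  · exact (ins_left (R := R) (s := 1) (t := 1) (N := q + 1) (N' := q + 1) q (by omega) (by omega) rfl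
      rfl dot).symm
  · exact (ins_right (R := R) (s := q) (t := q) (N := q + 1) (N' := q + 1) 1 (by omega) (by omega) rfl
      rfl (z q)).symm

theorem zAt_succ {N p q : ℕ} (h : p + 1 + q = N) :
    (zAt N (q + 1) : Hom R 2 _ _) = dotAt N p - zAt N q := by
  rw [zAt_eq (p := p) (by omega), z_succ, map_sub, ins_dotAt _ _ (by omega),
    zAt_eq (N := q + 1) (p := 1) (by omega), ins_ins, zAt_eq (N := N) (p := p + 1) (by omega)]
  rfl

theorem cupAt_zAt_left {d c : ℤ} (g : Hom R d (blk 0) (blk 2)) {N p q m : ℕ} (h : p + q = N)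
    (hm : m ≤ p) (h1 : d + 2 = c) (h2 : 2 + d = c) :
    comp h1 (cupAt g N m) (zAt (N + 2) q) = comp h2 (zAt N q) (cupAt g N m) := by
  rw [cupAt_eq g (k := N - m) (by omega), zAt_eq (N := N) (p := p) (by omega),
    zAt_eq (N := N + 2) (p := p + 2) (by omega)]
  exact ins_comm (s := 0) (t := 2) (s' := q) (t' := q) m (p - m) 0 g (z q) (by omega) (by omega)
    (by omega) (by omega) _ _ _ _ _ _ _ _ h1 h2

/-- The two dots on the legs of a cup agree. -/
def DotSlide {d : ℤ} (g : Hom R d (blk 0) (blk 2)) : Prop :=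
  ∀ N m, m ≤ N → comp rfl (cupAt g N m) (dotAt (N + 2) m) =
    comp rfl (cupAt g N m) (dotAt (N + 2) (m + 1))

theorem dotSlide_cup : DotSlide (cupB : Hom R 0 (blk 0) (blk 2)) := fun N m h => by
  have h1 : comp (zero_add 2) (U N m) (dotAt (N + 2) m) = (V N m : Hom R 2 _ _) :=
    U_dotAt_left h _
  exact h1.trans (U_dotAt_right h _).symm

theorem dotSlide_dotCup : DotSlide (dotCupB : Hom R 2 (blk 0) (blk 2)) := fun N m h => by
  rw [V_dotAt_left h, V_dotAt_right h]

/-- The two legs of the cup are adjacent, so their dots enter the alternating sum with opposite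
signs and cancel by `DotSlide`. The strands to their right are displaced by two and keep their
signs. -/
theorem cupAt_zAt_right {d c : ℤ} {g : Hom R d (blk 0) (blk 2)} (hg : DotSlide g) {N p q m : ℕ}
    (h : p + q = N) (hm : p ≤ m) (hm' : m ≤ N) (h1 : d + 2 = c) (h2 : 2 + d = c) :
    comp h1 (cupAt g N m) (zAt (N + 2) (q + 2)) = comp h2 (zAt N q) (cupAt g N m) := by
  subst h1
  induction q generalizing p with
  | zero =>
    obtain rfl : m = p := by omega
    rw [zAt_succ (p := m) (by omega), zAt_succ (p := m + 1) (by omega), zAt_zero, zAt_zero,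
      sub_zero, map_sub, hg N m hm', sub_self, zero_comp']
  | succ q ih =>
    rcases hm.eq_or_lt with rfl | hm
    · rw [zAt_succ (p := p) (by omega), zAt_succ (p := p + 1) (by omega), map_sub, map_sub,
        hg N p hm', sub_sub_cancel]
      exact cupAt_zAt_left g h le_rfl _ _
    · rw [zAt_succ (p := p) (by omega), map_sub, ih (p := p + 1) (by omega) (by omega),
        zAt_succ (p := p) (by omega), map_sub, LinearMap.sub_apply]
      congr 1
      exact (dotAt_cupAt_left g (by omega) hm' _ _).symm

/-! ### Families of functionals on diagrams -/

section Fam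

variable (R) (s : List (Option X.E)) (M : Type*) [AddCommGroup M] [Module K M]

/-- Linear functionals on the diagrams from `s` to `N` black strands. -/
abbrev Fam1 := ∀ (N : ℕ) (d : ℤ), Hom R d s (blk N) →ₗ[K] M

/-- Linear functionals on the diagrams from `s` to `p` black strands next to `q` black strands. -/
abbrev Fam2 := ∀ (p q N : ℕ) (d : ℤ), PLift (p + q = N) → (Hom R d s (blk N) →ₗ[K] M)

variable {R s M}

/-- The functionals vanish on undotted cups, and dotted cups can be removed. -/
structure IsSys1 (I : Fam1 R s M) : Prop where
  cup : ∀ {N m : ℕ} {d : ℤ} (_ : m ≤ N) (f : Hom R d s (blk N)),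
    I (N + 2) d (comp (add_zero d) f (U N m)) = 0
  dotCup : ∀ {N m : ℕ} {d : ℤ} (_ : m ≤ N) (f : Hom R d s (blk N)),
    I (N + 2) (d + 2) (comp rfl f (V N m)) = I N d f

/-- The functionals vanish on undotted cups, and dotted cups can be removed, where the cups are in
one of the two groups of black strands. -/
structure IsSys2 (E : Fam2 R s M) : Prop where
  cupL : ∀ {p q N m : ℕ} {d : ℤ} (h : p + q = N) (_ : m ≤ p) (f : Hom R d s (blk N)),
    E (p + 2) q (N + 2) d ⟨by omega⟩ (comp (add_zero d) f (U N m)) = 0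
  cupR : ∀ {p q N m : ℕ} {d : ℤ} (h : p + q = N) (_ : p ≤ m) (_ : m ≤ N) (f : Hom R d s (blk N)),
    E p (q + 2) (N + 2) d ⟨by omega⟩ (comp (add_zero d) f (U N m)) = 0
  dotCupL : ∀ {p q N m : ℕ} {d : ℤ} (h : p + q = N) (_ : m ≤ p) (f : Hom R d s (blk N)),
    E (p + 2) q (N + 2) (d + 2) ⟨by omega⟩ (comp rfl f (V N m)) = E p q N d ⟨h⟩ f
  dotCupR : ∀ {p q N m : ℕ} {d : ℤ} (h : p + q = N) (_ : p ≤ m) (_ : m ≤ N)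
    (f : Hom R d s (blk N)),
    E p (q + 2) (N + 2) (d + 2) ⟨by omega⟩ (comp rfl f (V N m)) = E p q N d ⟨h⟩ f

/-- Insertion of a cup between the two groups of strands. -/
def Fam2.cup (E : Fam2 R s M) : Fam2 R s M := fun p q N d h =>
  E (p + 1) (q + 1) (N + 2) d ⟨by have := h.down; omega⟩ ∘ₗ (comp (add_zero d)).flip (U N p)

/-- Insertion of a dotted cup between the two groups of strands. -/
def Fam2.dotCup (E : Fam2 R s M) : Fam2 R s M := fun p q N d h =>
  E (p + 1) (q + 1) (N + 2) (d + 2) ⟨by have := h.down; omega⟩ ∘ₗ (comp rfl).flip (V N p)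

/-- Insertion of the alternating sum of dots on the second group of strands. -/
def Fam2.zeta (E : Fam2 R s M) : Fam2 R s M := fun p q N d h =>
  E p q N (d + 2) h ∘ₗ (comp rfl).flip (zAt N q)

theorem Fam2.cup_apply (E : Fam2 R s M) {p q N : ℕ} {d : ℤ} (h : p + q = N)
    (f : Hom R d s (blk N)) : E.cup p q N d ⟨h⟩ f =
      E (p + 1) (q + 1) (N + 2) d ⟨by omega⟩ (comp (add_zero d) f (U N p)) := rfl

theorem Fam2.dotCup_apply (E : Fam2 R s M) {p q N : ℕ} {d : ℤ} (h : p + q = N)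
    (f : Hom R d s (blk N)) : E.dotCup p q N d ⟨h⟩ f =
      E (p + 1) (q + 1) (N + 2) (d + 2) ⟨by omega⟩ (comp rfl f (V N p)) := rfl

theorem Fam2.zeta_apply (E : Fam2 R s M) {p q N : ℕ} {d : ℤ} (h : p + q = N)
    (f : Hom R d s (blk N)) : E.zeta p q N d ⟨h⟩ f =
      E p q N (d + 2) ⟨h⟩ (comp rfl f (zAt N q)) := rfl

theorem assoc' {a b c e : ℤ} (h : b + c = e) {q r t v : List (Option X.E)}
    (f : Hom R a q r) (g : Hom R b r t) (k : Hom R c t v) {ab abc : ℤ} (h₁ : a + b = ab)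
    (h₂ : ab + c = abc) :
    comp h₂ (comp h₁ f g) k = comp (by omega) f (comp h g k) := assoc _ _ _ _ _ _ _

/-- Commuting squares, precomposed with a diagram. -/
theorem swap {a b c b' c' : ℤ} {q r t t' v : List (Option X.E)} (f : Hom R a q r)
    {g : Hom R b r t} {k : Hom R c t v} {g' : Hom R b' r t'} {k' : Hom R c' t' v} {e : ℤ}
    {h : b + c = e} {h' : b' + c' = e} (hgk : comp h g k = comp h' g' k') {ab ab' abc : ℤ}
    (h₁ : a + b = ab) (h₂ : ab + c = abc) (h₃ : a + b' = ab') (h₄ : ab' + c' = abc) :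
    comp h₂ (comp h₁ f g) k = comp h₄ (comp h₃ f g') k' := by
  rw [assoc' h, assoc' h', hgk]

theorem Fam2.congr (E : Fam2 R s M) {p p' q q' N : ℕ} {d d' a b : ℤ} {t : List (Option X.E)}
    (hp : p = p') (hq : q = q') (hd : d = d') (hN : p + q = N) (h : a + b = d) (h' : a + b = d')
    (f : Hom R a s t) (g : Hom R b t (blk N)) :
    E p q N d ⟨hN⟩ (comp h f g) = E p' q' N d' ⟨by omega⟩ (comp h' f g) := by
  subst hp hq hd; rfl

/-- A cup inserted at the wall is disjoint from the cups inside the groups. The order of creation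
can be exchanged, so that `E` sees the cup of the relation last. -/
theorem IsSys2.cup {E : Fam2 R s M} (hE : IsSys2 E) : IsSys2 E.cup where
  cupL {p q N m d} h hm f := by
    rw [Fam2.cup_apply, swap (g' := U N p) (k' := U (N + 2) m)
      (h' := add_zero 0) f (cupAt_cupAt _ _ hm (by omega) rfl (add_zero 0) (add_zero 0)).symm (add_zero _) (add_zero _) (add_zero _) (add_zero _)]
    exact hE.cupL (p := p + 1) (q := q + 1) (by omega) (by omega) _
  cupR {p q N m d} h hm hm' f := by
    rw [Fam2.cup_apply, swap (g' := U N p) (k' := U (N + 2) (m + 2))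
      (h' := add_zero 0) f (cupAt_cupAt _ _ hm (by omega) rfl (add_zero 0) _) _ _ (add_zero _) (add_zero _)]
    exact hE.cupR (p := p + 1) (q := q + 1) (by omega) (by omega) (by omega) _
  dotCupL {p q N m d} h hm f := by
    rw [Fam2.cup_apply, swap (g' := U N p) (k' := V (N + 2) m)
      (h' := zero_add 2) f (cupAt_cupAt _ _ hm (by omega) rfl (zero_add 2) (add_zero 2)).symm _ _ (add_zero _) rfl]
    exact hE.dotCupL (p := p + 1) (q := q + 1) (by omega) (by omega) _
  dotCupR {p q N m d} h hm hm' f := by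
    rw [Fam2.cup_apply, swap (g' := U N p) (k' := V (N + 2) (m + 2))
      (h' := zero_add 2) f (cupAt_cupAt _ _ hm (by omega) rfl (add_zero 2) _) _ _ (add_zero _) rfl]
    exact hE.dotCupR (p := p + 1) (q := q + 1) (by omega) (by omega) (by omega) _

theorem IsSys2.dotCup {E : Fam2 R s M} (hE : IsSys2 E) : IsSys2 E.dotCup where
  cupL {p q N m d} h hm f := by
    rw [Fam2.dotCup_apply, swap (g' := V N p) (k' := U (N + 2) m)
      (h' := add_zero 2) f (cupAt_cupAt _ _ hm (by omega) rfl (add_zero 2) (zero_add 2)).symm _ _ rfl (add_zero _)]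
    exact hE.cupL (p := p + 1) (q := q + 1) (by omega) (by omega) _
  cupR {p q N m d} h hm hm' f := by
    rw [Fam2.dotCup_apply, swap (g' := V N p) (k' := U (N + 2) (m + 2))
      (h' := add_zero 2) f (cupAt_cupAt _ _ hm (by omega) rfl (zero_add 2) _) _ _ rfl (add_zero _)]
    exact hE.cupR (p := p + 1) (q := q + 1) (by omega) (by omega) (by omega) _
  dotCupL {p q N m d} h hm f := by
    rw [Fam2.dotCup_apply, swap (g' := V N p) (k' := V (N + 2) m)
      (h' := rfl) f (cupAt_cupAt _ _ hm (by omega) rfl rfl rfl).symm _ _ rfl rfl]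
    exact hE.dotCupL (p := p + 1) (q := q + 1) (by omega) (by omega) _
  dotCupR {p q N m d} h hm hm' f := by
    rw [Fam2.dotCup_apply, swap (g' := V N p) (k' := V (N + 2) (m + 2))
      (h' := rfl) f (cupAt_cupAt _ _ hm (by omega) rfl rfl _) _ _ rfl rfl]
    exact hE.dotCupR (p := p + 1) (q := q + 1) (by omega) (by omega) (by omega) _

/-- This is where the signs in `z` matter: a cup in the right group carries no net dot, and `z`
passes to the diagram below it. -/
theorem IsSys2.zeta {E : Fam2 R s M} (hE : IsSys2 E) : IsSys2 E.zeta where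
  cupL {p q N m d} h hm f := by
    rw [Fam2.zeta_apply, swap (g' := zAt N q) (k' := U N m)
      (h' := add_zero 2) f (cupAt_zAt_left _ h hm (zero_add 2) _) _ _ rfl (add_zero _)]
    exact hE.cupL h hm _
  cupR {p q N m d} h hm hm' f := by
    rw [Fam2.zeta_apply, swap (g' := zAt N q) (k' := U N m)
      (h' := add_zero 2) f (cupAt_zAt_right dotSlide_cup h hm hm' (zero_add 2) _) _ _ rfl
      (add_zero _)]
    exact hE.cupR h hm hm' _
  dotCupL {p q N m d} h hm f := by
    rw [Fam2.zeta_apply, swap (g' := zAt N q) (k' := V N m)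
      (h' := rfl) f (cupAt_zAt_left _ h hm rfl _) _ _ rfl rfl]
    exact hE.dotCupL h hm _
  dotCupR {p q N m d} h hm hm' f := by
    rw [Fam2.zeta_apply, swap (g' := zAt N q) (k' := V N m)
      (h' := rfl) f (cupAt_zAt_right dotSlide_dotCup h hm hm' rfl _) _ _ rfl rfl]
    exact hE.dotCupR h hm hm' _

/-- A strand is moved through the wall between the two groups of strands. -/
theorem IsSys2.wall {E : Fam2 R s M} (hE : IsSys2 E) {p q N : ℕ} {d : ℤ} (h : p + (q + 1) = N)
    (f : Hom R d s (blk N)) : E p (q + 1) N d ⟨h⟩ f =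
      E.cup (p + 1) q N (d + 2) ⟨by omega⟩ (comp rfl f (dotAt N p)) +
        E.dotCup (p + 1) q N d ⟨by omega⟩ f := by
  -- The wall is placed after `p + 2` of the `N + 2` strands. Cups created at `p` then lie in the
  -- left group, and cups created at `p + 1` have one leg on each side.
  have h1 := congrArg (fun g => E (p + 2) (q + 1) (N + 2) (d + 2) ⟨by omega⟩ (comp rfl f g))
    (neck_cup (R := R) (N := N) (m := p) (by omega))
  simp only [map_add] at h1
  rw [hE.dotCupL h le_rfl f, ← assoc rfl (add_zero _) (add_zero 2) rfl, ← assoc rfl (add_zero _) (add_zero 2) rfl,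
    hE.cupL h le_rfl, zero_add] at h1
  exact h1.symm

/-- Neck cutting is applied to the right leg of a cup at the wall. Of its four terms, the two with
the new cup inside the first one are the two nestings in question. The other two contain an undotted
cup inside one group, on the right or on the left, and vanish. -/
theorem IsSys2.cup_dotCup {E : Fam2 R s M} (hE : IsSys2 E) : E.dotCup.cup = -E.cup.dotCup := by
  funext p q N d ⟨h⟩
  refine LinearMap.ext fun f => ?_
  change E (p + 2) (q + 2) (N + 2 + 2) (d + 2) _ (comp rfl (comp (add_zero d) f (U N p)) (V (N + 2) (p + 1))) =
    -E (p + 2) (q + 2) (N + 2 + 2) (d + 2) _ (comp (add_zero _) (comp rfl f (V N p)) (U (N + 2) (p + 1)))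
  have h1 := congrArg (fun g => E (p + 2) (q + 2) (N + 2 + 2) (d + 2) ⟨by omega⟩
    (comp rfl (comp (add_zero d) f (U N p)) g))
    (neck_cup (R := R) (N := N + 2) (m := p + 1) (by omega))
  -- The dot of the neck relation sits on the first cup, which thereby becomes the dotted one.
  have h2 : ∀ k, comp rfl (comp (add_zero d) f (U N p)) (comp (add_zero 2) (dotAt (N + 2) (p + 1))
      (U (N + 2) k)) = comp (add_zero _) (comp rfl f (V N p)) (U (N + 2) k) := fun k => by
    rw [← U_dotAt_right (by omega) (zero_add 2), ← assoc rfl (add_zero _) (add_zero 2) rfl,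
      ← assoc (add_zero d) rfl (zero_add 2) rfl]
  simp only [map_add, h2] at h1
  rw [hE.cupR (p := p + 2) (q := q) (by omega) (by omega) (by omega),
    swap (g' := V N p) (k' := U (N + 2) p) (h' := add_zero 2) f
      (cupAt_cupAt _ _ le_rfl (by omega) rfl (add_zero 2) (zero_add 2)).symm _ _ rfl (add_zero _),
    hE.cupL (p := p) (q := q + 2) (by omega) le_rfl, zero_add] at h1
  exact (neg_eq_of_add_eq_zero_right h1.symm).symm

/-- A removable dotted cup is created at the left end of the right group and its first leg is moved
through the wall. The correction term of `IsSys2.wall` puts a second dot on this cup, hence is zero.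
-/
theorem IsSys2.dotCup_dotCup {E : Fam2 R s M} (hE : IsSys2 E) : E.dotCup.dotCup = E := by
  funext p q N d ⟨h⟩
  refine LinearMap.ext fun f => ?_
  rw [Fam2.dotCup_apply]
  have h1 := hE.wall (p := p) (q := q + 1) (N := N + 2) (d := d + 2) (by omega)
    (comp rfl f (V N p))
  rw [hE.dotCupR h le_rfl (by omega), assoc' rfl, V_dotAt_left (by omega), map_zero, map_zero,
    zero_add] at h1
  exact h1.symm

theorem IsSys2.cup_iterate {E : Fam2 R s M} (hE : IsSys2 E) (k : ℕ) :
    IsSys2 (Fam2.cup^[k] E) := by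
  induction k with
  | zero => exact hE
  | succ k ih => rw [Function.iterate_succ_apply']; exact ih.cup

/-- The value of `E` on every diagram is a combination of values on diagrams in which all the
strands of the second group belong to nested cups between the groups, with at most one dot. -/
theorem IsSys2.mem {E : Fam2 R s M} (hE : IsSys2 E) (S : Submodule K M)
    (h0 : ∀ (k p : ℕ) (d : ℤ) (f : Hom R d s (blk p)), (Fam2.cup^[k] E) p 0 p d ⟨rfl⟩ f ∈ S)
    (h1 : ∀ (k p : ℕ) (d : ℤ) (f : Hom R d s (blk p)), (Fam2.cup^[k] E).dotCup p 0 p d ⟨rfl⟩ f ∈ S)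
    (p q N : ℕ) (d : ℤ) (h : p + q = N) (f : Hom R d s (blk N)) : E p q N d ⟨h⟩ f ∈ S := by
  -- Induction on the size `q` of the right group must treat all `k` and both parities of dotted
  -- cups at once: the wall move raises `k` or toggles the dotted cup.
  suffices H : ∀ (q p N : ℕ) (h : p + q = N) (k : ℕ) (d : ℤ) (f : Hom R d s (blk N)),
      (Fam2.cup^[k] E) p q N d ⟨h⟩ f ∈ S ∧ (Fam2.cup^[k] E).dotCup p q N d ⟨h⟩ f ∈ S from
    (H q p N h 0 d f).1
  intro q
  induction q with
  | zero =>
    intro p N h k d f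
    obtain rfl : p = N := h
    exact ⟨h0 k p d f, h1 k p d f⟩
  | succ q ih =>
    intro p N h k d f
    have hk := hE.cup_iterate k
    constructor
    · rw [hk.wall h f]
      refine add_mem ?_ (ih _ _ _ _ _ _).2
      have := (ih (p + 1) N (by omega) (k + 1) (d + 2) (comp rfl f (dotAt N p))).1
      rwa [Function.iterate_succ_apply'] at this
    -- Two dotted cups cancel, and a new undotted cup is moved past the dotted one at the price of a
    -- sign, so the dotted cup stays outermost.
    · rw [hk.dotCup.wall h f, hk.dotCup_dotCup, hk.cup_dotCup]
      refine add_mem ?_ (ih _ _ _ _ _ _).1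
      have := (ih (p + 1) N (by omega) (k + 1) (d + 2) (comp rfl f (dotAt N p))).2
      rw [Function.iterate_succ_apply'] at this
      exact neg_mem this

/-! The functionals that define the projections. -/

/-- The functionals on two groups of strands that do not depend on the grouping. -/
def Fam1.merge (I : Fam1 R s M) : Fam2 R s M := fun _ _ N d _ => I N d

theorem IsSys1.merge {I : Fam1 R s M} (hI : IsSys1 I) : IsSys2 I.merge where
  cupL h hm f := hI.cup (by omega) f
  cupR _ _ hm f := hI.cup hm f
  dotCupL h hm f := hI.dotCup (by omega) f
  dotCupR _ _ hm f := hI.dotCup hm f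

theorem IsSys2.right_zero {E : Fam2 R s M} (hE : IsSys2 E) :
    IsSys1 (fun N d => E N 0 N d ⟨rfl⟩) where
  cup hm f := hE.cupL (q := 0) rfl hm f
  dotCup hm f := hE.dotCupL (q := 0) rfl hm f

/-- The right leg of the inserted cup is the first strand of the right group, and `z (q + 1)` is a
dot on it minus `z q` on the remaining strands. The dot on the dotted leg gives zero. -/
theorem Fam2.dotCup_zeta (E : Fam2 R s M) : E.zeta.dotCup = -E.dotCup.zeta := by
  funext p q N d ⟨h⟩
  refine LinearMap.ext fun f => ?_
  change E (p + 1) (q + 1) (N + 2) (d + 2 + 2) _ (comp rfl (comp rfl f (V N p)) (zAt (N + 2) (q + 1))) =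
    -E (p + 1) (q + 1) (N + 2) (d + 2 + 2) _ (comp rfl (comp rfl f (zAt N q)) (V N p))
  rw [zAt_succ (p := p + 1) (by omega), map_sub, assoc' rfl f, V_dotAt_right (by omega), map_zero,
    zero_sub, map_neg]
  congr 2
  exact swap f (cupAt_zAt_left _ h le_rfl rfl rfl) _ _ _ _

/-- As for `Fam2.dotCup_zeta`, except that the dot on the right leg now turns the undotted cup into
a dotted one. -/
theorem Fam2.cup_zeta (E : Fam2 R s M) : E.zeta.cup = E.dotCup - E.cup.zeta := by
  funext p q N d ⟨h⟩
  refine LinearMap.ext fun f => ?_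
  change E (p + 1) (q + 1) (N + 2) (d + 2) _ (comp rfl (comp (add_zero d) f (U N p)) (zAt (N + 2) (q + 1))) =
    E (p + 1) (q + 1) (N + 2) (d + 2) _ (comp rfl f (V N p)) -
    E (p + 1) (q + 1) (N + 2) (d + 2) _ (comp (add_zero _) (comp rfl f (zAt N q)) (U N p))
  rw [zAt_succ (p := p + 1) (by omega), map_sub, assoc (add_zero d) rfl (zero_add 2) rfl,
    U_dotAt_right (by omega), map_sub]
  congr 2
  exact swap f (cupAt_zAt_left _ h le_rfl (zero_add 2) (add_zero 2)) _ _ _ _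

theorem Fam2.zeta_right_zero (E : Fam2 R s M) {N : ℕ} {d : ℤ} (h : N + 0 = N) :
    E.zeta N 0 N d ⟨h⟩ = 0 := by
  refine LinearMap.ext fun f => ?_
  rw [Fam2.zeta_apply, zAt_zero, map_zero, map_zero, LinearMap.zero_apply]

theorem Fam2.zeta_smul (E : Fam2 R s M) (c : K) : (c • E).zeta = c • E.zeta := rfl
theorem Fam2.cup_smul (E : Fam2 R s M) (c : K) : (c • E).cup = c • E.cup := rfl
theorem Fam2.dotCup_smul (E : Fam2 R s M) (c : K) : (c • E).dotCup = c • E.dotCup := rfl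

theorem IsSys2.smul {E : Fam2 R s M} (hE : IsSys2 E) (c : K) : IsSys2 (c • E) where
  cupL h hm f := (congrArg (c • ·) (hE.cupL h hm f)).trans (smul_zero c)
  cupR h hm hm' f := (congrArg (c • ·) (hE.cupR h hm hm' f)).trans (smul_zero c)
  dotCupL h hm f := congrArg (c • ·) (hE.dotCupL h hm f)
  dotCupR h hm hm' f := congrArg (c • ·) (hE.dotCupR h hm hm' f)

/-- The functional `f ↦ (-1)^(n choose 2) / n! I((1 ⊗ z_q^n) ∘ f)`. -/
def Fam1.proj (I : Fam1 R s M) (n : ℕ) : Fam2 R s M :=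
  ((-1) ^ n.choose 2 * (n.factorial : K)⁻¹) • Fam2.zeta^[n] I.merge

theorem IsSys1.zeta_iterate {I : Fam1 R s M} (hI : IsSys1 I) (n : ℕ) :
    IsSys2 (Fam2.zeta^[n] I.merge) := by
  induction n with
  | zero => exact hI.merge
  | succ n ih => rw [Function.iterate_succ_apply']; exact ih.zeta

theorem IsSys1.proj {I : Fam1 R s M} (hI : IsSys1 I) (n : ℕ) : IsSys2 (I.proj n) :=
  (hI.zeta_iterate n).smul _

theorem IsSys1.dotCup_zeta_iterate {I : Fam1 R s M} (hI : IsSys1 I) (n : ℕ) :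
    (Fam2.zeta^[n] I.merge).dotCup = (-1 : K) ^ n • Fam2.zeta^[n] I.merge := by
  induction n with
  | zero =>
    rw [pow_zero, one_smul]
    funext p q N d ⟨h⟩
    exact LinearMap.ext fun f => hI.dotCup (by omega) f
  | succ n ih =>
    rw [Function.iterate_succ_apply', Fam2.dotCup_zeta, ih, Fam2.zeta_smul, pow_succ', mul_smul,
      neg_one_smul]

theorem IsSys1.cup_merge {I : Fam1 R s M} (hI : IsSys1 I) : I.merge.cup = 0 := by
  funext p q N d ⟨h⟩
  exact LinearMap.ext fun f => hI.cup (Nat.le.intro h) f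

/-- The commutation rule makes `zeta` a raising and `cup` a lowering operator with vacuum `I.merge`.
Each of the `n + 1` factors contributes once, and all contributions have the same sign since
`dotCup` also anticommutes with `zeta`. -/
theorem IsSys1.cup_zeta_iterate {I : Fam1 R s M} (hI : IsSys1 I) (n : ℕ) :
    (Fam2.zeta^[n + 1] I.merge).cup = ((-1 : K) ^ n * (n + 1 : ℕ)) • Fam2.zeta^[n] I.merge := by
  induction n with
  | zero =>
    rw [Function.iterate_succ_apply', Fam2.cup_zeta, hI.dotCup_zeta_iterate,
      Function.iterate_zero_apply, hI.cup_merge]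
    simp only [pow_zero, one_smul, zero_add, Nat.cast_one, mul_one]
    exact sub_zero _
  | succ n ih =>
    rw [Function.iterate_succ_apply', Fam2.cup_zeta, ih, Fam2.zeta_smul, hI.dotCup_zeta_iterate,
      ← Function.iterate_succ_apply' Fam2.zeta, ← sub_smul]
    congr 1
    push_cast
    ring

theorem IsSys1.cup_proj_zero {I : Fam1 R s M} (hI : IsSys1 I) : (I.proj 0).cup = 0 := by
  rw [Fam1.proj, Fam2.cup_smul, Function.iterate_zero_apply, hI.cup_merge, smul_zero]

/-- This fixes the normalization of `π_n`: the factor `n + 1` is absorbed by the factorials, and the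
sign `(-1)^n` by `(n+1 choose 2) = (n choose 2) + n`. -/
theorem IsSys1.cup_proj_succ [CharZero K] {I : Fam1 R s M} (hI : IsSys1 I) (n : ℕ) :
    (I.proj (n + 1)).cup = I.proj n := by
  have h : (n.factorial : K) ≠ 0 := Nat.cast_ne_zero.mpr n.factorial_ne_zero
  have h' : ((n + 1 : ℕ) : K) ≠ 0 := Nat.cast_ne_zero.mpr n.succ_ne_zero
  rw [Fam1.proj, Fam2.cup_smul, hI.cup_zeta_iterate, smul_smul, Fam1.proj]
  congr 1
  rw [Nat.choose_succ_succ' n 1, Nat.choose_one_right, pow_add, Nat.factorial_succ, Nat.cast_mul]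
  have h2 : ((-1 : K) ^ n) * (-1) ^ n = 1 := by rw [← mul_pow]; simp
  field_simp
  linear_combination h2

theorem IsSys1.dotCup_proj {I : Fam1 R s M} (hI : IsSys1 I) (n : ℕ) :
    (I.proj n).dotCup = (-1 : K) ^ n • I.proj n := by
  rw [Fam1.proj, Fam2.dotCup_smul, hI.dotCup_zeta_iterate, smul_comm]

/-- On an empty right group `z_0 = 0`, so only the power `n = 0` survives. -/
theorem IsSys1.proj_right_zero {I : Fam1 R s M} (n : ℕ) {N : ℕ} {d : ℤ} (h : N + 0 = N) :
    I.proj n N 0 N d ⟨h⟩ = if n = 0 then I N d else 0 := by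
  cases n with
  | zero => simp [Fam1.proj, Fam1.merge]
  | succ n =>
    rw [if_neg n.succ_ne_zero, Fam1.proj, Function.iterate_succ_apply']
    refine LinearMap.ext fun f => ?_
    change (_ : K) • (Fam2.zeta (Fam2.zeta^[n] I.merge) N 0 N d ⟨h⟩ f) = _
    rw [Fam2.zeta_right_zero, LinearMap.zero_apply, smul_zero]

/-- The functional that defines the inclusions: insertion of `n` nested cups, surrounded by `b`
dotted cups. -/
def Fam2.hole (E : Fam2 R s M) (n : ℕ) : ℕ → Fam1 R s M
  | 0 => fun N d => (Fam2.cup^[n] E) N 0 N d ⟨rfl⟩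
  -- Every positive value counts as one dotted cup. Only `b < 2` is compared with `nestedCups`, in
  -- `Fam2.hole_apply`.
  | _ + 1 => fun N d => (Fam2.cup^[n] E).dotCup N 0 N d ⟨rfl⟩

theorem IsSys2.hole {E : Fam2 R s M} (hE : IsSys2 E) (n b : ℕ) : IsSys1 (E.hole n b) := by
  cases b with
  | zero => exact (hE.cup_iterate n).right_zero
  | succ b => exact (hE.cup_iterate n).dotCup.right_zero

theorem IsSys1.cup_iterate_proj [CharZero K] {I : Fam1 R s M} (hI : IsSys1 I) (m n : ℕ) :
    Fam2.cup^[m] (I.proj n) = if m ≤ n then I.proj (n - m) else 0 := by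
  induction m generalizing n with
  | zero => simp
  | succ m ih =>
    rw [Function.iterate_succ_apply]
    cases n with
    | zero =>
      rw [hI.cup_proj_zero, if_neg (by omega)]
      clear ih
      induction m with
      | zero => rfl
      | succ m ih => rw [Function.iterate_succ_apply', ih]; rfl
    | succ n => rw [hI.cup_proj_succ, ih, Nat.succ_sub_succ]; simp

/-- The abstract form of `π_n σ_m = δ_(nm)`. The `m` cups lower `proj n` to `proj (n - m)` or kill
it, and emptiness of the right group then forces `n = m`. A dotted cup only contributes the sign
`(-1)^(n - m)`, which is `1` in this case. -/
theorem IsSys1.hole_proj [CharZero K] {I : Fam1 R s M} (hI : IsSys1 I) (m n b : ℕ) :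
    (I.proj n).hole m b = if n = m then I else 0 := by
  cases b with
  | zero =>
    funext N d
    simp only [Fam2.hole]
    rw [hI.cup_iterate_proj]
    split_ifs with h1 h2 h2
    · rw [IsSys1.proj_right_zero, if_pos (by omega)]
    · rw [IsSys1.proj_right_zero, if_neg (by omega)]; rfl
    · omega
    · rfl
  | succ b =>
    funext N d
    simp only [Fam2.hole]
    rw [hI.cup_iterate_proj]
    split_ifs with h1 h2 h2
    · rw [hI.dotCup_proj]
      change (-1 : K) ^ (n - m) • I.proj (n - m) N 0 N d ⟨rfl⟩ = _
      rw [IsSys1.proj_right_zero, if_pos (by omega), show n - m = 0 by omega, pow_zero, one_smul]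
    · rw [hI.dotCup_proj]
      change (-1 : K) ^ (n - m) • I.proj (n - m) N 0 N d ⟨rfl⟩ = _
      rw [IsSys1.proj_right_zero, if_neg (by omega), smul_zero]; rfl
    · omega
    · rfl

end Fam

end Pres

end Kirby

/-! ### Dotted crossingless matchings and the degree bound. -/

namespace Kirby

namespace Pres

variable {K : Type u} [Field K] {X : Gens} {R : TmRel K X}

/-! ### Morphisms of large degree vanish -/

/-- The undotted and the dotted cup. -/
inductive IsCup : ∀ e : ℤ, Hom R e (blk 0) (blk 2) → Prop
  | cup : IsCup 0 cupB
  | dotCup : IsCup 2 dotCupB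

/-- Crossingless matchings with at most one dot on every arc. -/
inductive Forest : ∀ (n : ℕ) (d : ℤ), Hom R d (blk 0) (blk n) → Prop
  | nil : Forest 0 0 (id (blk 0))
  | cons {n k : ℕ} {d e c : ℤ} {w : Hom R d (blk 0) (blk n)} {g : Hom R e (blk 0) (blk 2)}
      (hw : Forest n d w) (hg : IsCup e g) (hk : k ≤ n) (h : d + e = c) :
      Forest (n + 2) c (comp h w (cupAt g n k))

/-- Linear combinations of dotted crossingless matchings. -/
def forests (R : TmRel K X) (n : ℕ) (d : ℤ) : Submodule K (Hom R d (blk 0) (blk n)) :=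
  Submodule.span K {w | Forest n d w}

/-- Each cup contributes two endpoints and a degree of at most two. -/
theorem Forest.degree_le {n : ℕ} {d : ℤ} {w : Hom R d (blk 0) (blk n)} (h : Forest n d w) :
    d ≤ n := by
  induction h with
  | nil => simp
  | cons hw hg hk h ih =>
    cases hg <;> (push_cast; omega)

theorem eq_zero_of_mem_forests {n : ℕ} {d : ℤ} {w : Hom R d (blk 0) (blk n)}
    (hw : w ∈ forests R n d) (h : (n : ℤ) < d) : w = 0 := by
  have : {w : Hom R d (blk 0) (blk n) | Forest n d w} = ∅ :=
    Set.eq_empty_of_forall_notMem fun w hw => absurd hw.degree_le (not_le.mpr h)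
  rwa [forests, this, Submodule.span_empty, Submodule.mem_bot] at hw

theorem forests_comp {n n' : ℕ} {d e c : ℤ} (h : d + e = c) (g : Hom R e (blk n) (blk n'))
    (hg : ∀ w, Forest n d w → comp h w g ∈ forests R n' c) {w : Hom R d (blk 0) (blk n)}
    (hw : w ∈ forests R n d) : comp h w g ∈ forests R n' c := by
  induction hw using Submodule.span_induction with
  | mem w hw => exact hg w hw
  | zero => rw [zero_comp']; exact zero_mem _
  | add f g _ _ hf hg => rw [map_add, LinearMap.add_apply]; exact add_mem hf hg
  | smul k f _ hf => rw [map_smul, LinearMap.smul_apply]; exact Submodule.smul_mem _ _ hf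

theorem forests_cupAt {n k : ℕ} {d e c : ℤ} (h : d + e = c) {g : Hom R e (blk 0) (blk 2)}
    (hg : IsCup e g) (hk : k ≤ n) {w : Hom R d (blk 0) (blk n)} (hw : w ∈ forests R n d) :
    comp h w (cupAt g n k) ∈ forests R (n + 2) c :=
  forests_comp h _ (fun _ hw => Submodule.subset_span (.cons hw hg hk h)) hw

theorem IsCup.dotSlide {e : ℤ} {g : Hom R e (blk 0) (blk 2)} (hg : IsCup e g) : DotSlide g := by
  cases hg
  · exact dotSlide_cup
  · exact dotSlide_dotCup

theorem forests_comp_id {n : ℕ} {d c : ℤ} (h : d + 0 = c) {w : Hom R d (blk 0) (blk n)}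
    (hw : w ∈ forests R n d) : comp h w (id (blk n)) ∈ forests R n c := by
  obtain rfl : d = c := by omega
  rwa [comp_id]

/-- The dot slides down to the cup that ends at its strand. There it dots an undotted cup or
annihilates a dotted one. -/
theorem forests_dotAt {n m : ℕ} {d c : ℤ} (h : d + 2 = c) (hm : m < n)
    {w : Hom R d (blk 0) (blk n)} (hw : w ∈ forests R n d) :
    comp h w (dotAt n m) ∈ forests R n c := by
  subst h
  refine forests_comp _ _ (fun w hw => ?_) hw
  clear * - hm hw
  induction hw generalizing m with
  | nil => omega
  | @cons n k d e c w g hw hg hk h ih =>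
    subst h
    have same : comp rfl (comp rfl w (cupAt g n k)) (dotAt (n + 2) k) ∈
        forests R (n + 2) (d + e + 2) := by
      rw [assoc' rfl]
      cases hg with
      | cup =>
        have h1 : comp (zero_add 2) (U n k) (dotAt (n + 2) k) = (V n k : Hom R 2 _ _) :=
          U_dotAt_left hk _
        exact (congrArg (comp (by ring) w · ∈ _) h1).mpr
          (forests_cupAt _ .dotCup hk (Submodule.subset_span hw))
      | dotCup =>
        rw [V_dotAt_left hk, map_zero]
        exact zero_mem _
    rcases lt_or_ge m k with h1 | h1
    · rw [assoc' rfl, ← dotAt_cupAt_left g h1 hk (add_comm 2 e) rfl,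
        ← assoc rfl (by ring) (add_comm 2 e) (by ring)]
      exact forests_cupAt _ hg hk (ih (by omega))
    · rcases h1.eq_or_lt with rfl | h1
      · exact same
      · rcases (Nat.succ_le_iff.mpr h1).eq_or_lt with rfl | h1
        · rwa [assoc' rfl, ← hg.dotSlide n k hk, ← assoc' rfl]
        · rw [assoc' rfl, ← dotAt_cupAt_right (l := m - 2) g (by omega) (by omega) (by omega)
            (add_comm 2 e) rfl, ← assoc rfl (by ring) (add_comm 2 e) (by ring)]
          exact forests_cupAt _ hg hk (ih (by omega))

/-- The cap is compared with the last cup. Disjoint ones commute; if they share both ends, a circle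
(`2` or `0`) splits off; if they share one end, a zigzag is straightened and may leave a dot. The
free index `n'` is needed for the induction on `w`. -/
theorem Forest.capAt [CharZero K] {n' : ℕ} {d : ℤ} {w : Hom R d (blk 0) (blk n')}
    (hw : Forest n' d w) : ∀ {n m : ℕ} (hn : n' = n + 2) (_ : m ≤ n),
      comp (add_zero d) w (hn ▸ Pres.capAt n m : Hom R 0 (blk n') (blk n)) ∈ forests R n d := by
  induction hw with
  | nil => intro n m hn; omega
  | @cons n₀ k d e c w g hw hg hk h ih =>
    intro n m hn hm
    obtain rfl : n₀ = n := by omega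
    subst h
    change comp _ (comp rfl w (cupAt g n₀ k)) (Pres.capAt n₀ m) ∈ _
    rw [assoc' (add_zero e)]
    rcases lt_trichotomy m k with h1 | rfl | h1
    · rcases (Nat.succ_le_iff.mpr h1).eq_or_lt with rfl | h1
      · cases hg with
        | cup =>
          rw [U_capAt_left (by omega)]
          exact forests_comp_id _ (Submodule.subset_span hw)
        | dotCup =>
          rw [V_capAt_left (by omega)]
          exact forests_dotAt _ (by omega) (Submodule.subset_span hw)
      · obtain ⟨n, rfl⟩ : ∃ n, n₀ = n + 2 := ⟨n₀ - 2, by omega⟩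
        obtain ⟨k, rfl⟩ : ∃ k', k = k' + 2 := ⟨k - 2, by omega⟩
        rw [cupAt_capAt_left g (by omega) (by omega) (add_zero e) (zero_add e),
          ← assoc (add_zero d) rfl (zero_add e) rfl]
        exact forests_cupAt _ hg (by omega) (ih rfl (by omega))
    · cases hg with
      | cup =>
        rw [U_capAt_same hk, map_smul]
        exact Submodule.smul_mem _ _ (forests_comp_id _ (Submodule.subset_span hw))
      | dotCup =>
        rw [V_capAt_same hk, map_zero]
        exact zero_mem _
    · rcases (Nat.succ_le_iff.mpr h1).eq_or_lt with rfl | h1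
      · cases hg with
        | cup =>
          rw [U_capAt_right (by omega)]
          exact forests_comp_id _ (Submodule.subset_span hw)
        | dotCup =>
          rw [V_capAt_right (by omega)]
          exact forests_dotAt _ (by omega) (Submodule.subset_span hw)
      · obtain ⟨n, rfl⟩ : ∃ n, n₀ = n + 2 := ⟨n₀ - 2, by omega⟩
        rw [cupAt_capAt_right (l := m - 2) g (by omega) (by omega) (by omega) (add_zero e)
          (zero_add e), ← assoc (add_zero d) rfl (zero_add e) rfl]
        exact forests_cupAt _ hg (by omega) (ih rfl (by omega))

theorem forests_capAt [CharZero K] {n m : ℕ} {d : ℤ} (hm : m ≤ n)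
    {w : Hom R d (blk 0) (blk (n + 2))} (hw : w ∈ forests R (n + 2) d) :
    comp (add_zero d) w (capAt n m) ∈ forests R n d :=
  forests_comp _ _ (fun _ hw => hw.capAt rfl hm) hw

/-- All strands are black. -/
def IsBlack (s : List (Option X.E)) : Prop := ∀ x ∈ s, x = none

theorem isBlack_blk (n : ℕ) : IsBlack (blk n : List (Option X.E)) := fun _ h =>
  List.eq_of_mem_replicate h

theorem IsBlack.eq {s : List (Option X.E)} (h : IsBlack s) : s = blk s.length :=
  List.eq_replicate_iff.mpr ⟨rfl, h⟩

theorem isBlack_append {s t : List (Option X.E)} : IsBlack (s ++ t) ↔ IsBlack s ∧ IsBlack t := by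
  simp only [IsBlack, List.mem_append, or_imp, forall_and]

/-- Insertion of `f` between black strands preserves combinations of matchings. -/
def Preserves {d : ℤ} {s t : List (Option X.E)} (f : Hom R d s t) : Prop :=
  ∀ (a b : ℕ) {N N' : ℕ} (hs : blk a ++ (s ++ blk b) = blk N) (ht : blk a ++ (t ++ blk b) = blk N')
    {d₀ c : ℤ} (h : d₀ + d = c) (w : Hom R d₀ (blk 0) (blk N)), w ∈ forests R N d₀ →
    comp h w (tens (zero_add d) hs ht (id (blk a)) (tens (add_zero d) rfl rfl f (id (blk b)))) ∈
      forests R N' c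

theorem preserves_zero {d : ℤ} {s t : List (Option X.E)} : Preserves (0 : Hom R d s t) := by
  intro a b N N' hs ht d₀ c h w hw
  rw [map_zero, LinearMap.zero_apply, map_zero, map_zero]
  exact zero_mem _

theorem tens_tens_congr {a b c e g : ℤ} (h : a + b = c) (h' : e + c = g)
    {x x' s s' t t' u v N N' : List (Option X.E)} (w : Hom R e x x') (f : Hom R a s t)
    (k : Hom R b s' t') (hu : s ++ s' = u) (hv : t ++ t' = v) (hN : x ++ (s ++ s') = N)
    (hN' : x' ++ (t ++ t') = N') : tens h' hN hN' w (tens h rfl rfl f k) =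
      tens h' (by rw [← hu, hN]) (by rw [← hv, hN']) w (tens h hu hv f k) := by
  subst hu hv; rfl

theorem Preserves.of_ins {d : ℤ} {s t : ℕ} {f : Hom R d (blk s) (blk t)}
    (H : ∀ (a b N N' : ℕ) (h1 : a + s + b = N) (h2 : a + t + b = N') (d₀ c : ℤ) (h : d₀ + d = c)
      (w : Hom R d₀ (blk 0) (blk N)), w ∈ forests R N d₀ →
      comp h w (ins a b h1 h2 f) ∈ forests R N' c) : Preserves f := by
  intro a b N N' hs ht d₀ c h w hw
  have h1 : a + s + b = N := by
    have := congrArg List.length hs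
    simpa [add_assoc] using this
  have h2 : a + t + b = N' := by
    have := congrArg List.length ht
    simpa [add_assoc] using this
  rw [tens_tens_congr (hu := blk_add s b) (hv := blk_add t b)]
  exact H a b N N' h1 h2 d₀ c h w hw

/-- A term between black words could a priori pass through other letters. As no adjoined generator
ends in an all-black word, a term with black target has black source or represents zero. Both claims
are proved in one induction, because the intermediate word of a composite is only controlled by the
first. -/
theorem preserves_mk [CharZero K] (hX : ∀ g, ¬ IsBlack (X.cod g)) {d : ℤ} {s t : List (Option X.E)}
    (f : Tm K X d s t) (ht : IsBlack t) :
    (IsBlack s ∨ (mk f : Hom R d s t) = 0) ∧ Preserves (mk f : Hom R d s t) := by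
  induction f with
  | id s =>
    refine ⟨Or.inl ht, ?_⟩
    intro a b N N' hs ht d₀ c h w hw
    obtain rfl : N = N' := by
      have := congrArg List.length (hs.symm.trans ht)
      simpa using this
    obtain rfl : d₀ = c := by omega
    rw [mk_id, tens_id, tens_id, comp_id]
    exact hw
  | dot =>
    refine ⟨Or.inl (isBlack_blk 1), Preserves.of_ins (s := 1) (t := 1) ?_⟩
    intro a b N N' h1 h2 d₀ c h w hw
    obtain rfl : N = N' := by omega
    change comp h w (ins a b h1 h2 dotB) ∈ _
    rw [← dotAt_eq (N := N) (m := a) (k := b) (by omega)]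
    exact forests_dotAt _ (by omega) hw
  | cup =>
    refine ⟨Or.inl (isBlack_blk 0), Preserves.of_ins (s := 0) (t := 2) ?_⟩
    intro a b N N' h1 h2 d₀ c h w hw
    obtain rfl : N' = N + 2 := by omega
    change comp h w (ins a b h1 h2 cupB) ∈ _
    rw [← cupAt_eq (N := N) (m := a) (k := b) cupB (by omega)]
    exact forests_cupAt _ .cup (by omega) hw
  | cap =>
    refine ⟨Or.inl (isBlack_blk 2), Preserves.of_ins (s := 2) (t := 0) ?_⟩
    intro a b N N' h1 h2 d₀ c h w hw
    obtain rfl : N = N' + 2 := by omega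
    obtain rfl : d₀ = c := by omega
    change comp h w (ins a b h1 h2 capB) ∈ _
    rw [← capAt_eq (N := N') (m := a) (k := b) (by omega)]
    exact forests_capAt (by omega) hw
  | gen g => exact absurd ht (hX g)
  | @comp a b c h r s t f g hf hg =>
    obtain ⟨h1, h2⟩ := hg ht
    rcases h1 with h1 | h1
    · obtain ⟨h3, h4⟩ := hf h1
      refine ⟨h3.imp_right fun h3 => by rw [mk_comp, h3, zero_comp'], ?_⟩
      intro x y N N' hs ht' d₀ e h' w hw
      have hm : blk x ++ (s ++ blk y) = blk (x + s.length + y) := by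
        conv_lhs => rw [h1.eq, blk_add, blk_add, ← add_assoc]
      have e1 := interchange (R := R) (add_zero 0) h h (zero_add a) (zero_add b) (zero_add c) hs hm
        ht' (id (blk x)) (id (blk x)) (tens (add_zero a) rfl rfl (mk f) (id (blk y)))
        (tens (add_zero b) rfl rfl (mk g) (id (blk y)))
      have e2 := interchange (R := R) h (add_zero 0) h (add_zero a) (add_zero b) (add_zero c) rfl
        rfl rfl (mk f) (mk g) (id (blk y)) (id (blk y))
      rw [id_comp] at e1 e2
      rw [mk_comp, e2, e1, ← assoc (ab := d₀ + a) rfl (by omega) h h']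
      exact h2 x y hm ht' _ _ (h4 x y hs hm rfl w hw)
    · have h5 : (mk (.comp h f g) : Hom R c r t) = 0 := by rw [mk_comp, h1, comp_zero']
      rw [h5]
      exact ⟨Or.inr rfl, preserves_zero⟩
  | @tens a b c h s s' s'' t t' t'' hs htt f g hf hg =>
    subst hs htt
    obtain ⟨b1, b2⟩ := isBlack_append.mp ht
    obtain ⟨h1, h2⟩ := hf b1
    obtain ⟨h3, h4⟩ := hg b2
    have z1 : (mk f : Hom R a s t) = 0 → (mk (.tens h rfl rfl f g) : Hom R c _ _) = 0 := fun hz => by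
      rw [mk_tens, hz, map_zero, LinearMap.zero_apply]
    have z2 : (mk g : Hom R b s' t') = 0 → (mk (.tens h rfl rfl f g) : Hom R c _ _) = 0 :=
      fun hz => by rw [mk_tens, hz, map_zero]
    rcases h1 with h1 | h1
    swap
    · rw [z1 h1]; exact ⟨Or.inr rfl, preserves_zero⟩
    rcases h3 with h3 | h3
    swap
    · rw [z2 h3]; exact ⟨Or.inr rfl, preserves_zero⟩
    refine ⟨Or.inl (isBlack_append.mpr ⟨h1, h3⟩), ?_⟩
    obtain ⟨n, rfl⟩ : ∃ n, s = blk n := ⟨_, h1.eq⟩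
    obtain ⟨n', rfl⟩ : ∃ n, s' = blk n := ⟨_, h3.eq⟩
    obtain ⟨m, rfl⟩ : ∃ n, t = blk n := ⟨_, b1.eq⟩
    obtain ⟨m', rfl⟩ : ∃ n, t' = blk n := ⟨_, b2.eq⟩
    intro x y N N' hs ht' d₀ e h' w hw
    -- The tensor product is applied as `f ⊗ 1` followed by `1 ⊗ g`; the remaining work is
    -- rebracketing.
    have f1 := h2 x (n' + y) (N := N) (N' := x + m + n' + y) (by rw [← hs, ← blk_add n' y, List.append_assoc])
      (by simp only [blk_add]; congr 1; omega) rfl w hw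
    have f2 := h4 (x + m) y (N := x + m + n' + y) (N' := N') (by simp only [blk_add]; congr 1; omega)
      (by rw [← ht', ← blk_add x m]; simp only [List.append_assoc]) (show d₀ + a + b = e by omega) _ f1
    rw [assoc' h] at f2
    refine (congrArg (comp h' w · ∈ _) ?_).mpr f2
    have hN : x + n + n' + y = N := by
      have := congrArg List.length hs
      simpa [add_assoc] using this
    have hN' : x + m + m' + y = N' := by
      have := congrArg List.length ht'
      simpa [add_assoc] using this
    subst hN hN'
    have g1 : tens (zero_add b) (by simp only [blk_add]; congr 1; omega)
        (by simp only [blk_add]; congr 1; omega) (id (blk (x + m)))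
        (tens (add_zero b) rfl rfl (mk g) (id (blk y))) =
        (tens (zero_add b) (s'' := blk (x + m + n' + y)) (t'' := blk (x + m + m' + y))
        (by simp only [blk_add]; congr 1; omega)
        (by simp only [blk_add]; congr 1; omega) (id (blk x)) (tens (zero_add b)
          (s'' := blk m ++ (blk n' ++ blk y)) (t'' := blk m ++ (blk m' ++ blk y)) rfl rfl
          (id (blk m)) (tens (add_zero b) rfl rfl (mk g) (id (blk y)))) : Hom R b _ _) := by
      rw [← tens_id_blk (R := R) (a := x) (b := m) rfl]
      exact tens_assoc (add_zero 0) (zero_add b) (zero_add b) (zero_add b) _ _ _ _ _ _ _ _ _ _ _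
    have g2 : tens (zero_add a) (s'' := blk (x + n + n' + y)) (t'' := blk (x + m + n' + y))
        (by simp only [blk_add]; congr 1; omega) (by simp only [blk_add]; congr 1; omega)
        (id (blk x)) (tens (add_zero a) rfl rfl (mk f) (id (blk (n' + y)))) =
        (tens (zero_add a) (by simp only [blk_add]; congr 1; omega)
          (by simp only [blk_add]; congr 1; omega) (id (blk x)) (tens (add_zero a)
          (s'' := blk n ++ (blk n' ++ blk y)) (t'' := blk m ++ (blk n' ++ blk y)) rfl rfl
          (mk f) (id (blk n' ++ blk y))) : Hom R a _ _) := by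
      have : ∀ {v : List (Option X.E)} (hv : blk n' ++ blk y = v) {p q : List (Option X.E)}
          (hp : blk x ++ (blk n ++ v) = p) (hq : blk x ++ (blk m ++ v) = q),
          tens (zero_add a) hp hq (id (blk x)) (tens (add_zero a) rfl rfl (mk f) (id v)) =
          (tens (zero_add a) (by rw [hv, hp]) (by rw [hv, hq]) (id (blk x)) (tens (add_zero a)
          (s'' := blk n ++ (blk n' ++ blk y)) (t'' := blk m ++ (blk n' ++ blk y)) rfl rfl
          (mk f) (id (blk n' ++ blk y))) : Hom R a _ _) := by
        intro v hv p q hp hq; subst hv; rfl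
      exact this (blk_add n' y) _ _
    rw [g1, g2, ← interchange (add_zero 0) h h (zero_add a) (zero_add b) (zero_add c), id_comp,
      ← interchange (add_zero a) (zero_add b) h (add_zero a) (zero_add b) h, comp_id, id_comp]
    rw [mk_tens, tens_tens_congr (f := mk f)
      (hu := (List.append_assoc (blk n) (blk n') (blk y)).symm)
      (hv := (List.append_assoc (blk m) (blk m') (blk y)).symm)]
    congr 1
    exact tens_assoc h (add_zero c) (add_zero b) h _ _ _ _ _ _ _ _ _ _ _
  | zero => exact ⟨Or.inr mk_zero, preserves_zero⟩
  | @add a s t f g hf hg =>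
    obtain ⟨h1, h2⟩ := hf ht
    obtain ⟨h3, h4⟩ := hg ht
    refine ⟨?_, ?_⟩
    · rcases h1 with h1 | h1
      · exact Or.inl h1
      · exact h3.imp_right fun h3 => by rw [mk_add, h1, h3, add_zero]
    · intro x y N N' hs ht' d₀ e h' w hw
      rw [mk_add, map_add, LinearMap.add_apply, map_add, map_add]
      exact add_mem (h2 x y hs ht' h' w hw) (h4 x y hs ht' h' w hw)
  | @smul a s t k f hf =>
    obtain ⟨h1, h2⟩ := hf ht
    refine ⟨h1.imp_right fun h1 => by rw [mk_smul, h1, smul_zero], ?_⟩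
    intro x y N N' hs ht' d₀ e h' w hw
    rw [mk_smul, map_smul, LinearMap.smul_apply, map_smul, map_smul]
    exact Submodule.smul_mem _ _ (h2 x y hs ht' h' w hw)

/-- Incoming strands are bent around one at a time. This preserves both the degree and the number of
boundary points, and leads to the case of an empty source, where matchings span. -/
theorem eq_zero_of_degree_blk [CharZero K] (hX : ∀ g, ¬ IsBlack (X.cod g)) (p : ℕ) :
    ∀ {n : ℕ} {d : ℤ} (f : Hom R d (blk p) (blk n)), (p : ℤ) + n < d → f = 0 := by
  induction p with
  | zero =>
    intro n d f h
    obtain ⟨f, rfl⟩ := mk_surj f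
    have h1 := (preserves_mk (R := R) hX f (isBlack_blk n)).2 0 0 (N := 0) (N' := n) rfl
      (by simp) (zero_add d) (id (blk 0)) (Submodule.subset_span .nil)
    rw [id_comp] at h1
    rw [tens_tens_congr (f := mk f) (hu := blk_add 0 0) (hv := blk_add n 0)] at h1
    have h2 : ins 0 0 (by omega) (by omega) (mk f) ∈ forests R n d := h1
    rw [ins_zero] at h2
    exact eq_zero_of_mem_forests h2 (by push_cast at h; omega)
  | succ p ih =>
    intro n d f h
    -- The first incoming strand becomes an additional outgoing strand.
    have h1 := ih (n := n + 1) (comp (zero_add d) (U p 0) (ins (N' := n + 1) 1 0 (by omega)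
      (by omega) f)) (by push_cast at h ⊢; omega)
    -- A cap bends the strand back, and a zigzag recovers `f`.
    have h2 := congrArg (fun q => comp (add_zero d) (ins (N := p + 1) (N' := n + 2) 1 0 (by omega)
      (by omega) q) (capAt n 0)) h1
    simp only [map_zero, LinearMap.zero_apply] at h2
    rw [ins_comp (N' := p + 3) 1 0 _ (by omega), ins_cupAt _ _ _ (by omega), ins_ins,
      assoc (zero_add d) (add_zero d) (add_zero d) (zero_add d)] at h2
    have h3 : comp (add_zero d) (ins (N := p + 3) (N' := n + 2) (1 + 1) (0 + 0) (by omega)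
        (by omega) f) (capAt n 0) = comp (zero_add d) (capAt (p + 1) 0) f := by
      have := ins_comm (s := 2) (t := 0) (s' := p + 1) (t' := n) (N := p + 3) (N' := n)
        (N₁ := p + 1) (N₂ := n + 2) 0 0 0 (capB : Hom R 0 _ _) f
        rfl rfl rfl rfl (by omega) (by omega) (by omega) (by omega) (by omega) (by omega)
        (by omega) (by omega) (zero_add d) (add_zero d)
      rw [ins_zero, ← capAt_eq (by omega), ← capAt_eq (by omega)] at this
      exact this.symm
    rw [h3, ← assoc (add_zero 0) (zero_add d) (zero_add d) (zero_add d),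
      U_capAt_left (by omega), id_comp] at h2
    exact h2

/-- Morphisms between black words vanish if their degree exceeds the number of boundary points. -/
theorem eq_zero_of_degree [CharZero K] (hX : ∀ g, ¬ IsBlack (X.cod g)) {s : List (Option X.E)}
    {n : ℕ} {d : ℤ} (f : Hom R d s (blk n)) (h : (s.length : ℤ) + n < d) : f = 0 := by
  obtain ⟨f', rfl⟩ := mk_surj f
  rcases (preserves_mk (R := R) hX f' (isBlack_blk n)).1 with h1 | h1
  · obtain ⟨p, rfl⟩ : ∃ n, s = blk n := ⟨_, h1.eq⟩
    exact eq_zero_of_degree_blk hX p _ (by simpa using h)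
  · exact h1

end Pres

end Kirby

/-! ### Projectors and cups; evaluation of the functionals on nested cups and powers of `z`. -/

namespace Kirby

/-! ### The symmetrizer absorbs permutations from the right -/

section Symmetrizer

variable {A : ℕ → Type u} [∀ n, Ring (A n)] (S : ∀ n, A n →+* A (n + 1)) (s : ∀ n, A (n + 2))

theorem towerCoset_fixed_right (n : ℕ) : ∀ {B : Type u} [Ring B] (φ : A (n + 1) →+* B) (Y : B),
    (∀ t, TowerGen S s (n + 1) t → Y * φ t = Y) →
      Y * φ (towerCoset S s n) = ((n + 1 : ℕ) : B) * Y := by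
  induction n with
  | zero => intro B _ φ Y _; simp [towerCoset]
  | succ n ih =>
    intro B _ φ Y hY
    have := ih (φ.comp (S _)) Y (fun t h => hY _ (.next _ t h))
    rw [RingHom.comp_apply] at this
    rw [towerCoset, map_add, map_one, map_mul, mul_add, mul_one, ← mul_assoc, this, mul_assoc,
      hY _ (.first n)]
    push_cast
    noncomm_ring

theorem towerSym_fixed_right (n : ℕ) : ∀ {B : Type u} [Ring B] (φ : A n →+* B) (Y : B),
    (∀ t, TowerGen S s n t → Y * φ t = Y) →
      Y * φ (towerSym S s n) = (n.factorial : B) * Y := by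
  induction n with
  | zero => intro B _ φ Y _; simp [towerSym]
  | succ n ih =>
    intro B _ φ Y hY
    have h1 := ih (φ.comp (S _)) Y (fun t h => hY _ (.next _ t h))
    have h2 := towerCoset_fixed_right S s n φ Y hY
    rw [RingHom.comp_apply] at h1
    rw [towerSym, map_mul, ← mul_assoc, h2, mul_assoc, h1, ← mul_assoc, ← Nat.cast_mul,
      Nat.factorial_succ]

open MulOpposite

theorem TowerGen.op {n : ℕ} {t : A n} (h : TowerGen S s n t) :
    TowerGen (A := fun n => (A n)ᵐᵒᵖ) (fun n => RingHom.op (S n)) (fun n => op (s n)) n (op t) := by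
  induction h with
  | first n => exact .first n
  | next n t _ ih => exact .next n _ ih

theorem TowerGen.unop : ∀ {n : ℕ} {t : (A n)ᵐᵒᵖ},
    TowerGen (A := fun n => (A n)ᵐᵒᵖ) (fun n => RingHom.op (S n)) (fun n => MulOpposite.op (s n)) n t →
    TowerGen S s n t.unop
  | _, _, .first n => .first n
  | _, _, .next n _ h => .next n _ h.unop

/-- The recursion for the symmetrizer is one-sided and makes only left absorption evident.
Invertibility of `n!` identifies it with its mirror image. -/
theorem towerSym_absorb_right (hs : ∀ n, s n * s n = 1)
    (hbr : ∀ n, s (n + 1) * S _ (s n) * s (n + 1) = S _ (s n) * s (n + 1) * S _ (s n))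
    (hcomm : ∀ n (a : A n), s n * S _ (S _ a) = S _ (S _ a) * s n)
    (n : ℕ) (hn : IsUnit (n.factorial : A n)) (t : A n) (ht : TowerGen S s n t) :
    towerSym S s n * t = towerSym S s n := by
  -- The mirror image, built by the same recursion in the opposite rings, absorbs on the right. Its
  -- product with the symmetrizer is `n!` times either factor, so the two agree.
  set b := (towerSym (A := fun n => (A n)ᵐᵒᵖ) (fun n => RingHom.op (S n)) (fun n => op (s n)) n)
  have h1 : ∀ t, TowerGen S s n t → b.unop * t = b.unop := fun t ht => by
    have := towerSym_absorb (A := fun n => (A n)ᵐᵒᵖ) (fun n => RingHom.op (S n)) (fun n => op (s n))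
      (fun n => by rw [← op_mul, hs, op_one])
      (fun n => by
        have := congrArg op (hbr n)
        simp only [op_mul] at this
        rw [mul_assoc, mul_assoc]
        exact this)
      (fun n a => by
        have := congrArg op (hcomm n a.unop)
        simp only [op_mul] at this
        exact this.symm) n (op t) ht.op
    exact congrArg MulOpposite.unop this
  have h2 : b.unop * towerSym S s n = (n.factorial : A n) * b.unop :=
    towerSym_fixed_right S s n (RingHom.id _) _ h1
  have h3 : b.unop * towerSym S s n = towerSym S s n * (n.factorial : A n) := by
    have := towerSym_fixed_right (A := fun n => (A n)ᵐᵒᵖ) (fun n => RingHom.op (S n))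
      (fun n => op (s n)) n (RingHom.id _) (op (towerSym S s n)) (fun t ht => by
        have := towerSym_absorb S s hs hbr hcomm n _ ht.unop
        exact congrArg op this)
    have := congrArg MulOpposite.unop this
    simpa using this
  rw [← (Nat.cast_commute n.factorial _).eq, h2] at h3
  have h4 : b.unop = towerSym S s n := hn.mul_left_cancel h3
  rw [← h4, h1 t ht]

end Symmetrizer

namespace Pres

variable {K : Type u} [Field K] {X : Gens} {R : TmRel K X}

/-! ### Transport along equalities of words -/

/-- Transport along an equality of the targets. -/
def castR {d : ℤ} {s t t' : List (Option X.E)} (e : t = t') : Hom R d s t →ₗ[K] Hom R d s t' :=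
  e ▸ LinearMap.id

theorem castR_rfl {d : ℤ} {s t : List (Option X.E)} (f : Hom R d s t) : castR rfl f = f := rfl

theorem castR_castR {d : ℤ} {s t t' t'' : List (Option X.E)} (e : t = t') (e' : t' = t'')
    (f : Hom R d s t) : castR e' (castR e f) = castR (e.trans e') f := by subst e e'; rfl

theorem comp_castR {a b c : ℤ} (h : a + b = c) {r s t t' : List (Option X.E)} (e : t = t')
    (f : Hom R a r s) (g : Hom R b s t) : comp h f (castR e g) = castR e (comp h f g) := by
  subst e; rfl

theorem castR_tens {a b c : ℤ} (h : a + b = c) {s s' s'' t t' t'' t₁ : List (Option X.E)}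
    (hs : s ++ s' = s'') (ht : t ++ t' = t'') (e : t'' = t₁) (f : Hom R a s t) (g : Hom R b s' t') :
    castR e (tens h hs ht f g) = tens h hs (ht.trans e) f g := by subst e; rfl

theorem tens_castR_left {a b c : ℤ} (h : a + b = c) {s s' s'' t t' t'' t₁ : List (Option X.E)}
    (hs : s ++ s' = s'') (e : t = t₁) (ht : t₁ ++ t' = t'') (f : Hom R a s t) (g : Hom R b s' t') :
    tens h hs ht (castR e f) g = tens h hs (by rw [e, ht]) f g := by subst e; rfl

theorem tens_castR_right {a b c : ℤ} (h : a + b = c) {s s' s'' t t' t'' t₁ : List (Option X.E)}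
    (hs : s ++ s' = s'') (e : t' = t₁) (ht : t ++ t₁ = t'') (f : Hom R a s t) (g : Hom R b s' t') :
    tens h hs ht f (castR e g) = tens h hs (by rw [e, ht]) f g := by subst e; rfl

theorem tens_tens_congr' {a b c e g : ℤ} (h : a + b = c) (h' : e + c = g)
    {x x' s s' t t' u v u' v' N N' : List (Option X.E)} (w : Hom R e x x') (f : Hom R a s t)
    (k : Hom R b s' t') (hu : s ++ s' = u) (hv : t ++ t' = v) (hu' : s ++ s' = u')
    (hv' : t ++ t' = v') (hN : x ++ u = N) (hN' : x' ++ v = N') :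
    tens h' hN hN' w (tens h hu hv f k) =
      tens h' (by rw [← hu', hu, hN]) (by rw [← hv', hv, hN']) w (tens h hu' hv' f k) := by
  subst hu hv hu' hv'; rfl

/-! ### Jones-Wenzl projectors and cups -/

/-- The diagram `cup ∘ cap` on the strands `m + 1` and `m + 2` among `N` strands. -/
def capCupAt (N m : ℕ) : Hom R 0 (blk N) (blk N) :=
  if h : m + 2 ≤ N then ins (s := 2) (t := 2) m (N - m - 2) (by omega) (by omega)
    (comp (add_zero 0) capB cupB) else 0

theorem capCupAt_eq {N m k : ℕ} (h : m + 2 + k = N) : (capCupAt N m : Hom R 0 _ _) =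
    ins (s := 2) (t := 2) m k h h (comp (add_zero 0) capB cupB) := by
  rw [capCupAt, dif_pos (by omega)]; exact ins_congr rfl (by omega) _

theorem capCupAt_eq_comp {N m : ℕ} (h : m ≤ N) : (capCupAt (N + 2) m : Hom R 0 _ _) =
    comp (add_zero 0) (capAt N m) (U N m) := by
  rw [capCupAt_eq (k := N - m) (by omega), ins_comp (t := 0) (N' := N) m (N - m) _ (by omega),
    capAt_eq (k := N - m) (by omega), U, cupAt_eq (k := N - m) _ (by omega)]

theorem crossL_eq (n : ℕ) : (crossL n : Hom R 0 (blk (n + 2)) (blk (n + 2))) =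
    id (blk (n + 2)) - capCupAt (n + 2) 0 := by
  have h1 : (id [none, none] : Hom R 0 (blk 2) (blk 2)) = id (blk 2) := rfl
  have h2 : (crossL n : Hom R 0 (blk (n + 2)) (blk (n + 2))) =
      ins (s := 2) (t := 2) 0 n (by omega) (by omega) (cross : Hom R 0 (blk 2) (blk 2)) :=
    (ins_left (R := R) (s := 2) (t := 2) (N := n + 2) (N' := n + 2) n (by omega) (by omega) rfl rfl cross).symm
  rw [h2, cross, map_sub, h1, ins_id, capCupAt_eq (k := n) (by omega)]

theorem left_eq_ins {d : ℤ} {m n : ℕ} (f : Hom R d (blk m) (blk n)) :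
    (left f : Hom R d (blk (m + 1)) (blk (n + 1))) =
      ins (N := m + 1) (N' := n + 1) 1 0 (by omega) (by omega) f :=
  (ins_right (R := R) (s := m) (t := n) (N := m + 1) (N' := n + 1) 1 (by omega) (by omega) rfl rfl f).symm

theorem ins_left' (a b : ℕ) {d : ℤ} {m n N N' : ℕ} (f : Hom R d (blk m) (blk n))
    (h : a + (m + 1) + b = N) (h' : a + (n + 1) + b = N') :
    ins a b h h' (left f : Hom R d (blk (m + 1)) (blk (n + 1))) =
      ins (a + 1) b (by omega) (by omega) f := by
  rw [left_eq_ins, ins_ins]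
  exact ins_congr rfl (by omega) f

section Absorb

variable {M : Type*} [AddCommGroup M] [Module K M] {s : List (Option X.E)} {d : ℤ} {N : ℕ}

/-- A functional that vanishes on cups sees every crossing `1 - cup ∘ cap` as the identity, and each
of the `n + 1` coset representatives contributes `L f`. -/
theorem apply_ins_cosetSum (L : Hom R d s (blk N) →ₗ[K] M) (n : ℕ) :
    ∀ (a b : ℕ) (h : a + (n + 1) + b = N)
      (_ : ∀ m, a ≤ m → m < a + n → ∀ f, L (comp (add_zero d) f (capCupAt N m)) = 0) f,
      L (comp (add_zero d) f (ins a b h h (cosetSum n))) = ((n + 1 : ℕ) : K) • L f := by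
  induction n with
  | zero =>
    intro a b h _ f
    rw [cosetSum, ins_id, comp_id]; simp
  | succ n ih =>
    intro a b h hL f
    have h1 := ih (a + 1) b (by omega) (fun m h1 h2 => hL m (by omega) (by omega))
    have h2 : ins a b (s := n + 2) (t := n + 2) h h (crossL n) =
        (id (blk N) - capCupAt N a : Hom R 0 _ _) := by
      rw [crossL_eq, map_sub, ins_id, capCupAt_eq (k := n) (by omega), ins_ins,
        capCupAt_eq (k := n + b) (by omega)]
      rfl
    rw [cosetSum, map_add, map_add, map_add, ins_id, comp_id,
      ins_comp (t := n + 2) (N' := N) a b h h h, ins_left', ← assoc (add_zero d) (add_zero d) (add_zero 0) (add_zero d),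
      h1, h2, map_sub, map_sub, comp_id, hL a le_rfl (by omega), sub_zero]
    rw [Nat.cast_succ (n + 1), add_smul, one_smul, add_comm]

theorem apply_ins_symSum (L : Hom R d s (blk N) →ₗ[K] M) (n : ℕ) :
    ∀ (a b : ℕ) (h : a + n + b = N)
      (_ : ∀ m, a ≤ m → m + 1 < a + n → ∀ f, L (comp (add_zero d) f (capCupAt N m)) = 0) f,
      L (comp (add_zero d) f (ins a b h h (symSum n))) = (n.factorial : K) • L f := by
  induction n with
  | zero =>
    intro a b h _ f
    rw [symSum, ins_id, comp_id]; simp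
  | succ n ih =>
    intro a b h hL f
    have h1 := ih (a + 1) b (by omega) (fun m h1 h2 => hL m (by omega) (by omega))
    have h2 := apply_ins_cosetSum L n a b h (fun m h1 h2 => hL m h1 (by omega))
    rw [symSum, ins_comp (t := n + 1) (N' := N) a b h h h, ins_left',
      ← assoc (add_zero d) (add_zero d) (add_zero 0) (add_zero d), h2, h1, smul_smul,
      Nat.factorial_succ, Nat.cast_mul]

/-- A functional that vanishes on cups does not see a Jones-Wenzl projector. -/
theorem apply_ins_jw [CharZero K] (L : Hom R d s (blk N) →ₗ[K] M) {n a b : ℕ} (h : a + n + b = N)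
    (hL : ∀ m, a ≤ m → m + 1 < a + n → ∀ f, L (comp (add_zero d) f (capCupAt N m)) = 0) f :
    L (comp (add_zero d) f (ins a b h h (jw n))) = L f := by
  have h' : (n.factorial : K) ≠ 0 := Nat.cast_ne_zero.mpr n.factorial_ne_zero
  rw [jw, map_smul, map_smul, map_smul, apply_ins_symSum L n a b h hL, smul_smul,
    inv_mul_cancel₀ h', one_smul]

end Absorb

theorem crossL_symSum [CharZero K] (n : ℕ) :
    comp (add_zero 0) (crossL n) (symSum (n + 2)) = (symSum (n + 2) : Hom R 0 _ _) := by
  have hu : IsUnit (((n + 2).factorial : ℕ) : Hom R 0 (blk (n + 2)) (blk (n + 2))) := by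
    have h' : ((n + 2).factorial : K) ≠ 0 := Nat.cast_ne_zero.mpr (n + 2).factorial_ne_zero
    have e : ∀ Y : Hom R 0 (blk (n + 2)) (blk (n + 2)), ((n + 2).factorial : Hom R 0 (blk (n + 2)) (blk (n + 2))) * Y =
        ((n + 2).factorial : K) • Y := fun Y => by
      rw [← nsmul_eq_mul, Nat.cast_smul_eq_nsmul]
    have e' : ((n + 2).factorial : Hom R 0 (blk (n + 2)) (blk (n + 2))) *
        (((n + 2).factorial : K)⁻¹ • 1) = 1 := by
      rw [e, smul_smul, mul_inv_cancel₀ h', one_smul]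
    exact ⟨⟨_, _, e', (Nat.cast_commute _ _).eq.symm.trans e'⟩, rfl⟩
  have := towerSym_absorb_right (A := fun n => Hom R 0 (blk n) (blk n)) (fun n => leftHom (blk n))
    crossL crossL_sq crossL_braid crossL_comm (n + 2) hu _ (.first n)
  rw [← symSum_eq] at this
  exact this

/-- A cup followed by the crossing of its legs is minus the cup, because the circle has value `2`.
The symmetrizer absorbs this crossing, so the composite equals its own negative. A cup further right
is already killed by the smaller symmetrizer with which the larger one begins. -/
theorem U_symSum [CharZero K] {N m : ℕ} (h : m ≤ N) :
    comp (add_zero 0) (U N m) (symSum (N + 2)) = (0 : Hom R 0 _ _) := by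
  induction m generalizing N with
  | zero =>
    have h1 := congrArg (comp (add_zero 0) (U N 0)) (crossL_symSum (R := R) N)
    rw [← assoc (add_zero 0) (add_zero 0) (add_zero 0) (add_zero 0), crossL_eq,
      capCupAt_eq_comp h, map_sub, comp_id, ← assoc (add_zero 0) (add_zero 0) (add_zero 0)
      (add_zero 0), U_capAt_same h, map_smul, LinearMap.smul_apply, id_comp, two_smul,
      sub_add_cancel_left, map_neg, LinearMap.neg_apply] at h1
    have h2 : (2 : K) • comp (add_zero 0) (U N 0) (symSum (N + 2)) = (0 : Hom R 0 _ _) := by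
      rw [two_smul]
      nth_rewrite 1 [← h1]
      exact neg_add_cancel _
    exact (smul_eq_zero.mp h2).resolve_left two_ne_zero
  | succ m ih =>
    obtain ⟨N, rfl⟩ : ∃ n, N = n + 1 := ⟨N - 1, by omega⟩
    rw [symSum, ← assoc (add_zero 0) (add_zero 0) (add_zero 0) (add_zero 0)]
    have h1 : comp (add_zero 0) (U (N + 1) (m + 1)) (left (symSum (N + 2)) : Hom R 0 (blk (N + 3)) (blk (N + 3))) = 0 := by
      have := congrArg (ins (R := R) (s := N) (t := N + 2) (N := N + 1) (N' := N + 3) 1 0 (by omega) (by omega)) (ih (N := N) (by omega))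
      rw [ins_comp (N' := N + 3) 1 0 _ (by omega), ins_cupAt _ _ _ (by omega), map_zero] at this
      rw [left_eq_ins, add_comm m 1]
      exact this
    have h2 := congrArg (fun q => comp (add_zero 0) q (cosetSum (N + 2))) h1
    simp only [map_zero, LinearMap.zero_apply] at h2
    exact h2

/-- Jones-Wenzl projectors annihilate cups. -/
theorem U_jw [CharZero K] {N m : ℕ} (h : m ≤ N) :
    comp (add_zero 0) (U N m) (jw (N + 2)) = (0 : Hom R 0 _ _) := by
  rw [jw, map_smul, U_symSum h, smul_zero]

/-! ### Nested cups -/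

/-- The nested cups, as a morphism between words of black strands. -/
def cupsB (n : ℕ) : Hom R 0 (blk 0) (blk (n + n)) := castR (blk_add n n) (cups n)

/-- The nested cups surrounded by dotted cups, as a morphism between words of black strands. -/
def nestedCupsB (n b : ℕ) : Hom R (2 * b) (blk 0) (blk (n + b + (n + b))) :=
  castR (blk_add (n + b) (n + b)) (nestedCups n b)

theorem nestedCupsB_zero (n : ℕ) : (nestedCupsB n 0 : Hom R 0 _ _) = cupsB n := rfl

theorem cupsB_zero : (cupsB 0 : Hom R 0 (blk 0) (blk 0)) = id (blk 0) := rfl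

theorem cupsB_succ (n : ℕ) : (cupsB (n + 1) : Hom R 0 (blk 0) (blk (n + 1 + (n + 1)))) =
    comp (add_zero 0) cupB (ins (s := 0) (t := n + n) (N := 2) (N' := n + 1 + (n + 1)) 1 1 (by omega) (by omega) (cupsB n)) := by
  rw [cupsB, cups, ← comp_castR, left, castR_tens, ins_apply, cupsB, tens_castR_left]
  congr 1
  exact tens_tens_congr' _ _ _ _ _ _ _ _ _ _ _

theorem nestedCupsB_one (n : ℕ) (h : (2 : ℤ) + 0 = 2 * (1 : ℕ)) :
    (nestedCupsB n 1 : Hom R (2 * (1 : ℕ)) (blk 0) (blk (n + 1 + (n + 1)))) =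
      comp h dotCupB (ins (s := 0) (t := n + n) (N := 2) (N' := n + 1 + (n + 1)) 1 1 (by omega)
        (by omega) (cupsB n)) := by
  rw [nestedCupsB, nestedCups, ← comp_castR, left, castR_tens, ins_apply, cupsB, tens_castR_left]
  refine congrArg (comp _ dotCup) ?_
  exact tens_tens_congr' _ _ _ _ _ _ _ _ _ _ _

/-- Powers of a morphism of degree two. -/
def pow {s : List (Option X.E)} (f : Hom R 2 s s) (n : ℕ) : Hom R (n * 2) s s :=
  (cat R).pow (X := s) f n

theorem pow_zero {s t : List (Option X.E)} {d e : ℤ} (f : Hom R 2 s s)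
    (h : d + (0 : ℕ) * 2 = e) (h' : d = e) (g : Hom R d t s) :
    comp h g (pow f 0) = h' ▸ g := by
  subst h'
  change comp h g ((cat R).castDeg (X := s) (Y := s) (by simp) (id s)) = g
  have : ∀ {a : ℤ} (h0 : 0 = a) (h1 : d + a = d),
      comp h1 g ((cat R).castDeg (X := s) (Y := s) h0 (id s)) = g := by
    intro a h0 h1; subst h0; exact comp_id _ _
  exact this (by simp) _

theorem pow_succ {s : List (Option X.E)} (f : Hom R 2 s s) (n : ℕ) : pow f (n + 1) =
    comp (c := ((n + 1 : ℕ) : ℤ) * 2) (by push_cast; ring) (pow f n) f := rfl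

section Fam

variable {s : List (Option X.E)} {M : Type*} [AddCommGroup M] [Module K M]

/-- Each cup is created at the wall, between the legs of the preceding one; hence the first operator
applied to `f` gives the outermost cup. -/
theorem Fam2.cup_iterate_apply (E : Fam2 R s M) (n : ℕ) : ∀ {p q N N' : ℕ} {d : ℤ} (h : p + q = N)
    (h' : p + (n + n) + q = N') (f : Hom R d s (blk N)), (Fam2.cup^[n] E) p q N d ⟨h⟩ f =
      E (p + n) (q + n) N' d ⟨by omega⟩ (comp (add_zero d) f (ins p q (by omega) h' (cupsB n))) := by
  induction n with
  | zero =>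
    intro p q N N' d h h' f
    obtain rfl : N = N' := by omega
    rw [cupsB_zero, ins_id, comp_id]; rfl
  | succ n ih =>
    intro p q N N' d h h' f
    rw [Function.iterate_succ_apply', Fam2.cup_apply, ih (N' := N') (by omega) (by omega),
      assoc' (add_zero 0), cupsB_succ, ins_comp (R := R) (t := 2) (N' := N + 2) p q _ (by omega), ins_ins,
      ← cupAt_eq (N := N) (m := p) (k := q) (cupB (R := R)) h]
    rw [ins_congr rfl (Nat.add_comm 1 q)]
    exact Fam2.congr E (by omega) (by omega) rfl _ _ _ _ _

theorem Fam2.hole_apply (E : Fam2 R s M) {n b : ℕ} (hb : b < 2) {N N' : ℕ} {d e : ℤ}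
    (h : N + (n + b) + (n + b) = N') (he : d + 2 * b = e) (f : Hom R d s (blk N)) :
    E.hole n b N d f = E (N + (n + b)) (n + b) N' e ⟨h⟩
      (comp he f (ins N 0 (by omega) (by omega) (nestedCupsB n b))) := by
  obtain rfl | rfl : b = 0 ∨ b = 1 := by omega
  · change (Fam2.cup^[n] E) N 0 N d ⟨rfl⟩ f = _
    rw [Fam2.cup_iterate_apply (N' := N') _ _ _ (by omega), nestedCupsB_zero]
    exact Fam2.congr E (by omega) (by omega) (by simpa using he) _ _ _ _ _
  · change (Fam2.cup^[n] E) (N + 1) 1 (N + 2) (d + 2) ⟨_⟩ (comp rfl f (V N N)) = _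
    rw [Fam2.cup_iterate_apply (N' := N') _ _ _ (by omega), nestedCupsB_one,
      ins_comp (t := 2) (N' := N + 2) N 0 _ (by omega), ins_ins, assoc' (add_zero 2),
      ← cupAt_eq (N := N) (m := N) (k := 0) (dotCupB (R := R)) rfl]
    exact Fam2.congr E (by omega) (by omega) (by simpa using he) _ _ _ _ _

theorem Fam2.zeta_iterate_apply (E : Fam2 R s M) (n : ℕ) {p q N : ℕ} {d e : ℤ} (h : p + q = N)
    (he : d + n * 2 = e) (f : Hom R d s (blk N)) : (Fam2.zeta^[n] E) p q N d ⟨h⟩ f =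
      E p q N e ⟨h⟩ (comp he f (pow (zAt N q) n)) := by
  induction n generalizing E e with
  | zero =>
    obtain rfl : d = e := by simpa using he
    rw [pow_zero _ _ rfl]; rfl
  | succ n ih =>
    rw [Function.iterate_succ_apply, ih E.zeta rfl, Fam2.zeta_apply, pow_succ, assoc rfl rfl
      (bc := ((n + 1 : ℕ) : ℤ) * 2) (by push_cast; ring) (by push_cast; ring)]
    exact Fam2.congr E rfl rfl (by rw [← he]; push_cast; ring) _ _ _ _ _

end Fam

theorem ins_pow_z {p q N : ℕ} (h : p + q = N) (n : ℕ) :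
    ins p 0 (by omega) (by omega) (pow (z q) n) = (pow (zAt N q) n : Hom R _ _ _) := by
  induction n with
  | zero =>
    have : ∀ {a : ℤ} (h0 : 0 = a), ins p 0 (by omega) (by omega)
        ((cat R).castDeg (X := blk q) (Y := blk q) h0 (id (blk q))) =
      ((cat R).castDeg (X := blk N) (Y := blk N) h0 (id (blk N)) : Hom R a _ _) := by
      intro a h0; subst h0; exact ins_id _ _ _
    exact this (by simp)
  | succ n ih => rw [pow_succ, pow_succ, ← ih, ins_comp (N' := N) p 0 _ (by omega), ← zAt_eq h]

end Pres

end Kirby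

/-! ### Pairs of projectors, extension of partially defined systems, and naturality. -/

namespace Kirby

namespace Pres

variable {K : Type u} [Field K] {X : Gens} {R : TmRel K X}

/-- The Jones-Wenzl projectors on two adjacent groups of strands. -/
def jwPair {p q N : ℕ} (h : p + q = N) : Hom R 0 (blk N) (blk N) :=
  comp (add_zero 0) (ins (s := p) (t := p) (N := N) (N' := N) 0 q (by omega) (by omega) (jw p))
    (ins (s := q) (t := q) p 0 (by omega) (by omega) (jw q))

theorem jwPair_eq {p q N : ℕ} (h : p + q = N) : (jwPair h : Hom R 0 _ _) =
    tens (add_zero 0) (by rw [blk_add, h]) (by rw [blk_add, h]) (jw p) (jw q) := by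
  have hs : blk p ++ blk q = (blk N : List (Option X.E)) := by rw [blk_add, h]
  rw [jwPair, ins_left _ _ _ hs hs, ins_right _ _ _ hs hs, ← interchange (add_zero 0) (add_zero 0)
    (add_zero 0) (add_zero 0) (add_zero 0) (add_zero 0), comp_id, id_comp]

section Absorb

variable {M : Type*} [AddCommGroup M] [Module K M] {s : List (Option X.E)} {d : ℤ} {N : ℕ}

theorem apply_jw [CharZero K] (L : Hom R d s (blk N) →ₗ[K] M)
    (hL : ∀ m, m + 2 ≤ N → ∀ f, L (comp (add_zero d) f (capCupAt N m)) = 0) (f) :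
    L (comp (add_zero d) f (jw N)) = L f := by
  have := apply_ins_jw L (n := N) (a := 0) (b := 0) (by omega)
    (fun m _ hm => hL m (by omega)) f
  rwa [ins_zero] at this

theorem apply_jwPair [CharZero K] (L : Hom R d s (blk N) →ₗ[K] M) {p q : ℕ} (h : p + q = N)
    (hL : ∀ m, m + 2 ≤ p → ∀ f, L (comp (add_zero d) f (capCupAt N m)) = 0)
    (hR : ∀ m, p ≤ m → m + 2 ≤ N → ∀ f, L (comp (add_zero d) f (capCupAt N m)) = 0) (f) :
    L (comp (add_zero d) f (jwPair h)) = L f := by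
  rw [jwPair, ← assoc (add_zero d) (add_zero d) (add_zero 0) (add_zero d),
    apply_ins_jw L _ (fun m hm hm' => hR m hm (by omega)),
    apply_ins_jw L _ (fun m _ hm' => hL m (by omega))]

theorem comp_capCupAt {m : ℕ} (h : m + 2 ≤ N + 2) (f : Hom R d s (blk (N + 2))) :
    comp (add_zero d) f (capCupAt (N + 2) m) =
      comp (add_zero d) (comp (add_zero d) f (capAt N m)) (U N m) := by
  rw [capCupAt_eq_comp (by omega), assoc (add_zero d) (add_zero d) (add_zero 0) (add_zero d)]

theorem IsSys1.apply_jw [CharZero K] {I : Fam1 R s M} (hI : IsSys1 I) (f : Hom R d s (blk N)) :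
    I N d (comp (add_zero d) f (jw N)) = I N d f := by
  refine Pres.apply_jw (I N d) (fun m hm f => ?_) f
  obtain ⟨N, rfl⟩ : ∃ n, N = n + 2 := ⟨N - 2, by omega⟩
  rw [comp_capCupAt hm]
  exact hI.cup (by omega) _

theorem IsSys2.apply_jwPair [CharZero K] {E : Fam2 R s M} (hE : IsSys2 E) {p q : ℕ}
    (h : p + q = N) (f : Hom R d s (blk N)) :
    E p q N d ⟨h⟩ (comp (add_zero d) f (jwPair h)) = E p q N d ⟨h⟩ f := by
  refine Pres.apply_jwPair (E p q N d ⟨h⟩) h (fun m hm f => ?_) (fun m hm hm' f => ?_) f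
  · obtain ⟨N, rfl⟩ : ∃ n, N = n + 2 := ⟨N - 2, by omega⟩
    obtain ⟨p, rfl⟩ : ∃ n, p = n + 2 := ⟨p - 2, by omega⟩
    rw [comp_capCupAt (by omega)]
    exact hE.cupL (by omega) (by omega) _
  · obtain ⟨N, rfl⟩ : ∃ n, N = n + 2 := ⟨N - 2, by omega⟩
    obtain ⟨q, rfl⟩ : ∃ n, q = n + 2 := ⟨q - 2, by omega⟩
    rw [comp_capCupAt (by omega)]
    exact hE.cupR (by omega) (by omega) (by omega) _

end Absorb

theorem U_jwPair_left [CharZero K] {p q N m : ℕ} (h : p + q = N) (h' : p + 2 + q = N + 2)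
    (hm : m ≤ p) : comp (add_zero 0) (U N m) (jwPair h') = (0 : Hom R 0 _ _) := by
  have h1 : comp (add_zero 0) (U N m) (ins (s := p + 2) (t := p + 2) (N := N + 2) (N' := N + 2) 0 q (by omega) (by omega) (jw (p + 2))) =
      (0 : Hom R 0 _ _) := by
    have := congrArg (ins (R := R) (s := p) (t := p + 2) (N := N) (N' := N + 2) 0 q (by omega) (by omega))
      (U_jw (R := R) hm)
    rwa [ins_comp (N' := N + 2) 0 q _ (by omega), ins_cupAt _ _ _ hm, map_zero, Nat.zero_add] at this
  rw [jwPair, ← assoc (add_zero 0) (add_zero 0) (add_zero 0) (add_zero 0), h1, zero_comp']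

theorem ins_jw_comm {p q N : ℕ} (h : p + q = N) : (jwPair h : Hom R 0 _ _) =
    comp (add_zero 0) (ins (s := q) (t := q) (N := N) (N' := N) p 0 (by omega) (by omega) (jw q))
      (ins (s := p) (t := p) 0 q (by omega) (by omega) (jw p)) := by
  exact ins_comm (s := p) (t := p) (s' := q) (t' := q) 0 0 0 (jw p) (jw q) (by omega) (by omega)
    (by omega) (by omega) _ _ _ _ _ _ _ _ _ _

theorem U_jwPair_right [CharZero K] {p q N m : ℕ} (h : p + q = N) (h' : p + (q + 2) = N + 2)
    (hm : p ≤ m) (hm' : m ≤ N) :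
    comp (add_zero 0) (U N m) (jwPair h') = (0 : Hom R 0 _ _) := by
  have h1 : comp (add_zero 0) (U N m) (ins (s := q + 2) (t := q + 2) (N := N + 2) (N' := N + 2) p 0 (by omega) (by omega) (jw (q + 2))) =
      (0 : Hom R 0 _ _) := by
    have := congrArg (ins (R := R) (s := q) (t := q + 2) (N := N) (N' := N + 2) p 0 (by omega) (by omega))
      (U_jw (R := R) (N := q) (m := m - p) (by omega))
    rwa [ins_comp (N' := N + 2) p 0 _ (by omega), ins_cupAt _ _ _ (by omega), map_zero,
      show p + (m - p) = m by omega] at this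
  rw [ins_jw_comm, ← assoc (add_zero 0) (add_zero 0) (add_zero 0) (add_zero 0), h1, zero_comp']

/-- If `J` annihilates cups in a range of positions, then the position of a dotted cup below `J`
in this range does not matter. -/
theorem V_comp_eq {N a b : ℕ} {t : List (Option X.E)} (J : Hom R 0 (blk (N + 2)) t) (hb : b ≤ N)
    (hJ : ∀ m, a ≤ m → m ≤ b → comp (add_zero 0) (U N m) J = 0) {m : ℕ} (ha : a ≤ m)
    (hm : m ≤ b) : comp (add_zero 2) (V N m) J = comp (add_zero 2) (V N b) J := by
  obtain ⟨k, rfl⟩ : ∃ k, b = m + k := ⟨b - m, by omega⟩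
  induction k with
  | zero => rfl
  | succ k ih =>
    rw [ih (by omega) (fun m h1 h2 => hJ m h1 (by omega)) (by omega)]
    -- The undotted terms of the bent neck relation are annihilated by `J`, and what remains moves
    -- the dotted cup by one position.
    have h1 := congrArg (fun q => comp (add_zero 2) q J) (neck_cup (R := R) (N := N) (m := m + k) (by omega))
    simp only [map_add, LinearMap.add_apply] at h1
    rw [assoc (add_zero 2) (add_zero 2) (add_zero 0) (add_zero 2), hJ _ (by omega) (by omega),
      assoc (add_zero 2) (add_zero 2) (add_zero 0) (add_zero 2), hJ _ (by omega) (by omega),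
      map_zero, zero_add, zero_add] at h1
    exact h1.symm

/-! ### Families of functionals that are defined on large diagrams -/

section Fam

variable {s : List (Option X.E)} {M : Type*} [AddCommGroup M] [Module K M]

/-- The relations of `IsSys1` hold for at least `v` strands. -/
structure IsSys1From (v : ℕ) (I : Fam1 R s M) : Prop where
  cup : ∀ {N m : ℕ} {d : ℤ} (_ : v ≤ N) (_ : m ≤ N) (f : Hom R d s (blk N)),
    I (N + 2) d (comp (add_zero d) f (U N m)) = 0
  dotCup : ∀ {N m : ℕ} {d : ℤ} (_ : v ≤ N) (_ : m ≤ N) (f : Hom R d s (blk N)),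
    I (N + 2) (d + 2) (comp rfl f (V N m)) = I N d f

/-- Insertion of a dotted cup to the right. -/
def Fam1.shift (I : Fam1 R s M) : Fam1 R s M := fun N d =>
  I (N + 2) (d + 2) ∘ₗ (comp rfl).flip (V N N)

theorem Fam1.shift_apply (I : Fam1 R s M) {N : ℕ} {d : ℤ} (f : Hom R d s (blk N)) :
    I.shift N d f = I (N + 2) (d + 2) (comp rfl f (V N N)) := rfl

/-- The added dotted cup has two strands, so diagrams one strand below the old threshold are now
covered; it stays to the right of all other cups. -/
theorem IsSys1From.shift {v : ℕ} {I : Fam1 R s M} (hI : IsSys1From (v + 1) I) :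
    IsSys1From v I.shift where
  cup {N m d} hv hm f := by
    rw [Fam1.shift_apply, swap (g' := V N N) (k' := U (N + 2) m) (h' := add_zero 2) f
      (cupAt_cupAt _ _ hm (by omega) rfl (add_zero 2) (zero_add 2)).symm _ _ rfl (add_zero _)]
    exact hI.cup (by omega) (by omega) _
  dotCup {N m d} hv hm f := by
    rw [Fam1.shift_apply, swap (g' := V N N) (k' := V (N + 2) m) (h' := rfl) f
      (cupAt_cupAt _ _ hm (by omega) rfl rfl rfl).symm _ _ rfl rfl]
    exact hI.dotCup (by omega) (by omega) _

/-- A Kirby object `ω_v` has no terms with fewer than `v` strands. The missing values are supplied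
by adding dotted cups, which does not change the values that exist. -/
theorem IsSys1From.shift_iterate {v : ℕ} {I : Fam1 R s M} (hI : IsSys1From v I) :
    IsSys1 (Fam1.shift^[v] I) ∧ ∀ N d, v ≤ N → (Fam1.shift^[v] I) N d = I N d := by
  induction v generalizing I with
  | zero => exact ⟨⟨hI.cup (Nat.zero_le _), hI.dotCup (Nat.zero_le _)⟩, fun _ _ _ => rfl⟩
  | succ v ih =>
    refine ⟨(ih hI.shift).1, fun N d hN => ?_⟩
    rw [Function.iterate_succ_apply, (ih hI.shift).2 N d (by omega)]
    exact LinearMap.ext fun f => hI.dotCup hN le_rfl f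

/-- A value of a system on `N` strands is its value on the same diagram with `k` dotted cups added,
so systems can be compared on large diagrams. -/
theorem IsSys1.ext_add {I I' : Fam1 R s M} (hI : IsSys1 I) (hI' : IsSys1 I') {N k : ℕ}
    (h : ∀ (n : ℕ) (_ : N + 2 * k = n) d f, I n d f = I' n d f) (d : ℤ) (f : Hom R d s (blk N)) :
    I N d f = I' N d f := by
  induction k generalizing N d with
  | zero => exact h N rfl d f
  | succ k ih =>
    rw [← hI.dotCup (m := N) le_rfl, ← hI'.dotCup (m := N) le_rfl]
    exact ih (fun n hn d f => h n (by omega) d f) _ _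

/-- The relations of `IsSys2` hold for at least `i` strands in the first and at least `j` strands
in the second group. -/
structure IsSys2From (i j : ℕ) (E : Fam2 R s M) : Prop where
  cupL : ∀ {p q N m : ℕ} {d : ℤ} (h : p + q = N) (_ : i ≤ p) (_ : j ≤ q) (_ : m ≤ p)
    (f : Hom R d s (blk N)),
    E (p + 2) q (N + 2) d ⟨by omega⟩ (comp (add_zero d) f (U N m)) = 0
  cupR : ∀ {p q N m : ℕ} {d : ℤ} (h : p + q = N) (_ : i ≤ p) (_ : j ≤ q) (_ : p ≤ m) (_ : m ≤ N)
    (f : Hom R d s (blk N)),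
    E p (q + 2) (N + 2) d ⟨by omega⟩ (comp (add_zero d) f (U N m)) = 0
  dotCupL : ∀ {p q N m : ℕ} {d : ℤ} (h : p + q = N) (_ : i ≤ p) (_ : j ≤ q) (_ : m ≤ p)
    (f : Hom R d s (blk N)),
    E (p + 2) q (N + 2) (d + 2) ⟨by omega⟩ (comp rfl f (V N m)) = E p q N d ⟨h⟩ f
  dotCupR : ∀ {p q N m : ℕ} {d : ℤ} (h : p + q = N) (_ : i ≤ p) (_ : j ≤ q) (_ : p ≤ m)
    (_ : m ≤ N) (f : Hom R d s (blk N)),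
    E p (q + 2) (N + 2) (d + 2) ⟨by omega⟩ (comp rfl f (V N m)) = E p q N d ⟨h⟩ f

/-- Insertion of a dotted cup to the left of the first group of strands. -/
def Fam2.shiftL (E : Fam2 R s M) : Fam2 R s M := fun p q N d h =>
  E (p + 2) q (N + 2) (d + 2) ⟨by have := h.down; omega⟩ ∘ₗ (comp rfl).flip (V N 0)

/-- Insertion of a dotted cup to the right of the second group of strands. -/
def Fam2.shiftR (E : Fam2 R s M) : Fam2 R s M := fun p q N d h =>
  E p (q + 2) (N + 2) (d + 2) ⟨by have := h.down; omega⟩ ∘ₗ (comp rfl).flip (V N N)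

theorem Fam2.shiftL_apply (E : Fam2 R s M) {p q N : ℕ} {d : ℤ} (h : p + q = N)
    (f : Hom R d s (blk N)) : E.shiftL p q N d ⟨h⟩ f =
      E (p + 2) q (N + 2) (d + 2) ⟨by omega⟩ (comp rfl f (V N 0)) := rfl

theorem Fam2.shiftR_apply (E : Fam2 R s M) {p q N : ℕ} {d : ℤ} (h : p + q = N)
    (f : Hom R d s (blk N)) : E.shiftR p q N d ⟨h⟩ f =
      E p (q + 2) (N + 2) (d + 2) ⟨by omega⟩ (comp rfl f (V N N)) := rfl

/-- The left group grows at the far left, and in `shiftR` the right group grows at the far right.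
These additions do not interfere with each other or with the wall. -/
theorem IsSys2From.shiftL {i j : ℕ} {E : Fam2 R s M} (hE : IsSys2From (i + 1) j E) :
    IsSys2From i j E.shiftL where
  cupL {p q N m d} h hp hq hm f := by
    rw [Fam2.shiftL_apply, swap (g' := V N 0) (k' := U (N + 2) (m + 2)) (h' := add_zero 2) f
      (cupAt_cupAt _ _ (Nat.zero_le _) (by omega) rfl (zero_add 2) (add_zero 2)) _ _ rfl
      (add_zero _)]
    exact hE.cupL (p := p + 2) (by omega) (by omega) (by omega) (by omega) _
  cupR {p q N m d} h hp hq hm hm' f := by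
    rw [Fam2.shiftL_apply, swap (g' := V N 0) (k' := U (N + 2) (m + 2)) (h' := add_zero 2) f
      (cupAt_cupAt _ _ (Nat.zero_le _) (by omega) rfl (zero_add 2) (add_zero 2)) _ _ rfl
      (add_zero _)]
    exact hE.cupR (p := p + 2) (by omega) (by omega) (by omega) (by omega) (by omega) _
  dotCupL {p q N m d} h hp hq hm f := by
    rw [Fam2.shiftL_apply, swap (g' := V N 0) (k' := V (N + 2) (m + 2)) (h' := rfl) f
      (cupAt_cupAt _ _ (Nat.zero_le _) (by omega) rfl rfl rfl) _ _ rfl rfl]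
    exact hE.dotCupL (p := p + 2) (by omega) (by omega) (by omega) (by omega) _
  dotCupR {p q N m d} h hp hq hm hm' f := by
    rw [Fam2.shiftL_apply, swap (g' := V N 0) (k' := V (N + 2) (m + 2)) (h' := rfl) f
      (cupAt_cupAt _ _ (Nat.zero_le _) (by omega) rfl rfl rfl) _ _ rfl rfl]
    exact hE.dotCupR (p := p + 2) (by omega) (by omega) (by omega) (by omega) (by omega) _

theorem IsSys2From.shiftR {i j : ℕ} {E : Fam2 R s M} (hE : IsSys2From i (j + 1) E) :
    IsSys2From i j E.shiftR where
  cupL {p q N m d} h hp hq hm f := by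
    rw [Fam2.shiftR_apply, swap (g' := V N N) (k' := U (N + 2) m) (h' := add_zero 2) f
      (cupAt_cupAt _ _ (by omega) (by omega) rfl (add_zero 2) (zero_add 2)).symm _ _ rfl
      (add_zero _)]
    exact hE.cupL (q := q + 2) (by omega) (by omega) (by omega) (by omega) _
  cupR {p q N m d} h hp hq hm hm' f := by
    rw [Fam2.shiftR_apply, swap (g' := V N N) (k' := U (N + 2) m) (h' := add_zero 2) f
      (cupAt_cupAt _ _ (by omega) (by omega) rfl (add_zero 2) (zero_add 2)).symm _ _ rfl
      (add_zero _)]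
    exact hE.cupR (q := q + 2) (by omega) (by omega) (by omega) (by omega) (by omega) _
  dotCupL {p q N m d} h hp hq hm f := by
    rw [Fam2.shiftR_apply, swap (g' := V N N) (k' := V (N + 2) m) (h' := rfl) f
      (cupAt_cupAt _ _ (by omega) (by omega) rfl rfl rfl).symm _ _ rfl rfl]
    exact hE.dotCupL (q := q + 2) (by omega) (by omega) (by omega) (by omega) _
  dotCupR {p q N m d} h hp hq hm hm' f := by
    rw [Fam2.shiftR_apply, swap (g' := V N N) (k' := V (N + 2) m) (h' := rfl) f
      (cupAt_cupAt _ _ (by omega) (by omega) rfl rfl rfl).symm _ _ rfl rfl]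
    exact hE.dotCupR (q := q + 2) (by omega) (by omega) (by omega) (by omega) (by omega) _

theorem IsSys2From.shift_iterate_left {i j : ℕ} {E : Fam2 R s M} (hE : IsSys2From i j E) :
    IsSys2From 0 j (Fam2.shiftL^[i] E) ∧ ∀ p q N d h, i ≤ p → j ≤ q →
      (Fam2.shiftL^[i] E) p q N d h = E p q N d h := by
  induction i generalizing E with
  | zero => exact ⟨hE, fun _ _ _ _ _ _ _ => rfl⟩
  | succ i ih =>
    refine ⟨(ih hE.shiftL).1, fun p q N d h hp hq => ?_⟩
    rw [Function.iterate_succ_apply, (ih hE.shiftL).2 p q N d h (by omega) hq]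
    exact LinearMap.ext fun f => hE.dotCupL h.down hp hq (Nat.zero_le _) f

theorem IsSys2From.shift_iterate_right {j : ℕ} {E : Fam2 R s M} (hE : IsSys2From 0 j E) :
    IsSys2 (Fam2.shiftR^[j] E) ∧ ∀ p q N d h, j ≤ q →
      (Fam2.shiftR^[j] E) p q N d h = E p q N d h := by
  induction j generalizing E with
  | zero =>
    exact ⟨⟨fun h => hE.cupL h (Nat.zero_le _) (Nat.zero_le _),
      fun h => hE.cupR h (Nat.zero_le _) (Nat.zero_le _),
      fun h => hE.dotCupL h (Nat.zero_le _) (Nat.zero_le _),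
      fun h => hE.dotCupR h (Nat.zero_le _) (Nat.zero_le _)⟩, fun _ _ _ _ _ _ => rfl⟩
  | succ j ih =>
    refine ⟨(ih hE.shiftR).1, fun p q N d h hq => ?_⟩
    rw [Function.iterate_succ_apply, (ih hE.shiftR).2 p q N d h (by omega)]
    exact LinearMap.ext fun f => hE.dotCupR h.down (Nat.zero_le _) hq (Nat.le.intro h.down) le_rfl f

/-- The extension of a family that is defined on large diagrams. -/
def Fam2.extend (i j : ℕ) (E : Fam2 R s M) : Fam2 R s M := Fam2.shiftR^[j] (Fam2.shiftL^[i] E)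

theorem IsSys2From.extend {i j : ℕ} {E : Fam2 R s M} (hE : IsSys2From i j E) :
    IsSys2 (E.extend i j) := hE.shift_iterate_left.1.shift_iterate_right.1

theorem IsSys2From.extend_eq {i j : ℕ} {E : Fam2 R s M} (hE : IsSys2From i j E) {p q N : ℕ}
    {d : ℤ} (h : PLift (p + q = N)) (hp : i ≤ p) (hq : j ≤ q) :
    E.extend i j p q N d h = E p q N d h :=
  (hE.shift_iterate_left.1.shift_iterate_right.2 p q N d h hq).trans
    (hE.shift_iterate_left.2 p q N d h hp hq)

theorem IsSys2.ext_add {E E' : Fam2 R s M} (hE : IsSys2 E) (hE' : IsSys2 E') {p q N k l : ℕ}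
    (hN : p + q = N) (h : ∀ (p' q' N' : ℕ) (_ : p' = p + 2 * k) (_ : q' = q + 2 * l)
      (hN' : p' + q' = N') (d : ℤ) f, E p' q' N' d ⟨hN'⟩ f = E' p' q' N' d ⟨hN'⟩ f) (d : ℤ)
    (f : Hom R d s (blk N)) : E p q N d ⟨hN⟩ f = E' p q N d ⟨hN⟩ f := by
  induction k generalizing p N d with
  | zero =>
    induction l generalizing q N d with
    | zero => exact h p q N rfl rfl hN d f
    | succ l ih =>
      rw [← hE.dotCupR hN (Nat.le.intro hN) le_rfl, ← hE'.dotCupR hN (Nat.le.intro hN) le_rfl]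
      exact ih _ (fun p' q' N' hp hq hN' d f => h p' q' N' hp (by omega) hN' d f) _ _
  | succ k ih =>
    rw [← hE.dotCupL hN (Nat.zero_le _), ← hE'.dotCupL hN (Nat.zero_le _)]
    exact ih _ (fun p' q' N' hp hq hN' d f => h p' q' N' (by omega) hq hN' d f) _ _

/-! ### Naturality -/

variable {s' : List (Option X.E)} {M' : Type*} [AddCommGroup M'] [Module K M'] {δ : ℤ}

/-- The family `I'` is obtained from `I` by precomposition with `G`, up to `L`. -/
def Fam1.Natural (L : M →ₗ[K] M') (G : Hom R δ s' s) (I : Fam1 R s M) (I' : Fam1 R s' M') : Prop :=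
  ∀ (N : ℕ) (d d' : ℤ) (h : δ + d = d') (f : Hom R d s (blk N)),
    L (I N d f) = I' N d' (comp h G f)

/-- The family `E'` is obtained from `E` by precomposition with `G`, up to `L`. -/
def Fam2.Natural (L : M →ₗ[K] M') (G : Hom R δ s' s) (E : Fam2 R s M) (E' : Fam2 R s' M') : Prop :=
  ∀ (p q N : ℕ) (d d' : ℤ) (hN : PLift (p + q = N)) (h : δ + d = d') (f : Hom R d s (blk N)),
    L (E p q N d hN f) = E' p q N d' hN (comp h G f)

variable {L : M →ₗ[K] M'} {G : Hom R δ s' s}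

/-- All operations on families act at the outgoing end of the diagram, so by associativity they are
compatible with precomposition. -/
theorem Fam2.Natural.cup {E : Fam2 R s M} {E' : Fam2 R s' M'} (H : E.Natural L G E') :
    E.cup.Natural L G E'.cup := fun p q N d d' hN h f => by
  refine (H _ _ _ _ _ _ h _).trans (congrArg _ ?_)
  exact (assoc _ _ _ _ _ _ _).symm

theorem Fam2.Natural.dotCup {E : Fam2 R s M} {E' : Fam2 R s' M'} (H : E.Natural L G E') :
    E.dotCup.Natural L G E'.dotCup := fun p q N d d' hN h f => by
  refine (H _ _ _ _ (d' + 2) _ (by omega) _).trans (congrArg _ ?_)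
  exact (assoc _ _ _ _ _ _ _).symm

theorem Fam2.Natural.zeta {E : Fam2 R s M} {E' : Fam2 R s' M'} (H : E.Natural L G E') :
    E.zeta.Natural L G E'.zeta := fun p q N d d' hN h f => by
  refine (H _ _ _ _ (d' + 2) _ (by omega) _).trans (congrArg _ ?_)
  exact (assoc _ _ _ _ _ _ _).symm

theorem Fam2.Natural.shiftL {E : Fam2 R s M} {E' : Fam2 R s' M'} (H : E.Natural L G E') :
    E.shiftL.Natural L G E'.shiftL := fun p q N d d' hN h f => by
  refine (H _ _ _ _ (d' + 2) _ (by omega) _).trans (congrArg _ ?_)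
  exact (assoc _ _ _ _ _ _ _).symm

theorem Fam2.Natural.shiftR {E : Fam2 R s M} {E' : Fam2 R s' M'} (H : E.Natural L G E') :
    E.shiftR.Natural L G E'.shiftR := fun p q N d d' hN h f => by
  refine (H _ _ _ _ (d' + 2) _ (by omega) _).trans (congrArg _ ?_)
  exact (assoc _ _ _ _ _ _ _).symm

theorem Fam1.Natural.shift {I : Fam1 R s M} {I' : Fam1 R s' M'} (H : I.Natural L G I') :
    I.shift.Natural L G I'.shift := fun N d d' h f => by
  refine (H _ _ (d' + 2) (by omega) _).trans (congrArg _ ?_)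
  exact (assoc _ _ _ _ _ _ _).symm

theorem Fam1.Natural.shift_iterate {I : Fam1 R s M} {I' : Fam1 R s' M'} (H : I.Natural L G I')
    (n : ℕ) : (Fam1.shift^[n] I).Natural L G (Fam1.shift^[n] I') := by
  induction n with
  | zero => exact H
  | succ n ih => rw [Function.iterate_succ_apply', Function.iterate_succ_apply']; exact ih.shift

theorem Fam2.Natural.extend {E : Fam2 R s M} {E' : Fam2 R s' M'} (H : E.Natural L G E')
    (i j : ℕ) : (E.extend i j).Natural L G (E'.extend i j) := by
  have h1 : (Fam2.shiftL^[i] E).Natural L G (Fam2.shiftL^[i] E') := by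
    induction i with
    | zero => exact H
    | succ n ih => rw [Function.iterate_succ_apply', Function.iterate_succ_apply']; exact ih.shiftL
  unfold Fam2.extend
  induction j with
  | zero => exact h1
  | succ n ih => rw [Function.iterate_succ_apply', Function.iterate_succ_apply']; exact ih.shiftR

theorem Fam2.Natural.cup_iterate {E : Fam2 R s M} {E' : Fam2 R s' M'} (H : E.Natural L G E')
    (n : ℕ) : (Fam2.cup^[n] E).Natural L G (Fam2.cup^[n] E') := by
  induction n with
  | zero => exact H
  | succ n ih => rw [Function.iterate_succ_apply', Function.iterate_succ_apply']; exact ih.cup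

theorem Fam2.Natural.hole {E : Fam2 R s M} {E' : Fam2 R s' M'} (H : E.Natural L G E')
    (n b : ℕ) : (E.hole n b).Natural L G (E'.hole n b) := by
  intro N d d' h f
  cases b with
  | zero => exact H.cup_iterate n N 0 N _ _ ⟨rfl⟩ h f
  | succ b => exact (H.cup_iterate n).dotCup N 0 N _ _ ⟨rfl⟩ h f

theorem Fam1.Natural.proj {I : Fam1 R s M} {I' : Fam1 R s' M'} (H : I.Natural L G I') (n : ℕ) :
    (I.proj n).Natural L G (I'.proj n) := by
  have h1 : (Fam2.zeta^[n] I.merge).Natural L G (Fam2.zeta^[n] I'.merge) := by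
    induction n with
    | zero => exact fun _ _ N d d' _ h f => H N d d' h f
    | succ n ih => rw [Function.iterate_succ_apply', Function.iterate_succ_apply']; exact ih.zeta
  intro p q N d d' hN h f
  exact (map_smul L _ _).trans (congrArg (_ • ·) (h1 p q N d d' hN h f))

end Fam

end Pres

end Kirby

/-! ### Formal part: biproducts from summable families, one-entry matrices, ind-objects of
sequences. -/

namespace GrCat

variable {K : Type u} [Field K]

/-! ### Biproducts and locally finite sums -/

/-- A criterion for biproducts in terms of a notion of locally finite sums of morphisms. -/
theorem isBiproduct_of_sums (C : GrCat.{u, w} K) {I : Type} [DecidableEq I] {Y : C.Obj} {X : I → C.Obj}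
    {σ : ∀ i, C.Hom 0 (X i) Y} {π : ∀ i, C.Hom 0 Y (X i)}
    (S : ∀ {a : ℤ} {A B : C.Obj}, (I → C.Hom a A B) → C.Hom a A B → Prop)
    (unique : ∀ {a : ℤ} {A B : C.Obj} {F : I → C.Hom a A B} {G G' : C.Hom a A B},
      S F G → S F G' → G = G')
    (comp_left : ∀ {a b c : ℤ} (h : a + b = c) {A B D : C.Obj} (f : C.Hom a A B)
      {F : I → C.Hom b B D} {G : C.Hom b B D}, S F G →
        S (fun i => C.comp h f (F i)) (C.comp h f G))
    (comp_right : ∀ {a b c : ℤ} (h : a + b = c) {A B D : C.Obj} {F : I → C.Hom a A B}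
      {G : C.Hom a A B} (f : C.Hom b B D), S F G →
        S (fun i => C.comp h (F i) f) (C.comp h G f))
    (single : ∀ {a : ℤ} {A B : C.Obj} (x : C.Hom a A B) (k : I),
      S (fun i => if i = k then x else 0) x)
    (same : ∀ i, C.comp (add_zero 0) (σ i) (π i) = C.id (X i))
    (ne : ∀ i j, i ≠ j → C.comp (add_zero 0) (σ j) (π i) = 0)
    (sum : S (fun i => C.comp (add_zero 0) (π i) (σ i)) (C.id Y))
    (exists_right : ∀ (a : ℤ) (T : C.Obj) (F : ∀ i, C.Hom a (X i) T),
      ∃ G : C.Hom a Y T, S (fun i => C.comp (zero_add a) (π i) (F i)) G)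
    (exists_left : ∀ (a : ℤ) (T : C.Obj) (F : ∀ i, C.Hom a T (X i)),
      ∃ G : C.Hom a T Y, S (fun i => C.comp (add_zero a) (F i) (σ i)) G) :
    C.IsBiproduct Y X σ π where
  comp_self := same
  comp_ne := ne
  coproduct a T := by
    constructor
    · intro G G' h
      -- Composing the decomposition of the identity with `G` shows that `G` is determined by its
      -- composites with the `σ i`.
      have key : ∀ G : C.Hom a Y T,
          S (fun i => C.comp (zero_add a) (π i) (C.comp (zero_add a) (σ i) G)) G := fun G => by
        have := comp_right (zero_add a) G sum
        simp only [C.assoc (add_zero 0) (zero_add a) (zero_add a) (zero_add a), C.id_comp] at this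
        exact this
      have h1 := key G
      simp only [fun i => congrFun h i] at h1
      exact unique h1 (key G')
    · intro F
      obtain ⟨G, hG⟩ := exists_right a T F
      refine ⟨G, funext fun k => ?_⟩
      have h1 := comp_left (zero_add a) (σ k) hG
      refine unique h1 ?_
      -- By orthogonality all terms except the `k`-th vanish.
      convert single (F k) k using 2 with i
      rw [← C.assoc (add_zero 0) (zero_add a) (zero_add a) (zero_add a)]
      split_ifs with h
      · subst h; rw [same, C.id_comp]
      · rw [ne i k h, map_zero, LinearMap.zero_apply]
  product a T := by
    constructor
    · intro G G' h
      have key : ∀ G : C.Hom a T Y,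
          S (fun i => C.comp (add_zero a) (C.comp (add_zero a) G (π i)) (σ i)) G := fun G => by
        have := comp_left (add_zero a) G sum
        simp only [← C.assoc (add_zero a) (add_zero a) (add_zero 0) (add_zero a), C.comp_id] at this
        exact this
      have h1 := key G
      simp only [fun i => congrFun h i] at h1
      exact unique h1 (key G')
    · intro F
      obtain ⟨G, hG⟩ := exists_left a T F
      refine ⟨G, funext fun k => ?_⟩
      have h1 := comp_right (add_zero a) (π k) hG
      refine unique h1 ?_
      convert single (F k) k using 2 with i
      rw [C.assoc (add_zero a) (add_zero a) (add_zero 0) (add_zero a)]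
      split_ifs with h
      · subst h; rw [same, C.comp_id]
      · rw [ne k i (Ne.symm h), map_zero]

theorem orthogonalIdempotents_of_comp (C : GrCat.{u, w} K) {I : Type} {Y : C.Obj} {X : I → C.Obj}
    {σ : ∀ i, C.Hom 0 (X i) Y} {π : ∀ i, C.Hom 0 Y (X i)}
    (same : ∀ i, C.comp (add_zero 0) (σ i) (π i) = C.id (X i))
    (ne : ∀ i j, i ≠ j → C.comp (add_zero 0) (σ j) (π i) = 0) :
    C.OrthogonalIdempotents (fun i => C.comp (add_zero 0) (π i) (σ i)) := by
  constructor
  · intro i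
    rw [C.assoc (add_zero 0) (add_zero 0) (add_zero 0) (add_zero 0),
      ← C.assoc (add_zero 0) (add_zero 0) (add_zero 0) (add_zero 0) (σ i), same, C.id_comp]
  · intro i j h
    rw [C.assoc (add_zero 0) (add_zero 0) (add_zero 0) (add_zero 0),
      ← C.assoc (add_zero 0) (add_zero 0) (add_zero 0) (add_zero 0) (σ i), ne j i h.symm, map_zero,
      LinearMap.zero_apply, map_zero]

/-! ### Objects with a single homogeneous summand -/

/-- The object `q ^ e Q`, as a sum over a (one-element) index type `J`. -/
def sing {C : GrCat.{u, w} K} (J : Type) [Fintype J] (e : ℤ) (Q : C.Obj) : C.MatObj :=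
  ⟨J, inferInstance, fun _ => e, fun _ => Q⟩

section rawHom

variable {C : GrCat.{u, w} K} {J J' J'' : Type} [Fintype J] [Fintype J'] [Fintype J'']
  {e e' e'' : ℤ} {Q Q' Q'' : C.KarObj}

/-- The matrix with the entry `e' ∘ f ∘ e`, which is zero unless the degree of `f` is right. -/
def rawHom (J J' : Type) [Fintype J] [Fintype J'] (e e' : ℤ) (Q Q' : C.KarObj) (d : ℤ) :
    C.Hom d Q.X Q'.X →ₗ[K] C.Kar.MatHom 0 (sing J e Q) (sing J' e' Q') :=
  -- The default `0` makes the map linear and defined in every degree, as functionals on diagrams of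
  -- arbitrary degree require.
  if h : d = 0 - (e' - e) then
    { toFun := fun f _ _ => C.Kar.castDeg h (C.sandwich Q Q' f)
      map_add' := fun f g => by
        subst h; funext _ _
        exact Subtype.ext (by
          change C.comp _ (C.comp _ Q.e (f + g)) Q'.e = C.comp _ (C.comp _ Q.e f) Q'.e +
            C.comp _ (C.comp _ Q.e g) Q'.e
          rw [map_add, map_add, LinearMap.add_apply]
          rfl)
      map_smul' := fun k f => by
        subst h; funext _ _
        exact Subtype.ext (by
          change C.comp _ (C.comp _ Q.e (k • f)) Q'.e = k • C.comp _ (C.comp _ Q.e f) Q'.e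
          rw [map_smul, map_smul, LinearMap.smul_apply]) }
  else 0

theorem rawHom_apply {d : ℤ} (h : d = 0 - (e' - e)) (f : C.Hom d Q.X Q'.X) :
    rawHom J J' e e' Q Q' d f = fun _ _ => C.Kar.castDeg h (C.sandwich Q Q' f) := by
  rw [rawHom, dif_pos h]; rfl

theorem rawHom_of_ne {d : ℤ} (h : d ≠ 0 - (e' - e)) : rawHom J J' e e' Q Q' d = 0 := by
  rw [rawHom, dif_neg h]

/-- The entry ends in the idempotent `Q'.e`. For the Kirby objects this is how projectors enter the
functionals. -/
theorem rawHom_congr {d : ℤ} {f g : C.Hom d Q.X Q'.X}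
    (h : C.comp (add_zero d) f Q'.e = C.comp (add_zero d) g Q'.e) :
    rawHom J J' e e' Q Q' d f = rawHom J J' e e' Q Q' d g := by
  by_cases hd : d = 0 - (e' - e)
  · rw [rawHom_apply hd, rawHom_apply hd]
    have : C.sandwich Q Q' f = C.sandwich Q Q' g := Subtype.ext (by
      change C.comp _ (C.comp _ Q.e f) Q'.e = C.comp _ (C.comp _ Q.e g) Q'.e
      rw [C.assoc (zero_add d) (add_zero d) (add_zero d) (zero_add d), h,
        C.assoc (zero_add d) (add_zero d) (add_zero d) (zero_add d)])
    rw [this]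
  · rw [rawHom_of_ne hd]; rfl

/-- The outer idempotents are part of `rawHom`, but the one at the middle object has to be recorded.
The degree condition on `f` excludes the case of two wrong degrees with the right sum, where the
left-hand side would be zero for no good reason. -/
theorem rawHom_comp [Unique J'] {d d' d'' : ℤ} (h : d + d' = d'') (hd : d = 0 - (e' - e))
    (f : C.Hom d Q.X Q'.X) (g : C.Hom d' Q'.X Q''.X) :
    C.Kar.matComp (add_zero 0) (rawHom J J' e e' Q Q' d f) (rawHom J' J'' e' e'' Q' Q'' d' g) =
      rawHom J J'' e e'' Q Q'' d'' (C.comp h (C.comp (add_zero d) f Q'.e) g) := by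
  by_cases hd' : d' = 0 - (e'' - e')
  · have hd'' : d'' = 0 - (e'' - e) := by omega
    rw [rawHom_apply hd, rawHom_apply hd', rawHom_apply hd'']
    funext i k
    change ∑ _ : J', _ = _
    rw [Fintype.sum_unique]
    have key : ∀ {a b c : ℤ} (ha : d = a) (hb : d' = b) (hc : d'' = c) (habc : a + b = c),
        C.Kar.comp (X := Q) (Y := Q') (Z := Q'') habc (C.Kar.castDeg ha (C.sandwich Q Q' f))
          (C.Kar.castDeg hb (C.sandwich Q' Q'' g)) =
        C.Kar.castDeg hc (C.sandwich Q Q'' (C.comp h (C.comp (add_zero d) f Q'.e) g)) := by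
      intro a b c ha hb hc habc
      subst ha hb hc
      refine Subtype.ext ?_
      change C.comp h (C.comp _ (C.comp _ Q.e f) Q'.e) (C.comp _ (C.comp _ Q'.e g) Q''.e) =
        C.comp _ (C.comp _ Q.e (C.comp h (C.comp _ f Q'.e) g)) Q''.e
      have h1 : C.comp h (C.comp (add_zero d) (C.comp (zero_add d) Q.e f) Q'.e)
          (C.comp (add_zero d') (C.comp (zero_add d') Q'.e g) Q''.e) =
          C.comp (zero_add d'') Q.e (C.comp h f (C.comp (add_zero d') (C.comp (zero_add d') Q'.e g) Q''.e)) := by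
        rw [C.assoc (add_zero d) h (zero_add d') h, C.assoc (zero_add d) h h (zero_add d''),
          C.assoc (zero_add d') (add_zero d') (add_zero d') (zero_add d'),
          ← C.assoc (add_zero 0) (zero_add d') (zero_add d') (zero_add d'), Q'.idem]
      rw [h1, C.assoc (zero_add d'') (add_zero d'') (add_zero d'') (zero_add d''),
        C.assoc h (add_zero d'') (add_zero d') h, C.assoc (add_zero d) h (zero_add d') h,
        C.assoc (zero_add d') (add_zero d') (add_zero d') (zero_add d')]
    exact key _ _ _ _
  · have hd'' : d'' ≠ 0 - (e'' - e) := by omega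
    rw [rawHom_of_ne hd', rawHom_of_ne hd'']
    funext i k
    change ∑ _ : J', C.Kar.comp _ _ (0 : C.Kar.Hom _ _ _) = 0
    exact Finset.sum_eq_zero fun _ _ => map_zero _

theorem rawHom_id [Unique J] {d : ℤ} (hd : d = 0) (f : C.Hom d Q.X Q.X)
    (hf : f = C.castDeg hd.symm (C.id Q.X)) :
    rawHom J J e e Q Q d f = C.Kar.matId (sing J e Q) := by
  subst hd hf
  rw [rawHom_apply (by ring)]
  funext i j
  obtain rfl : i = j := Subsingleton.elim (α := J) i j
  rw [matId_same]
  have key : ∀ {a : ℤ} (ha : 0 = a) (ha' : a = 0), C.Kar.castDeg ha (C.sandwich Q Q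
      (C.castDeg rfl (C.id Q.X))) = C.Kar.idOf (X := Q) ha' rfl := by
    intro a ha ha'
    subst ha
    refine Subtype.ext ?_
    change C.comp _ (C.comp _ Q.e (C.id Q.X)) Q.e = Q.e
    rw [C.comp_id, Q.idem]
  exact key _ _

end rawHom

/-! ### Ind-objects of sequences -/

section Ind

variable {C : GrCat.{u, w} K}

/-- The objects of the index category of a sequence. -/
abbrev stage (n : ℕ) : AsSmall.{u} ℕ := ⟨n⟩

/-- The morphisms of the index category of a sequence. -/
def step {m n : ℕ} (h : m ≤ n) : stage.{u} m ⟶ stage n := ⟨homOfLE h⟩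

theorem seqInd_map_step (X : ℕ → C.Obj) (s : ∀ n, C.Hom 0 (X n) (X (n + 1))) (n : ℕ) :
    (seqInd C X s).map (step (Nat.le_succ n)) = s n :=
  Functor.ofSequence_map_homOfLE_succ (C := C.Deg0) (X := X) s n

theorem IndObj.map_id (α : C.IndObj) (i : α.J) : α.map (𝟙 i) = C.id (α.obj i) := α.F.map_id i

theorem IndObj.map_comp (α : C.IndObj) {i j k : α.J} (f : i ⟶ j) (g : j ⟶ k) :
    α.map (f ≫ g) = C.comp (add_zero 0) (α.map f) (α.map g) := α.F.map_comp f g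

/-- Compatibility of a family of elements of the colimits with a structure map. -/
def Compat {a : ℤ} {α β : C.IndObj} (x : ∀ i : α.J, C.ColimHom a (α.obj i) β) {i j : α.J}
    (f : i ⟶ j) : Prop := ColimHom.pre (zero_add a) (α.map f) β (x j) = x i

theorem Compat.id {a : ℤ} {α β : C.IndObj} (x : ∀ i : α.J, C.ColimHom a (α.obj i) β) (i : α.J) :
    Compat x (𝟙 i) := by
  rw [Compat, IndObj.map_id, ColimHom.pre_id]

theorem Compat.comp {a : ℤ} {α β : C.IndObj} {x : ∀ i : α.J, C.ColimHom a (α.obj i) β}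
    {i j k : α.J} {f : i ⟶ j} {g : j ⟶ k} (hf : Compat x f) (hg : Compat x g) :
    Compat x (f ≫ g) := by
  rw [Compat, IndObj.map_comp, ColimHom.pre_pre (add_zero 0) (zero_add a) (zero_add a) (zero_add a)]
  exact (congrArg _ hg).trans hf

/-- A morphism out of a sequence. -/
theorem compat_of_step {P : ∀ {i j : AsSmall.{u} ℕ} (_ : i ⟶ j), Prop} (hid : ∀ i, P (𝟙 i))
    (hcomp : ∀ {i j k : AsSmall.{u} ℕ} {f : i ⟶ j} {g : j ⟶ k}, P f → P g → P (f ≫ g))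
    (hstep : ∀ n, P (step.{u} (Nat.le_succ n))) {i j : AsSmall.{u} ℕ} (f : i ⟶ j) : P f := by
  obtain ⟨m⟩ := i
  obtain ⟨n⟩ := j
  have h : m ≤ n := leOfHom f.down
  obtain rfl : f = step h := rfl
  induction n, h using Nat.le_induction with
  | base => exact hid _
  | succ n h ih => exact hcomp ih (hstep n)

/-! ### Locally finite sums in the ind-completion -/

/-- Sums of morphisms of `Ind C` that are finite on every term of the source. -/
def IndSum {I : Type} {a : ℤ} {α β : C.IndObj} (F : I → C.IndHom a α β) (G : C.IndHom a α β) :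
    Prop :=
  ∀ i, FinSum (fun n => (F n).1 i) (G.1 i)

theorem IndSum.unique {I : Type} {a : ℤ} {α β : C.IndObj} {F : I → C.IndHom a α β}
    {G G' : C.IndHom a α β} (h : IndSum F G) (h' : IndSum F G') : G = G' :=
  IndHom.ext fun i => (h i).unique (h' i)

theorem IndSum.comp_left {I : Type} {a b c : ℤ} (h : a + b = c) {α β γ : C.IndObj}
    (f : C.IndHom a α β) {F : I → C.IndHom b β γ} {G : C.IndHom b β γ} (hF : IndSum F G) :
    IndSum (fun i => IndHom.comp h f (F i)) (IndHom.comp h f G) := fun i => by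
  change FinSum (fun n => IndHom.post h _ (F n) (f.1 i)) (IndHom.post h _ G (f.1 i))
  obtain ⟨j, φ, hφ⟩ := (f.1 i).exists_rep
  rw [← hφ]
  refine FinSum.congr (v := fun n => ColimHom.pre h φ γ ((F n).1 j)) ?_
    (fun n => (IndHom.post_mk h _ (F n) j φ).symm) (IndHom.post_mk h _ G j φ).symm
  exact (hF j).map (ColimHom.pre h φ γ).toAddMonoidHom

theorem IndSum.comp_right {I : Type} {a b c : ℤ} (h : a + b = c) {α β γ : C.IndObj}
    {F : I → C.IndHom a α β} {G : C.IndHom a α β} (f : C.IndHom b β γ) (hF : IndSum F G) :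
    IndSum (fun i => IndHom.comp h (F i) f) (IndHom.comp h G f) := fun i =>
  (hF i).map (IndHom.post h _ f).toAddMonoidHom

theorem _root_.Kirby.FinSum.ite {I : Type} [DecidableEq I] {M : Type u} [AddCommGroup M] (x : M)
    (k : I) : FinSum (fun i => if i = k then x else 0) x :=
  finSum_iff.2 ⟨{k}, fun i hi => if_neg (by simpa using hi), by simp⟩

theorem IndSum.single {I : Type} [DecidableEq I] {a : ℤ} {α β : C.IndObj} (x : C.IndHom a α β)
    (k : I) : IndSum (fun i => if i = k then x else 0) x := fun i =>
  (FinSum.ite (x.1 i) k).congr (fun n => by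
    beta_reduce; split_ifs <;> rfl) rfl

/-- A family of morphisms has a sum if it is finite on every term of the source. -/
theorem IndSum.exists_sum {I : Type} {a : ℤ} {α β : C.IndObj} (F : I → C.IndHom a α β)
    (hF : ∀ i, (fun n => (F n).1 i).support.Finite) : ∃ G, IndSum F G := by
  refine ⟨⟨fun i => ∑ᶠ n, (F n).1 i, fun {i i'} s => ?_⟩, fun i => ⟨hF i, rfl⟩⟩
  refine (FinSum.map ⟨hF i', rfl⟩ (ColimHom.pre (zero_add a) (IndObj.map α s) β).toAddMonoidHom).unique
    (FinSum.congr ⟨hF i, rfl⟩ (fun n => ?_) rfl)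
  exact ((F n).2 s).symm

end Ind

end GrCat

/-! ### The maps to a Kirby object through a single term of its system. -/

namespace Kirby

namespace Pres

variable {K : Type u} [Field K] {X : Gens} {R : TmRel K X}

/-! ### Functionals that factor through an idempotent -/

section Null

variable {M : Type*} [AddCommGroup M] [Module K M] {s : List (Option X.E)} {d e : ℤ} {N : ℕ}
  {J : Hom R 0 (blk (N + 2)) (blk (N + 2))} (L : Hom R e s (blk (N + 2)) →ₗ[K] M)

/-- The functional `L` vanishes on morphisms that are annihilated by `J`. -/
def NullOn (J : Hom R 0 (blk N) (blk N)) (L : Hom R e s (blk N) →ₗ[K] M) : Prop :=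
  ∀ g, comp (add_zero e) g J = 0 → L g = 0

variable {L}

theorem NullOn.apply_U (hL : NullOn J L) {m : ℕ} (hJ : comp (add_zero 0) (U N m) J = 0) (f) :
    L (comp (add_zero e) f (U N m)) = 0 :=
  hL _ (by rw [assoc (add_zero e) (add_zero e) (add_zero 0) (add_zero e), hJ, map_zero])

theorem NullOn.apply_V (hL : NullOn J L) {a b m : ℕ} (hb : b ≤ N)
    (hJ : ∀ m, a ≤ m → m ≤ b → comp (add_zero 0) (U N m) J = 0) (ha : a ≤ m) (hm : m ≤ b)
    (h : d + 2 = e) (f : Hom R d s (blk N)) : L (comp h f (V N m)) = L (comp h f (V N b)) := by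
  rw [← sub_eq_zero, ← map_sub]
  refine hL _ ?_
  rw [map_sub, LinearMap.sub_apply, assoc h (add_zero e) (add_zero 2) h,
    assoc h (add_zero e) (add_zero 2) h, V_comp_eq J hb hJ ha hm, sub_self]

/-- The undotted cup is exchanged with the disjoint dotted cup, after which it meets `J` directly.
The two alternatives are a cup to the left and a cup to the right of the dotted one. -/
theorem NullOn.apply_capCupAt_V (hL : NullOn J L) {b m : ℕ} (hm : m + 2 ≤ N) (hb : b ≤ N)
    (hJ : m + 2 ≤ b ∧ comp (add_zero 0) (U N m) J = 0 ∨
      b ≤ m ∧ comp (add_zero 0) (U N (m + 2)) J = 0) (h : d + 2 = e) (f : Hom R d s (blk N)) :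
    L (comp h (comp (add_zero d) f (capCupAt N m)) (V N b)) = 0 := by
  obtain ⟨n, rfl⟩ : ∃ n, N = n + 2 := ⟨N - 2, by omega⟩
  rw [comp_capCupAt hm]
  rcases hJ with ⟨hmb, hJ⟩ | ⟨hmb, hJ⟩
  · rw [swap (g := U n m) (k := V (n + 2) b) (g' := V n (b - 2)) (k' := U (n + 2) m)
      (h := zero_add 2) (h' := add_zero 2) _ (cupAt_cupAt _ _ (l := m) (m := b - 2) (m' := b)
        (by omega) (by omega) (by omega) _ _).symm _ _ h (add_zero e)]
    exact hL.apply_U hJ _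
  · rw [swap (g := U n m) (k := V (n + 2) b) (g' := V n b) (k' := U (n + 2) (m + 2))
      (h := zero_add 2) (h' := add_zero 2) _ (cupAt_cupAt _ _ hmb (by omega) rfl _ _) _ _ h
        (add_zero e)]
    exact hL.apply_U hJ _

/-- The projector below a transition map is absorbed by the larger projector above it, so composites
of transition maps can be computed without the intermediate projectors. -/
theorem NullOn.absorb_jw [CharZero K] (hL : NullOn (jw (N + 2)) L) (h : d + 2 = e)
    (f : Hom R d s (blk N)) :
    L (comp h (comp (add_zero d) f (jw N)) (V N N)) = L (comp h f (V N N)) :=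
  apply_jw (L ∘ₗ (comp h).flip (V N N)) (fun _ hm f =>
    hL.apply_capCupAt_V hm le_rfl (Or.inl ⟨hm, U_jw (by omega)⟩) h f) f

theorem NullOn.absorb_jwPair_left [CharZero K] {p q : ℕ} (hN : p + q = N) {hN' : p + 2 + q = N + 2}
    (hL : NullOn (jwPair hN') L) (h : d + 2 = e) (f : Hom R d s (blk N)) :
    L (comp h (comp (add_zero d) f (jwPair hN)) (V N p)) = L (comp h f (V N p)) :=
  apply_jwPair (L ∘ₗ (comp h).flip (V N p)) hN
    (fun _ hm f => hL.apply_capCupAt_V (by omega) (by omega)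
      (Or.inl ⟨hm, U_jwPair_left hN _ (by omega)⟩) h f)
    (fun m hm hm' f => hL.apply_capCupAt_V (by omega) (by omega) (Or.inr ⟨hm, by
      obtain ⟨q, rfl⟩ : ∃ r, q = r + 2 := ⟨q - 2, by omega⟩
      exact U_jwPair_right (p := p + 2) (by omega) _ (by omega) (by omega)⟩) h f) f

theorem NullOn.absorb_jwPair_right [CharZero K] {p q : ℕ} (hN : p + q = N)
    {hN' : p + (q + 2) = N + 2} (hL : NullOn (jwPair hN') L) (h : d + 2 = e)
    (f : Hom R d s (blk N)) :
    L (comp h (comp (add_zero d) f (jwPair hN)) (V N N)) = L (comp h f (V N N)) :=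
  apply_jwPair (L ∘ₗ (comp h).flip (V N N)) hN
    (fun m hm f => hL.apply_capCupAt_V (by omega) (by omega)
      (Or.inl ⟨by omega, by
        obtain ⟨p, rfl⟩ : ∃ r, p = r + 2 := ⟨p - 2, by omega⟩
        exact U_jwPair_left (q := q + 2) (by omega) _ (by omega)⟩) h f)
    (fun m hm hm' f => hL.apply_capCupAt_V (by omega) (by omega) (Or.inl ⟨by omega,
      U_jwPair_right hN _ (by omega) (by omega)⟩) h f) f

end Null

end Pres

open GrCat Pres

variable {K : Type u} [Field K]

/-! ### Diagrams as elements of the colimits that define the Kirby objects -/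

/-- The word underlying an object of the Karoubi envelope. -/
def word (Q : (dTL K).KarObj) : List (Option noGens.E) := Q.X

section Kirby

variable [CharZero K] (J : Type) [Fintype J] (e : ℤ) (Q : (dTL K).KarObj)

/-- Diagrams with `v + 2r` outgoing strands, as elements of `colim Hom(-, q^d κ_v)`. -/
noncomputable def kirbyLeg (d : ℤ) (v r : ℕ) (D : ℤ) :
    Pres.Hom (noRel K) D (word Q) (blk (v + 2 * r)) →ₗ[K]
      (dTL K).Kar.Mat.ColimHom 0 (sing J e Q) (kirby K d v) where
  toFun f := ColimHom.mk (kirby K d v) ⟨r⟩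
    (rawHom J Unit e (d - (v + 2 * r)) Q (jwObj K (v + 2 * r)) D f)
  map_add' f g := (congrArg _ (map_add (rawHom J Unit e _ Q (jwObj K (v + 2 * r)) D) f g)).trans
    ((ColimHom.mk (kirby K d v) ⟨r⟩).map_add _ _)
  map_smul' c f := (congrArg _ (map_smul (rawHom J Unit e _ Q (jwObj K (v + 2 * r)) D) c f)).trans
    ((ColimHom.mk (kirby K d v) ⟨r⟩).map_smul _ _)

theorem kirbyLeg_apply (d : ℤ) (v r : ℕ) (D : ℤ)
    (f : Pres.Hom (noRel K) D (word Q) (blk (v + 2 * r))) :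
    kirbyLeg J e Q d v r D f = ColimHom.mk (kirby K d v) ⟨r⟩
      (rawHom J Unit e (d - (v + 2 * r)) Q (jwObj K (v + 2 * r)) D f) := rfl

theorem kirbyLeg_of_ne {d : ℤ} {v r : ℕ} {D : ℤ} (h : D ≠ 0 - (d - (v + 2 * r) - e)) :
    kirbyLeg J e Q d v r D = 0 := by
  refine LinearMap.ext fun f => ?_
  rw [kirbyLeg_apply, rawHom_of_ne h]
  exact (ColimHom.mk (kirby K d v) ⟨r⟩).map_zero

theorem nullOn_kirbyLeg (d : ℤ) (v r : ℕ) (D : ℤ) :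
    NullOn (jw (v + 2 * r)) (kirbyLeg J e Q d v r D) := fun g hg => by
  rw [← map_zero (kirbyLeg J e Q d v r D)]
  refine congrArg (ColimHom.mk (kirby K d v) ⟨r⟩) (rawHom_congr (Q' := jwObj K (v + 2 * r)) ?_)
  exact Eq.trans hg (zero_comp' (add_zero D) _).symm

theorem kirby_map_step (d : ℤ) (v r : ℕ) :
    (kirby K d v).map (step (Nat.le_succ r)) =
      rawHom Unit Unit (d - (v + 2 * r)) (d - (v + 2 * (r + 1 : ℕ))) (jwObj K (v + 2 * r))
        (jwObj K (v + 2 * (r + 1))) 2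
          (V (v + 2 * r) (v + 2 * r) : Pres.Hom (noRel K) 2 (blk (v + 2 * r)) (blk (v + 2 * r + 2))) := by
  refine (seqInd_map_step _ _ r).trans (Eq.trans ?_ (rawHom_apply
    (by push_cast; ring : (2 : ℤ) = 0 - ((d - (v + 2 * (r + 1 : ℕ))) - (d - (v + 2 * r)))) _).symm)
  funext _ _
  refine congrArg (GrCat.castDeg _ _) (congrArg (GrCat.sandwich (dTL K) _ _) ?_)
  exact ((cupAt_eq (k := 0) _ rfl).trans (ins_right _ _ _ _ _ _)).symm

/-- In the colimit a morphism is identified with its composite with the transition map, that is,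
with a projector followed by a dotted cup at the right end; `NullOn.absorb_jw` removes this
projector. In the wrong degree both sides vanish. -/
theorem kirbyLeg_succ (d : ℤ) (v r : ℕ) {D D' : ℤ} (h : D + 2 = D')
    (f : Pres.Hom (noRel K) D (word Q) (blk (v + 2 * r))) :
    kirbyLeg J e Q d v (r + 1) D' (comp h f (V (v + 2 * r) (v + 2 * r))) =
      kirbyLeg J e Q d v r D f := by
  refine ((nullOn_kirbyLeg J e Q d v (r + 1) D').absorb_jw h f).symm.trans ?_
  by_cases hD : D = 0 - (d - (v + 2 * r) - e)
  · have h1 := ColimHom.mk_map (kirby K d v) (step (Nat.le_succ r)) (add_zero 0)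
      (rawHom J Unit e (d - (v + 2 * r)) Q (jwObj K (v + 2 * r)) D f)
    rw [kirby_map_step] at h1
    refine Eq.trans ?_ h1
    exact congrArg (ColimHom.mk (kirby K d v) (stage (r + 1)))
      (rawHom_comp (J := J) (J' := Unit) (J'' := Unit) (e'' := d - (v + 2 * (r + 1 : ℕ)))
        (Q' := jwObj K (v + 2 * r)) (Q'' := jwObj K (v + 2 * (r + 1))) h hD f
        (V (v + 2 * r) (v + 2 * r) : Pres.Hom (noRel K) 2 (blk (v + 2 * r)) (blk (v + 2 * r + 2)))).symm
  · rw [kirbyLeg_of_ne _ _ _ hD, kirbyLeg_of_ne _ _ _ (by push_cast; omega)]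
    rfl

end Kirby

end Kirby

theorem GrCat.rawHom_tens {K : Type u} [Field K] {C : GrCat.{u, w} K} (T : C.Tensor)
    {J₁ J₂ J₁' J₂' : Type} [Fintype J₁] [Fintype J₂] [Fintype J₁'] [Fintype J₂'] {e₁ e₂ e₁' e₂' : ℤ}
    {P Q P' Q' : C.KarObj} {a b c : ℤ} (ha : a = 0 - (e₁' - e₁)) (hb : b = 0 - (e₂' - e₂))
    (h : a + b = c) (f : C.Hom a P.X P'.X) (g : C.Hom b Q.X Q'.X) :
    T.kar.matHom (add_zero 0) (rawHom J₁ J₁' e₁ e₁' P P' a f) (rawHom J₂ J₂' e₂ e₂' Q Q' b g) =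
      rawHom (J₁ × J₂) (J₁' × J₂') (e₁ + e₂) (e₁' + e₂') (T.karObj P Q) (T.karObj P' Q') c
        (T.hom h f g) := by
  rw [rawHom_apply ha, rawHom_apply hb]
  refine Eq.trans ?_ (rawHom_apply (J := J₁ × J₂) (J' := J₁' × J₂')
    (Q := T.karObj P Q) (Q' := T.karObj P' Q')
    (by omega : c = 0 - (e₁' + e₂' - (e₁ + e₂))) (T.hom h f g)).symm
  funext _ _
  have key : ∀ {a' b' c' : ℤ} (ha : a = a') (hb : b = b') (hc : c = c') (h' : a' + b' = c'),
      T.kar.hom (X := P) (X' := P') (Y := Q) (Y' := Q') h' (C.Kar.castDeg ha (C.sandwich P P' f))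
        (C.Kar.castDeg hb (C.sandwich Q Q' g)) =
      C.Kar.castDeg hc (C.sandwich (T.karObj P Q) (T.karObj P' Q') (T.hom h f g)) := by
    intro a' b' c' ha hb hc h'
    subst ha hb hc
    refine Subtype.ext ?_
    change T.hom h (C.comp _ (C.comp _ P.e f) P'.e) (C.comp _ (C.comp _ Q.e g) Q'.e) =
      C.comp _ (C.comp _ (T.hom _ P.e Q.e) (T.hom h f g)) (T.hom _ P'.e Q'.e)
    rw [T.hom_comp (add_zero a) (add_zero b) (add_zero c) h (add_zero 0) h,
      T.hom_comp (zero_add a) (zero_add b) (zero_add c) (add_zero 0) h h]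
  exact key _ _ _ _

/-! ### The maps to a tensor product of two Kirby objects through a single term. -/

namespace Kirby

open GrCat Pres

namespace Pres

variable {K : Type u} [Field K] {X : Gens} {R : TmRel K X}

theorem castR_comp_tens {a b c d e : ℤ} (h : a + b = c) (h' : d + c = e)
    {r s s' t t' w w' u u' : List (Option X.E)} (e₁ : w = w') (e₂ : u = u') (f : Hom R d r w)
    (hs : s ++ s' = w) (ht : t ++ t' = u) (hs' : s ++ s' = w') (ht' : t ++ t' = u')
    (g : Hom R a s t) (k : Hom R b s' t') :
    comp h' (castR e₁ f) (tens h hs' ht' g k) = castR e₂ (comp h' f (tens h hs ht g k)) := by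
  subst e₁ e₂; rfl

theorem V_eq_tens_left {p q N : ℕ} (hN : p + q = N) (hs : blk p ++ blk q = (blk N : List (Option X.E)))
    (ht : blk (p + 2) ++ blk q = (blk (N + 2) : List (Option X.E))) :
    (V N p : Hom R 2 _ _) = tens (add_zero 2) hs ht (V p p) (id (blk q)) := by
  rw [← ins_left (s := p) (t := p + 2) (N := N) (N' := N + 2) q (by omega) (by omega), ins_cupAt _ _ _ le_rfl,
    Nat.zero_add]

theorem V_eq_tens_right {p q N : ℕ} (hN : p + q = N) (hs : blk p ++ blk q = (blk N : List (Option X.E)))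
    (ht : blk p ++ blk (q + 2) = (blk (N + 2) : List (Option X.E))) :
    (V N N : Hom R 2 _ _) = tens (zero_add 2) hs ht (id (blk p)) (V q q) := by
  rw [← ins_right (s := q) (t := q + 2) (N := N) (N' := N + 2) p (by omega) (by omega), ins_cupAt _ _ _ le_rfl,
    hN]

end Pres

variable {K : Type u} [Field K]

/-- The object `P_p ⊗ P_q` lives on a concatenation of words, whereas the functionals use a single
block of `N` strands; `castR` along this equality mediates. -/
theorem append_blk {X : Gens} {p q N : ℕ} (hN : p + q = N) :
    (blk N : List (Option X.E)) = List.append (blk p) (blk q) := by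
  rw [← hN]; exact (blk_add p q).symm

theorem comp_castR_jwTensor {s : List (Option noGens.E)} {p q N : ℕ} (hN : p + q = N) {D : ℤ}
    (f : Pres.Hom (noRel K) D s (blk N)) :
    comp (add_zero D) (castR (append_blk hN) f)
      (Pres.tens (add_zero 0) rfl rfl (jw p) (jw q)) =
        castR (append_blk hN) (comp (add_zero D) f (jwPair hN)) := by
  rw [jwPair_eq hN]
  exact castR_comp_tens _ _ _ _ _ _ _ _ _ _ _

variable [CharZero K]

theorem step_deg (d : ℤ) (v r : ℕ) :
    (2 : ℤ) = 0 - ((d - (v + 2 * (r + 1 : ℕ))) - (d - (v + 2 * r))) := by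
  push_cast; ring

/-- The index type of a term `P_p ⊗ P_q`, to which `rawHom_comp` and `rawHom_id` are applied. -/
instance : Unique (Unit × Unit) := ⟨⟨((), ())⟩, fun _ => rfl⟩

theorem kirby_map_id (d : ℤ) (v r : ℕ) :
    (kirby K d v).map (𝟙 (stage r)) =
      rawHom Unit Unit (d - (v + 2 * r)) (d - (v + 2 * r)) (jwObj K (v + 2 * r))
        (jwObj K (v + 2 * r)) 0 (Pres.id (blk (v + 2 * r))) :=
  (IndObj.map_id (kirby K d v) (stage r)).trans (rawHom_id rfl _ rfl).symm

section Tensor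

variable (J : Type) [Fintype J] (e : ℤ) (Q : (dTL K).KarObj)

/-- Diagrams with `i + 2k` outgoing strands next to `j + 2l` outgoing strands, as elements of
`colim Hom(-, κ_i ⊗ κ_j)`. -/
noncomputable def tensorLeg (i j k l : ℕ) {N : ℕ} (hN : i + 2 * k + (j + 2 * l) = N) (D : ℤ) :
    Pres.Hom (noRel K) D (word Q) (blk N) →ₗ[K]
      (dTL K).Kar.Mat.ColimHom 0 (sing J e Q) (kirbyTensor K i j) where
  toFun f := ColimHom.mk (kirbyTensor K i j) (⟨k⟩, ⟨l⟩)
    (rawHom J (Unit × Unit) e (0 - (i + 2 * k) + (0 - (j + 2 * l))) Q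
      (jwTensor K (i + 2 * k) (j + 2 * l)) D (castR (append_blk hN) f))
  map_add' f g := (congrArg _ ((congrArg _ (map_add (castR (append_blk hN)) f g)).trans
    (map_add (rawHom J (Unit × Unit) e _ Q (jwTensor K (i + 2 * k) (j + 2 * l)) D) _ _))).trans
    ((ColimHom.mk (kirbyTensor K i j) (⟨k⟩, ⟨l⟩)).map_add _ _)
  map_smul' c f := (congrArg _ ((congrArg _ (map_smul (castR (append_blk hN)) c f)).trans
    (map_smul (rawHom J (Unit × Unit) e _ Q (jwTensor K (i + 2 * k) (j + 2 * l)) D) _ _))).trans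
    ((ColimHom.mk (kirbyTensor K i j) (⟨k⟩, ⟨l⟩)).map_smul _ _)

theorem tensorLeg_apply (i j k l : ℕ) {N : ℕ} (hN : i + 2 * k + (j + 2 * l) = N) (D : ℤ)
    (f : Pres.Hom (noRel K) D (word Q) (blk N)) :
    tensorLeg J e Q i j k l hN D f = ColimHom.mk (kirbyTensor K i j) (⟨k⟩, ⟨l⟩)
    (rawHom J (Unit × Unit) e (0 - (i + 2 * k) + (0 - (j + 2 * l))) Q
      (jwTensor K (i + 2 * k) (j + 2 * l)) D (castR (append_blk hN) f)) := rfl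

theorem tensorLeg_of_ne {i j k l : ℕ} {N : ℕ} (hN : i + 2 * k + (j + 2 * l) = N) {D : ℤ}
    (h : D ≠ N + e) : tensorLeg J e Q i j k l hN D = 0 := by
  refine LinearMap.ext fun f => ?_
  rw [tensorLeg_apply, rawHom_of_ne (by omega)]
  exact (ColimHom.mk (kirbyTensor K i j) (⟨k⟩, ⟨l⟩)).map_zero

theorem nullOn_tensorLeg (i j k l : ℕ) {N : ℕ} (hN : i + 2 * k + (j + 2 * l) = N) (D : ℤ) :
    NullOn (jwPair hN) (tensorLeg J e Q i j k l hN D) := fun g hg => by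
  rw [← map_zero (tensorLeg J e Q i j k l hN D)]
  refine congrArg (ColimHom.mk (kirbyTensor K i j) (⟨k⟩, ⟨l⟩))
    (rawHom_congr (Q' := jwTensor K (i + 2 * k) (j + 2 * l)) ?_)
  refine (comp_castR_jwTensor hN g).trans ?_
  rw [hg, map_zero]
  exact ((congrArg (fun q => comp (add_zero D) q (jwTensor K (i + 2 * k) (j + 2 * l)).e)
    (map_zero (castR (append_blk hN)))).trans (zero_comp' (add_zero D) _)).symm

theorem kirbyTensor_map_step_left (i j k l : ℕ) :
    (kirbyTensor K i j).map (i := (stage k, stage l)) (j := (stage (k + 1), stage l))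
        (step (Nat.le_succ k), 𝟙 (stage l)) =
      rawHom (Unit × Unit) (Unit × Unit) (0 - (i + 2 * k) + (0 - (j + 2 * l)))
        (0 - (i + 2 * (k + 1 : ℕ)) + (0 - (j + 2 * l))) (jwTensor K (i + 2 * k) (j + 2 * l))
        (jwTensor K (i + 2 * (k + 1)) (j + 2 * l)) 2
          (Pres.tens (add_zero 2) rfl rfl (V (i + 2 * k) (i + 2 * k)) (Pres.id (blk (j + 2 * l)))) := by
  refine (congrArg₂ (fun p q => (dTLTensor K).hom (add_zero 0) p q) (kirby_map_step 0 i k)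
    (kirby_map_id 0 j l)).trans ?_
  exact rawHom_tens (Pres.tensor (noRel K)) (step_deg 0 i k) (by ring)
    (add_zero 2) _ _

/-- The transition map of the first factor adds its dotted cup at the right end of the first group,
which is the position of the wall. -/
theorem tensorLeg_succ_left (i j k l : ℕ) {N : ℕ} (hN : i + 2 * k + (j + 2 * l) = N) {D D' : ℤ}
    (h : D + 2 = D') (f : Pres.Hom (noRel K) D (word Q) (blk N)) :
    tensorLeg J e Q i j (k + 1) l (N := N + 2) (by omega) D' (comp h f (V N (i + 2 * k))) =
      tensorLeg J e Q i j k l hN D f := by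
  refine ((nullOn_tensorLeg J e Q i j (k + 1) l (N := N + 2) (by omega) D').absorb_jwPair_left hN h f).symm.trans ?_
  by_cases hD : D = N + e
  · have h1 := ColimHom.mk_map (kirbyTensor K i j) (j := (stage k, stage l))
      (j' := (stage (k + 1), stage l)) (step (Nat.le_succ k), 𝟙 (stage l)) (add_zero 0)
      (rawHom J (Unit × Unit) e (0 - (i + 2 * k) + (0 - (j + 2 * l))) Q
        (jwTensor K (i + 2 * k) (j + 2 * l)) D (castR (append_blk hN) f))
    rw [kirbyTensor_map_step_left] at h1
    refine Eq.trans ?_ h1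
    refine congrArg (ColimHom.mk (kirbyTensor K i j) (stage (k + 1), stage l)) (Eq.trans ?_
      (rawHom_comp (J := J) (J' := Unit × Unit) (J'' := Unit × Unit)
        (e' := 0 - (i + 2 * k) + (0 - (j + 2 * l))) (e'' := 0 - (i + 2 * (k + 1 : ℕ)) + (0 - (j + 2 * l)))
        (Q' := jwTensor K (i + 2 * k) (j + 2 * l)) (Q'' := jwTensor K (i + 2 * (k + 1)) (j + 2 * l))
        h (by omega) (castR (append_blk hN) f)
        (Pres.tens (add_zero 2) rfl rfl (V (i + 2 * k) (i + 2 * k)) (Pres.id (blk (j + 2 * l))))).symm)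
    refine congrArg _ ?_
    refine Eq.trans ?_ (congrArg (fun q => comp h q _) (comp_castR_jwTensor hN f).symm)
    rw [V_eq_tens_left hN (by rw [blk_add, hN]) (by rw [blk_add]; congr 1; omega)]
    exact (castR_comp_tens _ _ _ _ _ _ _ _ _ _ _).symm
  · rw [tensorLeg_of_ne _ _ _ _ hD, tensorLeg_of_ne _ _ _ _ (by push_cast; omega)]
    rfl

theorem kirbyTensor_map_step_right (i j k l : ℕ) :
    (kirbyTensor K i j).map (i := (stage k, stage l)) (j := (stage k, stage (l + 1)))
        (𝟙 (stage k), step (Nat.le_succ l)) =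
      rawHom (Unit × Unit) (Unit × Unit) (0 - (i + 2 * k) + (0 - (j + 2 * l)))
        (0 - (i + 2 * k) + (0 - (j + 2 * (l + 1 : ℕ)))) (jwTensor K (i + 2 * k) (j + 2 * l))
        (jwTensor K (i + 2 * k) (j + 2 * (l + 1))) 2
          (Pres.tens (zero_add 2) rfl rfl (Pres.id (blk (i + 2 * k))) (V (j + 2 * l) (j + 2 * l))) := by
  refine (congrArg₂ (fun p q => (dTLTensor K).hom (add_zero 0) p q) (kirby_map_id 0 i k)
    (kirby_map_step 0 j l)).trans ?_
  exact rawHom_tens (Pres.tensor (noRel K)) (by ring) (step_deg 0 j l)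
    (zero_add 2) _ _

theorem tensorLeg_succ_right (i j k l : ℕ) {N : ℕ} (hN : i + 2 * k + (j + 2 * l) = N) {D D' : ℤ}
    (h : D + 2 = D') (f : Pres.Hom (noRel K) D (word Q) (blk N)) :
    tensorLeg J e Q i j k (l + 1) (N := N + 2) (by omega) D' (comp h f (V N N)) =
      tensorLeg J e Q i j k l hN D f := by
  refine ((nullOn_tensorLeg J e Q i j k (l + 1) (N := N + 2) (by omega) D').absorb_jwPair_right hN h f).symm.trans ?_
  by_cases hD : D = N + e
  · have h1 := ColimHom.mk_map (kirbyTensor K i j) (j := (stage k, stage l))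
      (j' := (stage k, stage (l + 1))) (𝟙 (stage k), step (Nat.le_succ l)) (add_zero 0)
      (rawHom J (Unit × Unit) e (0 - (i + 2 * k) + (0 - (j + 2 * l))) Q
        (jwTensor K (i + 2 * k) (j + 2 * l)) D (castR (append_blk hN) f))
    rw [kirbyTensor_map_step_right] at h1
    refine Eq.trans ?_ h1
    refine congrArg (ColimHom.mk (kirbyTensor K i j) (stage k, stage (l + 1))) (Eq.trans ?_
      (rawHom_comp (J := J) (J' := Unit × Unit) (J'' := Unit × Unit)
        (e' := 0 - (i + 2 * k) + (0 - (j + 2 * l)))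
        (e'' := 0 - (i + 2 * k) + (0 - (j + 2 * (l + 1 : ℕ))))
        (Q' := jwTensor K (i + 2 * k) (j + 2 * l)) (Q'' := jwTensor K (i + 2 * k) (j + 2 * (l + 1)))
        h (by omega) (castR (append_blk hN) f)
        (Pres.tens (zero_add 2) rfl rfl (Pres.id (blk (i + 2 * k))) (V (j + 2 * l) (j + 2 * l)))).symm)
    refine congrArg _ ?_
    refine Eq.trans ?_ (congrArg (fun q => comp h q _) (comp_castR_jwTensor hN f).symm)
    rw [V_eq_tens_right hN (by rw [blk_add, hN]) (by rw [blk_add]; congr 1; omega)]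
    exact (castR_comp_tens _ _ _ _ _ _ _ _ _ _ _).symm
  · rw [tensorLeg_of_ne _ _ _ _ hD, tensorLeg_of_ne _ _ _ _ (by push_cast; omega)]
    rfl

end Tensor

section Pre

variable (J J' : Type) [Fintype J] [Fintype J'] [Unique J'] (e e' : ℤ) (Q Q' : (dTL K).KarObj)

theorem pre_kirbyLeg (d : ℤ) (v r : ℕ) {δ D D' : ℤ} (hδ : δ = 0 - (e' - e)) (h : δ + D = D')
    (g : Pres.Hom (noRel K) δ (word Q) (word Q'))
    (f : Pres.Hom (noRel K) D (word Q') (blk (v + 2 * r))) :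
    ColimHom.pre (zero_add 0) (rawHom J J' e e' Q Q' δ g) (kirby K d v)
        (kirbyLeg J' e' Q' d v r D f) =
      kirbyLeg J e Q d v r D' (comp h (comp (add_zero δ) g Q'.e) f) :=
  (ColimHom.pre_mk _ _ _ _ _).trans (congrArg (ColimHom.mk (kirby K d v) ⟨r⟩)
    (rawHom_comp (Q' := Q') (Q'' := jwObj K (v + 2 * r)) h hδ g f))

theorem pre_tensorLeg (i j k l : ℕ) {N : ℕ} (hN : i + 2 * k + (j + 2 * l) = N) {δ D D' : ℤ}
    (hδ : δ = 0 - (e' - e)) (h : δ + D = D') (g : Pres.Hom (noRel K) δ (word Q) (word Q'))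
    (f : Pres.Hom (noRel K) D (word Q') (blk N)) :
    ColimHom.pre (zero_add 0) (rawHom J J' e e' Q Q' δ g) (kirbyTensor K i j)
        (tensorLeg J' e' Q' i j k l hN D f) =
      tensorLeg J e Q i j k l hN D' (comp h (comp (add_zero δ) g Q'.e) f) := by
  refine Eq.trans ?_ (congrArg (fun q => ColimHom.mk (kirbyTensor K i j) (⟨k⟩, ⟨l⟩)
    (rawHom J (Unit × Unit) e (0 - (i + 2 * k) + (0 - (j + 2 * l))) Q
      (jwTensor K (i + 2 * k) (j + 2 * l)) D' q)) (comp_castR h (append_blk hN) _ _))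
  exact (ColimHom.pre_mk _ _ _ _ _).trans (congrArg (ColimHom.mk (kirbyTensor K i j) (⟨k⟩, ⟨l⟩))
    (rawHom_comp (J := J) (J' := J') (J'' := Unit × Unit) (e'' := 0 - (i + 2 * k) + (0 - (j + 2 * l)))
      (Q' := Q') (Q'' := jwTensor K (i + 2 * k) (j + 2 * l)) h hδ g (castR (append_blk hN) f)))

end Pre

end Kirby

/-! ### The systems of functionals attached to Kirby objects. -/

namespace Kirby

open GrCat Pres

-- A device for vanishing statements: the restriction of a system to a condition that dotted cups
-- preserve is again a system. If it agrees with the original on large diagrams, it agrees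
-- everywhere by `IsSys2.ext_add`.
open scoped Classical in
theorem Pres.IsSys2.restrict {K : Type u} [Field K] {X : Gens} {R : TmRel K X}
    {s : List (Option X.E)} {M : Type*} [AddCommGroup M] [Module K M] {E : Fam2 R s M}
    (hE : IsSys2 E) (P : ℕ → ℕ → ℕ → ℤ → Prop)
    (hl : ∀ p q N d, P (p + 2) q (N + 2) (d + 2) ↔ P p q N d)
    (hr : ∀ p q N d, P p (q + 2) (N + 2) (d + 2) ↔ P p q N d) :
    IsSys2 (fun p q N d h => if P p q N d then E p q N d h else 0) where
  cupL h hm f := by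
    split_ifs
    · exact hE.cupL h hm f
    · rfl
  cupR h hm hm' f := by
    split_ifs
    · exact hE.cupR h hm hm' f
    · rfl
  dotCupL h hm f := by
    simp only [hl]
    split_ifs
    · exact hE.dotCupL h hm f
    · rfl
  dotCupR h hm hm' f := by
    simp only [hr]
    split_ifs
    · exact hE.dotCupR h hm hm' f
    · rfl

variable {K : Type u} [Field K] [CharZero K]

section Families

variable (J : Type) [Fintype J] (e : ℤ) (Q : (dTL K).KarObj)

/-! ### The families of functionals that are given by the Kirby objects -/

open scoped Classical in
/-- Diagrams as elements of `colim Hom(-, q^d κ_v)`, for at least `v` outgoing strands. -/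
noncomputable def kirbyFam₀ (d : ℤ) (v : ℕ) : Fam1 (noRel K) (word Q)
    ((dTL K).Kar.Mat.ColimHom 0 (sing J e Q) (kirby K d v)) := fun N D =>
  if h : ∃ r, v + 2 * r = N then
    kirbyLeg J e Q d v h.choose D ∘ₗ castR (congrArg blk h.choose_spec.symm) else 0

theorem kirbyFam₀_leg (d : ℤ) (v r : ℕ) (D : ℤ) :
    kirbyFam₀ J e Q d v (v + 2 * r) D = kirbyLeg J e Q d v r D := by
  have h : ∃ r', v + 2 * r' = v + 2 * r := ⟨r, rfl⟩
  rw [kirbyFam₀, dif_pos h]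
  have key : ∀ r' (h : v + 2 * r' = v + 2 * r),
      kirbyLeg J e Q d v r' D ∘ₗ castR (congrArg blk h.symm) = kirbyLeg J e Q d v r D := by
    intro r' h
    obtain rfl : r' = r := by omega
    rfl
  exact key _ h.choose_spec

theorem kirbyFam₀_of_ne {d : ℤ} {v N : ℕ} (h : ¬ ∃ r, v + 2 * r = N) (D : ℤ) :
    kirbyFam₀ J e Q d v N D = 0 := by
  rw [kirbyFam₀, dif_neg h]

/-- Cups are killed by the final projector. By neck cutting, a dotted cup may be moved under that
projector to the right end, where it is the transition map. -/
theorem isSys1From_kirbyFam₀ (d : ℤ) (v : ℕ) : IsSys1From v (kirbyFam₀ J e Q d v) where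
  cup {N m D} hv hm f := by
    by_cases h : ∃ r, v + 2 * r = N
    · obtain ⟨r, rfl⟩ := h
      refine (congrArg (fun L : _ →ₗ[K] _ => L _) (kirbyFam₀_leg J e Q d v (r + 1) D)).trans ?_
      exact (nullOn_kirbyLeg J e Q d v (r + 1) D).apply_U (U_jw hm) f
    · rw [kirbyFam₀_of_ne, LinearMap.zero_apply]
      exact fun ⟨r, hr⟩ => h ⟨r - 1, by omega⟩
  dotCup {N m D} hv hm f := by
    by_cases h : ∃ r, v + 2 * r = N
    · obtain ⟨r, rfl⟩ := h
      refine (congrArg (fun L : _ →ₗ[K] _ => L _) (kirbyFam₀_leg J e Q d v (r + 1) (D + 2))).trans ?_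
      rw [kirbyFam₀_leg]
      exact ((nullOn_kirbyLeg J e Q d v (r + 1) (D + 2)).apply_V le_rfl
        (fun m _ hm => U_jw hm) (Nat.zero_le m) hm rfl f).trans (kirbyLeg_succ J e Q d v r rfl f)
    · rw [kirbyFam₀_of_ne _ _ _ h, kirbyFam₀_of_ne, LinearMap.zero_apply, LinearMap.zero_apply]
      exact fun ⟨r, hr⟩ => h ⟨r - 1, by omega⟩

/-- Diagrams as elements of `colim Hom(-, q^d κ_v)`. -/
noncomputable def kirbyFam (d : ℤ) (v : ℕ) : Fam1 (noRel K) (word Q)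
    ((dTL K).Kar.Mat.ColimHom 0 (sing J e Q) (kirby K d v)) :=
  Fam1.shift^[v] (kirbyFam₀ J e Q d v)

theorem isSys1_kirbyFam (d : ℤ) (v : ℕ) : IsSys1 (kirbyFam J e Q d v) :=
  (isSys1From_kirbyFam₀ J e Q d v).shift_iterate.1

theorem kirbyFam_leg (d : ℤ) (v r : ℕ) (D : ℤ) :
    kirbyFam J e Q d v (v + 2 * r) D = kirbyLeg J e Q d v r D :=
  ((isSys1From_kirbyFam₀ J e Q d v).shift_iterate.2 _ _ (Nat.le_add_right _ _)).trans
    (kirbyFam₀_leg J e Q d v r D)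

open scoped Classical in
/-- Diagrams as elements of `colim Hom(-, κ_i ⊗ κ_j)`, for at least `i` and `j` outgoing strands. -/
noncomputable def tensorFam₀ (i j : ℕ) : Fam2 (noRel K) (word Q)
    ((dTL K).Kar.Mat.ColimHom 0 (sing J e Q) (kirbyTensor K i j)) := fun p q N D hN =>
  if h : ∃ kl : ℕ × ℕ, i + 2 * kl.1 = p ∧ j + 2 * kl.2 = q then
    tensorLeg J e Q i j h.choose.1 h.choose.2 (N := N)
      (by have := h.choose_spec; have := hN.down; omega) D else 0

theorem tensorFam₀_leg (i j k l : ℕ) {N : ℕ} (hN : i + 2 * k + (j + 2 * l) = N) (D : ℤ) :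
    tensorFam₀ J e Q i j (i + 2 * k) (j + 2 * l) N D ⟨hN⟩ = tensorLeg J e Q i j k l hN D := by
  have h : ∃ kl : ℕ × ℕ, i + 2 * kl.1 = i + 2 * k ∧ j + 2 * kl.2 = j + 2 * l := ⟨(k, l), rfl, rfl⟩
  rw [tensorFam₀, dif_pos h]
  have key : ∀ (kl : ℕ × ℕ) (h : i + 2 * kl.1 = i + 2 * k ∧ j + 2 * kl.2 = j + 2 * l),
      tensorLeg J e Q i j kl.1 kl.2 (N := N) (by omega) D = tensorLeg J e Q i j k l hN D := by
    rintro ⟨k', l'⟩ h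
    obtain rfl : k' = k := by simp only at h; omega
    obtain rfl : l' = l := by simp only at h; omega
    rfl
  exact key _ h.choose_spec

theorem tensorFam₀_of_ne {i j p q N : ℕ} (hN : PLift (p + q = N))
    (h : ¬ ∃ kl : ℕ × ℕ, i + 2 * kl.1 = p ∧ j + 2 * kl.2 = q) (D : ℤ) :
    tensorFam₀ J e Q i j p q N D hN = 0 := by
  rw [tensorFam₀, dif_neg h]

/-- As for one group; a dotted cup is moved to the right end of its own group before
`tensorLeg_succ_left` or `tensorLeg_succ_right` applies. -/
theorem isSys2From_tensorFam₀ (i j : ℕ) : IsSys2From i j (tensorFam₀ J e Q i j) where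
  cupL {p q N m D} hN hp hq hm f := by
    by_cases h : ∃ kl : ℕ × ℕ, i + 2 * kl.1 = p ∧ j + 2 * kl.2 = q
    · obtain ⟨⟨k, l⟩, rfl, rfl⟩ := h
      refine (congrArg (fun L : _ →ₗ[K] _ => L _)
        (tensorFam₀_leg J e Q i j (k + 1) l (N := N + 2) (by omega) D)).trans ?_
      exact (nullOn_tensorLeg J e Q i j (k + 1) l _ D).apply_U (U_jwPair_left hN _ hm) f
    · rw [tensorFam₀_of_ne, LinearMap.zero_apply]
      exact fun ⟨kl, hr⟩ => h ⟨(kl.1 - 1, kl.2), by simp only; omega⟩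
  cupR {p q N m D} hN hp hq hm hm' f := by
    by_cases h : ∃ kl : ℕ × ℕ, i + 2 * kl.1 = p ∧ j + 2 * kl.2 = q
    · obtain ⟨⟨k, l⟩, rfl, rfl⟩ := h
      refine (congrArg (fun L : _ →ₗ[K] _ => L _)
        (tensorFam₀_leg J e Q i j k (l + 1) (N := N + 2) (by omega) D)).trans ?_
      exact (nullOn_tensorLeg J e Q i j k (l + 1) _ D).apply_U (U_jwPair_right hN _ hm hm') f
    · rw [tensorFam₀_of_ne, LinearMap.zero_apply]
      exact fun ⟨kl, hr⟩ => h ⟨(kl.1, kl.2 - 1), by simp only; omega⟩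
  dotCupL {p q N m D} hN hp hq hm f := by
    by_cases h : ∃ kl : ℕ × ℕ, i + 2 * kl.1 = p ∧ j + 2 * kl.2 = q
    · obtain ⟨⟨k, l⟩, rfl, rfl⟩ := h
      refine (congrArg (fun L : _ →ₗ[K] _ => L _)
        (tensorFam₀_leg J e Q i j (k + 1) l (N := N + 2) (by omega) (D + 2))).trans ?_
      rw [tensorFam₀_leg]
      exact ((nullOn_tensorLeg J e Q i j (k + 1) l _ (D + 2)).apply_V (Nat.le.intro hN)
        (fun m _ hm => U_jwPair_left hN _ hm) (Nat.zero_le m) hm rfl f).trans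
        (tensorLeg_succ_left J e Q i j k l hN rfl f)
    · rw [tensorFam₀_of_ne _ _ _ _ h, tensorFam₀_of_ne, LinearMap.zero_apply, LinearMap.zero_apply]
      exact fun ⟨kl, hr⟩ => h ⟨(kl.1 - 1, kl.2), by simp only; omega⟩
  dotCupR {p q N m D} hN hp hq hm hm' f := by
    by_cases h : ∃ kl : ℕ × ℕ, i + 2 * kl.1 = p ∧ j + 2 * kl.2 = q
    · obtain ⟨⟨k, l⟩, rfl, rfl⟩ := h
      refine (congrArg (fun L : _ →ₗ[K] _ => L _)
        (tensorFam₀_leg J e Q i j k (l + 1) (N := N + 2) (by omega) (D + 2))).trans ?_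
      rw [tensorFam₀_leg]
      exact ((nullOn_tensorLeg J e Q i j k (l + 1) _ (D + 2)).apply_V le_rfl
        (fun m hm hm' => U_jwPair_right hN _ hm hm') hm hm' rfl f).trans
        (tensorLeg_succ_right J e Q i j k l hN rfl f)
    · rw [tensorFam₀_of_ne _ _ _ _ h, tensorFam₀_of_ne, LinearMap.zero_apply, LinearMap.zero_apply]
      exact fun ⟨kl, hr⟩ => h ⟨(kl.1, kl.2 - 1), by simp only; omega⟩

/-- Diagrams as elements of `colim Hom(-, κ_i ⊗ κ_j)`. -/
noncomputable def tensorFam (i j : ℕ) : Fam2 (noRel K) (word Q)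
    ((dTL K).Kar.Mat.ColimHom 0 (sing J e Q) (kirbyTensor K i j)) :=
  (tensorFam₀ J e Q i j).extend i j

theorem isSys2_tensorFam (i j : ℕ) : IsSys2 (tensorFam J e Q i j) :=
  (isSys2From_tensorFam₀ J e Q i j).extend

theorem tensorFam_leg (i j k l : ℕ) {N : ℕ} (hN : i + 2 * k + (j + 2 * l) = N) (D : ℤ) :
    tensorFam J e Q i j (i + 2 * k) (j + 2 * l) N D ⟨hN⟩ = tensorLeg J e Q i j k l hN D :=
  ((isSys2From_tensorFam₀ J e Q i j).extend_eq ⟨hN⟩ (Nat.le_add_right _ _)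
    (Nat.le_add_right _ _)).trans (tensorFam₀_leg J e Q i j k l hN D)

/-- Elements of `colim Hom(-, κ_i ⊗ κ_j)` are nonzero only in the right degree and parity. -/
theorem tensorFam_of_ne {i j p q N : ℕ} {D : ℤ} (hN : PLift (p + q = N))
    (h : ¬ (p % 2 = i % 2 ∧ q % 2 = j % 2 ∧ D = N + e)) : tensorFam J e Q i j p q N D hN = 0 := by
  refine LinearMap.ext fun f => ?_
  -- The family is compared with its restriction to the right degree and parity. Adding `i` and `j`
  -- dotted cups reaches diagrams where the family is given by the terms of the system.
  refine ((isSys2_tensorFam J e Q i j).ext_add (k := i) (l := j) ((isSys2_tensorFam J e Q i j).restrict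
    (fun p q N D => p % 2 = i % 2 ∧ q % 2 = j % 2 ∧ D = N + e) (fun p q N D => by push_cast; omega)
    (fun p q N D => by push_cast; omega)) hN.down (fun p' q' N' hp hq hN' D' f => ?_) D f).trans ?_
  · split_ifs with h'
    · rfl
    · by_cases hkl : ∃ kl : ℕ × ℕ, i + 2 * kl.1 = p' ∧ j + 2 * kl.2 = q'
      · obtain ⟨⟨k, l⟩, rfl, rfl⟩ := hkl
        rw [tensorFam_leg, tensorLeg_of_ne]
        intro hD
        exact h' ⟨by omega, by omega, hD⟩
      · rw [tensorFam, (isSys2From_tensorFam₀ J e Q i j).extend_eq _ (by omega) (by omega),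
          tensorFam₀_of_ne _ _ _ _ hkl]
  · rw [if_neg h]

end Families

section Natural

variable (J J' : Type) [Fintype J] [Fintype J'] [Unique J'] (e e' : ℤ) (Q Q' : (dTL K).KarObj)

/-- The idempotent of `Q'` appears because composition with a matrix over the Karoubi envelope
inserts it after `g`. -/
theorem natural_kirbyFam (d : ℤ) (v : ℕ) {δ : ℤ} (hδ : δ = 0 - (e' - e))
    (g : Pres.Hom (noRel K) δ (word Q) (word Q')) :
    (kirbyFam J' e' Q' d v).Natural
      (ColimHom.pre (zero_add 0) (rawHom J J' e e' Q Q' δ g) (kirby K d v))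
      (comp (add_zero δ) g Q'.e) (kirbyFam J e Q d v) := by
  refine Fam1.Natural.shift_iterate (fun N D D' h f => ?_) v
  by_cases hN : ∃ r, v + 2 * r = N
  · obtain ⟨r, rfl⟩ := hN
    rw [kirbyFam₀_leg, kirbyFam₀_leg]
    exact pre_kirbyLeg J J' e e' Q Q' d v r hδ h g f
  · rw [kirbyFam₀_of_ne _ _ _ hN, kirbyFam₀_of_ne _ _ _ hN]
    exact (ColimHom.pre _ _ _).map_zero

theorem natural_tensorFam (i j : ℕ) {δ : ℤ} (hδ : δ = 0 - (e' - e))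
    (g : Pres.Hom (noRel K) δ (word Q) (word Q')) :
    (tensorFam J' e' Q' i j).Natural
      (ColimHom.pre (zero_add 0) (rawHom J J' e e' Q Q' δ g) (kirbyTensor K i j))
      (comp (add_zero δ) g Q'.e) (tensorFam J e Q i j) := by
  refine Fam2.Natural.extend (fun p q N D D' ⟨hN⟩ h f => ?_) i j
  by_cases hp : ∃ kl : ℕ × ℕ, i + 2 * kl.1 = p ∧ j + 2 * kl.2 = q
  · obtain ⟨⟨k, l⟩, rfl, rfl⟩ := hp
    rw [tensorFam₀_leg, tensorFam₀_leg]
    exact pre_tensorLeg J J' e e' Q Q' i j k l hN hδ h g f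
  · rw [tensorFam₀_of_ne _ _ _ _ hp, tensorFam₀_of_ne _ _ _ _ hp]
    exact (ColimHom.pre _ _ _).map_zero

end Natural

end Kirby

/-! ### Construction of the inclusions and projections between ind-objects. -/

namespace Kirby

open GrCat Pres

open scoped Classical in
theorem Pres.IsSys1.restrict {K : Type u} [Field K] {X : Gens} {R : TmRel K X}
    {s : List (Option X.E)} {M : Type*} [AddCommGroup M] [Module K M] {I : Fam1 R s M}
    (hI : IsSys1 I) (P : ℕ → ℤ → Prop) (h : ∀ N d, P (N + 2) (d + 2) ↔ P N d) :
    IsSys1 (fun N d => if P N d then I N d else 0) where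
  cup hm f := by
    split_ifs
    · exact hI.cup hm f
    · rfl
  dotCup hm f := by
    simp only [h]
    split_ifs
    · exact hI.dotCup hm f
    · rfl

variable {K : Type u} [Field K] [CharZero K]

section Support

variable (J : Type) [Fintype J] (e : ℤ) (Q : (dTL K).KarObj)

/-- Elements of `colim Hom(-, q^d κ_v)` are nonzero only in the right degree and parity. -/
theorem kirbyFam_of_ne {d : ℤ} {v N : ℕ} {D : ℤ} (h : ¬ (N % 2 = v % 2 ∧ D = N - d + e)) :
    kirbyFam J e Q d v N D = 0 := by
  refine LinearMap.ext fun f => ?_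
  refine ((isSys1_kirbyFam J e Q d v).ext_add (k := v) ((isSys1_kirbyFam J e Q d v).restrict
    (fun N D => N % 2 = v % 2 ∧ D = N - d + e) (fun N D => by push_cast; omega))
    (fun N' hN D' f => ?_) D f).trans ?_
  · split_ifs with h'
    · rfl
    · by_cases hr : ∃ r, v + 2 * r = N'
      · obtain ⟨r, rfl⟩ := hr
        rw [kirbyFam_leg, kirbyLeg_of_ne]
        intro hD
        exact h' ⟨by omega, by push_cast; omega⟩
      · rw [kirbyFam, (isSys1From_kirbyFam₀ J e Q d v).shift_iterate.2 _ _ (by omega),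
          kirbyFam₀_of_ne _ _ _ hr]
  · rw [if_neg h]

theorem tensorFam_hole_of_ne {i j n b N : ℕ} {D : ℤ} (hb : b < 2)
    (h : ¬ (N % 2 = (i + j) % 2 ∧ (n + b) % 2 = j % 2 ∧ D = N + 2 * n + e)) :
    (tensorFam J e Q i j).hole n b N D = 0 := by
  refine LinearMap.ext fun f => ?_
  rw [Fam2.hole_apply _ hb rfl rfl, tensorFam_of_ne, LinearMap.zero_apply, LinearMap.zero_apply]
  push_cast
  omega

theorem kirbyFam_proj_of_ne {d : ℤ} {v n p q N : ℕ} {D : ℤ} (hN : p + q = N)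
    (h : ¬ (N % 2 = v % 2 ∧ D = N - d - 2 * n + e)) :
    (kirbyFam J e Q d v).proj n p q N D ⟨hN⟩ = 0 := by
  refine LinearMap.ext fun f => ?_
  refine Eq.trans (congrArg (((-1) ^ n.choose 2 * (n.factorial : K)⁻¹) • ·) (Eq.trans
    (Fam2.zeta_iterate_apply (kirbyFam J e Q d v).merge n hN rfl f) ?_)) (smul_zero _)
  exact congrArg (fun L : _ →ₗ[K] _ => L _) (kirbyFam_of_ne J e Q (by omega))

end Support

/-! ### The inclusions and projections of the ind-completion -/

section Incl

variable (d : ℤ) (i j v n b : ℕ)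

/-- The component of the inclusion at the `r`-th term of the system. -/
noncomputable def inclAt (r : ℕ) : (dTL K).Kar.Mat.ColimHom 0 ((kirby K d v).obj ⟨r⟩)
    (kirbyTensor K i j) :=
  (tensorFam Unit (d - (v + 2 * r)) (jwObj K (v + 2 * r)) i j).hole n b (v + 2 * r) 0
    (Pres.id (blk (v + 2 * r)))

/-- A Yoneda argument: `inclAt` is the value at the identity, and naturality gives the value at `f`
followed by a projector. The projector is absorbed since the hole functionals form a system. -/
theorem pre_inclAt (J : Type) [Fintype J] (e : ℤ) (Q : (dTL K).KarObj) (r : ℕ) {D : ℤ}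
    (hD : D = 0 - (d - (v + 2 * r) - e)) (f : Pres.Hom (noRel K) D (word Q) (blk (v + 2 * r))) :
    ColimHom.pre (zero_add 0) (rawHom J Unit e (d - (v + 2 * r)) Q (jwObj K (v + 2 * r)) D f)
      (kirbyTensor K i j) (inclAt d i j v n b r) =
      (tensorFam J e Q i j).hole n b (v + 2 * r) D f := by
  refine ((natural_tensorFam J Unit e (d - (v + 2 * r)) Q (jwObj K (v + 2 * r)) i j hD f).hole n b
    (v + 2 * r) 0 D (add_zero D) _).trans ?_
  exact (congrArg _ (Pres.comp_id (add_zero D) _)).trans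
    (((isSys2_tensorFam J e Q i j).hole n b).apply_jw f)

/-- Compatibility with one transition map is exactly removal of a dotted cup in the system of hole
functionals. -/
theorem compat_inclAt {r r' : AsSmall.{u} ℕ} (f : r ⟶ r') :
    Compat (α := kirby K d v) (fun r => inclAt d i j v n b r.1) f := by
  refine compat_of_step (P := fun f => Compat (α := kirby K d v) (fun r => inclAt d i j v n b r.1) f)
    (fun r => Compat.id (α := kirby K d v) _ r)
    (fun h h' => Compat.comp (α := kirby K d v) h h') (fun r => ?_) f
  refine (congrArg (fun g => ColimHom.pre (zero_add 0) g (kirbyTensor K i j)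
    (inclAt d i j v n b (r + 1))) (kirby_map_step d v r)).trans ?_
  refine (pre_inclAt d i j v n b Unit (d - (v + 2 * r)) (jwObj K (v + 2 * r)) (r + 1)
    (step_deg d v r) _).trans ?_
  have h1 := ((isSys2_tensorFam Unit (d - (v + 2 * r)) (jwObj K (v + 2 * r)) i j).hole n b).dotCup
    (m := v + 2 * r) le_rfl (Pres.id (blk (v + 2 * r)))
  refine Eq.trans (congrArg _ ?_) h1
  exact (Pres.id_comp (zero_add 2) _).symm

/-- The inclusion `q^d κ_v ⟶ κ_i ⊗ κ_j` given by `n` nested cups and `b` dotted cups. -/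
noncomputable def incl : (dTL K).Kar.Mat.IndHom 0 (kirby K d v) (kirbyTensor K i j) :=
  ⟨fun r => inclAt d i j v n b r.1, fun f => compat_inclAt d i j v n b f⟩

/-- With at least `v` strands of the right parity and in the right degree this is `pre_inclAt`. Both
sides are systems, so the formula extends to small diagrams. -/
theorem post_incl (hb : b < 2) (hv : v % 2 = (i + j) % 2) (J : Type) [Fintype J]
    (e : ℤ) (Q : (dTL K).KarObj) (N : ℕ) (D : ℤ) (f : Pres.Hom (noRel K) D (word Q) (blk N)) :
    IndHom.post (add_zero 0) (sing J e Q) (incl (K := K) (-2 * n) i j v n b)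
      (kirbyFam J e Q (-2 * n) v N D f) = (tensorFam J e Q i j).hole n b N D f := by
  have h1 : IsSys1 (fun N D => IndHom.post (add_zero 0) (sing J e Q)
      (incl (K := K) (-2 * n) i j v n b) ∘ₗ kirbyFam J e Q (-2 * n) v N D) :=
    { cup := fun hm f => (congrArg _ ((isSys1_kirbyFam J e Q _ v).cup hm f)).trans
        (IndHom.post _ _ _).map_zero
      dotCup := fun hm f => congrArg _ ((isSys1_kirbyFam J e Q _ v).dotCup hm f) }
  refine h1.ext_add (k := v) ((isSys2_tensorFam J e Q i j).hole n b) (fun N' hN' D f => ?_) D f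
  by_cases hD : N' % 2 = v % 2 ∧ D = N' - (-2 * n) + e
  · obtain ⟨r, rfl⟩ : ∃ r, N' = v + 2 * r := ⟨(N' - v) / 2, by omega⟩
    refine (congrArg (fun L => IndHom.post (add_zero 0) (sing J e Q)
      (incl (K := K) (-2 * n) i j v n b) (L f)) (kirbyFam_leg J e Q (-2 * n) v r D)).trans ?_
    refine (IndHom.post_mk _ _ _ _ _).trans ?_
    exact pre_inclAt (-2 * n) i j v n b J e Q r (by push_cast at hD; omega) f
  · rw [tensorFam_hole_of_ne _ _ _ hb (by omega)]
    refine (congrArg (fun L => IndHom.post (add_zero 0) (sing J e Q)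
      (incl (K := K) (-2 * n) i j v n b) (L f)) (kirbyFam_of_ne J e Q hD)).trans ?_
    exact (IndHom.post _ _ _).map_zero

end Incl

section Proj

variable (d : ℤ) (i j v n : ℕ)

/-- The component of the projection at the term with indices `k` and `l` of the system. -/
noncomputable def projAt (k l : ℕ) : (dTL K).Kar.Mat.ColimHom 0
    ((kirbyTensor K i j).obj (⟨k⟩, ⟨l⟩)) (kirby K d v) :=
  (kirbyFam (Unit × Unit) (0 - (i + 2 * k) + (0 - (j + 2 * l))) (jwTensor K (i + 2 * k) (j + 2 * l))
    d v).proj n (i + 2 * k) (j + 2 * l) (i + 2 * k + (j + 2 * l)) 0 ⟨rfl⟩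
      (castR (append_blk rfl).symm (Pres.id (List.append (blk (i + 2 * k)) (blk (j + 2 * l)))))

theorem comp_jwTensor_castR {s : List (Option noGens.E)} {p q N : ℕ} (hN : p + q = N) {D : ℤ}
    (f : Pres.Hom (noRel K) D s (blk N)) :
    comp (add_zero D) (comp (add_zero D) (castR (append_blk hN) f) (jwTensor K p q).e)
      (castR (append_blk hN).symm (Pres.id (List.append (blk p) (blk q)))) =
    comp (add_zero D) f (jwPair hN) := by
  refine (comp_castR _ _ _ _).trans ?_
  refine (congrArg _ (Pres.comp_id _ _)).trans ?_
  refine (congrArg _ (comp_castR_jwTensor hN f)).trans ?_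
  exact castR_castR _ _ _

theorem pre_projAt (J : Type) [Fintype J] (e : ℤ) (Q : (dTL K).KarObj) (k l : ℕ) {N : ℕ}
    (hN : i + 2 * k + (j + 2 * l) = N) {D : ℤ}
    (hD : D = N + e) (f : Pres.Hom (noRel K) D (word Q) (blk N)) :
    ColimHom.pre (zero_add 0) (rawHom J (Unit × Unit) e (0 - (i + 2 * k) + (0 - (j + 2 * l))) Q
      (jwTensor K (i + 2 * k) (j + 2 * l)) D (castR (append_blk hN) f)) (kirby K d v)
      (projAt d i j v n k l) =
      (kirbyFam J e Q d v).proj n (i + 2 * k) (j + 2 * l) N D ⟨hN⟩ f := by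
  subst hN
  refine ((natural_kirbyFam J (Unit × Unit) e _ Q (jwTensor K (i + 2 * k) (j + 2 * l)) d v
    (by omega) (castR (append_blk rfl) f)).proj n _ _ _ 0 D ⟨rfl⟩ (add_zero D) _).trans ?_
  refine (congrArg _ (comp_jwTensor_castR rfl f)).trans ?_
  exact ((isSys1_kirbyFam J e Q d v).proj n).apply_jwPair rfl f

omit [CharZero K] in
theorem castR_V_left {p q N : ℕ} (hN : p + q = N) (hN' : p + 2 + q = N + 2) :
    (Pres.tens (add_zero 2) rfl rfl (V p p) (Pres.id (blk q)) :
      Pres.Hom (noRel K) 2 (List.append (blk p) (blk q)) (List.append (blk (p + 2)) (blk q))) =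
    castR (append_blk hN') (comp (zero_add 2) (castR (append_blk hN).symm
      (Pres.id (List.append (blk p) (blk q)))) (V N p)) := by
  rw [V_eq_tens_left hN (append_blk hN).symm (append_blk hN').symm,
    castR_comp_tens (add_zero 2) _ _ (append_blk hN').symm _ rfl rfl, castR_castR, castR_rfl, Pres.id_comp]

omit [CharZero K] in
theorem castR_V_right {p q N : ℕ} (hN : p + q = N) (hN' : p + (q + 2) = N + 2) :
    (Pres.tens (zero_add 2) rfl rfl (Pres.id (blk p)) (V q q) :
      Pres.Hom (noRel K) 2 (List.append (blk p) (blk q)) (List.append (blk p) (blk (q + 2)))) =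
    castR (append_blk hN') (comp (zero_add 2) (castR (append_blk hN).symm
      (Pres.id (List.append (blk p) (blk q)))) (V N N)) := by
  rw [V_eq_tens_right hN (append_blk hN).symm (append_blk hN').symm,
    castR_comp_tens (zero_add 2) _ _ (append_blk hN').symm _ rfl rfl, castR_castR, castR_rfl, Pres.id_comp]

theorem compat_projAt_left (l : ℕ) {k k' : AsSmall.{u} ℕ} (f : k ⟶ k') :
    Compat (α := kirbyTensor K i j) (i := (k, stage l)) (j := (k', stage l))
      (fun r => projAt d i j v n r.1.1 r.2.1) (f, 𝟙 (stage l)) := by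
  refine compat_of_step (P := fun {k k'} f => Compat (α := kirbyTensor K i j) (i := (k, stage l))
      (j := (k', stage l)) (fun r => projAt d i j v n r.1.1 r.2.1) (f, 𝟙 (stage l)))
    (fun k => Compat.id (α := kirbyTensor K i j) _ (k, stage l))
    (fun {k k' k'' f g} h h' => ?_) (fun k => ?_) f
  · have := Compat.comp (α := kirbyTensor K i j) h h'
    have e : (f ≫ g, 𝟙 (stage l) ≫ 𝟙 (stage l)) = (f ≫ g, 𝟙 (stage l)) :=
      Prod.ext rfl (Category.comp_id (𝟙 (stage l)))
    exact (congrArg (Compat (α := kirbyTensor K i j) (i := (k, stage l)) (j := (k'', stage l))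
      (fun r => projAt d i j v n r.1.1 r.2.1)) e).mp this
  · refine (congrArg (fun g => ColimHom.pre (zero_add 0) g (kirby K d v)
      (projAt d i j v n (k + 1) l)) ((kirbyTensor_map_step_left i j k l).trans
        (congrArg _ (castR_V_left rfl (by omega))))).trans ?_
    refine (pre_projAt d i j v n (Unit × Unit) _ (jwTensor K (i + 2 * k) (j + 2 * l)) (k + 1) l
      (N := i + 2 * k + (j + 2 * l) + 2) (by omega) (by push_cast; ring) _).trans ?_
    exact ((isSys1_kirbyFam (Unit × Unit) _ (jwTensor K (i + 2 * k) (j + 2 * l)) d v).proj n).dotCupL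
      (p := i + 2 * k) (q := j + 2 * l) (d := 0) rfl le_rfl _

theorem compat_projAt_right (k : ℕ) {l l' : AsSmall.{u} ℕ} (f : l ⟶ l') :
    Compat (α := kirbyTensor K i j) (i := (stage k, l)) (j := (stage k, l'))
      (fun r => projAt d i j v n r.1.1 r.2.1) (𝟙 (stage k), f) := by
  refine compat_of_step (P := fun {l l'} f => Compat (α := kirbyTensor K i j) (i := (stage k, l))
      (j := (stage k, l')) (fun r => projAt d i j v n r.1.1 r.2.1) (𝟙 (stage k), f))
    (fun l => Compat.id (α := kirbyTensor K i j) _ (stage k, l))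
    (fun {l l' l'' f g} h h' => ?_) (fun l => ?_) f
  · have := Compat.comp (α := kirbyTensor K i j) h h'
    have e : (𝟙 (stage k) ≫ 𝟙 (stage k), f ≫ g) = (𝟙 (stage k), f ≫ g) :=
      Prod.ext (Category.comp_id (𝟙 (stage k))) rfl
    exact (congrArg (Compat (α := kirbyTensor K i j) (i := (stage k, l)) (j := (stage k, l''))
      (fun r => projAt d i j v n r.1.1 r.2.1)) e).mp this
  · refine (congrArg (fun g => ColimHom.pre (zero_add 0) g (kirby K d v)
      (projAt d i j v n k (l + 1))) ((kirbyTensor_map_step_right i j k l).trans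
        (congrArg _ (castR_V_right rfl (by omega))))).trans ?_
    refine (pre_projAt d i j v n (Unit × Unit) _ (jwTensor K (i + 2 * k) (j + 2 * l)) k (l + 1)
      (N := i + 2 * k + (j + 2 * l) + 2) (by omega) (by push_cast; ring) _).trans ?_
    exact ((isSys1_kirbyFam (Unit × Unit) _ (jwTensor K (i + 2 * k) (j + 2 * l)) d v).proj n).dotCupR
      (p := i + 2 * k) (q := j + 2 * l) (d := 0) rfl (by omega) le_rfl _

/-- The projection `κ_i ⊗ κ_j ⟶ q^d κ_v` given by `n` dots. -/
noncomputable def proj : (dTL K).Kar.Mat.IndHom 0 (kirbyTensor K i j) (kirby K d v) :=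
  ⟨fun r => projAt d i j v n r.1.1 r.2.1, fun {r r'} f => by
    -- A morphism of the product index category is one in the first variable followed by one in the
    -- second.
    have h := Compat.comp (α := kirbyTensor K i j) (i := r) (j := (r'.1, r.2)) (k := r')
      (compat_projAt_left d i j v n r.2.1 f.1) (compat_projAt_right d i j v n r'.1.1 f.2)
    refine Eq.trans (congrArg (fun g => ColimHom.pre (zero_add 0) g (kirby K d v) _)
      (congrArg (kirbyTensor K i j).map ?_)) h
    exact Prod.ext (Category.comp_id f.1).symm (Category.id_comp f.2).symm⟩

/-- Both parities must be prescribed: with `p` and `q` both wrong the tensor family vanishes,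
whereas the right-hand side, which is built from the undivided `N` strands, need not. -/
theorem post_proj (J : Type) [Fintype J] (e : ℤ) (Q : (dTL K).KarObj) {p q N : ℕ} (hN : p + q = N)
    (hp : p % 2 = i % 2) (hq : q % 2 = j % 2) (D : ℤ)
    (f : Pres.Hom (noRel K) D (word Q) (blk N)) :
    IndHom.post (add_zero 0) (sing J e Q) (proj (K := K) (-2 * n) i j v n)
      (tensorFam J e Q i j p q N D ⟨hN⟩ f) =
        (kirbyFam J e Q (-2 * n) v).proj n p q N D ⟨hN⟩ f := by
  have h1 : IsSys2 (fun p q N D h => IndHom.post (add_zero 0) (sing J e Q)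
      (proj (K := K) (-2 * n) i j v n) ∘ₗ tensorFam J e Q i j p q N D h) :=
    { cupL := fun h hm f => (congrArg _ ((isSys2_tensorFam J e Q i j).cupL h hm f)).trans
        (IndHom.post _ _ _).map_zero
      cupR := fun h hm hm' f => (congrArg _ ((isSys2_tensorFam J e Q i j).cupR h hm hm' f)).trans
        (IndHom.post _ _ _).map_zero
      dotCupL := fun h hm f => congrArg _ ((isSys2_tensorFam J e Q i j).dotCupL h hm f)
      dotCupR := fun h hm hm' f =>
        congrArg _ ((isSys2_tensorFam J e Q i j).dotCupR h hm hm' f) }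
  refine h1.ext_add (k := i) (l := j) ((isSys1_kirbyFam J e Q _ v).proj n) hN
    (fun p' q' N' hp' hq' hN' D f => ?_) D f
  by_cases hD : D = N' + e
  · obtain ⟨k, rfl⟩ : ∃ k, p' = i + 2 * k := ⟨(p' - i) / 2, by omega⟩
    obtain ⟨l, rfl⟩ : ∃ l, q' = j + 2 * l := ⟨(q' - j) / 2, by omega⟩
    refine (congrArg (fun L => IndHom.post (add_zero 0) (sing J e Q)
      (proj (K := K) (-2 * n) i j v n) (L f)) (tensorFam_leg J e Q i j k l hN' D)).trans ?_
    refine (IndHom.post_mk _ _ _ _ _).trans ?_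
    exact pre_projAt (-2 * n) i j v n J e Q k l hN' hD f
  · rw [kirbyFam_proj_of_ne _ _ _ hN' (by omega)]
    refine (congrArg (fun L => IndHom.post (add_zero 0) (sing J e Q)
      (proj (K := K) (-2 * n) i j v n) (L f)) (tensorFam_of_ne J e Q _ (by omega))).trans ?_
    exact (IndHom.post _ _ _).map_zero

end Proj

end Kirby

/-! ### The biproduct decomposition in the ind-completion. -/

namespace Kirby

open GrCat Pres

variable {K : Type u} [Field K] [CharZero K]

/-- Morphisms to Kirby objects vanish in high degrees. -/
theorem colimHom_kirby_eq_zero {a d : ℤ} {v : ℕ} {X : (dTL K).Kar.MatObj}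
    (h : ∀ i : X.I, ((word (X.X i)).length : ℤ) < a - d + X.k i)
    (x : (dTL K).Kar.Mat.ColimHom a X (kirby K d v)) : x = 0 := by
  obtain ⟨⟨r⟩, φ, rfl⟩ := x.exists_rep
  refine Eq.trans (congrArg _ ?_) (ColimHom.mk (kirby K d v) ⟨r⟩).map_zero
  funext i j
  refine Subtype.ext ?_
  refine eq_zero_of_degree (R := noRel K) (n := v + 2 * r) (fun g => nomatch g) _ ?_
  have h1 := h i
  -- The shift of the `r`-th term compensates its number of strands, so the bound does not depend on
  -- `r`.
  change ((word (X.X i)).length : ℤ) + (v + 2 * r : ℕ) < a - ((d - (v + 2 * r)) - X.k i)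
  push_cast
  omega

section Biproduct

variable {i j v : ℕ} {b : ℕ → ℕ}

/-- The relation `π_n σ_m = δ_(nm)`, tested on diagrams: `post_proj` turns the projection into
`Fam1.proj`, and `IsSys1.hole_proj` evaluates it on nested cups. -/
theorem post_proj_hole (hv : v % 2 = (i + j) % 2) {m c : ℕ} (n : ℕ) (hc : c < 2)
    (hm : (m + c) % 2 = j % 2) (J : Type) [Fintype J] (e : ℤ) (Q : (dTL K).KarObj) {N : ℕ}
    (hN : N % 2 = v % 2) (D : ℤ) (f : Pres.Hom (noRel K) D (word Q) (blk N)) :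
    IndHom.post (add_zero 0) (sing J e Q) (proj (K := K) (-2 * n) i j v n)
      ((tensorFam J e Q i j).hole m c N D f) =
        if n = m then kirbyFam J e Q (-2 * n) v N D f else 0 := by
  refine (congrArg _ (Fam2.hole_apply _ hc rfl rfl f)).trans ?_
  refine (post_proj i j v n J e Q rfl (by omega) hm _ _).trans ?_
  rw [← Fam2.hole_apply _ hc, (isSys1_kirbyFam J e Q _ v).hole_proj]
  split_ifs <;> rfl

theorem kirbyFam_id (d : ℤ) (r : ℕ) :
    kirbyFam Unit (d - (v + 2 * r)) (jwObj K (v + 2 * r)) d v (v + 2 * r) 0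
      (Pres.id (blk (v + 2 * r))) = (IndHom.id (kirby K d v)).1 ⟨r⟩ :=
  (congrArg (fun L : _ →ₗ[K] _ => L _) (kirbyFam_leg Unit _ (jwObj K (v + 2 * r)) d v r 0)).trans
    (congrArg (ColimHom.mk (kirby K d v) ⟨r⟩) (rawHom_id rfl _ rfl))

theorem tensorFam_id (k l : ℕ) :
    tensorFam (Unit × Unit) (0 - (i + 2 * k) + (0 - (j + 2 * l)))
      (jwTensor K (i + 2 * k) (j + 2 * l)) i j (i + 2 * k) (j + 2 * l) (i + 2 * k + (j + 2 * l)) 0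
      ⟨rfl⟩ (castR (append_blk rfl).symm
        (Pres.id (List.append (blk (i + 2 * k)) (blk (j + 2 * l))))) =
      (IndHom.id (kirbyTensor K i j)).1 (⟨k⟩, ⟨l⟩) :=
  (congrArg (fun L : _ →ₗ[K] _ => L _) (tensorFam_leg (Unit × Unit) _
    (jwTensor K (i + 2 * k) (j + 2 * l)) i j k l rfl 0)).trans
    (congrArg (ColimHom.mk (kirbyTensor K i j) (⟨k⟩, ⟨l⟩))
      ((congrArg _ (castR_castR _ _ _)).trans (rawHom_id rfl _ rfl)))

theorem incl_proj_self (hv : v % 2 = (i + j) % 2) {n c : ℕ} (hc : c < 2)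
    (hm : (n + c) % 2 = j % 2) :
    IndHom.comp (add_zero 0) (incl (K := K) (-2 * n) i j v n c) (proj (-2 * n) i j v n) =
      IndHom.id (kirby K (-2 * n) v) := by
  refine IndHom.ext fun r => ?_
  refine (post_proj_hole hv n hc hm Unit _ (jwObj K (v + 2 * r.1)) (by omega) 0 _).trans ?_
  rw [if_pos rfl]
  exact kirbyFam_id _ _

theorem incl_proj_ne (hv : v % 2 = (i + j) % 2) {n m c : ℕ} (hc : c < 2)
    (hm : (m + c) % 2 = j % 2) (hn : n ≠ m) :
    IndHom.comp (add_zero 0) (incl (K := K) (-2 * m) i j v m c) (proj (-2 * n) i j v n) = 0 := by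
  refine IndHom.ext fun r => ?_
  refine (post_proj_hole hv n hc hm Unit _ (jwObj K (v + 2 * r.1)) (by omega) 0 _).trans ?_
  rw [if_neg hn]
  rfl

variable (i j v b) in
/-- The elements on which the projections decompose the identity. -/
noncomputable def decomposed (J : Type) [Fintype J] (e : ℤ) (Q : (dTL K).KarObj) :
    Submodule K ((dTL K).Kar.Mat.ColimHom 0 (sing J e Q) (kirbyTensor K i j)) where
  carrier := {m | FinSum (fun n : ℕ => IndHom.post (add_zero 0) (sing J e Q)
    (incl (K := K) (-2 * n) i j v n (b n)) (IndHom.post (add_zero 0) (sing J e Q)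
      (proj (K := K) (-2 * n) i j v n) m)) m}
  add_mem' h h' := (FinSum.add h h').congr (fun n : ℕ => (congrArg _
    ((IndHom.post _ _ (proj (K := K) (-2 * n) i j v n)).map_add _ _)).trans
      ((IndHom.post _ _ (incl (K := K) (-2 * n) i j v n (b n))).map_add _ _) |>.symm) rfl
  zero_mem' := finSum_iff.2 ⟨∅, fun (n : ℕ) _ => (congrArg _
      (IndHom.post _ _ (proj (K := K) (-2 * n) i j v n)).map_zero).trans
        (IndHom.post _ _ (incl (K := K) (-2 * n) i j v n (b n))).map_zero, rfl⟩
  smul_mem' c _ h := (FinSum.smul h c).congr (fun n : ℕ => (congrArg _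
    ((IndHom.post _ _ (proj (K := K) (-2 * n) i j v n)).map_smul _ _)).trans
      ((IndHom.post _ _ (incl (K := K) (-2 * n) i j v n (b n))).map_smul _ _) |>.symm) rfl

/-- On a value with `m` nested cups only the term `n = m` survives, and the inclusion then restores
the value. Values of the wrong parity are zero. -/
theorem hole_mem_decomposed (hv : v % 2 = (i + j) % 2) (hb : ∀ n, b n < 2)
    (hj : ∀ n, (n + b n) % 2 = j % 2) (J : Type) [Fintype J] (e : ℤ) (Q : (dTL K).KarObj)
    (m c N : ℕ) (hc : c < 2) (D : ℤ) (f : Pres.Hom (noRel K) D (word Q) (blk N)) :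
    (tensorFam J e Q i j).hole m c N D f ∈ decomposed i j v b J e Q := by
  by_cases h : N % 2 = (i + j) % 2 ∧ (m + c) % 2 = j % 2
  -- Parity determines whether there is a dotted cup.
  · have hcb : c = b m := by have := hb m; have := hj m; omega
    subst hcb
    refine finSum_iff.2 ⟨{m}, fun n hn => ?_, ?_⟩
    · refine (congrArg _ ((post_proj_hole hv n hc h.2 J e Q (by omega) D f).trans
        (if_neg (by simpa using hn)))).trans (IndHom.post _ _ _).map_zero
    · rw [Finset.sum_singleton]
      refine (congrArg _ ((post_proj_hole hv m hc h.2 J e Q (by omega) D f).trans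
        (if_pos rfl))).trans ?_
      exact post_incl i j v m (b m) hc hv J e Q N D f
  · rw [tensorFam_hole_of_ne _ _ _ hc (by omega)]
    exact zero_mem _

theorem mem_decomposed (hv : v % 2 = (i + j) % 2) (hb : ∀ n, b n < 2)
    (hj : ∀ n, (n + b n) % 2 = j % 2) (J : Type) [Fintype J] (e : ℤ) (Q : (dTL K).KarObj)
    (p q N : ℕ) (hN : p + q = N) (D : ℤ) (f : Pres.Hom (noRel K) D (word Q) (blk N)) :
    tensorFam J e Q i j p q N D ⟨hN⟩ f ∈ decomposed i j v b J e Q :=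
  (isSys2_tensorFam J e Q i j).mem _
    (fun k p d f => hole_mem_decomposed hv hb hj J e Q k 0 p (by omega) d f)
    (fun k p d f => hole_mem_decomposed hv hb hj J e Q k 1 p (by omega) d f) p q N D hN f

/-- The identity of the term `P_p ⊗ P_q` is itself a value of the tensor system, so spanning applies
to it. -/
theorem sum_proj_incl (hv : v % 2 = (i + j) % 2) (hb : ∀ n, b n < 2)
    (hj : ∀ n, (n + b n) % 2 = j % 2) :
    IndSum (fun n : ℕ => IndHom.comp (add_zero 0) (proj (K := K) (-2 * n) i j v n)
      (incl (-2 * n) i j v n (b n))) (IndHom.id (kirbyTensor K i j)) := by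
  rintro ⟨⟨k⟩, ⟨l⟩⟩
  have h : FinSum _ _ := mem_decomposed hv hb hj (Unit × Unit) (0 - (i + 2 * k) + (0 - (j + 2 * l)))
    (jwTensor K (i + 2 * k) (j + 2 * l)) (i + 2 * k) (j + 2 * l) _ rfl 0
    (castR (append_blk rfl).symm (Pres.id (List.append (blk (i + 2 * k)) (blk (j + 2 * l)))))
  refine FinSum.congr h (fun n => ?_) (tensorFam_id k l)
  refine congrArg (IndHom.post (add_zero 0) _ (incl (K := K) (-2 * n) i j v n (b n))) ?_
  refine (congrArg _ (tensorFam_id k l)).trans ?_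
  exact (IndHom.post_mk _ _ _ _ _).trans (ColimHom.pre_id _ _ _)

theorem exists_le_of_fintype {I : Type} [Fintype I] (f : I → ℤ) : ∃ n : ℕ, ∀ i, f i ≤ n :=
  ⟨∑ i, (f i).natAbs, fun i => by
    have := Finset.single_le_sum (f := fun i => (f i).natAbs) (fun _ _ => Nat.zero_le _)
      (Finset.mem_univ i)
    have h1 : (f i).natAbs ≤ ∑ i, (f i).natAbs := this
    omega⟩

/-- Only the parity of `v` enters, which covers both `|i + j|` and the representatives of residues.
What is left after `sum_proj_incl` is local finiteness, from the degree bound. -/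
theorem isBiproduct_kirby (hv : v % 2 = (i + j) % 2) (hb : ∀ n, b n < 2)
    (hj : ∀ n, (n + b n) % 2 = j % 2) :
    (dTL K).Kar.Mat.Ind.IsBiproduct (kirbyTensor K i j) (fun n : ℕ => kirby K (-2 * n) v)
      (fun n => incl (-2 * n) i j v n (b n)) (fun n => proj (-2 * n) i j v n) := by
  refine isBiproduct_of_sums _ (fun F G => IndSum F G) IndSum.unique
    (fun h _ _ _ f _ _ hF => IndSum.comp_left h f hF)
    (fun h _ _ _ _ _ f hF => IndSum.comp_right h f hF) IndSum.single
    (fun n => incl_proj_self hv (hb n) (hj n))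
    (fun n m h => incl_proj_ne hv (hb m) (hj m) h)
    (sum_proj_incl hv hb hj) (fun a T F => IndSum.exists_sum _ fun kl => ?_)
    (fun a T F => IndSum.exists_sum _ fun t => ?_)
  · obtain ⟨⟨k⟩, ⟨l⟩⟩ := kl
    -- The shift by `-2n` raises the degree of diagrams representing `π_n` on this term, until the
    -- projection itself is zero there.
    obtain ⟨n₀, hn₀⟩ := exists_le_of_fintype (I := Unit) fun _ =>
      ((word (jwTensor K (i + 2 * k) (j + 2 * l))).length : ℤ) -
        (0 - (i + 2 * k) + (0 - (j + 2 * l)))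
    refine (Set.finite_le_nat n₀).subset fun n hn => ?_
    by_contra hlt
    refine hn ((congrArg (IndHom.post (zero_add a) _ (F n)) ?_).trans
      (IndHom.post (zero_add a) _ (F n)).map_zero)
    refine colimHom_kirby_eq_zero (fun u => ?_) _
    have h1 := hn₀ ()
    have h2 : n₀ < n := not_le.1 hlt
    change ((word (jwTensor K (i + 2 * k) (j + 2 * l))).length : ℤ) <
      0 - -2 * (n : ℤ) + (0 - (i + 2 * k) + (0 - (j + 2 * l)))
    omega
  · have : Fintype (MatObj.I (IndObj.obj T t)) := MatObj.fin (IndObj.obj T t)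
    -- Each term of `T` has finitely many summands, so one bound makes the maps `F n` vanish on all
    -- of them for large `n`.
    obtain ⟨n₀, hn₀⟩ := exists_le_of_fintype (I := MatObj.I (IndObj.obj T t)) fun u =>
      ((word (MatObj.X (IndObj.obj T t) u)).length : ℤ) - MatObj.k (IndObj.obj T t) u - a
    refine (Set.finite_le_nat n₀).subset fun n hn => ?_
    by_contra hlt
    refine hn ((congrArg (IndHom.post (add_zero a) _ (incl (K := K) (-2 * n) i j v n (b n))) ?_).trans
      (IndHom.post (add_zero a) _ (incl (K := K) (-2 * n) i j v n (b n))).map_zero)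
    refine colimHom_kirby_eq_zero (fun u => ?_) _
    have h1 := hn₀ u
    have h2 : n₀ < n := not_le.1 hlt
    omega

end Biproduct

end Kirby

/-! ### The explicit representatives of the `σ_n` and `π_n`. -/

namespace Kirby

open GrCat Pres

namespace Pres

variable {K : Type u} [Field K] {X : Gens} {R : TmRel K X}

theorem id_comp_tens {a b c e : ℤ} (he : 0 + c = e) (h : a + b = c) (h' : a + b = e)
    {s s' s'' t t' t'' : List (Option X.E)} (hs : s ++ s' = s'') (ht : t ++ t' = t'')
    (f : Hom R a s t) (g : Hom R b s' t') :
    comp he (id s'') (tens h hs ht f g) = tens h' hs ht f g := by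
  obtain rfl : c = e := by omega
  exact id_comp he _

theorem Fam2.hole_apply' {M : Type*} [AddCommGroup M] [Module K M] {s : List (Option X.E)}
    (E : Fam2 R s M) {n b : ℕ} (hb : b < 2) {N N' p q : ℕ} {d e : ℤ}
    (hp : N + (n + b) = p) (hq : n + b = q) (h : p + q = N') (he : d + 2 * b = e)
    (f : Hom R d s (blk N)) : E.hole n b N d f = E p q N' e ⟨h⟩
      (comp he f (ins N 0 (by omega) (by omega) (nestedCupsB n b))) := by
  subst hp hq
  exact E.hole_apply hb h he f

end Pres

variable {K : Type u} [Field K]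

theorem castR_ins_nestedCupsB {m n b p q N : ℕ} (hp : m + (n + b) = p) (hq : n + b = q)
    (hN : p + q = N) : castR (append_blk hN) (comp (zero_add _) (Pres.id (blk m))
      (ins m 0 (by omega) (by omega) (nestedCupsB n b))) =
    (Pres.tens (zero_add _) (List.append_nil _) (by
      subst hp hq; rw [← blk_add m]; exact (List.append_assoc _ _ _).symm) (Pres.id (blk m))
        (Pres.nestedCups n b) : Pres.Hom (noRel K) (2 * b) _ (List.append (blk p) (blk q))) := by
  subst hp hq
  rw [ins_right (s := 0) (t := n + b + (n + b)) (N := m) m _ _ (List.append_nil _) ((blk_add _ _).trans (congrArg blk (by omega))),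
    nestedCupsB, tens_castR_right, Pres.id_comp, castR_tens]

theorem castR_pow_zAt {p q m n N : ℕ} {e : ℤ} (hN : p + q = N) (hm : N = m) (he : 0 + n * 2 = e)
    (he' : 0 + n * 2 = e) :
    castR (congrArg blk hm) (comp he (castR (append_blk hN).symm
      (Pres.id (List.append (blk p) (blk q)))) (Pres.pow (zAt N q) n)) =
    (Pres.tens he' rfl ((append_blk hN).symm.trans (congrArg blk hm)) (Pres.id (blk p))
      (Pres.pow (Pres.z q) n) : Pres.Hom (noRel K) e (List.append (blk p) (blk q)) (blk m)) := by
  rw [← ins_pow_z hN, ins_right _ _ _ (append_blk hN).symm (append_blk hN).symm,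
    castR_comp_tens (zero_add _) _ _ (append_blk hN).symm _ rfl rfl,
    id_comp_tens _ _ he', castR_castR, castR_tens]

variable [CharZero K]

/-- The hole functional is one value of the tensor family on nested cups. The groups have `i + 2k`
and `j + 2l` strands, where the family is given by a term of the system. -/
theorem inclAt_eq {i j v n b : ℕ} (hb : b < 2) (r k l : ℕ)
    (hp : v + 2 * r + (n + b) = i + 2 * k) (hq : n + b = j + 2 * l) :
    inclAt (K := K) (-2 * n) i j v n b r = ColimHom.mk (kirbyTensor K i j) (⟨k⟩, ⟨l⟩)
      (sigmaComp K i j v n b r k l hp hq) := by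
  refine (Fam2.hole_apply' (tensorFam Unit (-2 * n - (v + 2 * r)) (jwObj K (v + 2 * r)) i j) hb hp hq rfl (zero_add _) _).trans ?_
  refine (congrArg (fun L : _ →ₗ[K] _ => L _) (tensorFam_leg Unit _ (jwObj K (v + 2 * r)) i j k l
    rfl _)).trans ?_
  refine congrArg (ColimHom.mk (kirbyTensor K i j) (⟨k⟩, ⟨l⟩)) ?_
  refine (congrArg _ (castR_ins_nestedCupsB hp hq rfl)).trans ?_
  exact rawHom_apply (by omega) _

/-- Iterates of `zeta` are unfolded to a power of `z` on the right group; the target has `v + 2r`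
strands, so the family is given by a term of the system. -/
theorem projAt_eq {i j v n : ℕ} (r k l : ℕ) (h : i + 2 * k + (j + 2 * l) = v + 2 * r) :
    projAt (K := K) (-2 * n) i j v n k l = ColimHom.mk (kirby K (-2 * n) v) ⟨r⟩
      (piComp K i j v n r k l h) := by
  refine (congrArg (((-1) ^ n.choose 2 * (n.factorial : K)⁻¹) • ·) (Fam2.zeta_iterate_apply
    (kirbyFam (Unit × Unit) (0 - (i + 2 * k) + (0 - (j + 2 * l)))
      (jwTensor K (i + 2 * k) (j + 2 * l)) (-2 * n) v).merge n rfl (d := 0) (e := 2 * n) (by ring) _)).trans ?_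
  have key : ∀ (J : Type) [Fintype J] (e : ℤ) (Q : (dTL K).KarObj) (N : ℕ) (hN : v + 2 * r = N)
      (D : ℤ) (f : Pres.Hom (noRel K) D (word Q) (blk N)),
      kirbyFam J e Q (-2 * n) v N D f =
        kirbyLeg J e Q (-2 * n) v r D (castR (congrArg blk hN.symm) f) := by
    intro J _ e Q N hN D f
    subst hN
    rw [kirbyFam_leg, castR_rfl]
  refine (congrArg (((-1) ^ n.choose 2 * (n.factorial : K)⁻¹) • ·) (key _ _ _ _ h.symm _ _)).trans ?_
  refine ((kirbyLeg (Unit × Unit) (0 - (i + 2 * k) + (0 - (j + 2 * l)))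
    (jwTensor K (i + 2 * k) (j + 2 * l)) (-2 * n) v r (2 * n)).map_smul _ _).symm.trans ?_
  refine congrArg (ColimHom.mk (kirby K (-2 * n) v) ⟨r⟩) ?_
  refine Eq.trans (congrArg _ ?_) (rawHom_apply (J := Unit × Unit) (J' := Unit)
    (Q := jwTensor K (i + 2 * k) (j + 2 * l)) (Q' := jwObj K (v + 2 * r)) (by omega)
    (piDiag K n (i + 2 * k) (j + 2 * l) (v + 2 * r) h))
  refine congrArg (((-1) ^ n.choose 2 * (n.factorial : K)⁻¹) • ·) ?_
  exact castR_pow_zAt rfl h _ (by ring)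

theorem parity_lt (j : ZMod 2) (n : ℕ) : parity j n < 2 := ZMod.val_lt _

theorem parity_mod (j : ZMod 2) (n : ℕ) : (n + parity j n) % 2 = ZMod.val j % 2 := by
  have h := parity_spec j n
  rw [← ZMod.natCast_zmod_val j] at h
  have := (ZMod.natCast_eq_natCast_iff' _ _ 2).1 h
  rwa [ZMod.natCast_zmod_val] at this

theorem biproduct_natAbs (i j : ℤ) :
      ∃ (σ : ∀ n : ℕ, (dTL K).Kar.Mat.Ind.Hom 0 (kirby K (-2 * n) (i + j).natAbs)
          (kirbyTensor K i.natAbs j.natAbs))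
        (π : ∀ n : ℕ, (dTL K).Kar.Mat.Ind.Hom 0 (kirbyTensor K i.natAbs j.natAbs)
          (kirby K (-2 * n) (i + j).natAbs)),
        (dTL K).Kar.Mat.Ind.IsBiproduct (kirbyTensor K i.natAbs j.natAbs)
          (fun n : ℕ => kirby K (-2 * n) (i + j).natAbs) σ π :=
  -- The absolute values satisfy `|i + j| ≡ |i| + |j|` mod 2, and `b n` makes `n + b n` congruent to
  -- `|j|`.
  ⟨_, _, isBiproduct_kirby (b := fun n => (n + j.natAbs) % 2) (by omega) (fun n => by omega)
    (fun n => by omega)⟩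

theorem biproduct_zmod (i j : ZMod 2) :
      ∃ (σ : ∀ n : ℕ, (dTL K).Kar.Mat.Ind.Hom 0 (kirby K (-2 * n) (ZMod.val (i + j)))
          (kirbyTensor K (ZMod.val i) (ZMod.val j)))
        (π : ∀ n : ℕ, (dTL K).Kar.Mat.Ind.Hom 0 (kirbyTensor K (ZMod.val i) (ZMod.val j))
          (kirby K (-2 * n) (ZMod.val (i + j)))),
        (∀ n, IsSigma K i j n (σ n)) ∧ (∀ n, IsPi K i j n (π n)) ∧
        (dTL K).Kar.Mat.Ind.IsBiproduct (kirbyTensor K (ZMod.val i) (ZMod.val j))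
          (fun n : ℕ => kirby K (-2 * n) (ZMod.val (i + j))) σ π ∧
        (dTL K).Kar.Mat.Ind.OrthogonalIdempotents
          (fun n => (dTL K).Kar.Mat.Ind.comp (add_zero 0) (π n) (σ n)) ∧
        ∀ p : (kirbyTensor K (ZMod.val i) (ZMod.val j)).J,
          FinSum (fun n => ((dTL K).Kar.Mat.Ind.comp (add_zero 0) (π n) (σ n)).1 p)
            (((dTL K).Kar.Mat.Ind.id (kirbyTensor K (ZMod.val i) (ZMod.val j))).1 p) := by
  have hv : ZMod.val (i + j) % 2 = (ZMod.val i + ZMod.val j) % 2 := by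
    rw [ZMod.val_add, Nat.mod_mod]
  have hbi := isBiproduct_kirby (K := K) hv (parity_lt j) (parity_mod j)
  exact ⟨_, _, fun n r k l hp hq => inclAt_eq (parity_lt j n) r k l hp hq,
    fun n r k l h => projAt_eq r k l h, hbi,
    orthogonalIdempotents_of_comp _ hbi.comp_self hbi.comp_ne,
    sum_proj_incl hv (parity_lt j) (parity_mod j)⟩

end Kirby

/-! ### Cups and dots under `ι_p ⊗ ι_q`. -/

namespace Kirby

open GrCat Pres

namespace Pres

variable {K : Type u} [Field K] {X : Gens} {R : TmRel K X}

theorem cupAt_eq_tens_left {d : ℤ} (g : Hom R d (blk 0) (blk 2)) {p q N m : ℕ} (hN : p + q = N)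
    (hm : m ≤ p) (hs : blk p ++ blk q = (blk N : List (Option X.E)))
    (ht : blk (p + 2) ++ blk q = (blk (N + 2) : List (Option X.E))) :
    cupAt g N m = tens (add_zero d) hs ht (cupAt g p m) (id (blk q)) := by
  rw [← ins_left (s := p) (t := p + 2) (N := N) (N' := N + 2) q (by omega) (by omega),
    ins_cupAt _ _ _ hm, Nat.zero_add]

theorem cupAt_eq_tens_right {d : ℤ} (g : Hom R d (blk 0) (blk 2)) {p q N m : ℕ} (hN : p + q = N)
    (hm : p ≤ m) (hm' : m ≤ N) (hs : blk p ++ blk q = (blk N : List (Option X.E)))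
    (ht : blk p ++ blk (q + 2) = (blk (N + 2) : List (Option X.E))) :
    cupAt g N m = tens (zero_add d) hs ht (id (blk p)) (cupAt g q (m - p)) := by
  rw [← ins_right (s := q) (t := q + 2) (N := N) (N' := N + 2) p (by omega) (by omega),
    ins_cupAt _ _ _ (by omega), Nat.add_sub_cancel' hm]

end Pres

variable {K : Type u} [Field K]

/-! ### Relations for the morphisms `ι` -/

theorem U_iota {N m : ℕ} (hm : m ≤ N) {i : ZMod 2} (hi : ((N + 2 : ℕ) : ZMod 2) = i) {a : ℤ}
    (h : 0 + -((N + 2 : ℕ) : ℤ) = a) :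
    Pres.comp h (U N m) (iota (N + 2) i hi) = (0 : KHom' K a _ _) := by
  obtain ⟨k, rfl⟩ := Nat.exists_eq_add_of_le hm
  rw [U, cupAt_eq (k := k) _ rfl, ins_apply]
  refine Eq.trans ?_ (Pres.sound (R := KRel K) (.of (KRel.cup_iota m k i hi a h (blk_add m k) (by
    change blk m ++ (blk 2 ++ blk k) = _; rw [blk_add, blk_add]; congr 1; omega))))
  exact congrArg (fun q => Pres.comp h q (iota (K := K) (m + k + 2) i hi))
    (tens_tens_congr' _ _ _ _ _ _ _ _ _ _ _)

theorem V_iota {N m : ℕ} (hm : m ≤ N) {i : ZMod 2} (hi : ((N + 2 : ℕ) : ZMod 2) = i)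
    (hi' : (N : ZMod 2) = i) (h : 2 + -((N + 2 : ℕ) : ℤ) = -(N : ℤ)) :
    Pres.comp h (V N m) (iota (N + 2) i hi) = (iota N i hi' : KHom' K _ _ _) := by
  obtain ⟨k, rfl⟩ := Nat.exists_eq_add_of_le hm
  rw [V, cupAt_eq (k := k) _ rfl, ins_apply]
  refine Eq.trans ?_ (Pres.sound (R := KRel K) (.of (KRel.dotCup_iota m k i hi hi' h (blk_add m k) (by
    change blk m ++ (blk 2 ++ blk k) = _; rw [blk_add, blk_add]; congr 1; omega))))
  exact congrArg (fun q => Pres.comp h q (iota (K := K) (m + k + 2) i hi))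
    (tens_tens_congr' _ _ _ _ _ _ _ _ _ _ _)

/-- The morphism `ι_p ⊗ ι_q`. -/
def iotaPair {p q N : ℕ} (hN : p + q = N) {i j : ZMod 2} (hp : (p : ZMod 2) = i)
    (hq : (q : ZMod 2) = j) : KHom' K (-N) (blk N) [pink i, pink j] :=
  Pres.tens (by push_cast [← hN]; ring) (by rw [blk_add, hN]) rfl (iota p i hp) (iota q j hq)

theorem natCast_add_two_zmod {p : ℕ} {i : ZMod 2} : ((p + 2 : ℕ) : ZMod 2) = i ↔ (p : ZMod 2) = i := by
  push_cast
  rw [show (2 : ZMod 2) = 0 from rfl, add_zero]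

section Pair

variable {p q N m : ℕ} {i j : ZMod 2}

/-- A cup inside one group meets only one of the two tensor factors, so this relation and the
following three reduce to those for a single `ι`. -/
theorem U_iotaPair_left (hN : p + q = N) (hN' : p + 2 + q = N + 2) (hm : m ≤ p)
    (hp : ((p + 2 : ℕ) : ZMod 2) = i) (hq : (q : ZMod 2) = j) {a : ℤ}
    (h : 0 + -((N + 2 : ℕ) : ℤ) = a) :
    Pres.comp h (U N m) (iotaPair hN' hp hq) = (0 : KHom' K a _ _) := by
  rw [U, cupAt_eq_tens_left _ hN hm (by rw [blk_add, hN]) (by rw [blk_add, hN']), iotaPair,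
    ← Pres.interchange rfl rfl h (add_zero 0) _ (by push_cast [← hN, ← h]; ring), U_iota hm]
  simp

theorem U_iotaPair_right (hN : p + q = N) (hN' : p + (q + 2) = N + 2) (hm : p ≤ m) (hm' : m ≤ N)
    (hp : (p : ZMod 2) = i) (hq : ((q + 2 : ℕ) : ZMod 2) = j) {a : ℤ}
    (h : 0 + -((N + 2 : ℕ) : ℤ) = a) :
    Pres.comp h (U N m) (iotaPair hN' hp hq) = (0 : KHom' K a _ _) := by
  rw [U, cupAt_eq_tens_right _ hN hm hm' (by rw [blk_add, hN]) (by rw [blk_add, hN']), iotaPair,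
    ← Pres.interchange rfl rfl h (add_zero 0) _ (by push_cast [← hN, ← h]; ring), U_iota (by omega)]
  simp

theorem V_iotaPair_left (hN : p + q = N) (hN' : p + 2 + q = N + 2) (hm : m ≤ p)
    (hp : ((p + 2 : ℕ) : ZMod 2) = i) (hp' : (p : ZMod 2) = i) (hq : (q : ZMod 2) = j)
    (h : 2 + -((N + 2 : ℕ) : ℤ) = -(N : ℤ)) :
    Pres.comp h (V N m) (iotaPair hN' hp hq) = (iotaPair hN hp' hq : KHom' K _ _ _) := by
  rw [V, cupAt_eq_tens_left _ hN hm (by rw [blk_add, hN]) (by rw [blk_add, hN']), iotaPair,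
    ← Pres.interchange (a'' := -(p : ℤ)) (by push_cast; ring) (zero_add _) h (add_zero 2) _
      (by push_cast [← hN]; ring), V_iota hm hp hp', Pres.id_comp]
  rfl

theorem V_iotaPair_right (hN : p + q = N) (hN' : p + (q + 2) = N + 2) (hm : p ≤ m) (hm' : m ≤ N)
    (hp : (p : ZMod 2) = i) (hq : ((q + 2 : ℕ) : ZMod 2) = j) (hq' : (q : ZMod 2) = j)
    (h : 2 + -((N + 2 : ℕ) : ℤ) = -(N : ℤ)) :
    Pres.comp h (V N m) (iotaPair hN' hp hq) = (iotaPair hN hp hq' : KHom' K _ _ _) := by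
  rw [V, cupAt_eq_tens_right _ hN hm hm' (by rw [blk_add, hN]) (by rw [blk_add, hN']), iotaPair,
    ← Pres.interchange (b'' := -(q : ℤ)) (zero_add _) (by push_cast; ring) h (zero_add 2) _
      (by push_cast [← hN]; ring), V_iota (by omega) hq hq', Pres.id_comp]
  rfl

/-- Dots on `ω'_j` become copies of `z` below `ι`, one at a time. -/
theorem iota_pow (hq : (q : ZMod 2) = j) (n : ℕ) {a : ℤ} (h : -(q : ℤ) + n * 2 = a)
    (h' : n * 2 + -(q : ℤ) = a) :
    Pres.comp h (iota q j hq) (Pres.pow (pdot j) n) =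
      (Pres.comp h' (Pres.pow (Pres.z q) n) (iota q j hq) : KHom' K a _ _) := by
  induction n generalizing a with
  | zero =>
    obtain rfl : a = -(q : ℤ) := by rw [← h]; push_cast; ring
    have e1 : ∀ {b : ℤ} (hb : 0 = b) (h : -(q : ℤ) + b = -(q : ℤ)), Pres.comp h (iota q j hq)
        ((KdTL' K).castDeg (X := [pink j]) (Y := [pink j]) hb (Pres.id [pink j])) =
          (iota q j hq : KHom' K _ _ _) := by
      intro b hb h; subst hb; exact Pres.comp_id _ _
    have e2 : ∀ {b : ℤ} (hb : 0 = b) (h : b + -(q : ℤ) = -(q : ℤ)), Pres.comp h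
        ((KdTL' K).castDeg (X := blk q) (Y := blk q) hb (Pres.id (blk q))) (iota q j hq) =
          (iota q j hq : KHom' K _ _ _) := by
      intro b hb h; subst hb; exact Pres.id_comp _ _
    exact (e1 (by simp) _).trans (e2 (by simp) _).symm
  | succ n ih =>
    have h1 : Pres.comp rfl (iota q j hq) (pdot j) =
        (Pres.comp (add_comm _ _) (Pres.z q) (iota q j hq) : KHom' K (-(q : ℤ) + 2) _ _) :=
      Pres.sound (R := KRel K) (.of (KRel.dot_iota q j hq (-(q : ℤ) + 2) rfl (add_comm _ _)))
    rw [Pres.pow_succ, Pres.pow_succ, ← Pres.assoc (ab := -(q : ℤ) + n * 2) rfl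
        (by rw [← h]; push_cast; ring) _ h,
      ih rfl (add_comm _ _), Pres.assoc _ (by rw [← h]; push_cast; ring) rfl
        (by rw [← h]; push_cast; ring), h1,
      Pres.assoc _ h' (add_comm _ _) (by rw [← h]; push_cast; ring)]

theorem iotaPair_comp_pow (hN : p + q = N) (hp : (p : ZMod 2) = i) (hq : (q : ZMod 2) = j) (n : ℕ)
    {a : ℤ} (h : -(N : ℤ) + n * 2 = a) (h' : n * 2 + -(N : ℤ) = a) :
    Pres.comp h (iotaPair hN hp hq) (Pres.tens (zero_add _) rfl rfl (Pres.id [pink i])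
      (Pres.pow (pdot j) n)) =
      (Pres.comp h' (Pres.pow (zAt N q) n) (iotaPair hN hp hq) : KHom' K a _ _) := by
  rw [← ins_pow_z hN, ins_right _ _ _ (by rw [blk_add, hN]) (by rw [blk_add, hN]), iotaPair,
    ← Pres.interchange (add_zero _) rfl h _ (zero_add _) (by push_cast [← hN, ← h]; ring),
    ← Pres.interchange (zero_add _) (add_comm _ _) h' (zero_add _) _
      (by push_cast [← hN, ← h]; ring), Pres.comp_id, Pres.id_comp, iota_pow]

theorem iotaPair_merge (hN : p + q = N) (hp : (p : ZMod 2) = i) (hq : (q : ZMod 2) = j)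
    {k : ZMod 2} (hk : i + j = k) (hNk : (N : ZMod 2) = k) (h : -(N : ℤ) + 0 = -(N : ℤ)) :
    Pres.comp h (iotaPair hN hp hq) (merge i j k hk) = (iota N k hNk : KHom' K _ _ _) := by
  subst hN
  exact Pres.sound (R := KRel K) (.of (KRel.merge_iota p q i j k hp hq hk hNk
    (by push_cast; ring) (blk_add p q)))

/-- On a canonical inclusion `π_n` acts as the functional `Fam1.proj n`: the dots turn into `z_q^n`,
and the vertex merges the two `ι`. -/
theorem iotaPair_kPi (hN : p + q = N) (hp : (p : ZMod 2) = i) (hq : (q : ZMod 2) = j)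
    (hNk : (N : ZMod 2) = i + j) (n : ℕ) {a : ℤ} (h : -(N : ℤ) + 2 * n = a)
    (h' : n * 2 + -(N : ℤ) = a) :
    Pres.comp h (iotaPair hN hp hq) (kPi K i j n) =
      ((-1) ^ n.choose 2 * (n.factorial : K)⁻¹) •
        Pres.comp h' (Pres.pow (zAt N q) n) (iota N (i + j) hNk) := by
  rw [kPi, map_smul, ← Pres.assoc (by rw [← h]; ring) (add_zero a) (by ring) h]
  congr 1
  refine (congrArg (fun f => Pres.comp (add_zero a) f (merge (K := K) i j (i + j) rfl))
    (iotaPair_comp_pow hN hp hq n _ h')).trans ?_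
  rw [Pres.assoc h' (add_zero a) (add_zero _) h', iotaPair_merge]

end Pair

end Kirby

/-! ### Diagrams under `ι` as systems, and the action of `σ_n` and `π_n` on them. -/

namespace Kirby

open GrCat Pres

variable {K : Type u} [Field K]

/-- The vertex merges `ι_m` with the left ends of the nested cups; their right ends stay in the
second factor. This puts the wall in the middle of the nested cups. -/
theorem tens_iota_iotaPair {m a N : ℕ} (hN : m + a + a = N) {i j : ZMod 2}
    (hm : (m : ZMod 2) = i + j) (ha : (a : ZMod 2) = j) (hma : ((m + a : ℕ) : ZMod 2) = i)
    {d : ℤ} (h : -(a : ℤ) + -(a : ℤ) = d) (h' : -(m : ℤ) + d = -(N : ℤ))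
    (hs : blk m ++ (blk a ++ blk a) = (blk N : KWord)) :
    Pres.comp (add_zero _) (Pres.tens h' hs rfl (iota m (i + j) hm)
      (Pres.tens (s'' := blk a ++ blk a) h rfl rfl (iota a j ha) (iota a j ha)))
      (Pres.tens (t'' := [pink i, pink j]) (add_zero 0) rfl rfl
        (merge (i + j) j i (add_add_self i j)) (Pres.id [pink j])) =
      (iotaPair hN hma ha : KHom' K _ _ _) := by
  have e : blk (m + a) ++ blk a = (blk N : KWord) := by rw [blk_add, hN]
  rw [← Pres.tens_assoc (ab := -((m + a : ℕ) : ℤ)) (s₁₂ := blk (m + a)) (t₁₂ := [pink (i + j), pink j])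
    (by push_cast; ring) (by push_cast [← hN]; ring) h h' (blk_add m a) e rfl hs rfl rfl rfl rfl,
    ← Pres.interchange (add_zero _) (add_zero _) (add_zero _) (by push_cast [← hN]; ring) (add_zero 0)
      (by push_cast [← hN]; ring), Pres.comp_id]
  exact congrArg (fun f => Pres.tens _ _ _ f _)
    (iotaPair_merge rfl hm ha (add_add_self i j) hma (add_zero _))

theorem iota_kSigma {N N' p q : ℕ} {i j : ZMod 2} (n : ℕ) (hN : (N : ZMod 2) = i + j)
    (hp : N + (n + parity j n) = p) (hq : n + parity j n = q) (hN' : p + q = N')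
    (hp' : (p : ZMod 2) = i) (hq' : (q : ZMod 2) = j) {c : ℤ} (h : -(N : ℤ) + -2 * n = c)
    (h' : 2 * (parity j n : ℤ) + -(N' : ℤ) = c) :
    Pres.comp h (iota N (i + j) hN) (kSigma K i j n) =
      (Pres.comp h' (ins N 0 (by omega) (by omega) (nestedCupsB n (parity j n)))
        (iotaPair hN' hp' hq') : KHom' K c _ _) := by
  subst hp hq
  have hs : blk N ++ (blk (n + parity j n) ++ blk (n + parity j n)) = (blk N' : KWord) := by
    rw [blk_add, blk_add]; congr 1; omega
  have hd : -((n + parity j n : ℕ) : ℤ) + -((n + parity j n : ℕ) : ℤ) =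
    -((n + parity j n : ℕ) : ℤ) + -((n + parity j n : ℕ) : ℤ) := rfl
  have h1 : Pres.comp h (iota N (i + j) hN) (Pres.tens (t'' := [pink (i + j), pink j, pink j])
      (zero_add _) rfl rfl (Pres.id [pink (i + j)]) (holeCup K j n)) =
    (Pres.comp h' (ins N 0 (by omega) (by omega) (nestedCupsB n (parity j n)))
      (Pres.tens (by push_cast [← hN']; ring) hs rfl (iota N (i + j) hN)
        (Pres.tens (s'' := blk (n + parity j n) ++ blk (n + parity j n)) hd rfl rfl
          (iota (n + parity j n) j hq') (iota (n + parity j n) j hq'))) : KHom' K c _ _) := by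
    rw [ins_right (s := 0) (t := n + parity j n + (n + parity j n)) (N := N) N _ _
      (List.append_nil _) ((blk_add _ _).trans (congrArg blk (by omega))), nestedCupsB,
      tens_castR_right, ← Pres.interchange (a'' := -(N : ℤ)) (b'' := -2 * (n : ℤ)) (zero_add _)
        (by push_cast; ring) h' _ _ h, Pres.id_comp]
    refine (congrArg (fun f => Pres.comp h f _) (Pres.tens_one (add_zero _) (List.append_nil _) rfl
      (iota N (i + j) hN)).symm).trans ?_
    refine (Pres.interchange (R := KRel K) (a'' := -(N : ℤ)) (b'' := -2 * (n : ℤ)) (add_zero _) (zero_add _) h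
      (add_zero _) (zero_add _) h (List.append_nil (blk N)) (rfl : [pink (i + j)] ++ [] = _) rfl (iota N (i + j) hN)
      (Pres.id [pink (i + j)]) (Pres.id []) (holeCup K j n)).symm.trans ?_
    rw [Pres.id_comp, Pres.comp_id]
    rfl
  rw [kSigma, ← Pres.assoc h (add_zero c) (add_zero _) h, h1,
    Pres.assoc h' (add_zero c) (add_zero _) h', tens_iota_iotaPair hN' hN hq' hp']

/-! ### Diagrams as morphisms to the objects `κ'_i` and `κ'_i ⊗ κ'_j` -/

section Fam

variable (K) (c : ℤ) (s : KWord) (i j : ZMod 2)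

open scoped Classical in
/-- Diagrams as morphisms to `κ'_i` of degree `c`. -/
noncomputable def pinkFam : Fam1 (KRel K) s (KHom' K c s [pink i]) := fun N d =>
  if h : (N : ZMod 2) = i ∧ d + -(N : ℤ) = c then (Pres.comp h.2).flip (iota N i h.1) else 0

open scoped Classical in
/-- Diagrams as morphisms to `κ'_i ⊗ κ'_j` of degree `c`. -/
noncomputable def pairFam : Fam2 (KRel K) s (KHom' K c s [pink i, pink j]) := fun p q N d hN =>
  if h : ((p : ZMod 2) = i ∧ (q : ZMod 2) = j) ∧ d + -(N : ℤ) = c then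
    (Pres.comp h.2).flip (iotaPair hN.down h.1.1 h.1.2) else 0

variable {K c s i j}

theorem pinkFam_apply {N : ℕ} {d : ℤ} (hN : (N : ZMod 2) = i) (h : d + -(N : ℤ) = c)
    (f : KHom' K d s (blk N)) : pinkFam K c s i N d f = Pres.comp h f (iota N i hN) := by
  rw [pinkFam, dif_pos ⟨hN, h⟩]; rfl

theorem pinkFam_of_ne {N : ℕ} {d : ℤ} (h : ¬ ((N : ZMod 2) = i ∧ d + -(N : ℤ) = c)) :
    pinkFam K c s i N d = 0 := dif_neg h

theorem pairFam_apply {p q N : ℕ} {d : ℤ} (hN : p + q = N) (hp : (p : ZMod 2) = i)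
    (hq : (q : ZMod 2) = j) (h : d + -(N : ℤ) = c) (f : KHom' K d s (blk N)) :
    pairFam K c s i j p q N d ⟨hN⟩ f = Pres.comp h f (iotaPair hN hp hq) := by
  rw [pairFam, dif_pos ⟨⟨hp, hq⟩, h⟩]; rfl

theorem pairFam_of_ne {p q N : ℕ} {d : ℤ} (hN : PLift (p + q = N))
    (h : ¬ (((p : ZMod 2) = i ∧ (q : ZMod 2) = j) ∧ d + -(N : ℤ) = c)) :
    pairFam K c s i j p q N d hN = 0 := dif_neg h

variable (K c s i j)

theorem isSys1_pinkFam : IsSys1 (pinkFam K c s i) where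
  cup {N m d} hm f := by
    by_cases h : ((N + 2 : ℕ) : ZMod 2) = i ∧ d + -((N + 2 : ℕ) : ℤ) = c
    · rw [pinkFam_apply h.1 h.2, Pres.assoc (add_zero d) h.2 (zero_add _) h.2, U_iota hm, map_zero]
    · rw [pinkFam_of_ne h, LinearMap.zero_apply]
  dotCup {N m d} hm f := by
    by_cases h : (N : ZMod 2) = i ∧ d + -(N : ℤ) = c
    · have h1 : ((N + 2 : ℕ) : ZMod 2) = i := natCast_add_two_zmod.2 h.1
      have h2 : d + 2 + -((N + 2 : ℕ) : ℤ) = c := by push_cast; linarith [h.2]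
      rw [pinkFam_apply h1 h2, pinkFam_apply h.1 h.2, Pres.assoc rfl h2 (by push_cast; ring) h.2,
        V_iota hm h1 h.1]
    · rw [pinkFam_of_ne h, pinkFam_of_ne, LinearMap.zero_apply, LinearMap.zero_apply]
      rintro ⟨h1, h2⟩
      exact h ⟨natCast_add_two_zmod.1 h1, by push_cast at h2; linarith⟩

theorem isSys2_pairFam : IsSys2 (pairFam K c s i j) where
  cupL {p q N m d} hN hm f := by
    by_cases h : (((p + 2 : ℕ) : ZMod 2) = i ∧ (q : ZMod 2) = j) ∧ d + -((N + 2 : ℕ) : ℤ) = c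
    · rw [pairFam_apply _ h.1.1 h.1.2 h.2, Pres.assoc (add_zero d) h.2 (zero_add _) h.2,
        U_iotaPair_left hN _ hm, map_zero]
    · rw [pairFam_of_ne _ h, LinearMap.zero_apply]
  cupR {p q N m d} hN hm hm' f := by
    by_cases h : ((p : ZMod 2) = i ∧ ((q + 2 : ℕ) : ZMod 2) = j) ∧ d + -((N + 2 : ℕ) : ℤ) = c
    · rw [pairFam_apply _ h.1.1 h.1.2 h.2, Pres.assoc (add_zero d) h.2 (zero_add _) h.2,
        U_iotaPair_right hN _ hm hm', map_zero]
    · rw [pairFam_of_ne _ h, LinearMap.zero_apply]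
  dotCupL {p q N m d} hN hm f := by
    by_cases h : ((p : ZMod 2) = i ∧ (q : ZMod 2) = j) ∧ d + -(N : ℤ) = c
    · have h1 : ((p + 2 : ℕ) : ZMod 2) = i := natCast_add_two_zmod.2 h.1.1
      have h2 : d + 2 + -((N + 2 : ℕ) : ℤ) = c := by push_cast; linarith [h.2]
      rw [pairFam_apply _ h1 h.1.2 h2, pairFam_apply _ h.1.1 h.1.2 h.2,
        Pres.assoc rfl h2 (by push_cast; ring) h.2, V_iotaPair_left hN _ hm h1 h.1.1 h.1.2]
    · rw [pairFam_of_ne _ h, pairFam_of_ne, LinearMap.zero_apply, LinearMap.zero_apply]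
      rintro ⟨⟨h1, h1'⟩, h2⟩
      exact h ⟨⟨natCast_add_two_zmod.1 h1, h1'⟩, by push_cast at h2; linarith⟩
  dotCupR {p q N m d} hN hm hm' f := by
    by_cases h : ((p : ZMod 2) = i ∧ (q : ZMod 2) = j) ∧ d + -(N : ℤ) = c
    · have h1 : ((q + 2 : ℕ) : ZMod 2) = j := natCast_add_two_zmod.2 h.1.2
      have h2 : d + 2 + -((N + 2 : ℕ) : ℤ) = c := by push_cast; linarith [h.2]
      rw [pairFam_apply _ h.1.1 h1 h2, pairFam_apply _ h.1.1 h.1.2 h.2,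
        Pres.assoc rfl h2 (by push_cast; ring) h.2, V_iotaPair_right hN _ hm hm' h.1.1 h1 h.1.2]
    · rw [pairFam_of_ne _ h, pairFam_of_ne, LinearMap.zero_apply, LinearMap.zero_apply]
      rintro ⟨⟨h1', h1⟩, h2⟩
      exact h ⟨⟨h1', natCast_add_two_zmod.1 h1⟩, by push_cast at h2; linarith⟩

variable {K c s i j}

theorem pairFam_hole_of_ne {n b N : ℕ} {d : ℤ} (hb : b < 2)
    (h : ¬ ((N : ZMod 2) = i + j ∧ ((n + b : ℕ) : ZMod 2) = j ∧ d + -(N : ℤ) = c + 2 * n)) :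
    (pairFam K c s i j).hole n b N d = 0 := by
  refine LinearMap.ext fun f => ?_
  rw [Fam2.hole_apply _ hb rfl rfl, pairFam_of_ne, LinearMap.zero_apply, LinearMap.zero_apply]
  rintro ⟨⟨h1, h2⟩, h3⟩
  refine h ⟨?_, h2, by push_cast at h3; linarith⟩
  rw [Nat.cast_add, h2] at h1
  rw [← h1, add_add_self]

/-- The counterpart of `post_proj`. Since `ι_n` exists for every `n`, no extension to small diagrams
is needed here. -/
theorem comp_kPi {c' : ℤ} (n : ℕ) (hc : c + 2 * n = c') {p q N : ℕ} (hN : p + q = N)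
    (hp : (p : ZMod 2) = i) (hq : (q : ZMod 2) = j) (d : ℤ) (f : KHom' K d s (blk N)) :
    Pres.comp hc (pairFam K c s i j p q N d ⟨hN⟩ f) (kPi K i j n) =
      (pinkFam K c' s (i + j)).proj n p q N d ⟨hN⟩ f := by
  have hNk : (N : ZMod 2) = i + j := by rw [← hN, Nat.cast_add, hp, hq]
  refine Eq.trans ?_ (congrArg (((-1) ^ n.choose 2 * (n.factorial : K)⁻¹) • ·)
    (Fam2.zeta_iterate_apply (pinkFam K c' s (i + j)).merge n hN rfl f)).symm
  change _ = (_ : K) • pinkFam K c' s (i + j) N (d + n * 2) _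
  by_cases h : d + -(N : ℤ) = c
  · have h1 : d + n * 2 + -(N : ℤ) = c' := by rw [← hc, ← h]; ring
    have h2 : d + (-(N : ℤ) + 2 * n) = c' := by rw [← hc, ← h]; ring
    rw [pairFam_apply hN hp hq h, pinkFam_apply hNk h1, Pres.assoc h hc rfl h2,
      iotaPair_kPi hN hp hq hNk n rfl (by ring), map_smul,
      Pres.assoc rfl h1 (by ring) h2]
  · rw [pairFam_of_ne _ (fun h' => h h'.2), pinkFam_of_ne, LinearMap.zero_apply,
      LinearMap.zero_apply, smul_zero, map_zero, LinearMap.zero_apply]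
    rintro ⟨-, h2⟩
    exact h (by linarith)

/-- The counterpart of `post_incl`. Outside the right degree and parity both sides are zero. -/
theorem comp_kSigma {c' : ℤ} (n : ℕ) (hc : c + -2 * n = c') {N : ℕ} (d : ℤ)
    (f : KHom' K d s (blk N)) :
    Pres.comp hc (pinkFam K c s (i + j) N d f) (kSigma K i j n) =
      (pairFam K c' s i j).hole n (parity j n) N d f := by
  by_cases h : (N : ZMod 2) = i + j ∧ d + -(N : ℤ) = c
  · have hq := parity_spec j n
    have hp : ((N + (n + parity j n) : ℕ) : ZMod 2) = i := by
      rw [Nat.cast_add, h.1, hq, add_add_self]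
    have h3 : d + 2 * (parity j n : ℤ) + -((N + (n + parity j n) + (n + parity j n) : ℕ) : ℤ) = c' := by
      rw [← hc, ← h.2]; push_cast; ring
    rw [Fam2.hole_apply _ (parity_lt j n) rfl rfl, pairFam_apply _ hp hq h3, pinkFam_apply h.1 h.2,
      Pres.assoc h.2 hc rfl (by rw [← hc, ← h.2]; ring),
      iota_kSigma (c := -(N : ℤ) + -2 * n) n h.1 rfl rfl rfl hp hq rfl (by push_cast; ring),
      Pres.assoc (bc := -(N : ℤ) + -2 * n) rfl h3 (by push_cast; ring)]
  · rw [pinkFam_of_ne h, pairFam_hole_of_ne (parity_lt j n), LinearMap.zero_apply,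
      LinearMap.zero_apply, map_zero, LinearMap.zero_apply]
    rintro ⟨h1, -, h2⟩
    exact h ⟨h1, by linarith⟩

end Fam

end Kirby

/-! ### Orthogonality and decomposition of the identity in `KdTL`. -/

namespace Kirby

open GrCat Pres

variable {K : Type u} [Field K]

section Zero

variable {c c' : ℤ} {s : KWord} {i j : ZMod 2}

theorem comp_id_pinkFam (h : c + 0 = c') {N : ℕ} (d : ℤ) (f : KHom' K d s (blk N)) :
    Pres.comp h (pinkFam K c s i N d f) (Pres.id [pink i]) = pinkFam K c' s i N d f := by
  obtain rfl : c = c' := by rw [← h, add_zero]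
  exact Pres.comp_id _ _

variable (N : ℕ) (hi : (N : ZMod 2) = i)

/-- A canonical inclusion is the value of the system at an identity, so tests on canonical
inclusions become statements about systems. `mor_pair` plays this role for two factors. -/
theorem mor_pink : (Incl.pink N i hi .nil).mor K =
    pinkFam K (Incl.pink N i hi .nil).deg (blk (N + 0)) i N 0 (Pres.id (blk N)) := by
  have h : ∀ (c : ℤ) (h : -(N : ℤ) + 0 = c), Pres.tens h (blk_add N 0) rfl (iota N i hi)
      (Pres.id []) = pinkFam K c (blk (N + 0)) i N 0 (Pres.id (blk N)) := by
    intro c h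
    obtain rfl : -(N : ℤ) = c := by rw [← h, add_zero]
    rw [pinkFam_apply hi (zero_add _), Pres.tens_one]
    exact (Pres.id_comp _ _).symm
  exact h _ rfl

theorem mor_pair (p q : ℕ) (hp : (p : ZMod 2) = i) (hq : (q : ZMod 2) = j) :
    (Incl.pink p i hp (.pink q j hq .nil)).mor K =
      pairFam K (Incl.pink p i hp (.pink q j hq .nil)).deg (blk (p + (q + 0))) i j p q (p + q) 0
        ⟨rfl⟩ (Pres.id (blk (p + q))) := by
  have h : ∀ (b : ℤ) (hb : -(q : ℤ) + 0 = b) (c : ℤ) (h : -(p : ℤ) + b = c),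
      Pres.tens (t := [pink i]) (t' := [pink j]) h (blk_add p (q + 0)) rfl (iota p i hp)
        (Pres.tens (t' := []) hb (blk_add q 0) rfl (iota q j hq) (Pres.id [])) =
      pairFam K c (blk (p + (q + 0))) i j p q (p + q) 0 ⟨rfl⟩ (Pres.id (blk (p + q))) := by
    intro b hb c h
    obtain rfl : -(q : ℤ) = b := by rw [← hb, add_zero]
    rw [pairFam_apply rfl hp hq (by rw [← h]; push_cast; ring), Pres.tens_one]
    obtain rfl : -((p + q : ℕ) : ℤ) = c := by rw [← h]; push_cast; ring
    exact (Pres.id_comp _ _).symm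
  exact h _ rfl _ rfl

end Zero

variable [CharZero K] {c c' : ℤ} {s : KWord} {i j : ZMod 2}

/-- The counterpart of `post_proj_hole`, again by `IsSys1.hole_proj`. -/
theorem comp_kPi_hole (n : ℕ) (hc : c + 2 * n = c') {m b N : ℕ} (hb : b < 2)
    (hN : (N : ZMod 2) = i + j) (hm : ((m + b : ℕ) : ZMod 2) = j) (d : ℤ)
    (f : KHom' K d s (blk N)) :
    Pres.comp hc ((pairFam K c s i j).hole m b N d f) (kPi K i j n) =
      if n = m then pinkFam K c' s (i + j) N d f else 0 := by
  have hp : ((N + (m + b) : ℕ) : ZMod 2) = i := by rw [Nat.cast_add, hN, hm, add_add_self]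
  rw [Fam2.hole_apply _ hb rfl rfl, comp_kPi n hc rfl hp hm, ← Fam2.hole_apply _ hb,
    (isSys1_pinkFam K c' s (i + j)).hole_proj]
  split_ifs <;> rfl

variable (K c s i j) in
/-- The morphisms to `κ'_i ⊗ κ'_j` that are the finite sums of their composites with the
`σ_n ∘ π_n`. -/
noncomputable def kDecomposed : Submodule K (KHom' K c s [pink i, pink j]) where
  carrier := {m | FinSum (fun n : ℕ => Pres.comp (show c + 2 * n + -2 * n = c by ring)
    (Pres.comp rfl m (kPi K i j n)) (kSigma K i j n)) m}
  add_mem' h h' := (FinSum.add h h').congr (fun n => by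
    simp only [map_add, LinearMap.add_apply]) rfl
  zero_mem' := finSum_iff.2 ⟨∅, fun n _ => by simp only [map_zero, LinearMap.zero_apply], rfl⟩
  smul_mem' k _ h := (FinSum.smul h k).congr (fun n => by
    simp only [map_smul, LinearMap.smul_apply]) rfl

/-- As in the ind-completion, the term `n = m` is the only one that survives and it reproduces the
value; `b` is forced by parity. -/
theorem hole_mem_kDecomposed {m b N : ℕ} (hb : b < 2) (d : ℤ) (f : KHom' K d s (blk N)) :
    (pairFam K c s i j).hole m b N d f ∈ kDecomposed K c s i j := by
  by_cases h : (N : ZMod 2) = i + j ∧ ((m + b : ℕ) : ZMod 2) = j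
  · have hbm : b = parity j m := by
      have h1 := h.2.trans (parity_spec j m).symm
      rw [ZMod.natCast_eq_natCast_iff] at h1
      have h2 : (m + b) % 2 = (m + parity j m) % 2 := h1
      have := parity_lt j m
      omega
    refine finSum_iff.2 ⟨{m}, fun n hn => ?_, ?_⟩
    · rw [comp_kPi_hole n rfl hb h.1 h.2, if_neg (by simpa using hn), map_zero,
        LinearMap.zero_apply]
    · rw [Finset.sum_singleton, comp_kPi_hole m rfl hb h.1 h.2, if_pos rfl, comp_kSigma, hbm]
  · rw [pairFam_hole_of_ne hb fun h' => h ⟨h'.1, h'.2.1⟩]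
    exact zero_mem _

theorem pairFam_mem_kDecomposed (p q N : ℕ) (d : ℤ) (hN : p + q = N) (f : KHom' K d s (blk N)) :
    pairFam K c s i j p q N d ⟨hN⟩ f ∈ kDecomposed K c s i j :=
  (isSys2_pairFam K c s i j).mem _
    (fun k p d f => hole_mem_kDecomposed (m := k) (b := 0) (N := p) (by omega) d f)
    (fun k p d f => hole_mem_kDecomposed (m := k) (b := 1) (N := p) (by omega) d f) p q N d hN f

omit [CharZero K] in
theorem finSum_of_mem_kDecomposed {m : KHom' K c s [pink i, pink j]}
    (hm : m ∈ kDecomposed K c s i j) (h : c + 0 = c') :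
    FinSum (fun n : ℕ => Pres.comp h m
      (Pres.comp (show (2 * n + -2 * n : ℤ) = 0 by ring) (kPi K i j n) (kSigma K i j n)))
      (Pres.comp h m (Pres.id [pink i, pink j])) := by
  obtain rfl : c = c' := by rw [← h, add_zero]
  refine FinSum.congr hm (fun n => ?_) (Pres.comp_id _ _).symm
  exact Pres.assoc _ _ _ _ _ _ _

variable (K i j)

/-- The composites `σ_n ∘ π_n` sum up to the identity. -/
theorem represents_kPi_kSigma : Represents ((KdTL K).id [pink i, pink j]).1
    (fun n : ℕ => (KdTL' K).comp (show (2 * n + -2 * n : ℤ) = 0 by ring) (kPi K i j n)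
      (kSigma K i j n)) := by
  intro x
  match x with
  | .pink p _ hp (.pink q _ hq .nil) =>
    refine finSum_of_mem_kDecomposed ?_ rfl
    rw [mor_pair]
    exact pairFam_mem_kDecomposed p q (p + q) 0 rfl _

variable {K i j}

omit [CharZero K] in
theorem KHom.of_comp_of {a b c : ℤ} (h : a + b = c) {S T U : KWord}
    (f : KHom' K a S T) (g : KHom' K b T U) :
    KHom.comp h (KHom.of f) (KHom.of g) = KHom.of (Pres.comp h f g) := by
  refine Subtype.ext (funext fun x => ?_)
  rw [KHom.comp_val h _ _ x (by rw [← h]; ring), KHom.of_eval _ _ (KHom.fac _ x)]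
  exact Pres.assoc _ _ _ _ _ _ _

theorem mor_kSigma_kPi (n m : ℕ) (h : (-2 * m + 2 * n : ℤ) = c) {N : ℕ}
    (hN : (N : ZMod 2) = i + j) :
    (KHom.of (Pres.comp h (kSigma K i j m) (kPi K i j n))).1 (.pink N _ hN .nil) =
      if n = m then pinkFam K ((Incl.pink N _ hN .nil).deg + c) (blk (N + 0)) (i + j) N 0
        (Pres.id (blk N)) else 0 := by
  change Pres.comp rfl ((Incl.pink N _ hN .nil).mor K) _ = _
  have h' : (Incl.pink N _ hN .nil).deg + -2 * m + 2 * n = (Incl.pink N _ hN .nil).deg + c := by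
    rw [← h]; ring
  rw [← Pres.assoc rfl h' h]
  refine (congrArg (fun g => Pres.comp h' (Pres.comp rfl g (kSigma K i j m)) (kPi K i j n))
    (mor_pink N hN)).trans ?_
  exact (congrArg (fun g => Pres.comp h' g (kPi K i j n)) (comp_kSigma m rfl 0 _)).trans
    (comp_kPi_hole n h' (parity_lt j m) hN (parity_spec j m) 0 _)

theorem kSigma_kPi_self (n : ℕ) (h : (-2 * n + 2 * n : ℤ) = 0) :
    KHom.comp h (KHom.of (kSigma K i j n)) (KHom.of (kPi K i j n)) =
      KHom.of (Pres.id [pink (i + j)]) := by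
  rw [KHom.of_comp_of]
  refine Subtype.ext (funext fun x => ?_)
  match x with
  | .pink N _ hN .nil =>
    rw [mor_kSigma_kPi, if_pos rfl]
    exact ((congrArg (fun g => Pres.comp rfl g (Pres.id [pink (i + j)])) (mor_pink N hN)).trans
      (comp_id_pinkFam rfl 0 _)).symm

theorem kSigma_kPi_ne {n m : ℕ} (hn : n ≠ m) (h : (-2 * m + 2 * n : ℤ) = c) :
    KHom.comp h (KHom.of (kSigma K i j m)) (KHom.of (kPi K i j n)) = 0 := by
  rw [KHom.of_comp_of]
  refine Subtype.ext (funext fun x => ?_)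
  match x with
  | .pink N _ hN .nil =>
    rw [mor_kSigma_kPi, if_neg hn]
    rfl

end Kirby

/-! ### Summability in `KdTL`. -/

namespace Kirby

open GrCat Pres

/-! ### Locally finite sums in `KdTL` -/

theorem FinSum.sigma {M : Type u} [AddCommGroup M] {N : Type} {I : N → Type} {v : ∀ n, I n → M}
    {m : N → M} (h : ∀ n, FinSum (v n) (m n)) (t : Finset N) (ht : ∀ n, n ∉ t → ∀ i, v n i = 0) :
    FinSum (fun p : Σ n, I n => v p.1 p.2) (∑ n ∈ t, m n) := by
  choose r hr hm using fun n => finSum_iff.1 (h n)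
  refine finSum_iff.2 ⟨t.sigma r, ?_, ?_⟩
  · rintro ⟨n, i⟩ hi
    rw [Finset.mem_sigma, not_and_or] at hi
    exact hi.elim (fun h' => ht n h' i) (hr n i)
  · rw [Finset.sum_sigma]
    exact Finset.sum_congr rfl fun n _ => hm n

variable {K : Type u} [Field K]

/-- `KHom.eval` is defined through a chosen formal sum. On morphisms that factor through a canonical
inclusion it depends only on the values of `G` there. -/
theorem KHom.eval_comp_mor {a b c d : ℤ} (h : a + b = c) {s T U : KWord}
    (G : KHom (K := K) b T U) (y : Incl T) (hd : d + y.deg = a) (he : d + (y.deg + b) = c)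
    (D : KHom' K d s (blk y.strands)) :
    KHom.eval h G (Pres.comp hd D (y.mor K)) = Pres.comp he D (G.1 y) := by
  obtain ⟨J, E, hE⟩ := KHom.exists_rep G
  refine (KHom.eval_spec h hE (Fac.mk y hd D)).unique ?_
  exact ((hE y).map (Pres.comp he D).toAddMonoidHom).congr
    (fun j => (Pres.assoc hd h rfl he D (y.mor K) (E j)).symm) rfl

theorem KHom.eval_zero {a b c : ℤ} (h : a + b = c) {s T U : KWord} (G : KHom (K := K) b T U) :
    KHom.eval h G (0 : KHom' K a s T) = 0 := by
  have := KHom.eval_smul h G (zero_mem (Fac (K := K) a s T)) 0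
  rwa [zero_smul, zero_smul] at this

theorem KHom.eval_sum {a b c : ℤ} (h : a + b = c) {s T U : KWord} (G : KHom (K := K) b T U)
    {I : Type} (t : Finset I) {g : I → KHom' K a s T} (hg : ∀ i, g i ∈ Fac a s T) :
    KHom.eval h G (∑ i ∈ t, g i) = ∑ i ∈ t, KHom.eval h G (g i) := by
  classical
  induction t using Finset.induction_on with
  | empty => exact KHom.eval_zero h G
  | insert i t hi ih =>
    rw [Finset.sum_insert hi, Finset.sum_insert hi,
      KHom.eval_add h G (hg i) (sum_mem fun i _ => hg i), ih]

/-- Sums of morphisms of `KdTL` that are finite on every canonical inclusion. -/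
def KSum {I : Type} {a : ℤ} {S T : KWord} (F : I → KHom (K := K) a S T)
    (G : KHom (K := K) a S T) : Prop :=
  ∀ x, FinSum (fun n => (F n).1 x) (G.1 x)

namespace KSum

variable {I : Type} {a b c : ℤ} {S T U : KWord}

theorem unique {F : I → KHom (K := K) a S T} {G G' : KHom (K := K) a S T} (h : KSum F G)
    (h' : KSum F G') : G = G' :=
  Subtype.ext (funext fun x => (h x).unique (h' x))

/-- Summability is defined on canonical inclusions only. It extends linearly to everything in `Fac`,
which contains the values of all morphisms of `KdTL`. -/
theorem eval {F : I → KHom (K := K) b T U} {G : KHom (K := K) b T U} (hF : KSum F G)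
    (h : a + b = c) {s : KWord} {g : KHom' K a s T} (hg : g ∈ Fac a s T) :
    FinSum (fun n => KHom.eval h (F n) g) (KHom.eval h G g) := by
  induction hg using Submodule.span_induction with
  | mem g hg =>
    obtain ⟨y, e, he, D, rfl⟩ := hg
    have h' : e + (y.deg + b) = c := by rw [← h, ← he]; ring
    exact ((hF y).map (Pres.comp h' D).toAddMonoidHom).congr
      (fun n => (KHom.eval_comp_mor h (F n) y he h' D).symm)
      (KHom.eval_comp_mor h G y he h' D).symm
  | zero =>
    exact finSum_iff.2 ⟨∅, fun n _ => KHom.eval_zero h (F n), (KHom.eval_zero h G).symm⟩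
  | add f g hf hg hf' hg' =>
    exact (hf'.add hg').congr (fun n => (KHom.eval_add h (F n) hf hg).symm)
      (KHom.eval_add h G hf hg).symm
  | smul k f hf hf' =>
    exact (hf'.smul k).congr (fun n => (KHom.eval_smul h (F n) hf k).symm)
      (KHom.eval_smul h G hf k).symm

theorem comp_left (h : a + b = c) (f : KHom (K := K) a S T) {F : I → KHom (K := K) b T U}
    {G : KHom (K := K) b T U} (hF : KSum F G) :
    KSum (fun n => KHom.comp h f (F n)) (KHom.comp h f G) := fun x =>
  hF.eval _ (KHom.fac f x)

theorem comp_right (h : a + b = c) {F : I → KHom (K := K) a S T} {G : KHom (K := K) a S T}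
    (f : KHom (K := K) b T U) (hF : KSum F G) :
    KSum (fun n => KHom.comp h (F n) f) (KHom.comp h G f) := fun x => by
  have h' : x.deg + a + b = x.deg + c := by rw [← h]; ring
  obtain ⟨t, ht, hG⟩ := finSum_iff.1 (hF x)
  refine finSum_iff.2 ⟨t, fun n hn => ?_, ?_⟩
  · rw [KHom.comp_val h _ _ x h', ht n hn, KHom.eval_zero]
  · rw [KHom.comp_val h _ _ x h', ← hG, KHom.eval_sum _ _ _ fun n => KHom.fac (F n) x]
    rfl

theorem single [DecidableEq I] (f : KHom (K := K) a S T) (k : I) :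
    KSum (fun i => if i = k then f else 0) f := fun x =>
  (FinSum.ite (f.1 x) k).congr (fun n => by beta_reduce; split_ifs <;> rfl) rfl

theorem sum {J : Type} (t : Finset J) {F : J → I → KHom (K := K) a S T}
    {G : J → KHom (K := K) a S T} (h : ∀ j, KSum (F j) (G j)) :
    KSum (fun n => ∑ j ∈ t, F j n) (∑ j ∈ t, G j) := by
  classical
  induction t using Finset.induction_on with
  | empty => exact fun x => finSum_iff.2 ⟨∅, fun _ _ => rfl, rfl⟩
  | insert j t hj ih =>
    simp only [Finset.sum_insert hj]
    exact fun x => (h j x).add (ih x)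

/-- A family of formal sums has a sum if it is finite on every canonical inclusion. -/
theorem exists_sum {F : ℕ → KHom (K := K) a S T} {I : ℕ → Type} {D : ∀ n, I n → KHom' K a S T}
    (hD : ∀ n, Represents (F n).1 (D n))
    (h : ∀ x : Incl S, ∃ n₀, ∀ n, n₀ < n → ∀ i, Pres.comp rfl (x.mor K) (D n i) = 0) :
    ∃ G, KSum F G := by
  choose n₀ hn₀ using h
  have h0 : ∀ (x : Incl S) (n : ℕ), n ∉ Finset.range (n₀ x + 1) → ∀ i,
      Pres.comp rfl (x.mor K) (D n i) = 0 := fun x n hn =>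
    hn₀ x n (by rw [Finset.mem_range] at hn; omega)
  -- The sum is represented by the union of all the formal sums. It is finite on `x` because each
  -- single diagram with `n > n₀ x` vanishes there; vanishing of the sums `F n` alone would not
  -- suffice.
  refine ⟨⟨fun x => ∑ n ∈ Finset.range (n₀ x + 1), (F n).1 x, Σ n, I n, fun p => D p.1 p.2,
    fun x => FinSum.sigma (fun n => hD n x) _ (h0 x)⟩, fun x =>
      finSum_iff.2 ⟨Finset.range (n₀ x + 1), fun n hn => ?_, rfl⟩⟩
  refine (hD n x).unique (finSum_iff.2 ⟨∅, fun i _ => h0 x n hn i, rfl⟩)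

end KSum

/-! ### Degree bounds -/

/-- The degree `-n` of `ι_n` offsets its `n` strands, so only the black letters contribute. -/
theorem Incl.strands_add_deg_le : ∀ {S : KWord} (x : Incl S), x.strands + x.deg ≤ S.length
  | _, nil => le_rfl
  | _, black x => by
    have := strands_add_deg_le x
    change ((x.strands + 1 : ℕ) : ℤ) + x.deg ≤ ((_ + 1 : ℕ) : ℤ)
    push_cast
    omega
  | _, pink n _ _ x => by
    have := strands_add_deg_le x
    change ((n + x.strands : ℕ) : ℤ) + (-n + x.deg) ≤ ((_ + 1 : ℕ) : ℤ)
    push_cast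
    omega

theorem kGens_cod_not_isBlack (g : kGens.G) : ¬ IsBlack (kGens.cod g) := by
  cases g <;> exact fun h => by simpa using h _ (List.mem_singleton.2 rfl)

variable [CharZero K]

/-- In a factorization through a canonical inclusion the first factor ends in a black word and is
subject to `eq_zero_of_degree`. By `Incl.strands_add_deg_le` the resulting bound does not involve
the number of intermediate strands. -/
theorem eq_zero_of_mem_fac {c : ℤ} {s T : KWord} {g : KHom' K c s T} (hg : g ∈ Fac c s T)
    (h : (s.length : ℤ) + T.length < c) : g = 0 := by
  induction hg using Submodule.span_induction with
  | mem g hg =>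
    obtain ⟨y, b, hb, D, rfl⟩ := hg
    rw [eq_zero_of_degree kGens_cod_not_isBlack D (by
      have := y.strands_add_deg_le
      omega), map_zero, LinearMap.zero_apply]
  | zero => rfl
  | add f g _ _ hf hg => rw [hf, hg, add_zero]
  | smul k f _ hf => rw [hf, smul_zero]

theorem mor_comp_eq_zero {S T : KWord} (x : Incl S) {a c : ℤ} (h : x.deg + a = c)
    (D : KHom' K a S T) (hc : (x.strands : ℤ) + T.length < c) :
    Pres.comp h (x.mor K) D = 0 := by
  refine eq_zero_of_mem_fac ?_ (by simpa using hc)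
  obtain ⟨D, rfl⟩ := Pres.mk_surj D
  exact Fac.mor_comp D x h

theorem exists_sum_kSigma {S : KWord} {i j : ZMod 2} {a : ℤ} {b : ℕ → ℤ}
    (hb : ∀ n, b n + -2 * n = a) (F : ∀ n, KHom (K := K) (b n) S [pink (i + j)]) :
    ∃ G, KSum (fun n => KHom.comp (hb n) (F n) (KHom.of (kSigma K i j n))) G := by
  choose I D hD using fun n => KHom.exists_rep (F n)
  refine KSum.exists_sum (fun n => (hD n).comp (hb n) (Represents.of (kSigma K i j n)))
    -- After `x`, a diagram for `F n` has degree `x.deg + a + 2n` and ends in a single letter, so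
    -- the degree bound applies for larger `n`.
    fun x => ⟨(x.strands + 1 - x.deg - a).toNat, fun n hn p => ?_⟩
  rw [← Pres.assoc rfl (by rw [← hb n]; ring) (hb n), mor_comp_eq_zero x, map_zero,
    LinearMap.zero_apply]
  have := hb n
  simp only [List.length_singleton]
  push_cast
  omega

theorem exists_sum_kPi {T : KWord} {i j : ZMod 2} {a : ℤ} {b : ℕ → ℤ}
    (hb : ∀ n : ℕ, 2 * n + b n = a) (F : ∀ n, KHom (K := K) (b n) [pink (i + j)] T) :
    ∃ G, KSum (fun n => KHom.comp (hb n) (KHom.of (kPi K i j n)) (F n)) G := by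
  choose I D hD using fun n => KHom.exists_rep (F n)
  refine KSum.exists_sum (fun n => (Represents.of (kPi K i j n)).comp (hb n) (hD n))
    -- Here `π_n` itself vanishes on `x`, as its composite with `x` has degree `x.deg + 2n` and ends
    -- in a single letter.
    fun x => ⟨(x.strands + 1 - x.deg).toNat, fun n hn p => ?_⟩
  rw [← Pres.assoc rfl (by rw [← hb n]; ring) (hb n), mor_comp_eq_zero x, map_zero,
    LinearMap.zero_apply]
  simp only [List.length_singleton]
  push_cast
  omega

end Kirby

/-! ### Passage to shifted objects: matrices over `KdTL`. -/

namespace GrCat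

variable {K : Type u} [Field K] (C : GrCat.{u, w} K)

theorem comp_castDeg {a b b' c : ℤ} (h : a + b' = c) (hb : b = b') (h' : a + b = c)
    {X Y Z : C.Obj} (f : C.Hom a X Y) (g : C.Hom b Y Z) :
    C.comp h f (C.castDeg hb g) = C.comp h' f g := by
  subst hb; rfl

theorem castDeg_comp {a a' b c : ℤ} (h : a' + b = c) (ha : a = a') (h' : a + b = c)
    {X Y Z : C.Obj} (f : C.Hom a X Y) (g : C.Hom b Y Z) :
    C.comp h (C.castDeg ha f) g = C.comp h' f g := by
  subst ha; rfl

theorem comp_eq_idOf {a b c : ℤ} (h : a + b = c) (h0 : a + b = 0) (hc : c = 0) {X Y : C.Obj}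
    {f : C.Hom a X Y} {g : C.Hom b Y X} (hfg : C.comp h0 f g = C.id X) :
    C.comp h f g = C.idOf hc rfl := by
  subst hc; exact hfg

/-- Matrix multiplication through an object with one summand has a single term, so composites with
`σ_n` and `π_n` can be computed entrywise. -/
theorem matComp_unit {a b c k : ℤ} (h : a + b = c) {A D : C.MatObj} {X : C.Obj}
    (f : C.MatHom a A ⟨Unit, inferInstance, fun _ => k, fun _ => X⟩)
    (g : C.MatHom b ⟨Unit, inferInstance, fun _ => k, fun _ => X⟩ D) (u : A.I) (v : D.I)
    (h' : a - (k - A.k u) + (b - (D.k v - k)) = c - (D.k v - A.k u)) :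
    C.matComp h f g u v = C.comp h' (f u ()) (g () v) :=
  Fintype.sum_unique (ι := Unit) fun j => C.comp h' (f u j) (g j v)

end GrCat

namespace Kirby

open GrCat

variable {K : Type u} [Field K]

theorem KSum.congr {I : Type} {a : ℤ} {S T : KWord} {F F' : I → KHom (K := K) a S T}
    {G G' : KHom (K := K) a S T} (h : KSum F G) (hF : ∀ n, F n = F' n) (hG : G = G') :
    KSum F' G' := by
  obtain rfl : F = F' := funext hF
  rwa [← hG]

/-- Sums of matrices over `KdTL` that are finite on every canonical inclusion. -/
def MatSum {I : Type} {a : ℤ} {A B : (KdTL K).MatObj} (F : I → (KdTL K).MatHom a A B)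
    (G : (KdTL K).MatHom a A B) : Prop :=
  ∀ u v, KSum (a := a - (B.k v - A.k u)) (fun n => F n u v) (G u v)

namespace MatSum

variable {I : Type} {a b c : ℤ} {A B D : (KdTL K).MatObj}

theorem unique {F : I → (KdTL K).MatHom a A B} {G G' : (KdTL K).MatHom a A B} (h : MatSum F G)
    (h' : MatSum F G') : G = G' :=
  funext fun u => funext fun v => (h u v).unique (h' u v)

theorem comp_left (h : a + b = c) (f : (KdTL K).MatHom a A B) {F : I → (KdTL K).MatHom b B D}
    {G : (KdTL K).MatHom b B D} (hF : MatSum F G) :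
    MatSum (fun n => (KdTL K).matComp h f (F n)) ((KdTL K).matComp h f G) := fun u v =>
  KSum.sum Finset.univ fun j => (hF j v).comp_left (by rw [← h]; ring) (f u j)

theorem comp_right (h : a + b = c) {F : I → (KdTL K).MatHom a A B} {G : (KdTL K).MatHom a A B}
    (f : (KdTL K).MatHom b B D) (hF : MatSum F G) :
    MatSum (fun n => (KdTL K).matComp h (F n) f) ((KdTL K).matComp h G f) := fun u v =>
  KSum.sum Finset.univ fun j => (hF u j).comp_right (by rw [← h]; ring) (f j v)

theorem single [DecidableEq I] (f : (KdTL K).MatHom a A B) (k : I) :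
    MatSum (fun i => if i = k then f else 0) f := fun u v =>
  (KSum.single (f u v) k).congr (fun n => by
    by_cases hn : n = k
    · exact (if_pos hn).trans (congrFun (congrFun (if_pos hn) u) v).symm
    · have h0 : (if n = k then f else 0) = (0 : (KdTL K).MatHom a A B) := if_neg hn
      exact (if_neg hn).trans (congrFun (congrFun h0 u) v).symm) rfl

end MatSum

variable [CharZero K] (i j : ZMod 2)

omit [CharZero K] in
theorem matComp_kSigmaMat {a c : ℤ} (h : a + 0 = c) {T : (KdTL K).MatObj} (n : ℕ)
    (F : (KdTL K).MatHom a T (kKirby K (-2 * n) (i + j))) (u : T.I) (v : Unit)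
    (h' : a - (-2 * n - T.k u) + -2 * n = c - (0 - T.k u)) :
    (KdTL K).Mat.comp h F (kSigmaMat K i j n) u v =
      KHom.comp h' (F u ()) (KHom.of (kSigma K i j n)) :=
  (matComp_unit (KdTL K) h F (kSigmaMat K i j n) u v
    (show a - (-2 * n - T.k u) + (0 - (0 - -2 * n)) = c - (0 - T.k u) by rw [← h]; ring)).trans
    (comp_castDeg (KdTL K) (b := -2 * n) (b' := 0 - (0 - -2 * n)) _ (by ring) h' (F u ()) _)

omit [CharZero K] in
theorem matComp_kPiMat {a c : ℤ} (h : 0 + a = c) {T : (KdTL K).MatObj} (n : ℕ)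
    (F : (KdTL K).MatHom a (kKirby K (-2 * n) (i + j)) T) (u : Unit) (v : T.I)
    (h' : 2 * n + (a - (T.k v - -2 * n)) = c - (T.k v - 0)) :
    (KdTL K).Mat.comp h (kPiMat K i j n) F u v =
      KHom.comp h' (KHom.of (kPi K i j n)) (F () v) :=
  (matComp_unit (KdTL K) h (kPiMat K i j n) F u v
    (show 0 - (-2 * n - 0) + (a - (T.k v - -2 * n)) = c - (T.k v - 0) by rw [← h]; ring)).trans
    (castDeg_comp (KdTL K) (a := 2 * n) (a' := 0 - (-2 * n - 0)) _ (by ring) h' _ (F () v))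

omit [CharZero K] in
theorem kSigmaMat_kPiMat (n m : ℕ) (u v : Unit)
    (h : (-2 * m + 2 * n : ℤ) = 0 - (-2 * n - -2 * m)) :
    (KdTL K).Mat.comp (add_zero 0) (kSigmaMat K i j m) (kPiMat K i j n) u v =
      KHom.comp h (KHom.of (kSigma K i j m)) (KHom.of (kPi K i j n)) :=
  (matComp_unit (KdTL K) (add_zero 0) (kSigmaMat K i j m) (kPiMat K i j n) u v
    (show 0 - (0 - -2 * m) + (0 - (-2 * n - 0)) = (0 - (-2 * n - -2 * m) : ℤ) by ring)).trans
    (castDeg_comp (KdTL K) (a := -2 * m) (a' := 0 - (0 - -2 * m)) (b := 0 - (-2 * n - 0))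
      _ (by ring) (show -2 * m + (0 - (-2 * n - 0)) = (0 - (-2 * n - -2 * m) : ℤ) by ring) _ _) |>.trans
    (comp_castDeg (KdTL K) (b := 2 * n) (b' := 0 - (-2 * n - 0)) _ (by ring) h _ _)

theorem kSigmaMat_kPiMat_self (n : ℕ) :
    (KdTL K).Mat.comp (add_zero 0) (kSigmaMat K i j n) (kPiMat K i j n) =
      (KdTL K).Mat.id (kKirby K (-2 * n) (i + j)) := by
  funext u v
  refine (kSigmaMat_kPiMat i j n n u v (by ring)).trans ?_
  refine Eq.trans ?_ (matId_same (KdTL K) (kKirby K (-2 * n) (i + j)) u).symm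
  exact comp_eq_idOf (KdTL K) (by ring) (by ring) (by ring) (kSigma_kPi_self n (by ring))

theorem kSigmaMat_kPiMat_ne (n m : ℕ) (h : n ≠ m) :
    (KdTL K).Mat.comp (add_zero 0) (kSigmaMat K i j m) (kPiMat K i j n) = 0 := by
  funext u v
  exact (kSigmaMat_kPiMat i j n m u v (by ring)).trans (kSigma_kPi_ne h (by ring))

theorem kSum_kPi_kSigma {c : ℤ} (hc : c = 0) (h : ∀ n : ℕ, (2 * n + -2 * n : ℤ) = c) :
    KSum (a := c) (fun n : ℕ => KHom.comp (h n) (KHom.of (kPi K i j n)) (KHom.of (kSigma K i j n)))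
      ((KdTL K).idOf hc rfl) := by
  subst hc
  intro x
  refine (represents_kPi_kSigma K i j x).congr (fun n => ?_) rfl
  exact (congrArg (fun f : KHom (K := K) 0 [pink i, pink j] [pink i, pink j] => f.1 x)
    (KHom.of_comp_of (h n) (kPi K i j n) (kSigma K i j n))).symm

theorem matSum_kPiMat_kSigmaMat :
    MatSum (fun n => (KdTL K).Mat.comp (add_zero 0) (kPiMat K i j n) (kSigmaMat K i j n))
      ((KdTL K).Mat.id (kTensor K i j)) := by
  intro u v
  refine (kSum_kPi_kSigma (K := K) i j (c := 0 - (0 - 0)) (by ring) (fun n => by ring)).congr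
    (fun n => Eq.symm ((matComp_kPiMat i j (add_zero 0) n (kSigmaMat K i j n) u v (by
      change (2 * n + (0 - (0 - -2 * n)) : ℤ) = 0 - (0 - 0); ring)).trans ?_))
    (matId_same (KdTL K) (kTensor K i j) u).symm
  exact comp_castDeg (KdTL K) (b := -2 * n) (b' := 0 - (0 - -2 * n))
    (show (2 * n + (0 - (0 - -2 * n)) : ℤ) = 0 - (0 - 0) by ring) (by ring)
    (show (2 * n + -2 * n : ℤ) = 0 - (0 - 0) by ring) _ _

/-- The shifts only relabel degrees. The criterion of summable families is checked on matrix
entries, where the results for `KdTL` apply. -/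
theorem isBiproduct_kTensor :
    (KdTL K).Mat.IsBiproduct (kTensor K i j) (fun n : ℕ => kKirby K (-2 * n) (i + j))
      (kSigmaMat K i j) (kPiMat K i j) := by
  refine isBiproduct_of_sums _ (fun F G => MatSum F G) MatSum.unique
    (fun h _ _ _ f _ _ hF => MatSum.comp_left h f hF)
    (fun h _ _ _ _ _ f hF => MatSum.comp_right h f hF) MatSum.single
    (kSigmaMat_kPiMat_self i j) (kSigmaMat_kPiMat_ne i j) (matSum_kPiMat_kSigmaMat i j)
    (fun a T F => ?_) (fun a T F => ?_)
  · have h : ∀ v : MatObj.I T, ∀ n : ℕ, (2 * n + (a - (MatObj.k T v - -2 * n)) : ℤ) =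
        a - (MatObj.k T v - 0) := fun v n => by ring
    -- Sums are formed separately for each summand of `T` and assembled into one matrix.
    choose G hG using fun v : MatObj.I T =>
      exists_sum_kPi (i := i) (j := j) (h v) fun n => F n () v
    refine ⟨fun _ v => G v, fun u v => ?_⟩
    exact (hG v).congr (fun n => (matComp_kPiMat i j (zero_add a) n (F n) u v (h v n)).symm) rfl
  · have h : ∀ u : MatObj.I T, ∀ n : ℕ, (a - (-2 * n - MatObj.k T u) + -2 * n : ℤ) =
        a - (0 - MatObj.k T u) := fun u n => by ring
    choose G hG using fun u : MatObj.I T =>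
      exists_sum_kSigma (i := i) (j := j) (h u) fun n => F n u ()
    refine ⟨fun u _ => G u, fun u v => ?_⟩
    exact (hG u).congr (fun n => (matComp_kSigmaMat i j (add_zero a) n (F n) u v (h u n)).symm) rfl

end Kirby

/-- (1) For all integers `i, j`, the object `κ_i ⊗ κ_j` of `Ind (Mat (Kar dTL))` is the biproduct
of the objects `q^(-2n) κ_(i+j)`, `n ≥ 0`, where `κ_k = κ_|k|`.
(2) For residues `i, j` modulo `2`, this holds with the explicit `σ_n`, `π_n`; the `σ_n ∘ π_n` are
orthogonal idempotents, and they form a (locally finite) decomposition of the identity.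
(3) The same statements hold for `κ'_i ⊗ κ'_j` in the diagrammatic category `KdTL`. -/
theorem mainTheorem6 {K : Type u} [Field K] [CharZero K] :
    (∀ i j : ℤ,
      ∃ (σ : ∀ n : ℕ, (dTL K).Kar.Mat.Ind.Hom 0 (kirby K (-2 * n) (i + j).natAbs)
          (kirbyTensor K i.natAbs j.natAbs))
        (π : ∀ n : ℕ, (dTL K).Kar.Mat.Ind.Hom 0 (kirbyTensor K i.natAbs j.natAbs)
          (kirby K (-2 * n) (i + j).natAbs)),
        (dTL K).Kar.Mat.Ind.IsBiproduct (kirbyTensor K i.natAbs j.natAbs)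
          (fun n : ℕ => kirby K (-2 * n) (i + j).natAbs) σ π) ∧
    (∀ i j : ZMod 2,
      ∃ (σ : ∀ n : ℕ, (dTL K).Kar.Mat.Ind.Hom 0 (kirby K (-2 * n) (ZMod.val (i + j)))
          (kirbyTensor K (ZMod.val i) (ZMod.val j)))
        (π : ∀ n : ℕ, (dTL K).Kar.Mat.Ind.Hom 0 (kirbyTensor K (ZMod.val i) (ZMod.val j))
          (kirby K (-2 * n) (ZMod.val (i + j)))),
        (∀ n, IsSigma K i j n (σ n)) ∧ (∀ n, IsPi K i j n (π n)) ∧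
        (dTL K).Kar.Mat.Ind.IsBiproduct (kirbyTensor K (ZMod.val i) (ZMod.val j))
          (fun n : ℕ => kirby K (-2 * n) (ZMod.val (i + j))) σ π ∧
        (dTL K).Kar.Mat.Ind.OrthogonalIdempotents
          (fun n => (dTL K).Kar.Mat.Ind.comp (add_zero 0) (π n) (σ n)) ∧
        ∀ p : (kirbyTensor K (ZMod.val i) (ZMod.val j)).J,
          FinSum (fun n => ((dTL K).Kar.Mat.Ind.comp (add_zero 0) (π n) (σ n)).1 p)
            (((dTL K).Kar.Mat.Ind.id (kirbyTensor K (ZMod.val i) (ZMod.val j))).1 p)) ∧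
    (∀ i j : ZMod 2,
      (KdTL K).Mat.IsBiproduct (kTensor K i j) (fun n : ℕ => kKirby K (-2 * n) (i + j))
        (kSigmaMat K i j) (kPiMat K i j) ∧
      (KdTL K).Mat.OrthogonalIdempotents
        (fun n => (KdTL K).Mat.comp (add_zero 0) (kPiMat K i j n) (kSigmaMat K i j n)) ∧
      Represents ((KdTL K).id [pink i, pink j]).1
        (fun n : ℕ => (KdTL' K).comp (show (2 * n + -2 * n : ℤ) = 0 by ring) (kPi K i j n)
          (kSigma K i j n))) := 
  ⟨biproduct_natAbs, biproduct_zmod, fun i j => ⟨isBiproduct_kTensor i j,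
    GrCat.orthogonalIdempotents_of_comp _ (kSigmaMat_kPiMat_self i j) (kSigmaMat_kPiMat_ne i j),
    represents_kPi_kSigma K i j⟩⟩
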